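/- Let $(X,\omega)$ be a (Hausdorff, second countable) Kähler manifold of complex dimension $n\ge 1$, and let $Y$ be a reduced divisor with simple normal crossings in $X$. Let $h_Y$ be a smooth Hermitian metric on $\mathcal O_X(Y)$, let $s_Y$ be the canonical section of $\mathcal O_X(Y)$, and write $|s_Y|^2=|s_Y|^2_{h_Y}$. Let $L$ be a holomorphic line bundle on $X$ with a smooth Hermitian metric $h_L=e^{-\varphi_L}$. Suppose that for some $\delta>0$ $$\Theta_{h_L}(L)\ge 0,\qquad \Theta_{h_L}(L)\ge \delta\,\Theta_{h_Y}(\mathcal O_X(Y)),$$ where $\Theta=i\partial\bar\partial\varphi$ is the curvature. Let $\xi$ be a smooth $L$-valued $(n,1)$-form with compact support, let $\gamma_\xi=\star\xi$ be its image under the Hodge operator of $\omega$ (an $L$-valued $(n-1,0)$-form), and let $\bar\partial^\star$ be the formal adjoint of $\bar\partial$ with respect to $\omega$ and $h_L$. Let $\partial s_Y$ be the $(1,0)$-part of the Chern derivative of $s_Y$, the metric $h_Y$ being understood in $\partial s_Y\wedge\overline{\partial s_Y}$, and let $c_{n-1}=\sqrt{-1}^{\,(n-1)^2}$. Let $\tau$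 be a real number for which $\tau^2+|s_Y|^2$ stays away from $1$, the zero of the logarithm: $|\tau^2+|s_Y|^2-1|\ge\varepsilon$ on $X$ for some $\varepsilon>0$. Consider the inequality $$c_{n-1}\int_X\frac{\tau^2}{(\tau^2+|s_Y|^2)^2}\,\gamma_\xi\wedge\overline{\gamma_\xi}\,e^{-\varphi_L}\wedge\sqrt{-1}\,\partial s_Y\wedge\overline{\partial s_Y}\ \le\ C\int_X\log^2(\tau^2+|s_Y|^2)\left(|\bar\partial^\star\xi|^2+|\bar\partial\xi|^2\right)e^{-\varphi_L}\,dV_\omega .$$ (1) If $|s_Y|^2\le e^{-\delta}$ on $X$, the inequality holds with a constant $C$ that depends only on $\delta$ and $\varepsilon$. (2) If $|s_Y|^2\le e^{-1/\delta}$ on $X$, the inequality holds with a constant $C$ that depends only on $\varepsilon$; for fixed $\varepsilon$, for instance $\varepsilon=1/2$, it is a numerical constant. In both cases $C$ does not depend on $n$, $X$, $\omega$, $Y$, $L$, the metrics, $\tau$ or $\xi$. -/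

import Mathlib

open scoped Manifold ContDiff ComplexConjugate Bundle
open MeasureTheory Bundle

namespace KahlerForms

noncomputable section

/-! ### Multilinear algebra on a tangent space -/

/-- The model space `ℂⁿ` of an `n`-dimensional complex manifold.  In Mathlib the tangent space
`TangentSpace 𝓘(ℂ, Cn n) x` is, by definition, a copy of `Cn n`, a vector being identified with its
coordinates in the preferred chart `chartAt (Cn n) x`; alternating forms on the tangent space at `x`
are therefore written as alternating forms on `Cn n`. -/
abbrev Cn (n : ℕ) : Type := Fin n → ℂ

/-- The real basis `(e₁, i e₁, e₂, i e₂, …, eₙ, i eₙ)` of `ℂⁿ`, in its canonical order. -/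
def realBasis {n : ℕ} (a : Fin (2 * n)) : Cn n :=
  Pi.single ⟨a / 2, by omega⟩ (if (a : ℕ) % 2 = 0 then 1 else Complex.I)

/-- The real coordinates `(Re v₁, Im v₁, …, Re vₙ, Im vₙ)` of `v ∈ ℂⁿ` in the basis `realBasis`. -/
def realCoord {n : ℕ} (v : Cn n) (a : Fin (2 * n)) : ℝ :=
  if (a : ℕ) % 2 = 0 then (v ⟨a / 2, by omega⟩).re else (v ⟨a / 2, by omega⟩).im

/-- The Gram matrix, in the basis `realBasis`, of the Riemannian metric `g(u, v) = w(u, i v)`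
attached to a real 2-form `w` of type (1,1). -/
def gram {n : ℕ} (w : Cn n [⋀^Fin 2]→L[ℝ] ℝ) : Matrix (Fin (2 * n)) (Fin (2 * n)) ℝ :=
  fun a b => w ![realBasis a, Complex.I • realBasis b]

/-- The Riemannian volume form `√(det g) dx₁ ∧ dy₁ ∧ ⋯ ∧ dxₙ ∧ dyₙ`, which is `wⁿ / n!`. -/
def volForm {n : ℕ} (w : Cn n [⋀^Fin 2]→L[ℝ] ℝ) (v : Fin (2 * n) → Cn n) : ℝ :=
  Real.sqrt (gram w).det * Matrix.det (fun a b => realCoord (v b) a)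

/-- The wedge product of a `k`-form and an `l`-form with values in `A` and `A'`, the values being
multiplied by means of `B`. -/
def wedge {V A A' : Type*} (B : A → A' → ℂ) {k l : ℕ}
    (α : (Fin k → V) → A) (β : (Fin l → V) → A') (v : Fin (k + l) → V) : ℂ :=
  ((k.factorial * l.factorial : ℕ) : ℂ)⁻¹ * ∑ σ : Equiv.Perm (Fin (k + l)),
    ((Equiv.Perm.sign σ : ℤ) : ℂ) *
      B (α fun a => v (σ (Fin.castAdd l a))) (β fun b => v (σ (Fin.natAdd k b)))

/-- The (complex linear) Hodge star of the Riemannian metric attached to `w`, from `k`-forms to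
`l`-forms, `k + l = 2n`:
`(⋆ξ)(v) = (1/k!) ∑_{I,J} g^{i₁j₁} ⋯ g^{i_k j_k} ξ(b_{i₁}, …, b_{i_k}) vol(b_{j₁}, …, b_{j_k}, v)`. -/
def hodgeStar {n : ℕ} {A : Type*} [AddCommGroup A] [Module ℝ A] (w : Cn n [⋀^Fin 2]→L[ℝ] ℝ)
    {k l : ℕ} (h : 2 * n = k + l) (ξ : (Fin k → Cn n) → A) (v : Fin l → Cn n) : A :=
  (k.factorial : ℝ)⁻¹ • ∑ I : Fin k → Fin (2 * n), ∑ J : Fin k → Fin (2 * n),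
    ((∏ a, (gram w)⁻¹ (I a) (J a)) *
      volForm w (fun c => Fin.append (fun a => realBasis (J a)) v (Fin.cast h c))) •
        ξ (fun a => realBasis (I a))

/-- The Hermitian inner product on `k`-forms with values in a complex line `A` with Hermitian inner
product `H`, induced by the Riemannian metric attached to `w`:
`⟨u, v⟩ = (1/k!) ∑_{I,J} g^{i₁j₁} ⋯ g^{i_k j_k} H(u(b_I), v(b_J))`. -/
def innerForm {n : ℕ} {A : Type*} (w : Cn n [⋀^Fin 2]→L[ℝ] ℝ) (H : A → A → ℂ) {k : ℕ}
    (u v : (Fin k → Cn n) → A) : ℂ :=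
  (k.factorial : ℂ)⁻¹ * ∑ I : Fin k → Fin (2 * n), ∑ J : Fin k → Fin (2 * n),
    ((∏ a, (gram w)⁻¹ (I a) (J a) : ℝ) : ℂ) *
      H (u fun a => realBasis (I a)) (v fun a => realBasis (J a))

/-- A `k`-form is of type `(p,q)`: `k = p + q` and `u(λ v₁, …, λ v_k) = λᵖ λ̄^q u(v₁, …, v_k)` for all
`λ ∈ ℂ`. -/
def IsOfType {n : ℕ} {A : Type*} [AddCommGroup A] [Module ℂ A] (p q : ℕ) {k : ℕ}
    (u : (Fin k → Cn n) → A) : Prop :=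
  k = p + q ∧ ∀ (c : ℂ) (v : Fin k → Cn n), u (fun a => c • v a) = (c ^ p * conj c ^ q) • u v

/-! ### Calculus in `ℂⁿ` -/

/-- `∂f(v) = ½ (df(v) - i df(i v))`. -/
def delAt {n : ℕ} (f : Cn n → ℂ) (p v : Cn n) : ℂ :=
  (fderiv ℝ f p v - Complex.I * fderiv ℝ f p (Complex.I • v)) / 2

/-- The Hermitian form `∑ ∂²φ/∂z_j∂z̄_k v_j v̄_k` of `i∂∂̄φ`. -/
def leviForm {n : ℕ} (φ : Cn n → ℝ) (p v : Cn n) : ℝ :=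
  (iteratedFDeriv ℝ 2 φ p ![v, v] +
    iteratedFDeriv ℝ 2 φ p ![Complex.I • v, Complex.I • v]) / 4

/-! ### Scalar forms and Kähler metrics on a complex manifold -/

section Manifold

variable {n : ℕ} {X : Type*} [TopologicalSpace X] [ChartedSpace (Cn n) X]
  [IsManifold 𝓘(ℂ, Cn n) ω X]

/-- The inverse, from coordinates to points, of the preferred chart at `x₀`. -/
def pt (x₀ : X) (p : Cn n) : X := (chartAt (Cn n) x₀).symm p

/-- The linear map which takes a vector in the coordinates of the preferred chart at `x₀`, based at
the point `q`, to the corresponding element of the tangent space at `q`. -/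
def toTangent (x₀ q : X) : Cn n →L[ℝ] Cn n :=
  (tangentCoordChange 𝓘(ℂ, Cn n) x₀ q q).restrictScalars ℝ

/-- A scalar form in the coordinates of the preferred chart at `x₀`. -/
def localScalarForm {k : ℕ} (w : X → Cn n [⋀^Fin k]→L[ℝ] ℝ) (x₀ : X) (p : Cn n) :
    Cn n [⋀^Fin k]→L[ℝ] ℝ :=
  (w (pt x₀ p)).compContinuousLinearMap (toTangent x₀ (pt x₀ p))

variable (n X) in
/-- A Kähler metric, given by its Kähler form: a smooth closed positive real form of type (1,1).
The Riemannian metric is `g(u, v) = ω(u, i v)`; for `ω = (i/2) ∑ dz_j ∧ dz̄_j` it is Euclidean. -/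
structure KahlerForm where
  form : X → Cn n [⋀^Fin 2]→L[ℝ] ℝ
  smooth : ∀ x₀ : X, ContDiffOn ℝ ∞ (localScalarForm form x₀) (chartAt (Cn n) x₀).target
  typeOneOne : ∀ (x : X) (u v : Cn n),
    form x ![Complex.I • u, Complex.I • v] = form x ![u, v]
  pos : ∀ (x : X) (v : Cn n), v ≠ 0 → 0 < form x ![v, Complex.I • v]
  closed : ∀ x₀ : X, extDeriv (localScalarForm form x₀) (chartAt (Cn n) x₀ x₀) = 0

/-- The part of the volume measure `dV_ω` in the domain of the preferred chart at `x₀`, namely the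
image of `√(det g)` times Lebesgue measure. -/
def chartVolume [MeasurableSpace X] (K : KahlerForm n X) (x₀ : X) : Measure X :=
  Measure.map (pt x₀) ((volume.restrict (chartAt (Cn n) x₀).target).withDensity fun p =>
    ENNReal.ofReal (Real.sqrt (gram (localScalarForm K.form x₀ p)).det))

/-- The volume measure `dV_ω`: the smallest measure that dominates the local ones.  These agree on
overlaps, so that `dV_ω` restricts to `chartVolume K x₀` on the domain of the chart at `x₀`. -/
def volMeasure [MeasurableSpace X] (K : KahlerForm n X) : Measure X :=
  ⨆ x₀ : X, chartVolume K x₀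

/-- The integral over `X` of a form of top degree, `∫_X T = ∫_X (T / dV_ω) dV_ω`. -/
def integralTop [MeasurableSpace X] (K : KahlerForm n X)
    (T : X → (Fin (2 * n) → Cn n) → ℂ) : ℂ :=
  ∫ x, T x realBasis / (volForm (K.form x) realBasis : ℂ) ∂(volMeasure K)

/-! ### Hermitian holomorphic line bundles and forms with values in them -/

variable (L : X → Type*) [TopologicalSpace (TotalSpace ℂ L)] [∀ x, TopologicalSpace (L x)]
  [∀ x, AddCommGroup (L x)] [∀ x, Module ℂ (L x)] [FiberBundle ℂ L] [VectorBundle ℂ ℂ L]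

/-- The coordinate `L_q → ℂ` on the fibre at `q` in the preferred trivialization at `x₀`. -/
def fibreCoord (x₀ q : X) : L q →L[ℂ] ℂ :=
  (trivializationAt ℂ L x₀).continuousLinearMapAt ℂ q

/-- The frame of `L` defined by the preferred trivialization at `x₀`. -/
def frame (x₀ q : X) : L q := (trivializationAt ℂ L x₀).symmL ℂ q 1

/-- A smooth Hermitian metric on a line bundle, linear in the first variable. -/
structure HermitianMetric where
  toFun : ∀ x, L x →ₗ[ℂ] L x →ₗ⋆[ℂ] ℂ
  symm : ∀ x (a b : L x), conj (toFun x a b) = toFun x b a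
  pos : ∀ x (a : L x), a ≠ 0 → 0 < (toFun x a a).re
  smooth : ∀ x₀ : X, ContMDiffOn 𝓘(ℝ, Cn n) 𝓘(ℝ, ℝ) ∞
    (fun q => (toFun q (frame L x₀ q) (frame L x₀ q)).re) (trivializationAt ℂ L x₀).baseSet

variable {L}

/-- The Hermitian product of two elements of the same fibre, `a b̄ e^{-φ}`. -/
def HermitianMetric.pair (h : HermitianMetric (n := n) L) (x : X) (a b : L x) : ℂ := h.toFun x a b

/-- The squared norm `|a|²_h`. -/
def HermitianMetric.normSq (h : HermitianMetric (n := n) L) (x : X) (a : L x) : ℝ :=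
  (h.pair x a a).re

/-- The local weight `φ = -log |e|²_h` for the holomorphic frame `e` at `x₀`, in the coordinates at
`x₀`. -/
def HermitianMetric.weight (h : HermitianMetric (n := n) L) (x₀ : X) (p : Cn n) : ℝ :=
  -Real.log (h.normSq (pt x₀ p) (frame L x₀ (pt x₀ p)))

/-- The curvature `Θ_h(L) = i∂∂̄φ` at `x`, as a Hermitian form on the tangent space. -/
def HermitianMetric.curvature (h : HermitianMetric (n := n) L) (x : X) (v : Cn n) : ℝ :=
  leviForm (h.weight x) (chartAt (Cn n) x x) v

/-- The (1,0)-part `∂s - s ∂φ` of the Chern derivative of a section `s` of `L`. -/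
def HermitianMetric.chernDel (h : HermitianMetric (n := n) L) (s : ∀ x, L x) (x : X)
    (v : Fin 1 → Cn n) : L x :=
  (delAt (fun p => fibreCoord L x (pt x p) (s (pt x p))) (chartAt (Cn n) x x) (v 0) -
    fibreCoord L x x (s x) *
      delAt (fun p => (h.weight x p : ℂ)) (chartAt (Cn n) x x) (v 0)) • frame L x x

/-- An `L`-valued form of degree `k`. -/
abbrev LForm (n : ℕ) {X : Type*} (L : X → Type*) [∀ x, TopologicalSpace (L x)]
    [∀ x, AddCommGroup (L x)] [∀ x, Module ℂ (L x)] (k : ℕ) :=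
  ∀ x : X, Cn n [⋀^Fin k]→L[ℝ] L x

/-- An `L`-valued form in the coordinates and in the frame at `x₀`. -/
def localForm {k : ℕ} (ξ : LForm n L k) (x₀ : X) (p : Cn n) : Cn n [⋀^Fin k]→L[ℝ] ℂ :=
  (((fibreCoord L x₀ (pt x₀ p)).restrictScalars ℝ).compContinuousAlternatingMap
    (ξ (pt x₀ p))).compContinuousLinearMap (toTangent x₀ (pt x₀ p))

/-- A form with values in `L` is smooth if its coefficients are. -/
def IsSmoothForm {k : ℕ} (ξ : LForm n L k) : Prop :=
  ∀ x₀ : X, ContDiffOn ℝ ∞ (localForm ξ x₀)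
    {p | p ∈ (chartAt (Cn n) x₀).target ∧ pt x₀ p ∈ (trivializationAt ℂ L x₀).baseSet}


/-- A smooth `L`-valued form of type `(p,q)` with compact support. -/
def IsTestForm (p q : ℕ) {k : ℕ} (ξ : LForm n L k) : Prop :=
  IsSmoothForm ξ ∧ (∀ x, IsOfType p q (ξ x)) ∧ IsCompact (closure {x | ξ x ≠ 0})

/-- `∂̄ξ` for an `L`-valued form `ξ` of type `(n,q)`, where `n` is the dimension.  There are no forms
of type `(n+1,q)`, so that `∂̄` is the exterior derivative in any holomorphic frame. -/
def dbar {k : ℕ} (ξ : LForm n L k) : LForm n L (k + 1) := fun x =>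
  (((trivializationAt ℂ L x).symmL ℂ x).restrictScalars ℝ).compContinuousAlternatingMap
    (extDeriv (localForm ξ x) (chartAt (Cn n) x x))

/-- `|u|²` at `x` for an `L`-valued form, with respect to the Kähler metric and the metric of `L`;
the factor `e^{-φ}` is included. -/
def normSqForm (K : KahlerForm n X) (h : HermitianMetric (n := n) L) {k : ℕ} (u : LForm n L k)
    (x : X) : ℝ :=
  (innerForm (K.form x) (h.pair x) (u x) (u x)).re

/-- `η = ∂̄*ξ` for an `L`-valued `(n,1)`-form `ξ`: `η` is the smooth `(n,0)`-form such that
`∫ ⟨∂̄ζ, ξ⟩ dV = ∫ ⟨ζ, η⟩ dV` for all smooth `(n,0)`-forms `ζ` with compact support. -/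
def IsDbarAdjoint [MeasurableSpace X] (K : KahlerForm n X) (h : HermitianMetric (n := n) L)
    (ξ : LForm n L (n + 1)) (η : LForm n L n) : Prop :=
  IsSmoothForm η ∧ (∀ x, IsOfType n 0 (η x)) ∧
    ∀ ζ : LForm n L n, IsTestForm n 0 ζ →
      ∫ x, innerForm (K.form x) (h.pair x) (dbar ζ x) (ξ x) ∂(volMeasure K) =
        ∫ x, innerForm (K.form x) (h.pair x) (ζ x) (η x) ∂(volMeasure K)

/-! ### Simple normal crossing divisors -/

/-- `c` is a holomorphic chart in which the sets `Y_j`, `j ∈ S`, are the distinct coordinate hyperplanes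
`z_{ι j} = 0`, and which the other sets `Y_j` do not meet. -/
def IsAdaptedChart {J : Type} (Y : J → Set X) (c : OpenPartialHomeomorph X (Cn n))
    (S : Finset J) (ι : J → Fin n) : Prop :=
  c ∈ IsManifold.maximalAtlas 𝓘(ℂ, Cn n) ω X ∧ Set.InjOn ι S ∧
    (∀ j ∈ S, Y j ∩ c.source = {y | y ∈ c.source ∧ c y (ι j) = 0}) ∧
    ∀ j, j ∉ S → Y j ∩ c.source = ∅

variable (n X) in
/-- A (reduced) divisor `Y = ∑ Y_j` with simple normal crossings: the `Y_j` are smooth hypersurfaces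
which, near every point, are distinct coordinate hyperplanes in suitable holomorphic coordinates. -/
structure SNCDivisor where
  J : Type
  comp : J → Set X
  exists_chart : ∀ x : X, ∃ (c : OpenPartialHomeomorph X (Cn n)) (S : Finset J) (ι : J → Fin n),
    x ∈ c.source ∧ IsAdaptedChart comp c S ι

/-- The holomorphic section `s` of the line bundle `F` has divisor `Y`: near every point it is, in a
holomorphic frame, a nowhere zero holomorphic function times `∏ z_{ι j}`.  This says that `(F, s)` is
the line bundle `𝒪(Y)` with its canonical section `s_Y`, up to a unique isomorphism. -/
def IsCanonicalSection (Y : SNCDivisor n X) (s : ∀ x, L x) : Prop :=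
  ∀ x : X, ∃ (c : OpenPartialHomeomorph X (Cn n)) (S : Finset Y.J) (ι : Y.J → Fin n) (f : X → ℂ),
    x ∈ c.source ∧ IsAdaptedChart Y.comp c S ι ∧ c.source ⊆ (trivializationAt ℂ L x).baseSet ∧
    ContMDiffOn 𝓘(ℂ, Cn n) 𝓘(ℂ, ℂ) ω f c.source ∧
    ∀ y ∈ c.source, f y ≠ 0 ∧ fibreCoord L x y (s y) = f y * ∏ j ∈ S, c y (ι j)

/-! ### The two sides of the estimate -/

variable {F : X → Type*} [TopologicalSpace (TotalSpace ℂ F)] [∀ x, TopologicalSpace (F x)]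
  [∀ x, AddCommGroup (F x)] [∀ x, Module ℂ (F x)] [FiberBundle ℂ F] [VectorBundle ℂ ℂ F]

/-- `γ_ξ = ⋆ξ`, of degree `n - 1`, for an `L`-valued form `ξ` of type `(n,1)`. -/
def gammaForm (hn : 1 ≤ n) (K : KahlerForm n X) (ξ : LForm n L (n + 1)) (x : X) :
    (Fin (n - 1) → Cn n) → L x :=
  hodgeStar (K.form x) (k := n + 1) (l := n - 1) (by omega) (ξ x)

/-- The form of top degree
`c_{n-1} γ_ξ ∧ γ̄_ξ e^{-φ_L} ∧ i ∂s ∧ ∂s̄ e^{-φ_F}`, where `c_{n-1} = i^{(n-1)²}`. -/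
def tangentialForm (hn : 1 ≤ n) (K : KahlerForm n X) (hL : HermitianMetric (n := n) L)
    (hF : HermitianMetric (n := n) F) (s : ∀ x, F x) (ξ : LForm n L (n + 1)) (x : X)
    (v : Fin (2 * n) → Cn n) : ℂ :=
  Complex.I ^ ((n - 1) ^ 2) *
    wedge (fun a b => a * b)
      (wedge (hL.pair x) (gammaForm hn K ξ x) (gammaForm hn K ξ x))
      (fun u => Complex.I * wedge (hF.pair x) (hF.chernDel s x) (hF.chernDel s x) u)
      (fun a => v (Fin.cast (by omega) a))

/-- `c_{n-1} ∫_X τ² / (τ² + |s|²)² γ_ξ ∧ γ̄_ξ e^{-φ_L} ∧ i ∂s ∧ ∂s̄`. -/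
def estimateLHS [MeasurableSpace X] (hn : 1 ≤ n) (K : KahlerForm n X)
    (hL : HermitianMetric (n := n) L) (hF : HermitianMetric (n := n) F) (s : ∀ x, F x) (τ : ℝ)
    (ξ : LForm n L (n + 1)) : ℝ :=
  (integralTop K fun x v =>
    ((τ ^ 2 / (τ ^ 2 + hF.normSq x (s x)) ^ 2 : ℝ) : ℂ) * tangentialForm hn K hL hF s ξ x v).re

/-- `∫_X log²(τ² + |s|²) (|∂̄*ξ|² + |∂̄ξ|²) e^{-φ_L} dV_ω`, where `η` stands for `∂̄*ξ`. -/
def estimateRHS [MeasurableSpace X] (K : KahlerForm n X)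
    (hL : HermitianMetric (n := n) L) (hF : HermitianMetric (n := n) F) (s : ∀ x, F x) (τ : ℝ)
    (ξ : LForm n L (n + 1)) (η : LForm n L n) : ℝ :=
  ∫ x, Real.log (τ ^ 2 + hF.normSq x (s x)) ^ 2 *
    (normSqForm K hL η x + normSqForm K hL (dbar ξ) x) ∂(volMeasure K)

end Manifold

end

end KahlerForms

open KahlerForms

/-! The estimate is a twisted Bochner–Kodaira inequality, in the manner of Ohsawa and Takegoshi,
with a well chosen twist. By means of the metric, an `L`-valued `(n,1)`-form `ξ` becomes a vector
field `V` with values in `K_X ⊗ L` (`dualVec`), and every ingredient is simple in terms of `V`. The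
form `⋆ξ` is a contraction of `dz₁ ∧ ⋯ ∧ dzₙ` with `V`, so that the left-hand integrand is
`τ²/(τ²+|s|²)² |∂s(V)|²`, up to a factor shared by all the norms (`tangentialForm_div_volForm`). The
coefficient of `∂̄*ξ` is `-2` times the weighted divergence of `V` (`topCoeff_dbarAdjoint`). The
coefficients of `∂̄ξ` are the antisymmetrization of `∂̄V` with its index lowered, because `ω` is
closed (`antiCoeff₂_extDeriv_eq`).

For a smooth function `g` with compact support, integrations by parts in `ℂⁿ` in which no metric
occurs give an exact identity (`bochner_identity`). For `g ≥ 0`, discarding the square of `∂̄V`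
leaves an inequality on a chart (`integral_bochnerTerm_nonneg`). It is linear in `g` and independent
of coordinates and frames, so that a partition of unity makes it global
(`integral_bochnerAt_nonneg`): up to the common factor, `∫ g (|∂̄*ξ|² + |∂̄ξ|²) ≥ ∫ (g Θ_L -
i∂∂̄g)(V, V) + Re (∂̄*ξ · conj ∂g(V))`. As `ξ` has compact support, there are no boundary terms.

The twist is `g = B + u + log (1 + u)` with `u = log ((1+τ²)/(τ²+|s|²))`, which is nonnegative
because `|s|² ≤ 1`. Then `-i∂∂̄g` contains three terms. The first is `g'(u) τ²/(τ²+|s|²)² |∂s|²`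
with `g' ≥ 1`, which dominates the left-hand side. The second is `-g'(u) |s|²/(τ²+|s|²) Θ_Y`, which
is compensated by `g Θ_L` as soon as `g'(u) |s|²/(τ²+|s|²) ≤ δ g`. The third is `|∂u|²/(1+u)²`,
which comes from the concavity of `log (1 + u)` and absorbs the cross term at the cost of `4(1+u)²
|∂̄*ξ|²` (`pointwise_estimate`).

The condition on `g` holds with `B = 2/δ` in case (1). In case (2) it holds with `B = 3`, because
`|s|² ≤ e^{-1/δ}` makes `|s|²/(τ²+|s|²)` small unless `u` is of size `1/δ`
(`curvature_factor_le_of_exp`). Finally `g + 4(1+u)²` is at most a constant times `log²(τ²+|s|²)`,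
since this logarithm is bounded away from `0` (`concaveFun_add_le`). -/

namespace KahlerForms

noncomputable section

set_option linter.unusedSectionVars false

/-! ### Complexified evaluation of real alternating forms on `ℂⁿ` -/

section Complexification

variable {n k : ℕ}

/-- The splitting of a real index into a complex index and a parity. -/
def realIndexEquiv (n : ℕ) : Fin (2 * n) ≃ Fin n × Fin 2 where
  toFun a := (⟨a / 2, by omega⟩, ⟨a % 2, by omega⟩)
  invFun p := ⟨2 * p.1 + p.2, by omega⟩
  left_inv a := by ext; simp; omega
  right_inv p := by ext <;> simp <;> omega

lemma sum_realIndex {A : Type*} [AddCommMonoid A] (F : Fin (2 * n) → A) :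
    ∑ a, F a = ∑ j : Fin n, (F ((realIndexEquiv n).symm (j, 0)) +
      F ((realIndexEquiv n).symm (j, 1))) := by
  rw [← (realIndexEquiv n).symm.sum_comp, Fintype.sum_prod_type]
  simp [Fin.sum_univ_two]

@[simp] lemma realBasis_symm_zero (j : Fin n) :
    realBasis ((realIndexEquiv n).symm (j, 0)) = Pi.single j (1 : ℂ) := by
  simp only [realBasis, realIndexEquiv, Equiv.coe_fn_symm_mk]
  congr 1
  · ext; simp
  · simp

@[simp] lemma realBasis_symm_one (j : Fin n) :
    realBasis ((realIndexEquiv n).symm (j, 1)) = Pi.single j Complex.I := by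
  have : (⟨(2 * (j : ℕ) + 1) / 2, by omega⟩ : Fin n) = j := by ext; simp; omega
  simp only [realBasis, realIndexEquiv, Equiv.coe_fn_symm_mk]
  simp [this, Nat.add_mod]

@[simp] lemma realCoord_symm_zero (v : Cn n) (j : Fin n) :
    realCoord v ((realIndexEquiv n).symm (j, 0)) = (v j).re := by
  simp [realCoord, realIndexEquiv]

@[simp] lemma realCoord_symm_one (v : Cn n) (j : Fin n) :
    realCoord v ((realIndexEquiv n).symm (j, 1)) = (v j).im := by
  have : (⟨(2 * (j : ℕ) + 1) / 2, by omega⟩ : Fin n) = j := by ext; simp; omega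
  simp [realCoord, realIndexEquiv, this, Nat.add_mod]

lemma sum_realCoord_smul_realBasis (v : Cn n) :
    ∑ a, realCoord v a • (realBasis a : Cn n) = v := by
  rw [sum_realIndex]
  ext i
  simp only [realCoord_symm_zero, realBasis_symm_zero, realCoord_symm_one, realBasis_symm_one,
    Finset.sum_apply, Pi.add_apply, Pi.smul_apply]
  rw [Finset.sum_eq_single i]
  · simp [Complex.re_add_im]
  · intro j _ hj
    simp [Pi.single_eq_of_ne hj.symm]
  · simp

lemma realCoord_add (u v : Cn n) (a : Fin (2 * n)) :
    realCoord (u + v) a = realCoord u a + realCoord v a := by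
  unfold realCoord; split_ifs <;> simp

lemma realCoord_smul (c : ℝ) (v : Cn n) (a : Fin (2 * n)) :
    realCoord (c • v) a = c * realCoord v a := by
  unfold realCoord; split_ifs <;> simp

lemma realCoord_realBasis (a b : Fin (2 * n)) :
    realCoord (realBasis a : Cn n) b = if a = b then 1 else 0 := by
  obtain ⟨⟨j, s⟩, rfl⟩ := (realIndexEquiv n).symm.surjective a
  obtain ⟨⟨l, t⟩, rfl⟩ := (realIndexEquiv n).symm.surjective b
  simp only [EmbeddingLike.apply_eq_iff_eq, Prod.mk.injEq]
  by_cases h : j = l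
  · subst h
    fin_cases s <;> fin_cases t <;> simp
  · fin_cases s <;> fin_cases t <;> simp [h]

/-- The complex multilinear extension of a real alternating form, in the real coordinates. -/
def cext (f : Cn n [⋀^Fin k]→L[ℝ] ℂ) : (Fin (2 * n) → ℂ) [⋀^Fin k]→ₗ[ℂ] ℂ :=
  { (∑ I : Fin k → Fin (2 * n), f (fun a => realBasis (I a)) •
      (MultilinearMap.mkPiAlgebra ℂ (Fin k) ℂ).compLinearMap
        (fun a => LinearMap.proj (R := ℂ) (φ := fun _ => ℂ) (I a)) :
      MultilinearMap ℂ (fun _ : Fin k => Fin (2 * n) → ℂ) ℂ) with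
    map_eq_zero_of_eq' := by
      intro v i j hv hij
      simp only [MultilinearMap.toFun_eq_coe, sum_apply,
        smul_apply, MultilinearMap.compLinearMap_apply,
        MultilinearMap.mkPiAlgebra_apply, LinearMap.proj_apply, smul_eq_mul]
      set S := ∑ I : Fin k → Fin (2 * n), f (fun a => realBasis (I a)) * ∏ a, v a (I a) with hS
      -- Exchanging the indices at `i` and `j` changes the sign of the coefficient of `f` but not
      -- the product, because `v i = v j`.
      have h : S = -S := by
        conv_lhs => rw [hS, ← (Equiv.arrowCongr (Equiv.swap i j) (Equiv.refl _)).sum_comp]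
        rw [hS, ← Finset.sum_neg_distrib]
        refine Finset.sum_congr rfl fun I _ => ?_
        have e1 : (fun a => realBasis ((Equiv.arrowCongr (Equiv.swap i j) (Equiv.refl _)) I a) :
            Fin k → Cn n) = (fun a => realBasis (I a)) ∘ Equiv.swap i j := by
          ext a; simp [Equiv.arrowCongr]
        have e2 : f ((fun a => realBasis (I a)) ∘ Equiv.swap i j) =
            -f (fun a => realBasis (I a)) := f.toAlternatingMap.map_swap _ hij
        rw [e1, e2, neg_mul]
        congr 2
        rw [← Equiv.prod_comp (Equiv.swap i j)]
        refine Finset.prod_congr rfl fun a _ => ?_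
        have : v ((Equiv.swap i j) a) = v a := by
          by_cases h1 : a = i
          · subst h1; simp [hv]
          by_cases h2 : a = j
          · subst h2; simp [hv]
          rw [Equiv.swap_apply_of_ne_of_ne h1 h2]
        simp [Equiv.arrowCongr, this]
      have : (2 : ℂ) * S = 0 := by linear_combination h
      simpa using this }

lemma cext_apply (f : Cn n [⋀^Fin k]→L[ℝ] ℂ) (z : Fin k → Fin (2 * n) → ℂ) :
    cext f z = ∑ I : Fin k → Fin (2 * n), f (fun a => realBasis (I a)) * ∏ a, z a (I a) := by
  change (∑ I : Fin k → Fin (2 * n), f (fun a => realBasis (I a)) •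
      (MultilinearMap.mkPiAlgebra ℂ (Fin k) ℂ).compLinearMap
        (fun a => LinearMap.proj (R := ℂ) (φ := fun _ => ℂ) (I a)) :
      MultilinearMap ℂ (fun _ : Fin k => Fin (2 * n) → ℂ) ℂ) z = _
  simp

/-- The real coordinates of a vector, as complex numbers. -/
def rvec (v : Cn n) (a : Fin (2 * n)) : ℂ := (realCoord v a : ℂ)

lemma cext_rvec (f : Cn n [⋀^Fin k]→L[ℝ] ℂ) (v : Fin k → Cn n) :
    cext f (fun a => rvec (v a)) = f v := by
  conv_rhs => rw [show v = fun a => ∑ c, realCoord (v a) c • (realBasis c : Cn n) from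
    funext fun a => (sum_realCoord_smul_realBasis (v a)).symm]
  rw [cext_apply]
  have := f.toMultilinearMap.map_sum (fun a c => realCoord (v a) c • (realBasis c : Cn n))
  refine Eq.trans ?_ this.symm
  refine Finset.sum_congr rfl fun I _ => ?_
  have := f.toMultilinearMap.map_smul_univ (fun a => realCoord (v a) (I a))
    (fun a => (realBasis (I a) : Cn n))
  refine Eq.trans ?_ this.symm
  simp [rvec, mul_comm]

/-- The `(1,0)`-part of a tangent vector, in complexified real coordinates. -/
def holVec (v : Cn n) (a : Fin (2 * n)) : ℂ :=
  if (a : ℕ) % 2 = 0 then v ⟨a / 2, by omega⟩ / 2 else -Complex.I * v ⟨a / 2, by omega⟩ / 2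

/-- The `(0,1)`-part of a tangent vector, in complexified real coordinates. -/
def antiVec (v : Cn n) (a : Fin (2 * n)) : ℂ := conj (holVec v a)

lemma holVec_add (u v : Cn n) : holVec (u + v) = holVec u + holVec v := by
  ext a; simp only [holVec, Pi.add_apply]; split_ifs <;> ring

lemma holVec_smul (c : ℂ) (v : Cn n) : holVec (c • v) = c • holVec v := by
  ext a; simp only [holVec, Pi.smul_apply, smul_eq_mul]; split_ifs <;> ring

/-- `holVec` as a linear map. -/
def holVecLM (n : ℕ) : Cn n →ₗ[ℂ] (Fin (2 * n) → ℂ) where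
  toFun := holVec
  map_add' := holVec_add
  map_smul' c v := by simp [holVec_smul]

@[simp] lemma holVecLM_apply (v : Cn n) : holVecLM n v = holVec v := rfl

lemma antiVec_add (u v : Cn n) : antiVec (u + v) = antiVec u + antiVec v := by
  ext a; simp [antiVec, holVec_add]

lemma antiVec_smul (c : ℂ) (v : Cn n) : antiVec (c • v) = conj c • antiVec v := by
  ext a; simp [antiVec, holVec_smul]

lemma antiVec_sum {ι : Type*} (s : Finset ι) (v : ι → Cn n) :
    antiVec (∑ i ∈ s, v i) = ∑ i ∈ s, antiVec (v i) := by
  classical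
  induction s using Finset.induction_on with
  | empty => ext a; simp [antiVec, holVec]
  | insert i s hi ih => rw [Finset.sum_insert hi, Finset.sum_insert hi, antiVec_add, ih]

lemma holVec_eq (v : Cn n) :
    holVec v = (2⁻¹ : ℂ) • rvec v + (-(Complex.I / 2)) • rvec (Complex.I • v) := by
  ext a
  simp only [holVec, rvec, realCoord, Pi.add_apply, Pi.smul_apply, smul_eq_mul]
  split_ifs <;> apply Complex.ext <;> simp <;> ring

lemma antiVec_eq (v : Cn n) :
    antiVec v = (2⁻¹ : ℂ) • rvec v + (Complex.I / 2) • rvec (Complex.I • v) := by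
  ext a
  simp only [antiVec, holVec_eq, rvec, Pi.add_apply, Pi.smul_apply, smul_eq_mul, map_add, map_mul,
    Complex.conj_ofReal, map_neg, map_div₀, Complex.conj_I, map_inv₀, map_ofNat]
  ring

lemma rvec_eq (v : Cn n) : rvec v = holVec v + antiVec v := by
  rw [holVec_eq, antiVec_eq]; module

/-- The `(1,0)`- or `(0,1)`-part of a vector, according to `t`. -/
def partVec (t : Bool) (v : Cn n) : Fin (2 * n) → ℂ := if t then antiVec v else holVec v

/-- The coefficients of `partVec` in terms of `v` and `i v`. -/
def partCoeff (t s : Bool) : ℂ :=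
  if s then (if t then Complex.I / 2 else -(Complex.I / 2)) else 2⁻¹

lemma partVec_eq (t : Bool) (v : Cn n) :
    partVec t v = ∑ s : Bool, partCoeff t s • rvec (if s then Complex.I • v else v) := by
  cases t <;> simp [partVec, partCoeff, holVec_eq, antiVec_eq, add_comm]

/-- Only values of `f` at the vectors `v a` and `i v a` occur. A map that commutes with `i`
therefore acts on complexified values without any reference to its real matrix. -/
lemma cext_partVec (f : Cn n [⋀^Fin k]→L[ℝ] ℂ) (t : Fin k → Bool) (v : Fin k → Cn n) :
    cext f (fun a => partVec (t a) (v a)) = ∑ S : Fin k → Bool, (∏ a, partCoeff (t a) (S a)) *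
      f (fun a => if S a then Complex.I • v a else v a) := by
  simp only [partVec_eq]
  refine ((cext f).toMultilinearMap.map_sum
    (fun a s => partCoeff (t a) s • rvec (if s then Complex.I • v a else v a))).trans ?_
  refine Finset.sum_congr rfl fun S _ => ?_
  refine ((cext f).toMultilinearMap.map_smul_univ (fun a => partCoeff (t a) (S a))
    (fun a => rvec (if S a then Complex.I • v a else v a))).trans ?_
  rw [smul_eq_mul]
  congr 1
  exact cext_rvec f _

/-- Complexified evaluation is natural for complex linear maps. -/
lemma cext_comp_partVec (f g : Cn n [⋀^Fin k]→L[ℝ] ℂ) (A : Cn n → Cn n)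
    (hA : ∀ v, A (Complex.I • v) = Complex.I • A v) (c : ℂ)
    (h : ∀ v : Fin k → Cn n, g v = c * f (fun a => A (v a)))
    (t : Fin k → Bool) (v : Fin k → Cn n) :
    cext g (fun a => partVec (t a) (v a)) = c * cext f (fun a => partVec (t a) (A (v a))) := by
  rw [cext_partVec, cext_partVec, Finset.mul_sum]
  refine Finset.sum_congr rfl fun S _ => ?_
  rw [h]
  have : (fun a => A (if S a = true then Complex.I • v a else v a)) =
      fun a => if S a = true then Complex.I • A (v a) else A (v a) := by
    ext1 a; split_ifs <;> simp [hA]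
  rw [this]; ring

lemma partVec_smul (t : Bool) (c : ℂ) (v : Cn n) :
    partVec t (c • v) = (if t then conj c else c) • partVec t v := by
  cases t <;> simp [partVec, holVec_smul, antiVec_smul]

/-- A form of type `(p,q)` vanishes on vectors of a different type. -/
lemma IsOfType.cext_eq_zero {p q : ℕ} {f : Cn n [⋀^Fin k]→L[ℝ] ℂ} (hf : IsOfType p q f)
    (t : Fin k → Bool) (v : Fin k → Cn n)
    (ht : (Finset.univ.filter fun a => t a = true).card ≠ q) :
    cext f (fun a => partVec (t a) (v a)) = 0 := by
  obtain ⟨hk, hf⟩ := hf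
  set r := (Finset.univ.filter fun a => t a = true).card with hr
  have hrk : r ≤ k := by
    simpa using Finset.card_le_univ (Finset.univ.filter fun a => t a = true)
  set s := (Finset.univ.filter fun a => ¬ t a = true).card with hs
  have hrs : r + s = k := by
    have := Finset.card_filter_add_card_filter_not (s := (Finset.univ : Finset (Fin k)))
      (fun a => t a = true)
    simpa [hr, hs] using this
  -- `e^i` has modulus one and, `π` being irrational, is not a root of unity, so that this single
  -- scalar separates all types.
  set c : ℂ := Complex.exp (Complex.I) with hc
  have hcc : c * conj c = 1 := by
    rw [hc, ← Complex.exp_conj, ← Complex.exp_add]; simp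
  have hc0 : c ≠ 0 := Complex.exp_ne_zero _
  have h1 : cext f (fun a => partVec (t a) (c • v a)) =
      c ^ s * conj c ^ r * cext f (fun a => partVec (t a) (v a)) := by
    simp only [partVec_smul]
    refine ((cext f).toMultilinearMap.map_smul_univ (fun a => if t a then conj c else c)
      (fun a => partVec (t a) (v a))).trans ?_
    rw [Finset.prod_ite, Finset.prod_const, Finset.prod_const, smul_eq_mul]
    simp only [← hr, ← hs]
    rw [mul_comm (conj c ^ r)]
    rfl
  -- The same value computed a second time, from the homogeneity of `f` rather than from
  -- multilinearity. The comparison gives `c^(p-q) = c^(s-r)` if the value is not zero.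
  have h2 := cext_comp_partVec f ((c ^ p * conj c ^ q) • f) (fun w => c • w)
    (fun w => smul_comm _ _ _) 1 (fun w => by rw [one_mul, hf]; rfl) t v
  have h3 : cext ((c ^ p * conj c ^ q) • f) (fun a => partVec (t a) (v a)) =
      (c ^ p * conj c ^ q) * cext f (fun a => partVec (t a) (v a)) := by
    rw [cext_apply, cext_apply, Finset.mul_sum]
    exact Finset.sum_congr rfl fun I _ => by simp [mul_assoc]
  rw [h3, one_mul, h1] at h2
  by_contra h0
  have h4 := mul_right_cancel₀ h0 h2
  have hcj : conj c = c⁻¹ := eq_inv_of_mul_eq_one_right hcc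
  rw [hcj] at h4
  have h5 : c ^ ((p : ℤ) - q - (s - r)) = 1 := by
    rw [zpow_sub₀ hc0, zpow_sub₀ hc0, zpow_sub₀ hc0]
    simp only [zpow_natCast]
    rw [div_eq_one_iff_eq (by positivity)]
    rw [div_eq_mul_inv, div_eq_mul_inv, ← inv_pow, ← inv_pow]; exact h4
  rw [hc, ← Complex.exp_int_mul, Complex.exp_eq_one_iff] at h5
  obtain ⟨N, hN⟩ := h5
  have h6 : (((p : ℤ) - q - (s - r) : ℤ) : ℝ) = N * (2 * Real.pi) := by
    have := congrArg Complex.im hN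
    simpa using this
  have hN0 : N = 0 := by
    by_contra hN0
    -- With `N ≠ 0` the integer on the left would equal `2Nπ`.
    have hirr := (irrational_pi.intCast_mul (m := 2 * N) (by omega))
    refine hirr ⟨(((p : ℤ) - q - (s - r) : ℤ) : ℚ), ?_⟩
    push_cast at h6 ⊢
    linarith
  rw [hN0] at h6
  have h7 : ((p : ℤ) - q - (s - r) : ℤ) = 0 := by exact_mod_cast (by simpa using h6 :
    (((p : ℤ) - q - (s - r) : ℤ) : ℝ) = 0)
  omega

end Complexification

/-! ### The Hermitian matrix of a `(1,1)`-form and unitary frames -/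

section Hermitian

open scoped ComplexOrder MatrixOrder Matrix.Norms.L2Operator

variable {n k : ℕ}

/-- The Hermitian form `g - i w` of a real form `w` of type `(1,1)`. -/
def hermForm (w : Cn n [⋀^Fin 2]→L[ℝ] ℝ) (u v : Cn n) : ℂ :=
  w ![u, Complex.I • v] - Complex.I * w ![u, v]

/-- The matrix of `hermForm`. -/
def hermMat (w : Cn n [⋀^Fin 2]→L[ℝ] ℝ) : Matrix (Fin n) (Fin n) ℂ :=
  fun j l => hermForm w (Pi.single j 1) (Pi.single l 1)

/-- A real form is of type `(1,1)` and positive. -/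
structure IsPositiveOneOne (w : Cn n [⋀^Fin 2]→L[ℝ] ℝ) : Prop where
  typeOneOne : ∀ u v : Cn n, w ![Complex.I • u, Complex.I • v] = w ![u, v]
  pos : ∀ v : Cn n, v ≠ 0 → 0 < w ![v, Complex.I • v]

variable {w : Cn n [⋀^Fin 2]→L[ℝ] ℝ}

lemma form_add_left (w : Cn n [⋀^Fin 2]→L[ℝ] ℝ) (u u' v : Cn n) :
    w ![u + u', v] = w ![u, v] + w ![u', v] := by
  have h := w.toMultilinearMap.map_update_add ![u, v] 0 u u'
  have e : ∀ x, Function.update ![u, v] 0 x = ![x, v] := fun x => by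
    ext i; fin_cases i <;> rfl
  rw [e, e, e] at h
  exact h

lemma form_smul_left (w : Cn n [⋀^Fin 2]→L[ℝ] ℝ) (c : ℝ) (u v : Cn n) :
    w ![c • u, v] = c * w ![u, v] := by
  have h := w.toMultilinearMap.map_update_smul ![u, v] 0 c u
  have e : ∀ x, Function.update ![u, v] 0 x = ![x, v] := fun x => by
    ext i; fin_cases i <;> rfl
  rw [e, e] at h
  exact h

lemma form_swap (w : Cn n [⋀^Fin 2]→L[ℝ] ℝ) (u v : Cn n) : w ![v, u] = -w ![u, v] := by
  have := w.toAlternatingMap.map_swap ![u, v] (i := 0) (j := 1) (by simp)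
  have e : (![u, v] ∘ Equiv.swap (0 : Fin 2) 1) = ![v, u] := by
    ext i; fin_cases i <;> simp
  rw [e] at this
  exact this

lemma form_add_right (w : Cn n [⋀^Fin 2]→L[ℝ] ℝ) (u v v' : Cn n) :
    w ![u, v + v'] = w ![u, v] + w ![u, v'] := by
  rw [form_swap, form_add_left, form_swap w u v, form_swap w u v']; ring

lemma form_smul_right (w : Cn n [⋀^Fin 2]→L[ℝ] ℝ) (c : ℝ) (u v : Cn n) :
    w ![u, c • v] = c * w ![u, v] := by
  rw [form_swap, form_smul_left, form_swap w u v]; ring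

lemma IsPositiveOneOne.form_I_left (hw : IsPositiveOneOne w) (u v : Cn n) :
    w ![Complex.I • u, v] = -w ![u, Complex.I • v] := by
  have h := hw.typeOneOne u (Complex.I • v)
  rw [← h, smul_smul, Complex.I_mul_I, neg_one_smul, ← neg_one_smul ℝ v, form_smul_right]
  ring

lemma hermForm_add_left (w : Cn n [⋀^Fin 2]→L[ℝ] ℝ) (u u' v : Cn n) :
    hermForm w (u + u') v = hermForm w u v + hermForm w u' v := by
  simp only [hermForm, form_add_left]; push_cast; ring

lemma IsPositiveOneOne.hermForm_smul_left (hw : IsPositiveOneOne w) (c : ℂ) (u v : Cn n) :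
    hermForm w (c • u) v = c * hermForm w u v := by
  have e : c • u = c.re • u + c.im • (Complex.I • u) := by
    ext i; simp only [Pi.smul_apply, Pi.add_apply, smul_eq_mul, Complex.real_smul]
    conv_lhs => rw [← Complex.re_add_im c]
    ring
  rw [e]
  simp only [hermForm, form_add_left, form_smul_left, hw.form_I_left]
  have e2 : Complex.I • Complex.I • v = (-1 : ℝ) • v := by
    rw [smul_smul, Complex.I_mul_I]; ext; simp
  rw [e2, form_smul_right]
  conv_rhs => rw [← Complex.re_add_im c]
  push_cast
  linear_combination ((c.im : ℂ) * w ![u, v]) * Complex.I_sq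

lemma IsPositiveOneOne.hermForm_symm (hw : IsPositiveOneOne w) (u v : Cn n) :
    conj (hermForm w u v) = hermForm w v u := by
  simp only [hermForm, map_sub, map_mul, Complex.conj_ofReal, Complex.conj_I]
  rw [form_swap w u v, form_swap w (Complex.I • u) v, hw.form_I_left]
  push_cast; ring

lemma IsPositiveOneOne.hermForm_sum_left (hw : IsPositiveOneOne w) {ι : Type*} (s : Finset ι)
    (c : ι → ℂ) (u : ι → Cn n) (v : Cn n) :
    hermForm w (∑ i ∈ s, c i • u i) v = ∑ i ∈ s, c i * hermForm w (u i) v := by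
  classical
  induction s using Finset.induction_on with
  | empty =>
    have := hw.hermForm_smul_left 0 0 v
    simpa using this
  | insert i s hi ih =>
    rw [Finset.sum_insert hi, Finset.sum_insert hi, hermForm_add_left, ih, hw.hermForm_smul_left]

lemma IsPositiveOneOne.hermForm_sum_right (hw : IsPositiveOneOne w) {ι : Type*} (s : Finset ι)
    (c : ι → ℂ) (u : Cn n) (v : ι → Cn n) :
    hermForm w u (∑ i ∈ s, c i • v i) = ∑ i ∈ s, conj (c i) * hermForm w u (v i) := by
  rw [← hw.hermForm_symm, hw.hermForm_sum_left, map_sum]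
  exact Finset.sum_congr rfl fun i _ => by rw [map_mul, hw.hermForm_symm]

lemma sum_smul_single (v : Cn n) : ∑ j, v j • (Pi.single j (1 : ℂ) : Cn n) = v := by
  ext i
  simp [Finset.sum_apply, Pi.single_apply]

lemma IsPositiveOneOne.hermForm_eq_sum (hw : IsPositiveOneOne w) (u v : Cn n) :
    hermForm w u v = ∑ j, ∑ l, u j * conj (v l) * hermMat w j l := by
  conv_lhs => rw [← sum_smul_single u, ← sum_smul_single v]
  rw [hw.hermForm_sum_left]
  refine Finset.sum_congr rfl fun j _ => ?_
  rw [hw.hermForm_sum_right, Finset.mul_sum]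
  exact Finset.sum_congr rfl fun l _ => by rw [hermMat]; ring

lemma hermForm_self_re (w : Cn n [⋀^Fin 2]→L[ℝ] ℝ) (v : Cn n) :
    (hermForm w v v).re = w ![v, Complex.I • v] := by
  simp [hermForm]

lemma hermForm_re (w : Cn n [⋀^Fin 2]→L[ℝ] ℝ) (u v : Cn n) :
    (hermForm w u v).re = w ![u, Complex.I • v] := by
  simp [hermForm]

lemma IsPositiveOneOne.posDef (hw : IsPositiveOneOne w) : (hermMat w).PosDef := by
  rw [Matrix.posDef_iff_dotProduct_mulVec]
  refine ⟨?_, fun x hx => ?_⟩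
  · ext j l
    simp only [Matrix.conjTranspose_apply, hermMat]
    exact hw.hermForm_symm _ _
  -- `hermForm` is linear in the first variable, so that `x* H x` is its value at the conjugate
  -- vector.
  · have e : star x ⬝ᵥ (hermMat w).mulVec x = hermForm w (star x) (star x) := by
      rw [hw.hermForm_eq_sum]
      simp only [dotProduct, Matrix.mulVec, Finset.mul_sum]
      refine Finset.sum_congr rfl fun j _ => Finset.sum_congr rfl fun l _ => ?_
      simp; ring
    have him : (hermForm w (star x) (star x)).im = 0 :=
      Complex.conj_eq_iff_im.1 (hw.hermForm_symm _ _)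
    rw [e, Complex.lt_def]
    refine ⟨?_, by simp [him]⟩
    rw [hermForm_self_re]
    exact hw.pos _ (by simpa using hx)

/-- A unitary frame of the Hermitian form of `w`, the rows of a matrix `C`. -/
def IsUnitaryFrame (w : Cn n [⋀^Fin 2]→L[ℝ] ℝ) (C : Matrix (Fin n) (Fin n) ℂ) : Prop :=
  C * hermMat w * C.conjTranspose = 1

/-- Factor the positive definite matrix as `B* B`; the rows of the conjugate transpose of `B⁻¹` are
orthonormal. -/
lemma IsPositiveOneOne.exists_unitaryFrame (hw : IsPositiveOneOne w) :
    ∃ C, IsUnitaryFrame w C := by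
  obtain ⟨B, hB⟩ := CStarAlgebra.nonneg_iff_eq_star_mul_self.1 hw.posDef.posSemidef.nonneg
  rw [Matrix.star_eq_conjTranspose] at hB
  have hdet : IsUnit (hermMat w).det := hw.posDef.det_pos.ne'.isUnit
  have hBu : IsUnit B.det := by
    rw [hB, Matrix.det_mul] at hdet
    exact isUnit_of_mul_isUnit_right hdet
  refine ⟨(B⁻¹).conjTranspose, ?_⟩
  rw [IsUnitaryFrame, hB, Matrix.conjTranspose_conjTranspose, ← Matrix.mul_assoc,
    ← Matrix.conjTranspose_mul, Matrix.mul_nonsing_inv _ hBu, Matrix.conjTranspose_one, one_mul,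
    Matrix.mul_nonsing_inv _ hBu]

lemma IsPositiveOneOne.hermForm_frame (hw : IsPositiveOneOne w) {C : Matrix (Fin n) (Fin n) ℂ}
    (hC : IsUnitaryFrame w C) (j l : Fin n) :
    hermForm w (C j) (C l) = if j = l then 1 else 0 := by
  have h := congrFun (congrFun hC j) l
  rw [Matrix.one_apply] at h
  rw [← h, hw.hermForm_eq_sum]
  simp only [Matrix.mul_apply, Matrix.conjTranspose_apply, Finset.sum_mul]
  rw [Finset.sum_comm]
  refine Finset.sum_congr rfl fun a _ => Finset.sum_congr rfl fun b _ => ?_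
  simp; ring

lemma IsUnitaryFrame.isUnit_det {C : Matrix (Fin n) (Fin n) ℂ} (hC : IsUnitaryFrame w C) :
    IsUnit C.det := by
  have := congrArg Matrix.det hC
  rw [Matrix.det_mul, Matrix.det_mul, Matrix.det_one, mul_assoc] at this
  exact IsUnit.of_mul_eq_one _ this

lemma IsUnitaryFrame.inv_hermMat {C : Matrix (Fin n) (Fin n) ℂ} (hC : IsUnitaryFrame w C) :
    (hermMat w)⁻¹ = C.conjTranspose * C := by
  apply Matrix.inv_eq_left_inv
  have h : (hermMat w * C.conjTranspose) * C = 1 := by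
    rw [mul_eq_one_comm, ← Matrix.mul_assoc]; exact hC
  rw [Matrix.mul_assoc] at h
  exact mul_eq_one_comm.1 h

/-- The relation `|det C|² = 1 / det H` is what replaces frame coefficients by coordinate
coefficients in all later formulas. -/
lemma IsUnitaryFrame.det_mul (_ : IsPositiveOneOne w) {C : Matrix (Fin n) (Fin n) ℂ}
    (hC : IsUnitaryFrame w C) : C.det * conj C.det * (hermMat w).det = 1 := by
  have := congrArg Matrix.det hC
  rw [Matrix.det_mul, Matrix.det_mul, Matrix.det_one, Matrix.det_conjTranspose] at this
  rw [← this]; simp; ring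

/-- The matrix, in the real coordinates, of a map of `ℂⁿ`. -/
def realMat (A : Cn n → Cn n) : Matrix (Fin (2 * n)) (Fin (2 * n)) ℝ :=
  fun a b => realCoord (A (realBasis b)) a

/-- `realBasis` as a basis. -/
def realBasisB (n : ℕ) : Module.Basis (Fin (2 * n)) ℝ (Cn n) :=
  Module.Basis.ofEquivFun
    { toFun := realCoord
      map_add' := fun u v => funext fun a => realCoord_add u v a
      map_smul' := fun c v => funext fun a => by simp [realCoord_smul]
      invFun := fun x => ∑ a, x a • realBasis a
      left_inv := sum_realCoord_smul_realBasis
      right_inv := fun x => by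
        ext b
        let L : Cn n →ₗ[ℝ] ℝ :=
          { toFun := fun v => realCoord v b
            map_add' := fun u v => realCoord_add u v b
            map_smul' := fun c v => by simp [realCoord_smul] }
        change L _ = _
        rw [map_sum]
        simp [L, realCoord_realBasis] }

lemma realBasisB_repr (v : Cn n) (a : Fin (2 * n)) : (realBasisB n).repr v a = realCoord v a := by
  simp [realBasisB, Module.Basis.ofEquivFun_repr_apply]

lemma realBasisB_apply (a : Fin (2 * n)) : realBasisB n a = realBasis a := by
  apply (realBasisB n).repr.injective
  ext b
  rw [realBasisB_repr (realBasis a), realCoord_realBasis, Module.Basis.repr_self,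
    Finsupp.single_apply]

lemma realMat_eq_toMatrix (A : Cn n →ₗ[ℝ] Cn n) :
    realMat A = LinearMap.toMatrix (realBasisB n) (realBasisB n) A := by
  ext a b
  rw [LinearMap.toMatrix_apply, realBasisB_repr, realBasisB_apply]; rfl

/-- The real determinant of a complex linear map is the norm, from `ℂ` to `ℝ`, of its complex
determinant. -/
lemma det_realMat (A : Cn n →ₗ[ℂ] Cn n) :
    (realMat A).det = Complex.normSq (LinearMap.det A) := by
  have := realMat_eq_toMatrix (A.restrictScalars ℝ)
  rw [LinearMap.coe_restrictScalars] at this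
  rw [this, LinearMap.det_toMatrix, LinearMap.det_restrictScalars, Algebra.norm_complex_apply]

lemma sum_realMat_smul (A : Cn n →ₗ[ℝ] Cn n) (b : Fin (2 * n)) :
    ∑ a, realMat A a b • (realBasis a : Cn n) = A (realBasis b) :=
  sum_realCoord_smul_realBasis _

lemma form_eq_sum (w : Cn n [⋀^Fin 2]→L[ℝ] ℝ) (u v : Cn n) :
    w ![u, Complex.I • v] = ∑ a, ∑ b, realCoord u a * realCoord v b * gram w a b := by
  let B : Cn n →ₗ[ℝ] Cn n →ₗ[ℝ] ℝ := LinearMap.mk₂ ℝ (fun u v => w ![u, Complex.I • v])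
    (fun u u' v => form_add_left w u u' _) (fun c u v => form_smul_left w c u _)
    (fun u v v' => by rw [smul_add, form_add_right])
    (fun c u v => by rw [smul_comm, form_smul_right]; rfl)
  change B u v = _
  conv_lhs => rw [← sum_realCoord_smul_realBasis u, ← sum_realCoord_smul_realBasis v]
  simp only [map_sum, LinearMap.sum_apply, map_smul, LinearMap.smul_apply, smul_eq_mul]
  simp only [Finset.mul_sum]
  rw [Finset.sum_comm]
  refine Finset.sum_congr rfl fun a _ => Finset.sum_congr rfl fun b _ => ?_
  rw [mul_assoc, mul_left_comm]; rfl

/-- The vectors of the frame given by the rows of `C` and their conjugates. -/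
def frameVec (C : Matrix (Fin n) (Fin n) ℂ) (c : Bool × Fin n) : Fin (2 * n) → ℂ :=
  partVec c.1 (C c.2)

/-- The linear map which takes the standard basis to the rows of `C`. -/
def frameMap (C : Matrix (Fin n) (Fin n) ℂ) : Cn n →ₗ[ℂ] Cn n := Matrix.toLin' C.transpose

lemma frameMap_single (C : Matrix (Fin n) (Fin n) ℂ) (j : Fin n) (c : ℂ) :
    frameMap C (Pi.single j c) = c • C j := by
  ext i
  simp [frameMap, Matrix.mulVec_single, mul_comm]

lemma det_frameMap (C : Matrix (Fin n) (Fin n) ℂ) : LinearMap.det (frameMap C) = C.det := by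
  rw [frameMap, LinearMap.det_toLin', Matrix.det_transpose]

/-- The vectors `C j` and `i C j` form an orthonormal basis of the Riemannian metric. -/
lemma IsPositiveOneOne.gram_frame (hw : IsPositiveOneOne w) {C : Matrix (Fin n) (Fin n) ℂ}
    (hC : IsUnitaryFrame w C) :
    (realMat (frameMap C)).transpose * gram w * realMat (frameMap C) = 1 := by
  ext a b
  have e : ((realMat (frameMap C)).transpose * gram w * realMat (frameMap C)) a b =
      w ![frameMap C (realBasis a), Complex.I • frameMap C (realBasis b)] := by
    rw [form_eq_sum]
    simp only [Matrix.mul_apply, Matrix.transpose_apply, Finset.sum_mul, realMat]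
    rw [Finset.sum_comm]
    exact Finset.sum_congr rfl fun a _ => Finset.sum_congr rfl fun b _ => by ring
  rw [e, ← hermForm_re, Matrix.one_apply]
  obtain ⟨⟨j, s⟩, rfl⟩ := (realIndexEquiv n).symm.surjective a
  obtain ⟨⟨l, t⟩, rfl⟩ := (realIndexEquiv n).symm.surjective b
  have hr : ∀ (c : ℂ) (u v : Cn n), hermForm w u (c • v) = conj c * hermForm w u v := by
    intro c u v
    rw [← hw.hermForm_symm, hw.hermForm_smul_left, map_mul, hw.hermForm_symm]
  simp only [EmbeddingLike.apply_eq_iff_eq, Prod.mk.injEq]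
  by_cases hjl : j = l
  · subst hjl
    fin_cases s <;> fin_cases t <;>
      simp [frameMap_single, hw.hermForm_smul_left, hr, hw.hermForm_frame hC]
  · fin_cases s <;> fin_cases t <;>
      simp [frameMap_single, hw.hermForm_smul_left, hr, hw.hermForm_frame hC, hjl]

lemma IsPositiveOneOne.inv_gram (hw : IsPositiveOneOne w) {C : Matrix (Fin n) (Fin n) ℂ}
    (hC : IsUnitaryFrame w C) :
    (gram w)⁻¹ = realMat (frameMap C) * (realMat (frameMap C)).transpose := by
  apply Matrix.inv_eq_left_inv
  have h := hw.gram_frame hC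
  rw [mul_eq_one_comm, ← Matrix.mul_assoc] at h
  exact h

/-- The inverse metric is the sum of `v ⊗ v + iv ⊗ iv` over the rows `v` of `C`. In terms of the
parts `v'` and `v''` of `v`, which are conjugate to each other, this is `2 (v' ⊗ v'' + v'' ⊗ v')`,
whence the factor `2`. -/
lemma IsPositiveOneOne.inv_gram_apply (hw : IsPositiveOneOne w) {C : Matrix (Fin n) (Fin n) ℂ}
    (hC : IsUnitaryFrame w C) (a b : Fin (2 * n)) :
    (((gram w)⁻¹ a b : ℝ) : ℂ) = ∑ c, 2 * (frameVec C c a * conj (frameVec C c b)) := by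
  rw [hw.inv_gram hC, Matrix.mul_apply, sum_realIndex]
  rw [Fintype.sum_prod_type]
  simp only [Fintype.sum_bool]
  rw [← Finset.sum_add_distrib]
  push_cast
  refine Finset.sum_congr rfl fun j _ => ?_
  simp only [Matrix.transpose_apply, realMat, realBasis_symm_zero, realBasis_symm_one,
    frameMap_single, one_smul, frameVec, partVec, if_true, Bool.false_eq_true, if_false]
  have h0 : ∀ a, (realCoord (C j) a : ℂ) = holVec (C j) a + antiVec (C j) a := fun a =>
    congrFun (rvec_eq (C j)) a
  have h1 : ∀ a, (realCoord (Complex.I • C j) a : ℂ) =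
      Complex.I * (holVec (C j) a - antiVec (C j) a) := fun a => by
    have := congrFun (rvec_eq (Complex.I • C j)) a
    rw [holVec_smul, antiVec_smul] at this
    refine Eq.trans this ?_
    simp; ring
  simp only [h0, h1, antiVec, Complex.conj_conj]
  linear_combination ((holVec (C j) a - conj (holVec (C j) a)) *
    (holVec (C j) b - conj (holVec (C j) b))) * Complex.I_sq

/-- The volume density of the metric is the determinant of the Hermitian matrix. -/
lemma IsPositiveOneOne.sqrt_det_gram (hw : IsPositiveOneOne w) :
    ((Real.sqrt (gram w).det : ℝ) : ℂ) = (hermMat w).det := by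
  obtain ⟨C, hC⟩ := hw.exists_unitaryFrame
  have h1 := congrArg Matrix.det (hw.gram_frame hC)
  rw [Matrix.det_mul, Matrix.det_mul, Matrix.det_transpose, Matrix.det_one, det_realMat,
    det_frameMap] at h1
  set d := Complex.normSq C.det with hd
  have hd0 : 0 < d := Complex.normSq_pos.2 hC.isUnit_det.ne_zero
  have h2 : (gram w).det = (d⁻¹) ^ 2 := by
    field_simp; linarith
  have h3 := IsUnitaryFrame.det_mul hw hC
  rw [Complex.mul_conj, ← hd] at h3
  rw [h2, Real.sqrt_sq (by positivity)]
  push_cast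
  exact inv_eq_of_mul_eq_one_right h3

end Hermitian

/-! ### The inner product of forms in a unitary frame -/

section InnerForm

variable {n k : ℕ} {w : Cn n [⋀^Fin 2]→L[ℝ] ℝ}

/-- The standard Hermitian product of complex numbers. -/
def stdPair (a b : ℂ) : ℂ := a * conj b

/-- To be applied to the inverse Gram matrix. Once the metric is diagonal in a frame indexed by `κ`,
a contraction of `k` indices becomes a sum over tuples of frame vectors, and the sums over `I` and
`J` separate. -/
lemma sum_prod_pair {ι κ : Type*} [Fintype ι] [Fintype κ] [DecidableEq ι] [DecidableEq κ]
    (G : ι → ι → ℂ) (U W : κ → ι → ℂ) (hG : ∀ a b, G a b = ∑ c, U c a * W c b)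
    (x y : (Fin k → ι) → ℂ) :
    ∑ I : Fin k → ι, ∑ J : Fin k → ι, (∏ a, G (I a) (J a)) * (x I * y J) =
      ∑ D : Fin k → κ, (∑ I : Fin k → ι, x I * ∏ a, U (D a) (I a)) *
        (∑ J : Fin k → ι, y J * ∏ a, W (D a) (J a)) := by
  simp only [hG, Finset.prod_univ_sum, Fintype.piFinset_univ, Finset.sum_mul_sum]
  rw [Finset.sum_comm' (t' := Finset.univ) (s' := fun _ => Finset.univ) (by simp)]
  simp only [Finset.sum_mul]
  rw [Finset.sum_comm]
  refine (Finset.sum_congr rfl fun I _ => Finset.sum_comm).trans ?_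
  rw [Finset.sum_comm]
  refine Finset.sum_congr rfl fun D _ => ?_
  refine Finset.sum_congr rfl fun I _ => Finset.sum_congr rfl fun J _ => ?_
  rw [Finset.prod_mul_distrib]; ring

/-- Each of the `k` contracted indices contributes one factor `2` from `inv_gram_apply`. -/
lemma IsPositiveOneOne.innerForm_eq (hw : IsPositiveOneOne w) {C : Matrix (Fin n) (Fin n) ℂ}
    (hC : IsUnitaryFrame w C) (u v : Cn n [⋀^Fin k]→L[ℝ] ℂ) :
    innerForm w stdPair u v = (2 ^ k / k.factorial : ℂ) * ∑ D : Fin k → Bool × Fin n,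
      cext u (fun a => frameVec C (D a)) * conj (cext v (fun a => frameVec C (D a))) := by
  rw [innerForm]
  have h := sum_prod_pair (k := k) (fun a b => (((gram w)⁻¹ a b : ℝ) : ℂ))
    (fun c a => 2 * frameVec C c a) (fun c b => conj (frameVec C c b))
    (fun a b => by rw [hw.inv_gram_apply hC]; simp only [mul_assoc])
    (fun I => u fun a => realBasis (I a)) (fun J => conj (v fun a => realBasis (J a)))
  simp only [stdPair, Complex.ofReal_prod]
  rw [h, Finset.mul_sum, Finset.mul_sum]
  refine Finset.sum_congr rfl fun D _ => ?_
  have e1 : ∑ I : Fin k → Fin (2 * n), (u fun a => realBasis (I a)) *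
      ∏ a, 2 * frameVec C (D a) (I a) = 2 ^ k * cext u (fun a => frameVec C (D a)) := by
    rw [cext_apply, Finset.mul_sum]
    refine Finset.sum_congr rfl fun I _ => ?_
    rw [Finset.prod_mul_distrib, Finset.prod_const, Finset.card_univ, Fintype.card_fin]; ring
  have e2 : ∑ J : Fin k → Fin (2 * n), conj (v fun a => realBasis (J a)) *
      ∏ a, conj (frameVec C (D a) (J a)) = conj (cext v (fun a => frameVec C (D a))) := by
    rw [cext_apply, map_sum]
    exact Finset.sum_congr rfl fun I _ => by rw [map_mul, map_prod]
  rw [e1, e2]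
  ring

lemma exists_perm_comp {κ : Type*} {m : ℕ} {base D : Fin m → κ} (hD : Function.Injective D)
    (h : ∀ a, ∃ b, base b = D a) : ∃ σ : Equiv.Perm (Fin m), D = base ∘ σ := by
  choose σ hσ using h
  have hinj : Function.Injective σ := fun a b hab => hD (by rw [← hσ a, ← hσ b, hab])
  exact ⟨Equiv.ofBijective σ (Finite.injective_iff_bijective.1 hinj), funext fun a => (hσ a).symm⟩

/-- A sum of a symmetric function over tuples is a sum over orbits of permutations. -/
lemma sum_tuples_eq {κ S M : Type*} [Fintype κ] [Fintype S] [AddCommMonoid M] {m : ℕ}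
    (g : (Fin m → κ) → M) (hg : ∀ (D : Fin m → κ) (σ : Equiv.Perm (Fin m)), g (D ∘ σ) = g D)
    (base : S → Fin m → κ) (hbase : ∀ s, Function.Injective (base s))
    (hdisj : ∀ s s', (∀ a, ∃ b, base s' b = base s a) → s = s')
    (hzero : ∀ D, (∀ s (σ : Equiv.Perm (Fin m)), D ≠ base s ∘ σ) → g D = 0) :
    ∑ D, g D = m.factorial • ∑ s, g (base s) := by
  classical
  have hinj : Function.Injective
      (fun p : S × Equiv.Perm (Fin m) => base p.1 ∘ p.2) := by
    rintro ⟨s, σ⟩ ⟨s', σ'⟩ h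
    have hs : s = s' := hdisj s s' fun a => ⟨σ' (σ.symm a), by
      have := congrFun h (σ.symm a)
      simpa using this.symm⟩
    subst hs
    congr 1
    ext a
    exact congrArg _ (hbase s (congrFun h a))
  have h1 : ∑ D, g D = ∑ p : S × Equiv.Perm (Fin m), g (base p.1 ∘ p.2) := by
    rw [← Finset.sum_image (s := Finset.univ) (g := fun p : S × Equiv.Perm (Fin m) =>
      base p.1 ∘ p.2) (f := g) (fun _ _ _ _ h => hinj h)]
    symm
    refine Finset.sum_subset (Finset.subset_univ _) fun D _ hD => hzero D fun s σ h => hD ?_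
    exact Finset.mem_image.2 ⟨(s, σ), Finset.mem_univ _, h.symm⟩
  rw [h1, Fintype.sum_prod_type, Finset.smul_sum]
  refine Finset.sum_congr rfl fun s _ => ?_
  rw [Finset.sum_congr rfl fun σ _ => hg (base s) σ, Finset.sum_const, Finset.card_univ,
    Fintype.card_perm, Fintype.card_fin]

/-- The version for sums of squares, where orbits other than the chosen ones may be dropped. -/
lemma sum_tuples_ge {κ S : Type*} [Fintype κ] [Fintype S] {m : ℕ}
    (g : (Fin m → κ) → ℝ) (hg : ∀ (D : Fin m → κ) (σ : Equiv.Perm (Fin m)), g (D ∘ σ) = g D)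
    (base : S → Fin m → κ) (hbase : ∀ s, Function.Injective (base s))
    (hdisj : ∀ s s', (∀ a, ∃ b, base s' b = base s a) → s = s') (hpos : ∀ D, 0 ≤ g D) :
    m.factorial • ∑ s, g (base s) ≤ ∑ D, g D := by
  classical
  -- Cut off outside the chosen orbits, the function falls under the exact formula.
  let g' : (Fin m → κ) → ℝ := fun D =>
    if ∃ s, ∃ σ : Equiv.Perm (Fin m), D = base s ∘ σ then g D else 0
  have hg' : ∀ (D : Fin m → κ) (σ : Equiv.Perm (Fin m)), g' (D ∘ σ) = g' D := by
    intro D σ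
    have : (∃ s, ∃ τ : Equiv.Perm (Fin m), D ∘ σ = base s ∘ τ) ↔
        ∃ s, ∃ τ : Equiv.Perm (Fin m), D = base s ∘ τ := by
      constructor
      · rintro ⟨s, τ, h⟩
        refine ⟨s, τ * σ⁻¹, ?_⟩
        ext a : 1
        have := congrFun h (σ⁻¹ a)
        simpa using this
      · rintro ⟨s, τ, h⟩
        exact ⟨s, τ * σ, by rw [h]; rfl⟩
    simp only [g', this, hg]
  have h := sum_tuples_eq g' hg' base hbase hdisj (fun D hD => by
    simp only [g']
    rw [if_neg]
    rintro ⟨s, σ, h⟩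
    exact hD s σ h)
  have e : ∀ s, g' (base s) = g (base s) := fun s => if_pos ⟨s, 1, rfl⟩
  simp only [e] at h
  rw [← h]
  refine Finset.sum_le_sum fun D _ => ?_
  simp only [g']
  split_ifs
  · exact le_rfl
  · exact hpos D

/-- The sign of the permutation occurs twice and cancels. -/
lemma cext_mul_conj_perm {κ : Type*} (u v : Cn n [⋀^Fin k]→L[ℝ] ℂ) (e : κ → Fin (2 * n) → ℂ)
    (D : Fin k → κ) (σ : Equiv.Perm (Fin k)) :
    cext u (fun a => e ((D ∘ σ) a)) * conj (cext v (fun a => e ((D ∘ σ) a))) =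
      cext u (fun a => e (D a)) * conj (cext v (fun a => e (D a))) := by
  have h1 := (cext u).map_perm (fun a => e (D a)) σ
  have h2 := (cext v).map_perm (fun a => e (D a)) σ
  have e1 : (fun a => e ((D ∘ σ) a)) = (fun a => e (D a)) ∘ σ := rfl
  rw [e1, h1, h2]
  rcases Int.units_eq_one_or (Equiv.Perm.sign σ) with h | h <;> rw [h] <;> simp

lemma cext_eq_zero_of_not_injective {κ : Type*} (u : Cn n [⋀^Fin k]→L[ℝ] ℂ)
    (e : κ → Fin (2 * n) → ℂ) (D : Fin k → κ) (hD : ¬ Function.Injective D) :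
    cext u (fun a => e (D a)) = 0 := by
  rw [Function.Injective] at hD
  push Not at hD
  obtain ⟨a, b, hab, hne⟩ := hD
  exact (cext u).map_eq_zero_of_eq _ (by rw [hab]) hne

/-- The standard unit vectors. -/
def unitVec (j : Fin n) : Cn n := Pi.single j 1

/-- The coefficient of `dz₁ ∧ ⋯ ∧ dzₙ`. -/
def topCoeff (u : Cn n [⋀^Fin n]→L[ℝ] ℂ) : ℂ := cext u fun j => holVec (unitVec j)

/-- The coefficient of `dz̄_a ∧ dz₁ ∧ ⋯ ∧ dzₙ`. -/
def antiCoeff (u : Cn n [⋀^Fin (n + 1)]→L[ℝ] ℂ) (a : Fin n) : ℂ :=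
  cext u (Fin.cons (antiVec (unitVec a)) fun j => holVec (unitVec j))

/-- The coefficient of `dz̄_a ∧ dz̄_b ∧ dz₁ ∧ ⋯ ∧ dzₙ`. -/
def antiCoeff₂ (u : Cn n [⋀^Fin (n + 2)]→L[ℝ] ℂ) (a b : Fin n) : ℂ :=
  cext u (Fin.cons (antiVec (unitVec a))
    (Fin.cons (antiVec (unitVec b)) fun j => holVec (unitVec j)))

/-- On the `n`-dimensional space of `(1,0)`-vectors an alternating map in `n` variables is a
multiple of the determinant. -/
lemma alternating_holVec_frame (g : (Fin (2 * n) → ℂ) [⋀^Fin n]→ₗ[ℂ] ℂ)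
    (C : Matrix (Fin n) (Fin n) ℂ) :
    g (fun j => holVec (C j)) = C.det * g (fun j => holVec (unitVec j)) := by
  have h := AlternatingMap.eq_smul_basis_det (Pi.basisFun ℂ (Fin n)) (g.compLinearMap (holVecLM n))
  have h2 := DFunLike.congr_fun h (fun j => C j)
  rw [Pi.basisFun_det] at h2
  have e1 : (g.compLinearMap (holVecLM n)) (fun j => C j) = g (fun j => holVec (C j)) := rfl
  have e2 : (g.compLinearMap (holVecLM n)) (Pi.basisFun ℂ (Fin n)) =
      g (fun j => holVec (unitVec j)) := by
    simp only [AlternatingMap.compLinearMap_apply]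
    congr 1; ext1 j
    simp [unitVec]
  rw [e1, e2] at h2
  rw [h2]
  change _ * Matrix.det C = _
  rw [mul_comm]

lemma antiVec_row (C : Matrix (Fin n) (Fin n) ℂ) (j : Fin n) :
    antiVec (C j) = ∑ a, conj (C j a) • antiVec (unitVec a) := by
  conv_lhs => rw [← sum_smul_single (C j)]
  rw [antiVec_sum]
  exact Finset.sum_congr rfl fun a _ => antiVec_smul _ _

lemma alternating_cons_sum {V ι : Type*} [AddCommGroup V] [Module ℂ V] {m : ℕ}
    (g : V [⋀^Fin (m + 1)]→ₗ[ℂ] ℂ) (s : Finset ι) (c : ι → ℂ) (z : ι → V) (r : Fin m → V) :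
    g (Fin.cons (∑ i ∈ s, c i • z i) r) = ∑ i ∈ s, c i * g (Fin.cons (z i) r) := by
  let L : V →ₗ[ℂ] ℂ :=
    { toFun := fun z => g (Fin.cons z r)
      map_add' := fun x y => g.toMultilinearMap.cons_add r x y
      map_smul' := fun c x => g.toMultilinearMap.cons_smul r c x }
  change L _ = ∑ i ∈ s, c i * L (z i)
  simp

/-- The `n` holomorphic slots only contribute `det C`; the antiholomorphic slot is conjugate linear
in the row. -/
lemma cext_cons_frame (u : Cn n [⋀^Fin (n + 1)]→L[ℝ] ℂ) (C : Matrix (Fin n) (Fin n) ℂ)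
    (j : Fin n) :
    cext u (Fin.cons (antiVec (C j)) fun l => holVec (C l)) =
      C.det * ∑ a, conj (C j a) * antiCoeff u a := by
  have h : ∀ z : Fin (2 * n) → ℂ, cext u (Fin.cons z fun l => holVec (C l)) =
      C.det * cext u (Fin.cons z fun l => holVec (unitVec l)) := fun z =>
    alternating_holVec_frame ((cext u).curryLeft z) C
  rw [h, antiVec_row, alternating_cons_sum]
  rfl

lemma cext_cons_cons_frame (u : Cn n [⋀^Fin (n + 2)]→L[ℝ] ℂ) (C : Matrix (Fin n) (Fin n) ℂ)
    (j l : Fin n) :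
    cext u (Fin.cons (antiVec (C j)) (Fin.cons (antiVec (C l)) fun i => holVec (C i))) =
      C.det * ∑ a, ∑ b, conj (C j a) * conj (C l b) * antiCoeff₂ u a b := by
  have h : ∀ z z' : Fin (2 * n) → ℂ,
      cext u (Fin.cons z (Fin.cons z' fun i => holVec (C i))) =
      C.det * cext u (Fin.cons z (Fin.cons z' fun i => holVec (unitVec i))) := fun z z' =>
    alternating_holVec_frame (((cext u).curryLeft z).curryLeft z') C
  rw [h, antiVec_row, antiVec_row, alternating_cons_sum]
  congr 1
  refine Finset.sum_congr rfl fun a _ => ?_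
  have h4 := alternating_cons_sum ((cext u).curryLeft (antiVec (unitVec a))) Finset.univ
    (fun b => conj (C l b)) (fun b => antiVec (unitVec b)) (fun i => holVec (unitVec i))
  refine (congrArg _ h4).trans ?_
  rw [Finset.mul_sum]
  refine Finset.sum_congr rfl fun b _ => ?_
  rw [mul_assoc]; rfl

lemma IsOfType.cext_frameVec_eq_zero {p q : ℕ} {u : Cn n [⋀^Fin k]→L[ℝ] ℂ} (hu : IsOfType p q u)
    (C : Matrix (Fin n) (Fin n) ℂ) (D : Fin k → Bool × Fin n)
    (hD : (Finset.univ.filter fun a => (D a).1 = true).card ≠ q) :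
    cext u (fun a => frameVec C (D a)) = 0 :=
  hu.cext_eq_zero (fun a => (D a).1) (fun a => C (D a).2) hD

/-- The index of the `(n,0)`-vectors. -/
def holIndex (j : Fin n) : Bool × Fin n := (false, j)

lemma holIndex_injective : Function.Injective (holIndex (n := n)) := fun _ _ h =>
  (Prod.mk.inj h).2

/-- By type, only the permutations of the full holomorphic frame contribute. Their number cancels
`n!`, and `|det C|² = 1 / det H`. -/
lemma IsPositiveOneOne.innerForm_top (hw : IsPositiveOneOne w) {u v : Cn n [⋀^Fin n]→L[ℝ] ℂ}
    (hv : IsOfType n 0 v) :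
    innerForm w stdPair u v =
      2 ^ n / (hermMat w).det * (topCoeff u * conj (topCoeff v)) := by
  obtain ⟨C, hC⟩ := hw.exists_unitaryFrame
  rw [hw.innerForm_eq hC, sum_tuples_eq (S := Unit) _
    (fun D σ => cext_mul_conj_perm u v (frameVec C) D σ) (fun _ => holIndex)
    (fun _ => holIndex_injective) (fun _ _ _ => rfl)]
  · have e : ∀ u : Cn n [⋀^Fin n]→L[ℝ] ℂ, cext u (fun a => frameVec C (holIndex a)) =
        C.det * topCoeff u := fun u => alternating_holVec_frame (cext u) C
    simp only [e, Finset.univ_unique, Finset.sum_singleton, nsmul_eq_mul, map_mul]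
    have hd := IsUnitaryFrame.det_mul hw hC
    have hd0 : (hermMat w).det ≠ 0 := fun h => by simp [h] at hd
    have hf : (n.factorial : ℂ) ≠ 0 := by exact_mod_cast n.factorial_ne_zero
    field_simp
    linear_combination (topCoeff u * conj (topCoeff v)) * hd
  · intro D hD
    by_cases hinj : Function.Injective D
    · by_cases h0 : (Finset.univ.filter fun a => (D a).1 = true).card = 0
      · exfalso
        rw [Finset.card_eq_zero, Finset.filter_eq_empty_iff] at h0
        obtain ⟨σ, hσ⟩ := exists_perm_comp (base := holIndex) hinj (fun a => ⟨(D a).2, by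
          have := h0 (Finset.mem_univ a)
          ext <;> simp_all [holIndex]⟩)
        exact hD () σ hσ
      · rw [hv.cext_frameVec_eq_zero C D h0]; simp
    · rw [cext_eq_zero_of_not_injective v _ D hinj]; simp

/-- The index of the `(n,1)`-vectors. -/
def antiIndex (j : Fin n) : Fin (n + 1) → Bool × Fin n := Fin.cons (true, j) holIndex

lemma antiIndex_injective (j : Fin n) : Function.Injective (antiIndex j) := by
  rw [antiIndex, Fin.cons_injective_iff]
  exact ⟨by simp [holIndex], holIndex_injective⟩

lemma antiIndex_disjoint (j l : Fin n) (h : ∀ a, ∃ b, antiIndex l b = antiIndex j a) : j = l := by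
  obtain ⟨b, hb⟩ := h 0
  simp only [antiIndex, Fin.cons_zero] at hb
  induction b using Fin.cases with
  | zero => simpa using hb.symm
  | succ b => simp [holIndex] at hb

lemma frameVec_antiIndex (C : Matrix (Fin n) (Fin n) ℂ) (j : Fin n) :
    (fun a => frameVec C (antiIndex j a)) =
      Fin.cons (antiVec (C j)) fun l => holVec (C l) := by
  ext1 a
  induction a using Fin.cases <;> rfl

/-- An injective index with one antiholomorphic entry is a permutation of `antiIndex j`. -/
lemma exists_antiIndex_perm {D : Fin (n + 1) → Bool × Fin n} (hinj : Function.Injective D)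
    (h1 : (Finset.univ.filter fun a => (D a).1 = true).card = 1) :
    ∃ (j : Fin n) (σ : Equiv.Perm (Fin (n + 1))), D = antiIndex j ∘ σ := by
  rw [Finset.card_eq_one] at h1
  obtain ⟨a, ha⟩ := h1
  refine ⟨(D a).2, exists_perm_comp hinj fun b => ?_⟩
  by_cases hb : (D b).1 = true
  · have : b ∈ ({a} : Finset (Fin (n + 1))) := by rw [← ha]; simp [hb]
    rw [Finset.mem_singleton] at this
    subst this
    exact ⟨0, by simp [antiIndex, ← hb]⟩
  · refine ⟨(D b).2.succ, ?_⟩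
    simp only [Bool.not_eq_true] at hb
    simp [antiIndex, holIndex, ← hb]

/-- The surviving orbits consist of the holomorphic frame together with one conjugate vector.
Summing over the latter produces `C* C = H⁻¹`, which is how the dual vector of `v` enters. -/
lemma IsPositiveOneOne.innerForm_anti (hw : IsPositiveOneOne w)
    {u v : Cn n [⋀^Fin (n + 1)]→L[ℝ] ℂ} (hv : IsOfType n 1 v) :
    innerForm w stdPair u v = 2 ^ (n + 1) / (hermMat w).det *
      ∑ a, antiCoeff u a * conj (Matrix.vecMul (antiCoeff v) (hermMat w)⁻¹ a) := by
  obtain ⟨C, hC⟩ := hw.exists_unitaryFrame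
  rw [hw.innerForm_eq hC, sum_tuples_eq _
    (fun D σ => cext_mul_conj_perm u v (frameVec C) D σ) antiIndex
    antiIndex_injective antiIndex_disjoint]
  · simp only [frameVec_antiIndex, cext_cons_frame, nsmul_eq_mul, map_mul, hC.inv_hermMat]
    have hd := IsUnitaryFrame.det_mul hw hC
    have hd0 : (hermMat w).det ≠ 0 := fun h => by simp [h] at hd
    have hf : ((n + 1).factorial : ℂ) ≠ 0 := by exact_mod_cast (n + 1).factorial_ne_zero
    have key : ∑ j, (∑ a, conj (C j a) * antiCoeff u a) *
        conj (∑ a, conj (C j a) * antiCoeff v a) =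
        ∑ a, antiCoeff u a *
          conj (Matrix.vecMul (antiCoeff v) (C.conjTranspose * C) a) := by
      simp only [map_sum, Finset.sum_mul_sum]
      simp only [Matrix.vecMul, dotProduct, Matrix.mul_apply, Matrix.conjTranspose_apply, map_sum,
        map_mul, Finset.mul_sum, Complex.conj_conj]
      rw [Finset.sum_comm]
      refine Finset.sum_congr rfl fun a _ => ?_
      rw [Finset.sum_comm]
      refine Finset.sum_congr rfl fun b _ => Finset.sum_congr rfl fun j _ => ?_
      simp; ring
    rw [← key]
    have e : ∀ j, C.det * (∑ a, conj (C j a) * antiCoeff u a) *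
        (conj C.det * conj (∑ a, conj (C j a) * antiCoeff v a)) = (C.det * conj C.det) *
        ((∑ a, conj (C j a) * antiCoeff u a) * conj (∑ a, conj (C j a) * antiCoeff v a)) :=
      fun j => by ring
    simp only [e, ← Finset.mul_sum]
    set K := ∑ j, (∑ a, conj (C j a) * antiCoeff u a) * conj (∑ a, conj (C j a) * antiCoeff v a)
    field_simp
    linear_combination K * hd
  · intro D hD
    by_cases hinj : Function.Injective D
    · by_cases h0 : (Finset.univ.filter fun a => (D a).1 = true).card = 1
      · obtain ⟨j, σ, h⟩ := exists_antiIndex_perm hinj h0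
        exact absurd h (hD j σ)
      · rw [hv.cext_frameVec_eq_zero C D h0]; simp
    · rw [cext_eq_zero_of_not_injective v _ D hinj]; simp

/-- The index of the `(n,2)`-vectors. -/
def antiIndex₂ (p : {p : Fin n × Fin n // p.1 < p.2}) : Fin (n + 2) → Bool × Fin n :=
  Fin.cons (true, p.1.1) (Fin.cons (true, p.1.2) holIndex)

lemma antiIndex₂_injective (p : {p : Fin n × Fin n // p.1 < p.2}) :
    Function.Injective (antiIndex₂ p) := by
  rw [antiIndex₂, Fin.cons_injective_iff]
  refine ⟨?_, antiIndex_injective p.1.2⟩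
  rintro ⟨b, hb⟩
  induction b using Fin.cases with
  | zero => simp only [Fin.cons_zero, Prod.mk.injEq, true_and] at hb; exact p.2.ne hb.symm
  | succ b => simp [holIndex] at hb

lemma antiIndex₂_mem (p : {p : Fin n × Fin n // p.1 < p.2}) (b : Fin (n + 2)) (j : Fin n)
    (h : antiIndex₂ p b = (true, j)) : j = p.1.1 ∨ j = p.1.2 := by
  induction b using Fin.cases with
  | zero => left; simpa [antiIndex₂] using h.symm
  | succ b =>
    induction b using Fin.cases with
    | zero => right; simpa [antiIndex₂] using h.symm
    | succ b => simp [antiIndex₂, holIndex] at h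

lemma antiIndex₂_disjoint (p q : {p : Fin n × Fin n // p.1 < p.2})
    (h : ∀ a, ∃ b, antiIndex₂ q b = antiIndex₂ p a) : p = q := by
  obtain ⟨b, hb⟩ := h 0
  obtain ⟨c, hc⟩ := h 1
  have h1 := antiIndex₂_mem q b p.1.1 hb
  have h2 := antiIndex₂_mem q c p.1.2 hc
  have hp := p.2
  have hq := q.2
  ext <;> rcases h1 with h1 | h1 <;> rcases h2 with h2 | h2 <;> simp only [Fin.lt_def] at * <;>
    omega

lemma frameVec_antiIndex₂ (C : Matrix (Fin n) (Fin n) ℂ)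
    (p : {p : Fin n × Fin n // p.1 < p.2}) :
    (fun a => frameVec C (antiIndex₂ p a)) =
      Fin.cons (antiVec (C p.1.1)) (Fin.cons (antiVec (C p.1.2)) fun l => holVec (C l)) := by
  ext1 a
  induction a using Fin.cases with
  | zero => rfl
  | succ a => induction a using Fin.cases <;> rfl

lemma sum_lt_eq_half {g : Fin n → Fin n → ℝ} (hs : ∀ j l, g j l = g l j) (h0 : ∀ j, g j j = 0) :
    ∑ p : {p : Fin n × Fin n // p.1 < p.2}, g p.1.1 p.1.2 = (∑ j, ∑ l, g j l) / 2 := by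
  have e1 : ∑ p : {p : Fin n × Fin n // p.1 < p.2}, g p.1.1 p.1.2 =
      ∑ j, ∑ l, if j < l then g j l else 0 := by
    rw [← Fintype.sum_prod_type' (f := fun j l => if j < l then g j l else 0),
      ← Finset.sum_filter]
    exact (Finset.sum_subtype (Finset.univ.filter fun p : Fin n × Fin n => p.1 < p.2)
      (by simp) (fun p : Fin n × Fin n => g p.1 p.2)).symm
  have e2 : ∑ j, ∑ l, (if j < l then g j l else 0) = ∑ j, ∑ l, if l < j then g j l else 0 := by
    rw [Finset.sum_comm]
    exact Finset.sum_congr rfl fun j _ => Finset.sum_congr rfl fun l _ => by rw [hs]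
  have e3 : ∑ j, ∑ l, g j l = ∑ j, ∑ l, (if j < l then g j l else 0) +
      ∑ j, ∑ l, if l < j then g j l else 0 := by
    rw [← Finset.sum_add_distrib]
    refine Finset.sum_congr rfl fun j _ => ?_
    rw [← Finset.sum_add_distrib]
    refine Finset.sum_congr rfl fun l _ => ?_
    rcases lt_trichotomy j l with h | h | h
    · simp [h, h.not_gt]
    · subst h; simp [h0]
    · simp [h, h.not_gt]
  rw [e1, e3, ← e2]; ring

/-- Only the orbits with two conjugate vectors `j < l` are retained. Writing the sum over `j < l` as
half of the sum over all pairs lowers the power `2^(n+2)` by one. -/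
lemma IsPositiveOneOne.innerForm_self_ge (hw : IsPositiveOneOne w)
    {C : Matrix (Fin n) (Fin n) ℂ} (hC : IsUnitaryFrame w C)
    (u : Cn n [⋀^Fin (n + 2)]→L[ℝ] ℂ) :
    2 ^ (n + 1) * Complex.normSq C.det * ∑ j, ∑ l,
      Complex.normSq (∑ a, ∑ b, conj (C j a) * conj (C l b) * antiCoeff₂ u a b) ≤
      (innerForm w stdPair u u).re := by
  rw [hw.innerForm_eq hC]
  have e : (2 ^ (n + 2) / (n + 2).factorial : ℂ) * ∑ D : Fin (n + 2) → Bool × Fin n,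
      cext u (fun a => frameVec C (D a)) * conj (cext u (fun a => frameVec C (D a))) =
      ((2 ^ (n + 2) / (n + 2).factorial * ∑ D : Fin (n + 2) → Bool × Fin n,
        Complex.normSq (cext u (fun a => frameVec C (D a))) : ℝ) : ℂ) := by
    push_cast; simp only [Complex.mul_conj]
  rw [e, Complex.ofReal_re]
  have hge := sum_tuples_ge (fun D => Complex.normSq (cext u (fun a => frameVec C (D a))))
    (fun D σ => by
      have := cext_mul_conj_perm u u (frameVec C) D σ
      rw [Complex.mul_conj, Complex.mul_conj] at this
      exact_mod_cast this) antiIndex₂ antiIndex₂_injective antiIndex₂_disjoint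
    (fun D => Complex.normSq_nonneg _)
  simp only [frameVec_antiIndex₂, nsmul_eq_mul] at hge
  have hhalf := sum_lt_eq_half (n := n) (g := fun j l => Complex.normSq (cext u
    (Fin.cons (antiVec (C j)) (Fin.cons (antiVec (C l)) fun i => holVec (C i)))))
    (fun j l => by
      have := cext_mul_conj_perm u u id (Fin.cons (antiVec (C j))
        (Fin.cons (antiVec (C l)) fun i => holVec (C i))) (Equiv.swap 0 1)
      rw [Complex.mul_conj, Complex.mul_conj] at this
      have this := Complex.ofReal_injective this
      rw [show (fun a => id ((Fin.cons (antiVec (C j)) (Fin.cons (antiVec (C l))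
        fun i => holVec (C i)) : Fin (n + 2) → Fin (2 * n) → ℂ) a)) = Fin.cons (antiVec (C j))
        (Fin.cons (antiVec (C l)) fun i => holVec (C i)) from rfl] at this
      rw [← this]
      congr 2
      ext1 a
      induction a using Fin.cases with
      | zero => simp
      | succ a =>
        induction a using Fin.cases with
        | zero => simp
        | succ a =>
          have : Equiv.swap (0 : Fin (n + 2)) 1 a.succ.succ = a.succ.succ :=
            Equiv.swap_apply_of_ne_of_ne (by simp) (by simp [Fin.ext_iff])
          simp [this])
    (fun j => by
      rw [(cext u).map_eq_zero_of_eq _ (i := 0) (j := 1) rfl (by simp)]; simp)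
  rw [hhalf] at hge
  simp only [cext_cons_cons_frame, Complex.normSq_mul, ← Finset.mul_sum] at hge
  have hf : (0 : ℝ) < (n + 2).factorial := by exact_mod_cast (n + 2).factorial_pos
  set K := ∑ j, ∑ l,
    Complex.normSq (∑ a, ∑ b, conj (C j a) * conj (C l b) * antiCoeff₂ u a b)
  calc _ = 2 ^ (n + 2) / (n + 2).factorial *
        ((n + 2).factorial * (Complex.normSq C.det * K / 2)) := by field_simp; ring
    _ ≤ _ := by gcongr

/-- The algebraic inequality behind the Bochner formula. -/
lemma sum_normSq_antisymm_ge {C h B : Matrix (Fin n) (Fin n) ℂ}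
    (hC : C * h * C.conjTranspose = 1) :
    -2 * (∑ j, ∑ l, B j l * conj (B l j)).re ≤ ∑ j, ∑ l,
      Complex.normSq (∑ a, ∑ b, conj (C j a) * conj (C l b) *
        (∑ i, (B a i * h i b - B b i * h i a))) := by
  -- For `B = ∂̄V` the entry `P j l` is the derivative of `V` along the conjugate of the frame
  -- vector `C j`, with its index lowered against `C l`.
  set P : Matrix (Fin n) (Fin n) ℂ := C.map conj * B * h * C.conjTranspose with hP
  have e1 : ∀ j l, ∑ a, ∑ b, conj (C j a) * conj (C l b) *
      (∑ i, (B a i * h i b - B b i * h i a)) = P j l - P l j := by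
    intro j l
    have e : ∀ j l, P j l = ∑ a, ∑ b, conj (C j a) * conj (C l b) * ∑ i, B a i * h i b := by
      intro j l
      rw [hP, Matrix.mul_assoc (C.map conj)]
      simp only [Matrix.mul_apply, Matrix.conjTranspose_apply, Matrix.map_apply, Finset.sum_mul]
      rw [Finset.sum_comm]
      refine Finset.sum_congr rfl fun a _ => Finset.sum_congr rfl fun b _ => ?_
      rw [Finset.mul_sum, Finset.mul_sum, Finset.sum_mul]
      refine Finset.sum_congr rfl fun i _ => ?_
      simp; ring
    rw [e, e l j, Finset.sum_comm (f := fun a b => conj (C l a) * conj (C j b) *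
      ∑ i, B a i * h i b), ← Finset.sum_sub_distrib]
    refine Finset.sum_congr rfl fun a _ => ?_
    rw [← Finset.sum_sub_distrib]
    refine Finset.sum_congr rfl fun b _ => ?_
    rw [Finset.sum_sub_distrib]; ring
  -- The trace of `P P̄` does not depend on the frame: the unitarity of `C` removes `h` and `C` from
  -- it.
  have e2 : ∑ j, ∑ l, P j l * conj (P l j) = ∑ j, ∑ l, B j l * conj (B l j) := by
    have t : ∀ Q : Matrix (Fin n) (Fin n) ℂ, ∑ j, ∑ l, Q j l * conj (Q l j) =
        (Q * Q.map conj).trace := fun Q => by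
      simp [Matrix.trace, Matrix.mul_apply]
    rw [t, t]
    have hmap : ∀ Q R : Matrix (Fin n) (Fin n) ℂ, (Q * R).map conj = Q.map conj * R.map conj :=
      fun Q R => Matrix.map_mul
    have hcc : (C.map conj).map conj = C := by ext; simp
    have h1 : h * C.conjTranspose * C = 1 := by
      rw [mul_eq_one_comm, ← Matrix.mul_assoc]; exact hC
    have h2 : h.map conj * (C.conjTranspose).map conj * C.map conj = 1 := by
      rw [← hmap, ← hmap, h1]
      ext i j; simp [Matrix.one_apply]
    calc (P * P.map conj).trace
        = (C.map conj * B * (h * C.conjTranspose * C) * B.map conj *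
            (h.map conj * (C.conjTranspose).map conj)).trace := by
          rw [hP]; simp only [hmap, hcc, Matrix.mul_assoc]
      _ = (h.map conj * (C.conjTranspose).map conj * (C.map conj * (B * B.map conj))).trace := by
          rw [h1, Matrix.mul_one, Matrix.trace_mul_comm]; simp only [Matrix.mul_assoc]
      _ = _ := by rw [← Matrix.mul_assoc, h2, Matrix.one_mul]
  simp only [e1]
  rw [← e2]
  have e3 : ∀ j l, Complex.normSq (P j l - P l j) =
      Complex.normSq (P j l) + Complex.normSq (P l j) - 2 * (P j l * conj (P l j)).re :=
    fun j l => Complex.normSq_sub _ _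
  simp only [e3, Finset.sum_sub_distrib, Finset.sum_add_distrib, ← Finset.mul_sum, Complex.re_sum]
  -- This square, the full norm of `∂̄V`, is what the Bochner inequality discards.
  have : 0 ≤ ∑ j, ∑ l, Complex.normSq (P j l) :=
    Finset.sum_nonneg fun _ _ => Finset.sum_nonneg fun _ _ => Complex.normSq_nonneg _
  have : 0 ≤ ∑ j, ∑ l, Complex.normSq (P l j) :=
    Finset.sum_nonneg fun _ _ => Finset.sum_nonneg fun _ _ => Complex.normSq_nonneg _
  linarith

/-- A lower bound for the norm of a form with antisymmetrized `(n,2)`-coefficients. -/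
lemma IsPositiveOneOne.innerForm_self_ge_neg_trace (hw : IsPositiveOneOne w)
    (u : Cn n [⋀^Fin (n + 2)]→L[ℝ] ℂ) (B : Matrix (Fin n) (Fin n) ℂ)
    (hu : ∀ a b, antiCoeff₂ u a b =
      ∑ i, (B a i * hermMat w i b - B b i * hermMat w i a)) :
    -(2 ^ (n + 2) / (hermMat w).det.re * (∑ j, ∑ l, B j l * conj (B l j)).re) ≤
      (innerForm w stdPair u u).re := by
  obtain ⟨C, hC⟩ := hw.exists_unitaryFrame
  refine le_trans ?_ (hw.innerForm_self_ge hC u)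
  simp only [hu]
  have h1 := sum_normSq_antisymm_ge (B := B) hC
  have hd := IsUnitaryFrame.det_mul hw hC
  rw [Complex.mul_conj] at hd
  have hd' : Complex.normSq C.det * (hermMat w).det.re = 1 := by
    have := congrArg Complex.re hd
    simpa using this
  have hpos : 0 < Complex.normSq C.det := Complex.normSq_pos.2 hC.isUnit_det.ne_zero
  have hinv : (hermMat w).det.re⁻¹ = Complex.normSq C.det := (eq_inv_of_mul_eq_one_left hd').symm
  rw [div_eq_mul_inv, hinv]
  calc _ = 2 ^ (n + 1) * Complex.normSq C.det * (-2 * (∑ j, ∑ l, B j l * conj (B l j)).re) := by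
        ring
    _ ≤ _ := by gcongr

lemma IsPositiveOneOne.det_re_pos (hw : IsPositiveOneOne w) : 0 < (hermMat w).det.re := by
  obtain ⟨C, hC⟩ := hw.exists_unitaryFrame
  have hd := IsUnitaryFrame.det_mul hw hC
  rw [Complex.mul_conj] at hd
  have hd' : Complex.normSq C.det * (hermMat w).det.re = 1 := by
    have := congrArg Complex.re hd
    simpa using this
  have hpos : 0 < Complex.normSq C.det := Complex.normSq_pos.2 hC.isUnit_det.ne_zero
  by_contra h
  nlinarith

lemma IsPositiveOneOne.ofReal_det_re (hw : IsPositiveOneOne w) :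
    ((hermMat w).det.re : ℂ) = (hermMat w).det := by
  rw [← hw.sqrt_det_gram]; simp

lemma IsPositiveOneOne.innerForm_self_nonneg (hw : IsPositiveOneOne w)
    (u : Cn n [⋀^Fin k]→L[ℝ] ℂ) : 0 ≤ (innerForm w stdPair u u).re := by
  obtain ⟨C, hC⟩ := hw.exists_unitaryFrame
  rw [hw.innerForm_eq hC]
  simp only [Complex.mul_conj]
  rw [← Complex.ofReal_sum]
  have e : ((2 : ℂ) ^ k / k.factorial) = ((2 ^ k / k.factorial : ℝ) : ℂ) := by push_cast; rfl
  rw [e, ← Complex.ofReal_mul, Complex.ofReal_re]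
  have : 0 ≤ ∑ D : Fin k → Bool × Fin n, Complex.normSq (cext u fun a => frameVec C (D a)) :=
    Finset.sum_nonneg fun _ _ => Complex.normSq_nonneg _
  positivity

/-- The inner product of forms is natural for complex linear isomorphisms. -/
lemma IsPositiveOneOne.innerForm_comp (hw : IsPositiveOneOne w) (w' : Cn n [⋀^Fin 2]→L[ℝ] ℝ)
    (A : Cn n →ₗ[ℂ] Cn n) (hA : Function.Injective A) (h : ∀ u v, w' ![u, v] = w ![A u, A v])
    (u u' v v' : Cn n [⋀^Fin k]→L[ℝ] ℂ) (c c' : ℂ)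
    (hu : ∀ x : Fin k → Cn n, u' x = c * u (fun a => A (x a)))
    (hv : ∀ x : Fin k → Cn n, v' x = c' * v (fun a => A (x a))) :
    innerForm w' stdPair u' v' = c * conj c' * innerForm w stdPair u v := by
  have hw' : IsPositiveOneOne w' :=
    ⟨fun x y => by rw [h, h, map_smul, map_smul, hw.typeOneOne],
     fun x hx => by
      rw [h, map_smul]
      exact hw.pos _ fun h0 => hx (hA (by rw [h0, map_zero]))⟩
  obtain ⟨C, hC⟩ := hw'.exists_unitaryFrame
  -- The image under `A` of a unitary frame for `w'` is unitary for `w`, and both inner products are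
  -- sums over these matching frames.
  let C' : Matrix (Fin n) (Fin n) ℂ := fun j => A (C j)
  have hC' : IsUnitaryFrame w C' := by
    ext j l
    have e : (C' * hermMat w * C'.conjTranspose) j l = hermForm w (C' j) (C' l) := by
      rw [hw.hermForm_eq_sum]
      simp only [Matrix.mul_apply, Matrix.conjTranspose_apply, Finset.sum_mul]
      rw [Finset.sum_comm]
      refine Finset.sum_congr rfl fun a _ => Finset.sum_congr rfl fun b _ => ?_
      simp; ring
    rw [e, Matrix.one_apply, ← hw'.hermForm_frame hC j l]
    simp only [hermForm, h, C', map_smul]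
  rw [hw'.innerForm_eq hC, hw.innerForm_eq hC', mul_left_comm]
  congr 1
  rw [Finset.mul_sum]
  refine Finset.sum_congr rfl fun D _ => ?_
  have e1 := cext_comp_partVec u u' A (fun v => map_smul A _ v) c hu (fun a => (D a).1)
    (fun a => C (D a).2)
  have e2 := cext_comp_partVec v v' A (fun v => map_smul A _ v) c' hv (fun a => (D a).1)
    (fun a => C (D a).2)
  have f1 : ∀ u : Cn n [⋀^Fin k]→L[ℝ] ℂ, cext u (fun a => frameVec C (D a)) =
    cext u (fun a => partVec (D a).1 (C (D a).2)) := fun _ => rfl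
  have f2 : ∀ u : Cn n [⋀^Fin k]→L[ℝ] ℂ, cext u (fun a => frameVec C' (D a)) =
    cext u (fun a => partVec (D a).1 (A (C (D a).2))) := fun _ => rfl
  rw [f1, f1, f2, f2, e1, e2, map_mul]
  ring

end InnerForm

/-! ### The Hodge star of an `(n,1)`-form -/

section HodgeStar

lemma append_update_left {V : Type*} {k l : ℕ} (z : Fin k → V) (r : Fin l → V) (i : Fin k)
    (x : V) [DecidableEq (Fin k)] :
    Fin.append (Function.update z i x) r =
      Function.update (Fin.append z r) (Fin.castAdd l i) x := by
  ext c
  induction c using Fin.addCases with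
  | left a =>
    by_cases h : a = i
    · subst h; simp
    · rw [Function.update_of_ne (by simpa using h)]; simp [h]
  | right b =>
    rw [Function.update_of_ne (by simp [Fin.ext_iff]; omega)]; simp

/-- An alternating map with its last arguments fixed. -/
def sliceAlt {V : Type*} [AddCommGroup V] [Module ℂ V] {k l : ℕ}
    (g : V [⋀^Fin (k + l)]→ₗ[ℂ] ℂ) (r : Fin l → V) : V [⋀^Fin k]→ₗ[ℂ] ℂ where
  toFun z := g (Fin.append z r)
  map_update_add' z i x y := by
    simp only [append_update_left]
    exact g.map_update_add _ _ _ _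
  map_update_smul' z i c x := by
    simp only [append_update_left]
    exact g.map_update_smul _ _ _ _
  map_eq_zero_of_eq' z i j hij hne := by
    refine g.map_eq_zero_of_eq (i := Fin.castAdd l i) (j := Fin.castAdd l j) _ (by simpa using hij) ?_
    simpa using hne

lemma sliceAlt_apply {V : Type*} [AddCommGroup V] [Module ℂ V] {k l : ℕ}
    (g : V [⋀^Fin (k + l)]→ₗ[ℂ] ℂ) (r : Fin l → V) (z : Fin k → V) :
    sliceAlt g r z = g (Fin.append z r) := rfl

lemma alternating_expand {d k : ℕ} (g : (Fin d → ℂ) [⋀^Fin k]→ₗ[ℂ] ℂ) (z : Fin k → Fin d → ℂ) :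
    g z = ∑ J : Fin k → Fin d, g (fun a => Pi.single (J a) 1) * ∏ a, z a (J a) := by
  have e : z = fun a => ∑ j, z a j • (Pi.single j (1 : ℂ) : Fin d → ℂ) := by
    ext a i; simp [Finset.sum_apply, Pi.single_apply]
  conv_lhs => rw [e]
  refine (g.toMultilinearMap.map_sum (fun a j => z a j • (Pi.single j (1 : ℂ) : Fin d → ℂ))).trans ?_
  refine Finset.sum_congr rfl fun J _ => ?_
  refine (g.toMultilinearMap.map_smul_univ (fun a => z a (J a))
    (fun a => (Pi.single (J a) (1 : ℂ) : Fin d → ℂ))).trans ?_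
  rw [smul_eq_mul, mul_comm]; rfl

/-- The determinant of the real coordinates, on complexified vectors. -/
def detAlt (n : ℕ) {k l : ℕ} (h : 2 * n = k + l) : (Fin (2 * n) → ℂ) [⋀^Fin (k + l)]→ₗ[ℂ] ℂ :=
  (Matrix.detRowAlternating (n := Fin (2 * n)) (R := ℂ)).domDomCongr (finCongr h)

lemma detAlt_apply {n k l : ℕ} (h : 2 * n = k + l) (x : Fin (k + l) → Fin (2 * n) → ℂ) :
    detAlt n h x = Matrix.det (fun c => x (Fin.cast h c)) := rfl

lemma rvec_realBasis {n : ℕ} (a : Fin (2 * n)) :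
    rvec (realBasis a : Cn n) = Pi.single a (1 : ℂ) := by
  ext b
  by_cases h : a = b
  · subst h; simp [rvec, realCoord_realBasis]
  · simp [rvec, realCoord_realBasis, h]

lemma volForm_eq {n k l : ℕ} (w : Cn n [⋀^Fin 2]→L[ℝ] ℝ) (h : 2 * n = k + l)
    (J : Fin k → Fin (2 * n)) (v : Fin l → Cn n) :
    ((volForm w (fun c => Fin.append (fun a => realBasis (J a)) v (Fin.cast h c)) : ℝ) : ℂ) =
      (Real.sqrt (gram w).det : ℂ) *
        sliceAlt (detAlt n h) (fun b => rvec (v b)) (fun a => Pi.single (J a) 1) := by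
  rw [volForm, sliceAlt_apply, detAlt_apply]
  push_cast
  congr 1
  have := RingHom.map_det (Complex.ofRealHom) (fun a b : Fin (2 * n) =>
    realCoord (Fin.append (fun a => realBasis (J a)) v (Fin.cast h b)) a)
  refine Eq.trans this ?_
  rw [← Matrix.det_transpose]
  congr 1
  ext b a
  change ((realCoord (Fin.append (fun a => realBasis (J a)) v (Fin.cast h b)) a : ℝ) : ℂ) = _
  generalize Fin.cast h b = c
  induction c using Fin.addCases with
  | left c => simp only [Fin.append_left, ← rvec_realBasis]; rfl
  | right c => simp only [Fin.append_right]; rfl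

lemma conj_frameVec {n : ℕ} (C : Matrix (Fin n) (Fin n) ℂ) (c : Bool × Fin n)
    (a : Fin (2 * n)) : conj (frameVec C c a) = frameVec C (!c.1, c.2) a := by
  obtain ⟨t, j⟩ := c
  cases t <;> simp [frameVec, partVec, antiVec]

/-- The linear map sending the standard basis to its `(0,1)`-parts. -/
def antiVecLM (n : ℕ) : Cn n →ₗ[ℂ] (Fin (2 * n) → ℂ) where
  toFun v := antiVec (fun j => conj (v j))
  map_add' u v := by rw [← antiVec_add]; congr 1; ext; simp
  map_smul' c v := by
    have : (fun j => conj ((c • v) j)) = conj c • fun j => conj (v j) := by ext; simp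
    rw [this, antiVec_smul]; simp

lemma alternating_antiVec_frame {n : ℕ} (g : (Fin (2 * n) → ℂ) [⋀^Fin n]→ₗ[ℂ] ℂ)
    (C : Matrix (Fin n) (Fin n) ℂ) :
    g (fun j => antiVec (C j)) = conj C.det * g (fun j => antiVec (unitVec j)) := by
  have h := AlternatingMap.eq_smul_basis_det (Pi.basisFun ℂ (Fin n)) (g.compLinearMap (antiVecLM n))
  have h2 := DFunLike.congr_fun h (fun j => fun l => conj (C j l))
  rw [Pi.basisFun_det] at h2
  have e1 : (g.compLinearMap (antiVecLM n)) (fun j => fun l => conj (C j l)) =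
      g (fun j => antiVec (C j)) := by
    simp only [AlternatingMap.compLinearMap_apply]
    congr 1; ext1 j
    simp [antiVecLM]
  have e2 : (g.compLinearMap (antiVecLM n)) (Pi.basisFun ℂ (Fin n)) =
      g (fun j => antiVec (unitVec j)) := by
    simp only [AlternatingMap.compLinearMap_apply]
    congr 1; ext1 j
    simp only [antiVecLM, LinearMap.coe_mk, AddHom.coe_mk, unitVec]
    congr 1; ext l
    by_cases hl : l = j
    · subst hl; simp
    · simp [hl]
  rw [e1, e2] at h2
  rw [h2]
  change _ * Matrix.det (C.map conj) = _
  rw [mul_comm]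
  congr 1
  exact (RingHom.map_det (starRingEnd ℂ) C).symm

variable {n : ℕ} {w : Cn n [⋀^Fin 2]→L[ℝ] ℝ}

/-- The vector dual to an `(n,1)`-form. -/
def dualVec (w : Cn n [⋀^Fin 2]→L[ℝ] ℝ) (f : Cn n [⋀^Fin (n + 1)]→L[ℝ] ℂ) : Cn n :=
  Matrix.vecMul (antiCoeff f) (hermMat w)⁻¹

/-- The inverse metric pairs every frame vector with its conjugate. Hence a form of type `(n,1)`
tests the volume form on one `(1,0)`-vector and on all `n` conjugate vectors. The coefficients
collect the `(1,0)`-vectors into the dual vector, and `|det C|²` cancels the density of the volume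
form. -/
lemma IsPositiveOneOne.hodgeStar_eq_slice (hw : IsPositiveOneOne w) {l : ℕ}
    (h : 2 * n = n + 1 + l) {f : Cn n [⋀^Fin (n + 1)]→L[ℝ] ℂ} (hf : IsOfType n 1 f)
    (v : Fin l → Cn n) :
    hodgeStar w h f v = 2 ^ (n + 1) * sliceAlt (detAlt n h) (fun b => rvec (v b))
      (Fin.cons (holVec (dualVec w f)) fun j => antiVec (unitVec j)) := by
  obtain ⟨C, hC⟩ := hw.exists_unitaryFrame
  set G := sliceAlt (detAlt n h) (fun b => rvec (v b)) with hG
  set q : ℂ := (Real.sqrt (gram w).det : ℂ) with hq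
  have h1 : hodgeStar w h f v = ((n + 1).factorial : ℂ)⁻¹ *
      ∑ I : Fin (n + 1) → Fin (2 * n), ∑ J : Fin (n + 1) → Fin (2 * n),
        (∏ a, (((gram w)⁻¹ (I a) (J a) : ℝ) : ℂ)) *
          ((f fun a => realBasis (I a)) * (q * G fun a => Pi.single (J a) 1)) := by
    rw [hodgeStar, Complex.real_smul]
    push_cast
    congr 1
    refine Finset.sum_congr rfl fun I _ => Finset.sum_congr rfl fun J _ => ?_
    rw [Complex.real_smul, Complex.ofReal_mul, volForm_eq, Complex.ofReal_prod]
    ring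
  rw [h1, sum_prod_pair (fun a b => (((gram w)⁻¹ a b : ℝ) : ℂ))
    (fun c a => 2 * frameVec C c a) (fun c b => conj (frameVec C c b))
    (fun a b => by rw [hw.inv_gram_apply hC]; simp only [mul_assoc])]
  have e1 : ∀ D : Fin (n + 1) → Bool × Fin n,
      ∑ I : Fin (n + 1) → Fin (2 * n), (f fun a => realBasis (I a)) *
      ∏ a, 2 * frameVec C (D a) (I a) = 2 ^ (n + 1) * cext f (fun a => frameVec C (D a)) := by
    intro D
    rw [cext_apply, Finset.mul_sum]
    refine Finset.sum_congr rfl fun I _ => ?_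
    rw [Finset.prod_mul_distrib, Finset.prod_const, Finset.card_univ, Fintype.card_fin]; ring
  have e2 : ∀ D : Fin (n + 1) → Bool × Fin n,
      ∑ J : Fin (n + 1) → Fin (2 * n), (q * G fun a => Pi.single (J a) 1) *
      ∏ a, conj (frameVec C (D a) (J a)) =
        q * G (fun a => frameVec C (!(D a).1, (D a).2)) := by
    intro D
    rw [alternating_expand G, Finset.mul_sum]
    exact Finset.sum_congr rfl fun J _ => by simp only [conj_frameVec]; ring
  simp only [e1, e2]
  rw [sum_tuples_eq (fun D => 2 ^ (n + 1) * cext f (fun a => frameVec C (D a)) *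
      (q * G (fun a => frameVec C (!(D a).1, (D a).2)))) ?_ antiIndex antiIndex_injective
      antiIndex_disjoint ?_]
  · have hf0 : ((n + 1).factorial : ℂ) ≠ 0 := by exact_mod_cast (n + 1).factorial_ne_zero
    have e3 : ∀ j, G (fun a => frameVec C (!(antiIndex j a).1, (antiIndex j a).2)) =
        conj C.det * G (Fin.cons (holVec (C j)) fun i => antiVec (unitVec i)) := by
      intro j
      refine Eq.trans ?_ (alternating_antiVec_frame (G.curryLeft (holVec (C j))) C)
      refine congrArg G ?_
      ext1 a
      induction a using Fin.cases <;> rfl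
    have e4 : holVec (dualVec w f) = ∑ j, (∑ a, conj (C j a) * antiCoeff f a) • holVec (C j) := by
      simp only [← holVecLM_apply, ← map_smul, ← map_sum]
      congr 1
      rw [dualVec, hC.inv_hermMat]
      ext i
      simp only [Matrix.vecMul, dotProduct, Matrix.mul_apply, Matrix.conjTranspose_apply,
        Finset.sum_apply, Pi.smul_apply, smul_eq_mul, Finset.mul_sum, Finset.sum_mul]
      rw [Finset.sum_comm]
      refine Finset.sum_congr rfl fun a _ => Finset.sum_congr rfl fun j _ => ?_
      simp; ring
    rw [e4, alternating_cons_sum]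
    simp only [frameVec_antiIndex, cext_cons_frame, e3, nsmul_eq_mul]
    have hd := IsUnitaryFrame.det_mul hw hC
    rw [← hw.sqrt_det_gram, ← hq] at hd
    rw [← mul_assoc, inv_mul_cancel₀ hf0, one_mul, Finset.mul_sum]
    refine Finset.sum_congr rfl fun j _ => ?_
    linear_combination (2 ^ (n + 1) * (∑ a, conj (C j a) * antiCoeff f a) *
      G (Fin.cons (holVec (C j)) fun i => antiVec (unitVec i))) * hd
  · intro D σ
    have h1 := (cext f).map_perm (fun a => frameVec C (D a)) σ
    have h2 := G.map_perm (fun a => frameVec C (!(D a).1, (D a).2)) σ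
    have g1 : (fun a => frameVec C ((D ∘ σ) a)) = (fun a => frameVec C (D a)) ∘ σ := rfl
    have g2 : (fun a => frameVec C (!((D ∘ σ) a).1, ((D ∘ σ) a).2)) =
      (fun a => frameVec C (!(D a).1, (D a).2)) ∘ σ := rfl
    rw [g1, g2, h1, h2]
    rcases Int.units_eq_one_or (Equiv.Perm.sign σ) with h | h <;> rw [h] <;> simp
  · intro D hD
    by_cases hinj : Function.Injective D
    · by_cases h0 : (Finset.univ.filter fun a => (D a).1 = true).card = 1
      · obtain ⟨j, σ, h⟩ := exists_antiIndex_perm hinj h0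
        exact absurd h (hD j σ)
      · rw [hf.cext_frameVec_eq_zero C D h0]; simp
    · rw [cext_eq_zero_of_not_injective f _ D hinj]; simp

end HodgeStar

/-! ### The Hodge star of an `(n,1)`-form as a contraction of `dz₁ ∧ ⋯ ∧ dzₙ` -/

section HodgeDet

variable {n m : ℕ}

lemma sum_holVec_mul (v : Cn n) (j : Fin n) :
    ∑ a, holVec v a * (realBasis a : Cn n) j = v j := by
  rw [sum_realIndex]
  have h0 : ∀ i, holVec v ((realIndexEquiv n).symm (i, 0)) = v i / 2 := fun i => by
    simp [holVec, realIndexEquiv]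
  have h1 : ∀ i, holVec v ((realIndexEquiv n).symm (i, 1)) = -Complex.I * v i / 2 := fun i => by
    have : (⟨(2 * (i : ℕ) + 1) / 2, by omega⟩ : Fin n) = i := by ext; simp; omega
    simp [holVec, realIndexEquiv, this, Nat.add_mod]
  simp only [h0, h1, realBasis_symm_zero, realBasis_symm_one]
  rw [Finset.sum_eq_single j]
  · simp only [Pi.single_eq_same]
    linear_combination (-(v j) / 2) * Complex.I_sq
  · intro i _ hi
    simp [Pi.single_eq_of_ne hi.symm]
  · simp

lemma sum_holVec_mul_conj (v : Cn n) (j : Fin n) :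
    ∑ a, holVec v a * conj ((realBasis a : Cn n) j) = 0 := by
  rw [sum_realIndex]
  have h0 : ∀ i, holVec v ((realIndexEquiv n).symm (i, 0)) = v i / 2 := fun i => by
    simp [holVec, realIndexEquiv]
  have h1 : ∀ i, holVec v ((realIndexEquiv n).symm (i, 1)) = -Complex.I * v i / 2 := fun i => by
    have : (⟨(2 * (i : ℕ) + 1) / 2, by omega⟩ : Fin n) = i := by ext; simp; omega
    simp [holVec, realIndexEquiv, this, Nat.add_mod]
  simp only [h0, h1, realBasis_symm_zero, realBasis_symm_one]
  refine Finset.sum_eq_zero fun i _ => ?_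
  by_cases hi : j = i
  · subst hi
    simp only [Pi.single_eq_same, map_one, Complex.conj_I]
    linear_combination ((v j) / 2) * Complex.I_sq
  · simp [Pi.single_eq_of_ne hi]

lemma sum_antiVec_mul_conj (v : Cn n) (j : Fin n) :
    ∑ a, antiVec v a * conj ((realBasis a : Cn n) j) = conj (v j) := by
  rw [← sum_holVec_mul v j, map_sum]
  exact Finset.sum_congr rfl fun a _ => by rw [map_mul]; rfl

lemma sum_antiVec_mul (v : Cn n) (j : Fin n) :
    ∑ a, antiVec v a * (realBasis a : Cn n) j = 0 := by
  have := congrArg conj (sum_holVec_mul_conj v j)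
  rw [map_sum, map_zero] at this
  rw [← this]
  exact Finset.sum_congr rfl fun a _ => by rw [map_mul, Complex.conj_conj]; rfl

lemma sum_rvec_mul (v : Cn n) (j : Fin n) :
    ∑ a, rvec v a * (realBasis a : Cn n) j = v j := by
  simp only [rvec_eq, Pi.add_apply, add_mul, Finset.sum_add_distrib, sum_holVec_mul,
    sum_antiVec_mul, add_zero]

lemma sum_realBasis_mul_conj (j l : Fin n) :
    ∑ a, (realBasis a : Cn n) j * conj ((realBasis a : Cn n) l) = if j = l then 2 else 0 := by
  rw [sum_realIndex]
  simp only [realBasis_symm_zero, realBasis_symm_one]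
  by_cases h : j = l
  · subst h
    rw [Finset.sum_eq_single j]
    · simp; norm_num
    · intro i _ hi
      simp [Pi.single_eq_of_ne hi.symm]
    · simp
  · rw [if_neg h]
    refine Finset.sum_eq_zero fun i _ => ?_
    by_cases hi : i = j
    · subst hi; simp [Pi.single_eq_of_ne (Ne.symm h)]
    · simp [Pi.single_eq_of_ne (Ne.symm hi)]

lemma sum_realBasis_mul (j l : Fin n) :
    ∑ a, (realBasis a : Cn n) j * (realBasis a : Cn n) l = 0 := by
  rw [sum_realIndex]
  simp only [realBasis_symm_zero, realBasis_symm_one]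
  refine Finset.sum_eq_zero fun i _ => ?_
  by_cases hi : i = j
  · subst hi
    by_cases h : i = l
    · subst h; simp
    · simp [Pi.single_eq_of_ne (Ne.symm h)]
  · simp [Pi.single_eq_of_ne (Ne.symm hi)]

/-- The coordinate functions `dz̄_j`, `dz_j` on the real basis. -/
def coordMat (s : Fin n ⊕ Fin n → Fin (2 * n)) : Matrix (Fin n ⊕ Fin n) (Fin n ⊕ Fin n) ℂ :=
  fun c => Sum.elim (fun j => conj ((realBasis (s c) : Cn n) j))
    (fun j => (realBasis (s c) : Cn n) j)

/-- On the real basis the functions `dz_j` and `dz̄_j` are orthogonal with squared norm `2`, so that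
`|det|² = 2^(2n)`. The order `s` of the rows does not affect the modulus. -/
lemma normSq_det_coordMat (s : (Fin n ⊕ Fin n) ≃ Fin (2 * n)) :
    Complex.normSq (coordMat s).det = 4 ^ n := by
  have h : (coordMat s).conjTranspose * coordMat s = (2 : ℂ) • (1 : Matrix _ _ ℂ) := by
    ext i j
    rw [Matrix.mul_apply]
    simp only [Matrix.conjTranspose_apply, coordMat]
    rcases i with i | i <;> rcases j with j | j
    · simp only [Sum.elim_inl, RCLike.star_def, Complex.conj_conj]
      rw [s.sum_comp (fun a => (realBasis a : Cn n) i * conj ((realBasis a : Cn n) j)),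
        sum_realBasis_mul_conj]
      simp [Matrix.one_apply]
    · simp only [Sum.elim_inl, Sum.elim_inr, RCLike.star_def, Complex.conj_conj]
      rw [s.sum_comp (fun a => (realBasis a : Cn n) i * (realBasis a : Cn n) j),
        sum_realBasis_mul]
      simp
    · simp only [Sum.elim_inl, Sum.elim_inr, RCLike.star_def, ← map_mul]
      rw [← map_sum, s.sum_comp (fun a => (realBasis a : Cn n) i * (realBasis a : Cn n) j),
        sum_realBasis_mul]
      simp
    · simp only [Sum.elim_inr, RCLike.star_def]
      have := s.sum_comp (fun a => (realBasis a : Cn n) j * conj ((realBasis a : Cn n) i))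
      simp only [mul_comm (conj _)]
      rw [this, sum_realBasis_mul_conj]
      simp [Matrix.one_apply, eq_comm]
  have h2 := congrArg Matrix.det h
  rw [Matrix.det_mul, Matrix.det_conjTranspose, Matrix.det_smul, Matrix.det_one] at h2
  have h3 : conj (coordMat s).det * (coordMat s).det = 2 ^ (n + n) := by simpa using h2
  rw [mul_comm, Complex.mul_conj] at h3
  have h4 : Complex.normSq (coordMat s).det = 2 ^ (n + n) := by exact_mod_cast h3
  rw [h4, ← two_mul, pow_mul]; norm_num

/-- The positions of the vectors in the evaluation of the Hodge star. -/
def slotFun (m : ℕ) (h : 2 * (m + 1) = m + 1 + 1 + m) : Fin (m + 1) ⊕ Fin (m + 1) → Fin (2 * (m + 1)) :=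
  Sum.elim (fun j => Fin.cast h.symm (Fin.castAdd m j.succ))
    (Fin.cons (Fin.cast h.symm (Fin.castAdd m 0)) fun b => Fin.cast h.symm (Fin.natAdd (m + 1 + 1) b))

lemma slotFun_bijective (h : 2 * (m + 1) = m + 1 + 1 + m) : Function.Bijective (slotFun m h) := by
  rw [Fintype.bijective_iff_injective_and_card]
  refine ⟨?_, by simp; omega⟩
  have hr : ∀ i : Fin (m + 1), (slotFun m h (Sum.inr i) : ℕ) =
      if (i : ℕ) = 0 then 0 else m + 1 + i := by
    intro i
    induction i using Fin.cases with
    | zero => simp [slotFun]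
    | succ i => simp [slotFun]; omega
  have hl : ∀ i : Fin (m + 1), (slotFun m h (Sum.inl i) : ℕ) = i + 1 := by
    intro i; simp [slotFun]
  rintro (i | i) (j | j) hij
  · have := congrArg Fin.val hij
    rw [hl, hl] at this
    congr 1; ext; omega
  · have := congrArg Fin.val hij
    rw [hl, hr] at this
    split_ifs at this <;> omega
  · have := congrArg Fin.val hij
    rw [hl, hr] at this
    split_ifs at this <;> omega
  · have := congrArg Fin.val hij
    rw [hr, hr] at this
    congr 1; ext
    split_ifs at this <;> omega

/-- Multiplication by `coordMat` evaluates all `dz̄_j` and `dz_j` on the rows. The conjugate basis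
vectors have `dz̄`-part the identity and `dz`-part zero, so that the product is block triangular;
the remaining block holds the `dz`-coordinates of `V` and of the `v b`. -/
lemma slice_mul_det_coordMat (h : 2 * (m + 1) = m + 1 + 1 + m) (V : Cn (m + 1))
    (v : Fin m → Cn (m + 1)) :
    sliceAlt (detAlt (m + 1) h) (fun b => rvec (v b))
      (Fin.cons (holVec V) fun j => antiVec (unitVec j)) * (coordMat (slotFun m h)).det =
      Matrix.det (Matrix.of (Fin.cons V v)) := by
  let s := Equiv.ofBijective _ (slotFun_bijective h)
  let row : Fin (m + 1 + 1 + m) → Fin (2 * (m + 1)) → ℂ :=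
    Fin.append (Fin.cons (holVec V) fun j => antiVec (unitVec j)) (fun b => rvec (v b))
  let R : Matrix (Fin (2 * (m + 1))) (Fin (2 * (m + 1))) ℂ := fun c => row (Fin.cast h c)
  have h1 : sliceAlt (detAlt (m + 1) h) (fun b => rvec (v b))
      (Fin.cons (holVec V) fun j => antiVec (unitVec j)) = R.det := rfl
  rw [h1, ← Matrix.det_submatrix_equiv_self s R, ← Matrix.det_mul]
  have hinl : ∀ j, R (slotFun m h (Sum.inl j)) = antiVec (unitVec j) := fun j => by
    simp [R, row, slotFun]
  have hinr : ∀ i : Fin (m + 1), ∃ b : Bool, R (slotFun m h (Sum.inr i)) =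
      if b then holVec ((Fin.cons V v : Fin (m + 1) → Cn (m + 1)) i) else
      rvec ((Fin.cons V v : Fin (m + 1) → Cn (m + 1)) i) := by
    intro i
    induction i using Fin.cases with
    | zero => exact ⟨true, by simp [R, row, slotFun]⟩
    | succ i => exact ⟨false, by simp [R, row, slotFun]⟩
  have h2 : R.submatrix s s * coordMat (slotFun m h) =
      Matrix.fromBlocks 1 0 (R.submatrix s s * coordMat (slotFun m h)).toBlocks₂₁
        (Matrix.of (Fin.cons V v)) := by
    ext i j
    have hmul : ∀ i (x : Fin (2 * (m + 1)) → ℂ), ∑ c, R.submatrix s s i c * x (slotFun m h c) =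
        ∑ a, R (slotFun m h i) a * x a := fun i x =>
      s.sum_comp (fun a => R (slotFun m h i) a * x a)
    rcases i with i | i <;> rcases j with j | j
    · rw [Matrix.mul_apply]
      refine (hmul _ (fun a => conj ((realBasis a : Cn (m + 1)) j))).trans ?_
      rw [hinl, sum_antiVec_mul_conj]
      simp only [Matrix.fromBlocks_apply₁₁, unitVec, Matrix.one_apply, Pi.single_apply]
      by_cases hij : i = j
      · simp [hij]
      · simp [hij, Ne.symm hij]
    · rw [Matrix.mul_apply]
      refine (hmul _ (fun a => (realBasis a : Cn (m + 1)) j)).trans ?_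
      rw [hinl, sum_antiVec_mul]
      simp
    · rfl
    · rw [Matrix.mul_apply]
      refine (hmul _ (fun a => (realBasis a : Cn (m + 1)) j)).trans ?_
      obtain ⟨b, hb⟩ := hinr i
      rw [hb]
      cases b
      · simp only [Bool.false_eq_true, if_false, sum_rvec_mul]; rfl
      · simp only [if_true, sum_holVec_mul]; rfl
  rw [h2, Matrix.det_fromBlocks_zero₁₂, Matrix.det_one, one_mul]

/-- The Hodge star of an `(n,1)`-form is a multiple of the contraction of `dz₁ ∧ ⋯ ∧ dzₙ` with the
dual vector. -/
lemma IsPositiveOneOne.hodgeStar_eq_det {w : Cn (m + 1) [⋀^Fin 2]→L[ℝ] ℝ}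
    (hw : IsPositiveOneOne w) (h : 2 * (m + 1) = m + 1 + 1 + m)
    {f : Cn (m + 1) [⋀^Fin (m + 1 + 1)]→L[ℝ] ℂ} (hf : IsOfType (m + 1) 1 f) :
    ∃ c : ℂ, Complex.normSq c = 4 ∧ ∀ v : Fin m → Cn (m + 1), hodgeStar w h f v =
      c * Matrix.det (Matrix.of (Fin.cons (dualVec w f) v)) := by
  have hd := normSq_det_coordMat (Equiv.ofBijective _ (slotFun_bijective h))
  rw [show ⇑(Equiv.ofBijective _ (slotFun_bijective h)) = slotFun m h from rfl] at hd
  have hd0 : (coordMat (slotFun m h)).det ≠ 0 := fun h0 => by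
    rw [h0, map_zero] at hd
    exact (by positivity : (4 : ℝ) ^ (m + 1) ≠ 0) hd.symm
  -- The squared modulus is `4^(m+2) / 4^(m+1) = 4`; only the modulus of this constant matters,
  -- because `γ` is paired with its conjugate.
  refine ⟨2 ^ (m + 1 + 1) / (coordMat (slotFun m h)).det, ?_, fun v => ?_⟩
  · rw [map_div₀, hd, map_pow]
    have : Complex.normSq 2 = 4 := by norm_num [Complex.normSq_apply]
    rw [this, pow_succ]
    field_simp
  · rw [hw.hodgeStar_eq_slice h hf, ← slice_mul_det_coordMat h (dualVec w f) v]
    field_simp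

end HodgeDet

/-! ### The wedge product of a contraction with one-forms -/

section Wedge

lemma sum_sign_comp {V : Type*} {N : ℕ} (Φ : (Fin N → V) → ℂ) (v : Fin N → V)
    (ρ : Equiv.Perm (Fin N)) :
    ∑ σ : Equiv.Perm (Fin N), ((Equiv.Perm.sign σ : ℤ) : ℂ) * Φ (fun c => v (σ (ρ c))) =
      ((Equiv.Perm.sign ρ : ℤ) : ℂ) *
        ∑ σ : Equiv.Perm (Fin N), ((Equiv.Perm.sign σ : ℤ) : ℂ) * Φ (fun c => v (σ c)) := by
  rw [Finset.mul_sum, ← Equiv.sum_comp (Equiv.mulRight ρ) (fun σ : Equiv.Perm (Fin N) =>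
    ((Equiv.Perm.sign ρ : ℤ) : ℂ) * (((Equiv.Perm.sign σ : ℤ) : ℂ) * Φ (fun c => v (σ c))))]
  refine Finset.sum_congr rfl fun σ _ => ?_
  have h : ((Equiv.Perm.sign ρ : ℤ) : ℂ) * ((Equiv.Perm.sign ρ : ℤ) : ℂ) = 1 := by
    rw [← Int.cast_mul, Int.units_coe_mul_self, Int.cast_one]
  simp only [Equiv.coe_mulRight, Equiv.Perm.sign_mul, Units.val_mul, Int.cast_mul,
    Equiv.Perm.mul_apply]
  linear_combination (-((Equiv.Perm.sign σ : ℤ) : ℂ) * Φ (fun c => v (σ (ρ c)))) * h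

/-- Permutations of the two parts of a tuple. -/
def appendPerm {k l : ℕ} (ρ : Equiv.Perm (Fin k)) (ρ' : Equiv.Perm (Fin l)) :
    Equiv.Perm (Fin (k + l)) :=
  finSumFinEquiv.permCongr (Equiv.sumCongr ρ ρ')

lemma appendPerm_castAdd {k l : ℕ} (ρ : Equiv.Perm (Fin k)) (ρ' : Equiv.Perm (Fin l))
    (a : Fin k) : appendPerm ρ ρ' (Fin.castAdd l a) = Fin.castAdd l (ρ a) := by
  simp [appendPerm, Equiv.permCongr_apply]

lemma appendPerm_natAdd {k l : ℕ} (ρ : Equiv.Perm (Fin k)) (ρ' : Equiv.Perm (Fin l))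
    (b : Fin l) : appendPerm ρ ρ' (Fin.natAdd k b) = Fin.natAdd k (ρ' b) := by
  simp [appendPerm, Equiv.permCongr_apply]

lemma sign_appendPerm {k l : ℕ} (ρ : Equiv.Perm (Fin k)) (ρ' : Equiv.Perm (Fin l)) :
    Equiv.Perm.sign (appendPerm ρ ρ') = Equiv.Perm.sign ρ * Equiv.Perm.sign ρ' := by
  rw [appendPerm, Equiv.Perm.sign_permCongr]
  exact Equiv.Perm.sign_sumCongr _ _

/-- Antisymmetrizing the parts of an antisymmetrized product has no effect up to a factor. -/
lemma sum_sign_antisymm {V : Type*} {k l : ℕ} (α : (Fin k → V) → ℂ) (β : (Fin l → V) → ℂ)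
    (v : Fin (k + l) → V) :
    ∑ σ : Equiv.Perm (Fin (k + l)), ((Equiv.Perm.sign σ : ℤ) : ℂ) *
      ((∑ ρ : Equiv.Perm (Fin k), ((Equiv.Perm.sign ρ : ℤ) : ℂ) *
          α (fun a => v (σ (Fin.castAdd l (ρ a))))) *
        ∑ ρ' : Equiv.Perm (Fin l), ((Equiv.Perm.sign ρ' : ℤ) : ℂ) *
          β (fun b => v (σ (Fin.natAdd k (ρ' b))))) =
      (k.factorial * l.factorial : ℂ) *
        ∑ σ : Equiv.Perm (Fin (k + l)), ((Equiv.Perm.sign σ : ℤ) : ℂ) *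
          (α (fun a => v (σ (Fin.castAdd l a))) * β (fun b => v (σ (Fin.natAdd k b)))) := by
  have hs : ∀ (N : ℕ) (ρ : Equiv.Perm (Fin N)),
      ((Equiv.Perm.sign ρ : ℤ) : ℂ) * ((Equiv.Perm.sign ρ : ℤ) : ℂ) = 1 := fun N ρ => by
    rw [← Int.cast_mul, Int.units_coe_mul_self, Int.cast_one]
  simp only [Finset.sum_mul_sum]
  simp only [Finset.mul_sum]
  rw [Finset.sum_comm]
  refine (Finset.sum_congr rfl fun ρ _ => Finset.sum_comm).trans ?_
  set S := ∑ σ : Equiv.Perm (Fin (k + l)), ((Equiv.Perm.sign σ : ℤ) : ℂ) *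
          (α (fun a => v (σ (Fin.castAdd l a))) * β (fun b => v (σ (Fin.natAdd k b)))) with hS
  have key : ∀ (ρ : Equiv.Perm (Fin k)) (ρ' : Equiv.Perm (Fin l)),
      ∑ σ : Equiv.Perm (Fin (k + l)), ((Equiv.Perm.sign σ : ℤ) : ℂ) *
        ((((Equiv.Perm.sign ρ : ℤ) : ℂ) * α (fun a => v (σ (Fin.castAdd l (ρ a))))) *
          (((Equiv.Perm.sign ρ' : ℤ) : ℂ) * β (fun b => v (σ (Fin.natAdd k (ρ' b)))))) = S := by
    intro ρ ρ'
    have h := sum_sign_comp (fun x => α (fun a => x (Fin.castAdd l a)) *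
      β (fun b => x (Fin.natAdd k b))) v (appendPerm ρ ρ')
    simp only [appendPerm_castAdd, appendPerm_natAdd, sign_appendPerm, Units.val_mul,
      Int.cast_mul] at h
    rw [← hS] at h
    have e : ∀ σ : Equiv.Perm (Fin (k + l)), ((Equiv.Perm.sign σ : ℤ) : ℂ) *
        ((((Equiv.Perm.sign ρ : ℤ) : ℂ) * α (fun a => v (σ (Fin.castAdd l (ρ a))))) *
          (((Equiv.Perm.sign ρ' : ℤ) : ℂ) * β (fun b => v (σ (Fin.natAdd k (ρ' b)))))) =
        (((Equiv.Perm.sign ρ : ℤ) : ℂ) * ((Equiv.Perm.sign ρ' : ℤ) : ℂ)) *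
          (((Equiv.Perm.sign σ : ℤ) : ℂ) * (α (fun a => v (σ (Fin.castAdd l (ρ a)))) *
            β (fun b => v (σ (Fin.natAdd k (ρ' b)))))) := fun σ => by ring
    rw [Finset.sum_congr rfl fun σ _ => e σ, ← Finset.mul_sum, h]
    linear_combination S * hs l ρ' * ((Equiv.Perm.sign ρ : ℤ) : ℂ) * ((Equiv.Perm.sign ρ : ℤ) : ℂ)
      + S * hs k ρ
  simp only [key, Finset.sum_const, Finset.card_univ, Fintype.card_perm, Fintype.card_fin,
    nsmul_eq_mul, ← Finset.mul_sum]
  rw [← hS]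
  ring

/-- A product of functionals, antisymmetrized, is a determinant. -/
lemma sum_sign_prod_eq_det {V : Type*} {N : ℕ} (r : Fin N → V → ℂ) (v : Fin N → V) :
    ∑ σ : Equiv.Perm (Fin N), ((Equiv.Perm.sign σ : ℤ) : ℂ) * ∏ c, r c (v (σ c)) =
      Matrix.det (Matrix.of fun a b => r b (v a)) := by
  rw [Matrix.det_apply']
  rfl

/-- The double wedge product as a determinant, when the first factor is decomposable. -/
lemma wedge_wedge_eq_det {V : Type*} {m : ℕ} (γ : (Fin m → V) → ℂ) (κ : ℂ) (ℓ : Fin m → V → ℂ)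
    (hγ : ∀ u, γ u = κ * Matrix.det (Matrix.of fun a b => ℓ b (u a))) (α : (Fin 1 → V) → ℂ)
    (v : Fin (m + m + (1 + 1)) → V) :
    wedge (fun a b => a * b) (wedge stdPair γ γ) (wedge stdPair α α) v =
      κ * conj κ * Matrix.det (Matrix.of fun a b =>
        (Fin.append (Fin.append ℓ fun i x => conj (ℓ i x))
          (Fin.append (fun (_ : Fin 1) x => α fun _ => x)
            fun (_ : Fin 1) x => conj (α fun _ => x)) : Fin (m + m + (1 + 1)) → V → ℂ) b (v a)) := by
  set P : (Fin m → V) → ℂ := fun u => ∏ i, ℓ i (u i) with hP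
  have hm : (m.factorial : ℂ) ≠ 0 := by exact_mod_cast m.factorial_ne_zero
  have hmm : ((m + m).factorial : ℂ) ≠ 0 := by exact_mod_cast (m + m).factorial_ne_zero
  have hγ' : ∀ u, γ u = κ * ∑ ρ : Equiv.Perm (Fin m), ((Equiv.Perm.sign ρ : ℤ) : ℂ) *
      P (fun a => u (ρ a)) := fun u => by rw [hγ, ← sum_sign_prod_eq_det]
  have hconj : ∀ u, conj (γ u) = conj κ * ∑ ρ : Equiv.Perm (Fin m),
      ((Equiv.Perm.sign ρ : ℤ) : ℂ) * conj (P (fun a => u (ρ a))) := fun u => by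
    rw [hγ', map_mul, map_sum]; simp
  -- Each determinant is an antisymmetrized product. Antisymmetrizing once more produces `m!²`,
  -- which is the normalization of `wedge`.
  have h1 : ∀ u, wedge stdPair γ γ u = (κ * conj κ) *
      ∑ σ : Equiv.Perm (Fin (m + m)), ((Equiv.Perm.sign σ : ℤ) : ℂ) *
        (P (fun a => u (σ (Fin.castAdd m a))) * conj (P (fun b => u (σ (Fin.natAdd m b))))) := by
    intro u
    have h := sum_sign_antisymm P (fun x => conj (P x)) u
    rw [wedge]
    have e : ∀ σ : Equiv.Perm (Fin (m + m)), ((Equiv.Perm.sign σ : ℤ) : ℂ) *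
        stdPair (γ fun a => u (σ (Fin.castAdd m a))) (γ fun b => u (σ (Fin.natAdd m b))) =
        (κ * conj κ) * (((Equiv.Perm.sign σ : ℤ) : ℂ) *
      ((∑ ρ : Equiv.Perm (Fin m), ((Equiv.Perm.sign ρ : ℤ) : ℂ) *
          P (fun a => u (σ (Fin.castAdd m (ρ a))))) *
        ∑ ρ' : Equiv.Perm (Fin m), ((Equiv.Perm.sign ρ' : ℤ) : ℂ) *
          conj (P (fun b => u (σ (Fin.natAdd m (ρ' b))))))) := fun σ => by
      rw [stdPair, hconj, hγ']; ring
    rw [Finset.sum_congr rfl fun σ _ => e σ, ← Finset.mul_sum, h]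
    push_cast
    field_simp
  have h2 : ∀ u : Fin (1 + 1) → V, wedge stdPair α α u =
      ∑ σ : Equiv.Perm (Fin (1 + 1)), ((Equiv.Perm.sign σ : ℤ) : ℂ) *
        (α (fun a => u (σ (Fin.castAdd 1 a))) * conj (α (fun b => u (σ (Fin.natAdd 1 b))))) := by
    intro u
    rw [wedge]
    simp [stdPair]
  rw [wedge]
  simp only [h1, h2]
  have h := sum_sign_antisymm (k := m + m) (l := 1 + 1)
    (fun x : Fin (m + m) → V => P (fun a => x (Fin.castAdd m a)) *
      conj (P (fun b => x (Fin.natAdd m b))))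
    (fun x : Fin (1 + 1) → V => α (fun a => x (Fin.castAdd 1 a)) *
      conj (α (fun b => x (Fin.natAdd 1 b)))) v
  simp only [mul_assoc (κ * conj κ), mul_left_comm _ (κ * conj κ)]
  rw [← Finset.mul_sum, h]
  rw [← sum_sign_prod_eq_det]
  have h5 : ∀ σ : Equiv.Perm (Fin (m + m + (1 + 1))),
      ∏ c, (Fin.append (Fin.append ℓ fun i x => conj (ℓ i x))
          (Fin.append (fun (_ : Fin 1) x => α fun _ => x)
            fun (_ : Fin 1) x => conj (α fun _ => x)) : Fin (m + m + (1 + 1)) → V → ℂ) c (v (σ c)) =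
      P (fun a => v (σ (Fin.castAdd (1 + 1) (Fin.castAdd m a)))) *
        conj (P (fun b => v (σ (Fin.castAdd (1 + 1) (Fin.natAdd m b))))) *
      (α (fun a => v (σ (Fin.natAdd (m + m) (Fin.castAdd 1 a)))) *
        conj (α (fun b => v (σ (Fin.natAdd (m + m) (Fin.natAdd 1 b)))))) := by
    intro σ
    rw [Fin.prod_univ_add, Fin.prod_univ_add, Fin.prod_univ_add]
    simp only [Fin.append_left, Fin.append_right, hP, map_prod]
    congr 2
    · simp only [Finset.univ_unique, Finset.prod_singleton]
      congr 1
      ext1 a; rw [Subsingleton.elim a default]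
    · simp only [Finset.univ_unique, Finset.prod_singleton]
      congr 2
      ext1 a; rw [Subsingleton.elim a default]
  simp only [h5]
  have hfin : ∀ S : ℂ, (((m + m).factorial * (1 + 1).factorial : ℕ) : ℂ)⁻¹ *
      (κ * conj κ * (((m + m).factorial * (1 + 1).factorial : ℂ) * S)) = κ * conj κ * S := by
    intro S
    have h2 : ((1 + 1).factorial : ℂ) ≠ 0 := by exact_mod_cast (1 + 1).factorial_ne_zero
    push_cast
    field_simp
  exact hfin _

end Wedge

/-! ### Positivity and exact value of the top form `γ ∧ γ̄ ∧ iα ∧ ᾱ` -/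

section TopForm

/-- The interleaving permutation. -/
def interleave (m : ℕ) : Equiv.Perm (Fin (m + m)) :=
  Equiv.ofBijective (Fin.addCases (fun i => ⟨2 * i, by omega⟩) (fun i => ⟨2 * i + 1, by omega⟩)) (by
    rw [← Finite.injective_iff_bijective]
    intro a b h
    induction a using Fin.addCases <;> induction b using Fin.addCases <;>
      simp only [Fin.addCases_left, Fin.addCases_right, Fin.mk.injEq] at h <;>
      (congr 1; ext; omega))

lemma interleave_castAdd {m : ℕ} (i : Fin m) :
    (interleave m (Fin.castAdd m i) : ℕ) = 2 * i := by
  simp [interleave]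

lemma interleave_natAdd {m : ℕ} (i : Fin m) :
    (interleave m (Fin.natAdd m i) : ℕ) = 2 * i + 1 := by
  simp only [interleave, Equiv.ofBijective_apply, Fin.addCases_right]

/-- The `j`-th index of the second block is inverted with the `m - 1 - j` later indices of the first
block, and with no others. -/
lemma sign_interleave (m : ℕ) :
    (Equiv.Perm.sign (interleave m) : ℤˣ) = (-1) ^ (∑ j ∈ Finset.range m, j) := by
  rw [Equiv.Perm.sign_eq_prod_prod_Iio]
  have e : ∀ j : Fin (m + m), ∏ i ∈ Finset.Iio j,
      (if interleave m i < interleave m j then (1 : ℤˣ) else -1) =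
      ∏ i : Fin (m + m), if i < j ∧ ¬ interleave m i < interleave m j then (-1 : ℤˣ) else 1 := by
    intro j
    rw [← Finset.prod_subset (Finset.subset_univ (Finset.Iio j))]
    · refine Finset.prod_congr rfl fun i hi => ?_
      rw [Finset.mem_Iio] at hi
      by_cases h : interleave m i < interleave m j <;> simp [h, hi]
    · intro i _ hi
      rw [Finset.mem_Iio] at hi
      simp [hi]
  simp only [e]
  rw [Fin.prod_univ_add]
  have h1 : ∀ j : Fin m, ∏ i : Fin (m + m), (if i < Fin.castAdd m j ∧
      ¬ interleave m i < interleave m (Fin.castAdd m j) then (-1 : ℤˣ) else 1) = 1 := by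
    intro j
    refine Finset.prod_eq_one fun i _ => if_neg ?_
    rintro ⟨h1, h2⟩
    induction i using Fin.addCases with
    | left i =>
      simp only [Fin.lt_def, interleave_castAdd, Fin.val_castAdd] at h1 h2; omega
    | right i => simp only [Fin.lt_def, Fin.val_castAdd, Fin.val_natAdd] at h1; omega
  have h2 : ∀ j : Fin m, ∏ i : Fin (m + m), (if i < Fin.natAdd m j ∧
      ¬ interleave m i < interleave m (Fin.natAdd m j) then (-1 : ℤˣ) else 1) =
      (-1) ^ (m - 1 - (j : ℕ)) := by
    intro j
    rw [Fin.prod_univ_add]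
    have e1 : ∏ i : Fin m, (if Fin.natAdd m i < Fin.natAdd m j ∧
      ¬ interleave m (Fin.natAdd m i) < interleave m (Fin.natAdd m j) then (-1 : ℤˣ) else 1) = 1 := by
      refine Finset.prod_eq_one fun i _ => if_neg ?_
      rintro ⟨h1, h2⟩
      simp only [Fin.lt_def, interleave_natAdd, Fin.val_natAdd] at h1 h2; omega
    have e2 : ∏ i : Fin m, (if Fin.castAdd m i < Fin.natAdd m j ∧
      ¬ interleave m (Fin.castAdd m i) < interleave m (Fin.natAdd m j) then (-1 : ℤˣ) else 1) =
        ∏ i : Fin m, if j < i then (-1 : ℤˣ) else 1 := by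
      refine Finset.prod_congr rfl fun i _ => if_congr ?_ rfl rfl
      simp only [Fin.lt_def, interleave_natAdd, interleave_castAdd, Fin.val_natAdd,
        Fin.val_castAdd]
      omega
    rw [e1, e2, mul_one, Finset.prod_ite, Finset.prod_const_one, mul_one, Finset.prod_const]
    congr 1
    have : (Finset.univ.filter fun i => j < i) = Finset.Ioi j := by ext; simp
    rw [this, Fin.card_Ioi]
  simp only [h1, h2, Finset.prod_const_one, one_mul]
  rw [Finset.prod_pow_eq_pow_sum]
  congr 1
  rw [Fin.sum_univ_eq_sum_range (fun j => m - 1 - j), Finset.sum_range_reflect (fun j => j) m]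

/-- The coordinate functions and their conjugates, on the real basis. -/
lemma det_coord_conj (m : ℕ) :
    Matrix.det (Matrix.of fun a b : Fin (m + m) =>
      (Fin.append (fun (i : Fin m) (x : Cn m) => x i) (fun i x => conj (x i)) :
        Fin (m + m) → Cn m → ℂ) b (realBasis (Fin.cast (by omega) a))) =
      (-1) ^ (∑ j ∈ Finset.range m, j) * (-2 * Complex.I) ^ m := by
  -- The values of `z` and `z̄` on `1` and `i`, with determinant `-2i`. After interleaving, the
  -- matrix consists of `m` such diagonal blocks.
  let Q : Matrix (Fin 2) (Fin 2) ℂ := !![1, 1; Complex.I, -Complex.I]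
  let e : Fin (m + m) ≃ Fin 2 × Fin m :=
    (finCongr (by omega)).trans ((realIndexEquiv m).trans (Equiv.prodComm _ _))
  let B : Matrix (Fin (m + m)) (Fin (m + m)) ℂ := (Matrix.blockDiagonal fun _ : Fin m => Q).submatrix e e
  have hB : B.det = (-2 * Complex.I) ^ m := by
    rw [Matrix.det_submatrix_equiv_self, Matrix.det_blockDiagonal, Finset.prod_const]
    simp [Q, Matrix.det_fin_two]
    ring
  have hM : (Matrix.of fun a b : Fin (m + m) =>
      (Fin.append (fun (i : Fin m) (x : Cn m) => x i) (fun i x => conj (x i)) :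
        Fin (m + m) → Cn m → ℂ) b (realBasis (Fin.cast (by omega) a))) =
      B.submatrix id (interleave m) := by
    have he : ∀ c : Fin (m + m), (((e c).1 : ℕ) = c % 2) ∧ (((e c).2 : ℕ) = c / 2) := fun c =>
      ⟨rfl, rfl⟩
    ext a b
    simp only [Matrix.of_apply, Matrix.submatrix_apply, B, Matrix.blockDiagonal_apply, id_eq]
    have ha : (realBasis (Fin.cast (by omega) a : Fin (2 * m)) : Cn m) =
        Pi.single (e a).2 (if (e a).1 = 0 then 1 else Complex.I) := by
      rw [realBasis]
      congr 1
      simp [Fin.ext_iff, (he a).1]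
    rw [ha]
    generalize e a = p
    induction b using Fin.addCases with
    | left b =>
      have h1 : e (interleave m (Fin.castAdd m b)) = (0, b) := by
        have := he (interleave m (Fin.castAdd m b))
        rw [interleave_castAdd] at this
        ext
        · rw [this.1]; simp
        · rw [this.2]; simp
      rw [h1, Fin.append_left]
      obtain ⟨s, j⟩ := p
      by_cases hj : j = b
      · subst hj; fin_cases s <;> simp [Q]
      · simp [hj]
    | right b =>
      have h1 : e (interleave m (Fin.natAdd m b)) = (1, b) := by
        have := he (interleave m (Fin.natAdd m b))
        rw [interleave_natAdd] at this
        ext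
        · rw [this.1]; simp
        · rw [this.2]; simp; omega
      rw [h1, Fin.append_right]
      obtain ⟨s, j⟩ := p
      by_cases hj : j = b
      · subst hj; fin_cases s <;> simp [Q]
      · simp [hj]
  rw [hM, Matrix.det_permute', hB, sign_interleave]
  push_cast
  rfl

/-- The top form of the coordinates without the last one and of a one-form. -/
lemma det_coord_oneForm (m : ℕ) (α : Cn (m + 1) →ₗ[ℂ] ℂ)
    (h : m + m + (1 + 1) = 2 * (m + 1)) :
    Matrix.det (Matrix.of fun a b : Fin (m + m + (1 + 1)) =>
      (Fin.append (Fin.append (fun (i : Fin m) (x : Cn (m + 1)) => x i.castSucc)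
          fun i x => conj (x i.castSucc))
        (Fin.append (fun (_ : Fin 1) x => α x) fun (_ : Fin 1) x => conj (α x)) :
          Fin (m + m + (1 + 1)) → Cn (m + 1) → ℂ) b (realBasis (Fin.cast h a))) =
      (-1) ^ (∑ j ∈ Finset.range m, j) * (-2 * Complex.I) ^ (m + 1) *
        Complex.normSq (α (unitVec (Fin.last m))) := by
  rw [← Matrix.det_submatrix_equiv_self finSumFinEquiv]
  set M := (Matrix.of fun a b : Fin (m + m + (1 + 1)) =>
      (Fin.append (Fin.append (fun (i : Fin m) (x : Cn (m + 1)) => x i.castSucc)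
          fun i x => conj (x i.castSucc))
        (Fin.append (fun (_ : Fin 1) x => α x) fun (_ : Fin 1) x => conj (α x)) :
          Fin (m + m + (1 + 1)) → Cn (m + 1) → ℂ) b (realBasis (Fin.cast h a))).submatrix
      finSumFinEquiv finSumFinEquiv with hM
  have hlast : ∀ (c : Fin (1 + 1)), (realBasis (Fin.cast h (Fin.natAdd (m + m) c)) : Cn (m + 1)) =
      Pi.single (Fin.last m) (if c = 0 then 1 else Complex.I) := by
    intro c
    rw [realBasis]
    congr 1
    · ext; simp; omega
    · have : ((m + m + (c : ℕ)) % 2 = 0) ↔ c = 0 := by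
        rw [Fin.ext_iff]; simp; omega
      simp only [Fin.val_cast, Fin.val_natAdd, this]
  have hfirst : ∀ (a : Fin (m + m)) (i : Fin m),
      (realBasis (Fin.cast h (Fin.castAdd (1 + 1) a)) : Cn (m + 1)) i.castSucc =
      (realBasis (Fin.cast (by omega : m + m = 2 * m) a) : Cn m) i := by
    intro a i
    simp only [realBasis, Pi.single_apply]
    simp [Fin.ext_iff]
  -- The first `m` coordinates vanish on the last pair of basis vectors, and these are the only
  -- vectors on which `α` has to be known.
  have hblk : M = Matrix.fromBlocks M.toBlocks₁₁ M.toBlocks₁₂ 0 M.toBlocks₂₂ := by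
    conv_lhs => rw [← Matrix.fromBlocks_toBlocks M]
    congr 1
    ext c b
    simp only [Matrix.toBlocks₂₁, hM, Matrix.submatrix_apply, Matrix.of_apply,
      finSumFinEquiv_apply_left, finSumFinEquiv_apply_right, Fin.append_left, hlast,
      Matrix.zero_apply]
    have : ∀ (i : Fin m) (x : ℂ), (Pi.single (Fin.last m) x : Cn (m + 1)) i.castSucc = 0 :=
      fun i x => by simp [Fin.castSucc_ne_last]
    induction b using Fin.addCases <;>
      simp only [Fin.append_left, Fin.append_right, this, map_zero]
  rw [hblk, Matrix.det_fromBlocks_zero₂₁]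
  have h11 : M.toBlocks₁₁.det = (-1) ^ (∑ j ∈ Finset.range m, j) * (-2 * Complex.I) ^ m := by
    rw [← det_coord_conj]
    congr 1
    ext a b
    simp only [Matrix.toBlocks₁₁, hM, Matrix.submatrix_apply, Matrix.of_apply,
      finSumFinEquiv_apply_left, Fin.append_left]
    induction b using Fin.addCases <;> simp only [Fin.append_left, Fin.append_right, hfirst]
  have hα : ∀ x : ℂ, α (Pi.single (Fin.last m) x) = x * α (unitVec (Fin.last m)) := by
    intro x
    rw [← smul_eq_mul, ← map_smul]
    congr 1
    ext i
    simp [unitVec, Pi.single_apply]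
  have h22 : M.toBlocks₂₂.det = (-2 * Complex.I) * Complex.normSq (α (unitVec (Fin.last m))) := by
    have e : M.toBlocks₂₂ = !![α (unitVec (Fin.last m)), conj (α (unitVec (Fin.last m)));
        Complex.I * α (unitVec (Fin.last m)), -Complex.I * conj (α (unitVec (Fin.last m)))] := by
      ext a b
      simp only [Matrix.toBlocks₂₂, hM, Matrix.submatrix_apply, Matrix.of_apply,
        finSumFinEquiv_apply_right, Fin.append_right, hlast]
      induction b using Fin.addCases with
      | left b =>
        simp only [Fin.append_left, hα]
        fin_cases a <;> fin_cases b <;> simp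
      | right b =>
        simp only [Fin.append_right, hα]
        fin_cases a <;> fin_cases b <;> simp
    rw [e, Matrix.det_fin_two_of, ← Complex.mul_conj]
    ring
  rw [h11, h22]
  ring

/-- This is why the factor `i^(m²)` is the right one: it compensates the ordering sign and the
powers of `i`, and makes the top form positive. -/
lemma sign_identity (m : ℕ) :
    Complex.I ^ (m ^ 2) * Complex.I * ((-1) ^ (∑ j ∈ Finset.range m, j) *
      (-2 * Complex.I) ^ (m + 1)) = 2 ^ (m + 1) := by
  induction m with
  | zero => simp; linear_combination (-2) * Complex.I_sq
  | succ m ih =>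
    rw [Finset.sum_range_succ, pow_add (-1 : ℂ), pow_succ (-2 * Complex.I) (m + 1),
      show (m + 1) ^ 2 = m ^ 2 + (2 * m + 1) by ring, pow_add Complex.I, pow_succ Complex.I (2 * m),
      pow_mul Complex.I, Complex.I_sq, pow_succ (2 : ℂ) (m + 1), ← ih]
    have h : ((-1 : ℂ) ^ m) * (-1) ^ m = 1 := by rw [← mul_pow]; simp
    linear_combination (Complex.I ^ m ^ 2 * Complex.I * ((-1) ^ (∑ j ∈ Finset.range m, j) *
      (-2 * Complex.I) ^ (m + 1)) * (-2) * Complex.I ^ 2) * h +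
      (Complex.I ^ m ^ 2 * Complex.I * ((-1) ^ (∑ j ∈ Finset.range m, j) *
      (-2 * Complex.I) ^ (m + 1)) * (-2)) * Complex.I_sq

/-- The top form `i^{m²} γ ∧ γ̄ ∧ i α ∧ ᾱ` for `γ` a contraction of `dz₁ ∧ ⋯ ∧ dzₙ`. -/
lemma wedge_wedge_realBasis {m : ℕ} (γ : (Fin m → Cn (m + 1)) → ℂ) (c : ℂ) (V : Cn (m + 1))
    (hγ : ∀ v, γ v = c * Matrix.det (Matrix.of (Fin.cons V v)))
    (α : Cn (m + 1) →ₗ[ℂ] ℂ) (h : m + m + (1 + 1) = 2 * (m + 1)) :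
    Complex.I ^ (m ^ 2) * (Complex.I * wedge (fun a b => a * b) (wedge stdPair γ γ)
      (wedge stdPair (fun u : Fin 1 → Cn (m + 1) => α (u 0)) (fun u => α (u 0)))
        (fun a => realBasis (Fin.cast h a))) =
      2 ^ (m + 1) * Complex.normSq c * Complex.normSq (α V) := by
  by_cases hV : V = 0
  · subst hV
    have hγ0 : ∀ v, γ v = 0 := fun v => by
      rw [hγ, Matrix.det_eq_zero_of_row_eq_zero 0 (by intro j; simp), mul_zero]
    simp [wedge, hγ0, stdPair]
  -- A linear change of coordinates moves `V` to the last unit vector, and the contraction becomes,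
  -- up to sign, the product of the other coordinates.
  obtain ⟨R, hR⟩ := SeparatingDual.exists_continuousLinearEquiv_apply_eq (R := ℂ)
    (x := unitVec (Fin.last m)) (y := V) (by
      intro h0
      have := congrFun h0 (Fin.last m)
      simp [unitVec] at this) hV
  let Rl : Cn (m + 1) →ₗ[ℂ] Cn (m + 1) := R.toLinearEquiv.toLinearMap
  let Rs : Cn (m + 1) →ₗ[ℂ] Cn (m + 1) := R.symm.toLinearEquiv.toLinearMap
  have hRRs : ∀ x, Rl (Rs x) = x := fun x => R.apply_symm_apply x
  have hRsR : ∀ x, Rs (Rl x) = x := fun x => R.symm_apply_apply x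
  have hdet1 : LinearMap.det Rl * LinearMap.det Rs = 1 := by
    rw [← LinearMap.det_comp, show Rl ∘ₗ Rs = LinearMap.id from LinearMap.ext hRRs,
      LinearMap.det_id]
  have hdet : ∀ v : Fin m → Cn (m + 1), Matrix.det (Matrix.of (Fin.cons V v)) =
      (LinearMap.det Rl * (-1) ^ m) *
        Matrix.det (Matrix.of fun a b : Fin m => Rs (v a) b.castSucc) := by
    intro v
    have e1 : (Matrix.of (Fin.cons V v) : Matrix (Fin (m + 1)) (Fin (m + 1)) ℂ) =
        Matrix.of (Fin.cons (unitVec (Fin.last m)) fun i => Rs (v i)) *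
          (LinearMap.toMatrix' Rl).transpose := by
      ext i j
      have : ∀ x : Cn (m + 1), ∑ l, x l * LinearMap.toMatrix' Rl j l = Rl x j := by
        intro x
        rw [← LinearMap.toMatrix'_mulVec Rl x]
        simp [Matrix.mulVec, dotProduct, mul_comm]
      rw [Matrix.mul_apply]
      simp only [Matrix.transpose_apply, Matrix.of_apply]
      rw [this]
      induction i using Fin.cases with
      | zero => simp only [Fin.cons_zero]; exact congrFun hR.symm j
      | succ i => simp only [Fin.cons_succ, hRRs]
    rw [e1, Matrix.det_mul, Matrix.det_transpose, LinearMap.det_toMatrix', Matrix.det_succ_row_zero,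
      Finset.sum_eq_single (Fin.last m)]
    · simp only [Fin.val_last, Matrix.of_apply, Fin.cons_zero, unitVec, Pi.single_eq_same, mul_one]
      rw [mul_comm _ (LinearMap.det Rl), mul_assoc]
      congr 3
      ext a b
      simp [Fin.succAbove_last]
    · intro j _ hj
      simp [unitVec, Pi.single_eq_of_ne hj]
    · simp
  rw [wedge_wedge_eq_det γ (c * (LinearMap.det Rl * (-1) ^ m))
    (fun i x => Rs x i.castSucc) (fun u => by rw [hγ, hdet]; ring)]
  let r : Fin (m + m + (1 + 1)) → Cn (m + 1) → ℂ :=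
    Fin.append (Fin.append (fun (i : Fin m) (x : Cn (m + 1)) => x i.castSucc)
          fun i x => conj (x i.castSucc))
        (Fin.append (fun (_ : Fin 1) x => (α ∘ₗ Rl) x) fun (_ : Fin 1) x => conj ((α ∘ₗ Rl) x))
  have hr : (Fin.append (Fin.append (fun (i : Fin m) x => Rs x i.castSucc)
        fun i x => conj (Rs x i.castSucc))
      (Fin.append (fun (_ : Fin 1) x => α x) fun (_ : Fin 1) x => conj (α x)) :
        Fin (m + m + (1 + 1)) → Cn (m + 1) → ℂ) = fun b x => r b (Rs x) := by
    ext b x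
    induction b using Fin.addCases with
    | left b => induction b using Fin.addCases <;> simp only [r, Fin.append_left, Fin.append_right]
    | right b =>
      induction b using Fin.addCases <;>
        simp only [r, Fin.append_left, Fin.append_right, LinearMap.comp_apply, hRRs]
  have hradd : ∀ b (x y : Cn (m + 1)), r b (x + y) = r b x + r b y := by
    intro b x y
    induction b using Fin.addCases with
    | left b =>
      induction b using Fin.addCases <;> simp only [r, Fin.append_left, Fin.append_right] <;> simp
    | right b =>
      induction b using Fin.addCases <;> simp only [r, Fin.append_left, Fin.append_right] <;> simp
  have hrsmul : ∀ b (t : ℝ) (x : Cn (m + 1)), r b (t • x) = t • r b x := by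
    intro b t x
    have ht : t • x = (t : ℂ) • x := by ext; simp
    rw [ht]
    induction b using Fin.addCases with
    | left b =>
      induction b using Fin.addCases <;> simp only [r, Fin.append_left, Fin.append_right] <;> simp
    | right b =>
      induction b using Fin.addCases <;> simp only [r, Fin.append_left, Fin.append_right] <;> simp
  let rl : Fin (m + m + (1 + 1)) → Cn (m + 1) →ₗ[ℝ] ℂ := fun b =>
    { toFun := r b, map_add' := hradd b, map_smul' := hrsmul b }
  have hmat : (Matrix.of fun a b : Fin (m + m + (1 + 1)) => r b (Rs (realBasis (Fin.cast h a)))) =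
      (((realMat Rs).map (Complex.ofRealHom)).submatrix (finCongr h) (finCongr h)).transpose *
        Matrix.of fun a b : Fin (m + m + (1 + 1)) => r b (realBasis (Fin.cast h a)) := by
    ext a b
    rw [Matrix.mul_apply]
    simp only [Matrix.of_apply, Matrix.transpose_apply, Matrix.submatrix_apply, Matrix.map_apply]
    have e := sum_realMat_smul (Rs.restrictScalars ℝ) (Fin.cast h a)
    have e2 : r b (Rs (realBasis (Fin.cast h a))) =
        ∑ c, realMat Rs c (Fin.cast h a) • r b (realBasis c) := by
      change rl b _ = ∑ c, _ • rl b _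
      rw [← LinearMap.coe_restrictScalars ℝ Rs, ← e, map_sum]
      simp
    rw [e2]
    refine ((finCongr h).sum_comp (fun c => realMat Rs c (Fin.cast h a) • r b (realBasis c))).symm.trans ?_
    refine Finset.sum_congr rfl fun c _ => ?_
    simp [Complex.real_smul]
  simp only
  rw [hr]
  rw [hmat, Matrix.det_mul, Matrix.det_transpose, Matrix.det_submatrix_equiv_self]
  have hdm : ((realMat Rs).map Complex.ofRealHom).det =
      (Complex.normSq (LinearMap.det Rs) : ℂ) := by
    rw [← det_realMat]
    exact (RingHom.map_det Complex.ofRealHom (realMat Rs)).symm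
  rw [hdm, det_coord_oneForm m (α ∘ₗ Rl) h]
  have hαV : (α ∘ₗ Rl) (unitVec (Fin.last m)) = α V := by
    rw [LinearMap.comp_apply]; exact congrArg α hR
  rw [hαV, ← sign_identity m]
  -- `|det R|²` comes from `γ` and `γ̄`, and `|det R⁻¹|²` from transforming the real basis; they
  -- cancel.
  have h1 : (LinearMap.det Rl * LinearMap.det Rs) * conj (LinearMap.det Rl * LinearMap.det Rs) = 1 := by
    rw [hdet1]; simp
  rw [map_mul] at h1
  rw [← Complex.mul_conj (LinearMap.det Rs), ← Complex.mul_conj c]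
  have h2 : ((-1 : ℂ) ^ m) * (-1) ^ m = 1 := by rw [← mul_pow]; simp
  simp only [map_mul, map_pow, map_neg, map_one]
  set X := Complex.I ^ m ^ 2 * Complex.I * ((-1) ^ (∑ j ∈ Finset.range m, j) *
      (-2 * Complex.I) ^ (m + 1)) * (Complex.normSq (α V) : ℂ) * c * conj c with hX
  linear_combination (X * (-1) ^ m * (-1) ^ m) * h1 + X * h2

end TopForm

/-! ### Complex linearity of `∂f` in the tangent vector -/

section DelAt

variable {n : ℕ}

/-- `∂f` at a point, as a linear form. -/
def delLM (f : Cn n → ℂ) (p : Cn n) : Cn n →ₗ[ℂ] ℂ where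
  toFun := delAt f p
  map_add' u v := by simp only [delAt, smul_add, map_add]; ring
  map_smul' c v := by
    have h1 : ∀ c : ℂ, c • v = c.re • v + c.im • (Complex.I • v) := by
      intro c
      rw [← Complex.coe_smul, ← Complex.coe_smul, smul_smul, ← add_smul, Complex.re_add_im]
    have h2 : Complex.I • c • v = c.re • (Complex.I • v) + (-c.im) • v := by
      rw [← Complex.coe_smul, ← Complex.coe_smul, smul_smul, smul_smul, ← add_smul]
      congr 1
      conv_lhs => rw [← Complex.re_add_im c]
      push_cast
      linear_combination (c.im : ℂ) * Complex.I_sq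
    simp only [delAt, RingHom.id_apply, smul_eq_mul]
    rw [h2, h1 c, map_add, map_add]
    simp only [(fderiv ℝ f p).map_smul]
    simp only [Complex.real_smul, Complex.ofReal_neg]
    conv_rhs => rw [← Complex.re_add_im c]
    linear_combination ((c.im : ℂ) * fderiv ℝ f p (Complex.I • v) / 2) * Complex.I_sq

end DelAt

/-! ### Frames, Hermitian metrics and the density of the left-hand side at a point -/

section Pointwise

variable {n : ℕ} {X : Type*} [TopologicalSpace X] [ChartedSpace (Cn n) X]
  [IsManifold 𝓘(ℂ, Cn n) ω X]
  {L : X → Type*} [TopologicalSpace (TotalSpace ℂ L)] [∀ x, TopologicalSpace (L x)]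
  [∀ x, AddCommGroup (L x)] [∀ x, Module ℂ (L x)] [FiberBundle ℂ L] [VectorBundle ℂ ℂ L]
  {F : X → Type*} [TopologicalSpace (TotalSpace ℂ F)] [∀ x, TopologicalSpace (F x)]
  [∀ x, AddCommGroup (F x)] [∀ x, Module ℂ (F x)] [FiberBundle ℂ F] [VectorBundle ℂ ℂ F]

lemma pt_chartAt (x : X) : pt x (chartAt (Cn n) x x) = x :=
  (chartAt (Cn n) x).left_inv (mem_chart_source _ x)

lemma toTangent_self (x : X) : toTangent (n := n) x x = ContinuousLinearMap.id ℝ (Cn n) := by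
  ext v : 1
  simp only [toTangent, ContinuousLinearMap.coe_restrictScalars', ContinuousLinearMap.id_apply]
  exact tangentCoordChange_self (by simp)

lemma fibreCoord_smul_frame (x₀ : X) {q : X} (hq : q ∈ (trivializationAt ℂ L x₀).baseSet)
    (a : L q) : fibreCoord L x₀ q a • frame L x₀ q = a := by
  rw [frame, ← map_smul, smul_eq_mul, mul_one]
  exact (trivializationAt ℂ L x₀).symmL_continuousLinearMapAt hq a

lemma fibreCoord_frame (x₀ : X) {q : X} (hq : q ∈ (trivializationAt ℂ L x₀).baseSet) :
    fibreCoord L x₀ q (frame L x₀ q) = 1 :=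
  (trivializationAt ℂ L x₀).continuousLinearMapAt_symmL hq 1

lemma frame_ne_zero (x₀ : X) {q : X} (hq : q ∈ (trivializationAt ℂ L x₀).baseSet) :
    frame L x₀ q ≠ 0 := by
  intro h
  have := fibreCoord_frame x₀ hq
  rw [h, map_zero] at this
  exact zero_ne_one this

lemma HermitianMetric.normSq_frame_pos (h : HermitianMetric (n := n) L) (x₀ : X) {q : X}
    (hq : q ∈ (trivializationAt ℂ L x₀).baseSet) : 0 < h.normSq q (frame L x₀ q) :=
  h.pos q _ (frame_ne_zero x₀ hq)

lemma HermitianMetric.pair_self (h : HermitianMetric (n := n) L) (x : X) (a : L x) :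
    h.pair x a a = (h.normSq x a : ℂ) := by
  rw [HermitianMetric.normSq]
  exact (Complex.conj_eq_iff_re.mp (h.symm x a a)).symm

lemma HermitianMetric.pair_eq (h : HermitianMetric (n := n) L) (x₀ : X) {q : X}
    (hq : q ∈ (trivializationAt ℂ L x₀).baseSet) (a b : L q) :
    h.pair q a b = (h.normSq q (frame L x₀ q) : ℂ) *
      stdPair (fibreCoord L x₀ q a) (fibreCoord L x₀ q b) := by
  conv_lhs => rw [← fibreCoord_smul_frame x₀ hq a, ← fibreCoord_smul_frame x₀ hq b]
  rw [← h.pair_self]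
  simp only [HermitianMetric.pair, map_smul, LinearMap.smul_apply, map_smulₛₗ, smul_eq_mul, stdPair]
  ring

lemma HermitianMetric.normSq_eq (h : HermitianMetric (n := n) L) (x₀ : X) {q : X}
    (hq : q ∈ (trivializationAt ℂ L x₀).baseSet) (a : L q) :
    h.normSq q a = h.normSq q (frame L x₀ q) * Complex.normSq (fibreCoord L x₀ q a) := by
  have := h.pair_eq x₀ hq a a
  rw [h.pair_self, stdPair, Complex.mul_conj] at this
  exact_mod_cast this

lemma HermitianMetric.normSq_nonneg (h : HermitianMetric (n := n) L) (x : X) (a : L x) :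
    0 ≤ h.normSq x a := by
  have hx : x ∈ (trivializationAt ℂ L x).baseSet := mem_baseSet_trivializationAt ℂ L x
  rw [h.normSq_eq x hx]
  exact mul_nonneg (h.normSq_frame_pos x hx).le (Complex.normSq_nonneg _)

lemma KahlerForm.isPositiveOneOne (K : KahlerForm n X) (x : X) : IsPositiveOneOne (K.form x) :=
  ⟨K.typeOneOne x, K.pos x⟩

/-- A form in the coordinates and the frame at its base point. -/
def centralForm {k : ℕ} (ξ : LForm n L k) (x : X) : Cn n [⋀^Fin k]→L[ℝ] ℂ :=
  ((fibreCoord L x x).restrictScalars ℝ).compContinuousAlternatingMap (ξ x)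

lemma centralForm_apply {k : ℕ} (ξ : LForm n L k) (x : X) (v : Fin k → Cn n) :
    centralForm ξ x v = fibreCoord L x x (ξ x v) := rfl

lemma IsOfType.centralForm {k p q : ℕ} {ξ : LForm n L k} {x : X} (h : IsOfType p q (ξ x)) :
    IsOfType p q (centralForm ξ x) :=
  ⟨h.1, fun c v => by rw [centralForm_apply, h.2, map_smul, centralForm_apply]⟩

lemma localForm_self {k : ℕ} (ξ : LForm n L k) (x : X) :
    localForm ξ x (chartAt (Cn n) x x) = centralForm ξ x := by
  ext v
  simp only [localForm, ContinuousAlternatingMap.compContinuousLinearMap_apply,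
    ContinuousLinearMap.compContinuousAlternatingMap_coe, centralForm, Function.comp_apply]
  -- The fibres depend on the point, so the identity of `pt x (chartAt x x)` with `x` is used
  -- through a variable `q`.
  have h : ∀ q : X, q = x → fibreCoord L x q (ξ q (fun i => toTangent (n := n) x q (v i))) =
      fibreCoord L x x (ξ x v) := by
    rintro q rfl
    rw [toTangent_self]; rfl
  exact h _ (pt_chartAt x)

lemma innerForm_pair (h : HermitianMetric (n := n) L) (w : Cn n [⋀^Fin 2]→L[ℝ] ℝ) (x₀ : X)
    {x : X} (hx : x ∈ (trivializationAt ℂ L x₀).baseSet) {k : ℕ} (u v : (Fin k → Cn n) → L x) :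
    innerForm w (h.pair x) u v = (h.normSq x (frame L x₀ x) : ℂ) *
      innerForm w stdPair (fun a => fibreCoord L x₀ x (u a)) fun a => fibreCoord L x₀ x (v a) := by
  simp only [innerForm, h.pair_eq x₀ hx, Finset.mul_sum]
  refine Finset.sum_congr rfl fun I _ => Finset.sum_congr rfl fun J _ => ?_
  ring

lemma fibreCoord_hodgeStar (w : Cn n [⋀^Fin 2]→L[ℝ] ℝ) {k l : ℕ} (h : 2 * n = k + l) (x : X)
    (ξ : (Fin k → Cn n) → L x) (v : Fin l → Cn n) :
    fibreCoord L x x (hodgeStar w h ξ v) = hodgeStar w h (fun u => fibreCoord L x x (ξ u)) v := by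
  have hr : ∀ (c : ℝ) (a : L x), fibreCoord L x x (c • a) = c • fibreCoord L x x a := fun c a =>
    ((fibreCoord L x x).restrictScalars ℝ).map_smul c a
  simp only [hodgeStar, hr, map_sum]

lemma wedge_smul {V A A' : Type*} (B : A → A' → ℂ) (B' : ℂ → ℂ → ℂ) {k l : ℕ}
    (α : (Fin k → V) → A) (β : (Fin l → V) → A') (α' : (Fin k → V) → ℂ) (β' : (Fin l → V) → ℂ)
    (c : ℂ) (h : ∀ u v, B (α u) (β v) = c * B' (α' u) (β' v)) (v : Fin (k + l) → V) :
    wedge B α β v = c * wedge B' α' β' v := by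
  simp only [wedge, h, Finset.mul_sum]
  refine Finset.sum_congr rfl fun I _ => ?_
  ring

lemma volForm_realBasis (w : Cn n [⋀^Fin 2]→L[ℝ] ℝ) (hw : IsPositiveOneOne w) :
    (volForm w realBasis : ℂ) = (hermMat w).det := by
  have : (fun a b => realCoord (realBasis b : Cn n) a) = (1 : Matrix _ _ ℝ) := by
    ext a b
    rw [realCoord_realBasis, Matrix.one_apply]
    simp [eq_comm]
  rw [volForm, this, Matrix.det_one, mul_one, hw.sqrt_det_gram]

/-- The Chern derivative in the frame at the base point. -/
def chernLM (hF : HermitianMetric (n := n) F) (s : ∀ x, F x) (x : X) : Cn n →ₗ[ℂ] ℂ :=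
  delLM (fun p => fibreCoord F x (pt x p) (s (pt x p))) (chartAt (Cn n) x x) -
    fibreCoord F x x (s x) • delLM (fun p => (hF.weight x p : ℂ)) (chartAt (Cn n) x x)

lemma chernDel_eq (hF : HermitianMetric (n := n) F) (s : ∀ x, F x) (x : X) (v : Fin 1 → Cn n) :
    hF.chernDel s x v = chernLM hF s x (v 0) • frame F x x := rfl

/-- The density by which the tangential form is expressed. -/
lemma tangentialForm_div_volForm (hn : 1 ≤ n) (K : KahlerForm n X)
    (hL : HermitianMetric (n := n) L) (hF : HermitianMetric (n := n) F) (s : ∀ x, F x)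
    (ξ : LForm n L (n + 1)) (x : X) (hξ : IsOfType n 1 (ξ x)) :
    tangentialForm hn K hL hF s ξ x realBasis / (volForm (K.form x) realBasis : ℂ) =
      ((2 ^ (n + 2) * hL.normSq x (frame L x x) / (hermMat (K.form x)).det.re *
        (hF.normSq x (frame F x x) *
          Complex.normSq (chernLM hF s x (dualVec (K.form x) (centralForm ξ x)))) : ℝ) : ℂ) := by
  -- With `n = m + 1` the degree `n - 1` of `γ` is `m` by computation.
  obtain ⟨m, rfl⟩ : ∃ m, n = m + 1 := ⟨n - 1, by omega⟩
  have hw := K.isPositiveOneOne x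
  have hxL : x ∈ (trivializationAt ℂ L x).baseSet := mem_baseSet_trivializationAt ℂ L x
  have hxF : x ∈ (trivializationAt ℂ F x).baseSet := mem_baseSet_trivializationAt ℂ F x
  obtain ⟨c, hc, hγ⟩ := hw.hodgeStar_eq_det (by omega) hξ.centralForm
  have hγ' : ∀ v : Fin m → Cn (m + 1), fibreCoord L x x (gammaForm hn K ξ x v) =
      c * Matrix.det (Matrix.of (Fin.cons (dualVec (K.form x) (centralForm ξ x)) v)) := by
    intro v
    rw [← hγ v, gammaForm]
    exact fibreCoord_hodgeStar _ _ _ _ _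
  have hcast : m + m + (1 + 1) = 2 * (m + 1) := by omega
  have key := wedge_wedge_realBasis _ c _ hγ' (chernLM hF s x) hcast
  set W := wedge (fun a b => a * b)
        (wedge stdPair (fun v : Fin m → Cn (m + 1) => fibreCoord L x x (gammaForm hn K ξ x v))
          (fun v => fibreCoord L x x (gammaForm hn K ξ x v)))
      (wedge stdPair (fun u : Fin 1 → Cn (m + 1) => chernLM hF s x (u 0))
        (fun u => chernLM hF s x (u 0)))
        (fun a => realBasis (Fin.cast hcast a)) with hW
  replace key : Complex.I ^ (m ^ 2) * (Complex.I * W) = 2 ^ (m + 1) * Complex.normSq c *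
      Complex.normSq (chernLM hF s x (dualVec (K.form x) (centralForm ξ x))) := key
  rw [volForm_realBasis _ hw, ← hw.ofReal_det_re]
  have e : tangentialForm hn K hL hF s ξ x realBasis =
      hL.normSq x (frame L x x) * hF.normSq x (frame F x x) *
      (Complex.I ^ (m ^ 2) * (Complex.I * W)) := by
    have h1 : ∀ v, wedge (hL.pair x) (gammaForm hn K ξ x) (gammaForm hn K ξ x) v =
        hL.normSq x (frame L x x) * wedge stdPair
          (fun v : Fin m → Cn (m + 1) => fibreCoord L x x (gammaForm hn K ξ x v))
          (fun v => fibreCoord L x x (gammaForm hn K ξ x v)) v := fun v =>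
      wedge_smul _ _ _ _ _ _ _ (fun a b => hL.pair_eq x hxL _ _) v
    have h2 : ∀ u, wedge (hF.pair x) (hF.chernDel s x) (hF.chernDel s x) u =
        hF.normSq x (frame F x x) * wedge stdPair
          (fun u : Fin 1 → Cn (m + 1) => chernLM hF s x (u 0))
          (fun u => chernLM hF s x (u 0)) u := fun u =>
      wedge_smul _ _ _ _ _ _ _ (fun a b => by
        rw [hF.pair_eq x hxF, chernDel_eq, chernDel_eq, map_smul, map_smul,
          fibreCoord_frame x hxF]
        simp) u
    rw [tangentialForm]
    have h3 := wedge_smul (fun a b => a * b) (fun a b => a * b)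
      (wedge (hL.pair x) (gammaForm hn K ξ x) (gammaForm hn K ξ x))
      (fun u => Complex.I * wedge (hF.pair x) (hF.chernDel s x) (hF.chernDel s x) u)
      (wedge stdPair
          (fun v : Fin m → Cn (m + 1) => fibreCoord L x x (gammaForm hn K ξ x v))
          (fun v => fibreCoord L x x (gammaForm hn K ξ x v)))
      (wedge stdPair
          (fun u : Fin 1 → Cn (m + 1) => chernLM hF s x (u 0))
          (fun u => chernLM hF s x (u 0)))
      (hL.normSq x (frame L x x) * (Complex.I * hF.normSq x (frame F x x)))
      (fun u v => by rw [h1, h2]; ring)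
    rw [h3]
    change Complex.I ^ (m ^ 2) * (_ * W) = _
    ring
  -- The constant is `2^n · 4 = 2^(n+2)`, with `4` the squared modulus of the factor in the Hodge
  -- star. The same power stands in the Bochner inequality.
  rw [e, key, hc, Complex.ofReal_re]
  push_cast
  ring

end Pointwise

/-! ### Derivatives along complex tangent vectors in `ℂⁿ` -/

section Wirtinger

variable {n : ℕ}

/-- The derivative of `f` in the direction of a complex tangent vector, given by its coordinates in
the real basis. -/
def cderiv (Z : Fin (2 * n) → ℂ) (f : Cn n → ℂ) (p : Cn n) : ℂ :=
  ∑ c, Z c * fderiv ℝ f p (realBasis c)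

lemma cderiv_rvec (v : Cn n) (f : Cn n → ℂ) (p : Cn n) :
    cderiv (rvec v) f p = fderiv ℝ f p v := by
  conv_rhs => rw [← sum_realCoord_smul_realBasis v]
  simp only [map_sum, map_smul, cderiv, rvec, Complex.real_smul]

lemma cderiv_add_left (Z W : Fin (2 * n) → ℂ) (f : Cn n → ℂ) (p : Cn n) :
    cderiv (Z + W) f p = cderiv Z f p + cderiv W f p := by
  simp [cderiv, add_mul, Finset.sum_add_distrib]

lemma cderiv_smul_left (c : ℂ) (Z : Fin (2 * n) → ℂ) (f : Cn n → ℂ) (p : Cn n) :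
    cderiv (c • Z) f p = c * cderiv Z f p := by
  simp [cderiv, mul_assoc, Finset.mul_sum]

lemma cderiv_sum_left {ι : Type*} (s : Finset ι) (Z : ι → Fin (2 * n) → ℂ) (f : Cn n → ℂ)
    (p : Cn n) : cderiv (∑ i ∈ s, Z i) f p = ∑ i ∈ s, cderiv (Z i) f p := by
  simp only [cderiv, Finset.sum_apply, Finset.sum_mul]
  exact Finset.sum_comm

lemma cderiv_holVec (f : Cn n → ℂ) (p v : Cn n) : cderiv (holVec v) f p = delAt f p v := by
  rw [holVec_eq, cderiv_add_left, cderiv_smul_left, cderiv_smul_left, cderiv_rvec, cderiv_rvec,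
    delAt]
  ring

lemma cderiv_antiVec (f : Cn n → ℂ) (p v : Cn n) : cderiv (antiVec v) f p =
    (fderiv ℝ f p v + Complex.I * fderiv ℝ f p (Complex.I • v)) / 2 := by
  rw [antiVec_eq, cderiv_add_left, cderiv_smul_left, cderiv_smul_left, cderiv_rvec, cderiv_rvec]
  ring

lemma cderiv_congr {Z : Fin (2 * n) → ℂ} {f g : Cn n → ℂ} {p : Cn n}
    (h : f =ᶠ[nhds p] g) : cderiv Z f p = cderiv Z g p := by
  rw [cderiv, h.fderiv_eq, cderiv]

variable {Z W : Fin (2 * n) → ℂ} {f g : Cn n → ℂ} {p : Cn n}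

lemma cderiv_const (c : ℂ) : cderiv Z (fun _ => c) p = 0 := by simp [cderiv]

lemma cderiv_add (hf : DifferentiableAt ℝ f p) (hg : DifferentiableAt ℝ g p) :
    cderiv Z (fun x => f x + g x) p = cderiv Z f p + cderiv Z g p := by
  simp [cderiv, fderiv_fun_add hf hg, mul_add, Finset.sum_add_distrib]

lemma cderiv_sub (hf : DifferentiableAt ℝ f p) (hg : DifferentiableAt ℝ g p) :
    cderiv Z (fun x => f x - g x) p = cderiv Z f p - cderiv Z g p := by
  simp [cderiv, fderiv_fun_sub hf hg, mul_sub, Finset.sum_sub_distrib]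

lemma cderiv_mul (hf : DifferentiableAt ℝ f p) (hg : DifferentiableAt ℝ g p) :
    cderiv Z (fun x => f x * g x) p = cderiv Z f p * g p + f p * cderiv Z g p := by
  simp only [cderiv, fderiv_fun_mul hf hg, Finset.sum_mul, Finset.mul_sum,
    ← Finset.sum_add_distrib]
  refine Finset.sum_congr rfl fun c _ => ?_
  simp
  ring

lemma cderiv_sum {ι : Type*} {s : Finset ι} {F : ι → Cn n → ℂ}
    (hF : ∀ i ∈ s, DifferentiableAt ℝ (F i) p) :
    cderiv Z (fun x => ∑ i ∈ s, F i x) p = ∑ i ∈ s, cderiv Z (F i) p := by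
  simp only [cderiv, fderiv_fun_sum hF, sum_apply, Finset.mul_sum]
  exact Finset.sum_comm

/-- The conjugate of a complex tangent vector. -/
def conjVec (Z : Fin (2 * n) → ℂ) : Fin (2 * n) → ℂ := fun c => conj (Z c)

lemma conjVec_holVec (v : Cn n) : conjVec (holVec v) = antiVec v := rfl

lemma conjVec_antiVec (v : Cn n) : conjVec (antiVec v) = holVec v := by
  ext c
  simp [conjVec, antiVec]

lemma cderiv_conj (hf : DifferentiableAt ℝ f p) :
    cderiv Z (fun x => conj (f x)) p = conj (cderiv (conjVec Z) f p) := by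
  have h : fderiv ℝ (fun x => conj (f x)) p =
      (Complex.conjCLE : ℂ →L[ℝ] ℂ).comp (fderiv ℝ f p) :=
    ((Complex.conjCLE : ℂ →L[ℝ] ℂ).hasFDerivAt.comp p hf.hasFDerivAt).fderiv
  simp [cderiv, conjVec, h]

lemma ContDiffAt.cderiv {k m : WithTop ℕ∞} (hf : ContDiffAt ℝ m f p) (hk : k + 1 ≤ m) :
    ContDiffAt ℝ k (cderiv Z f) p := by
  unfold KahlerForms.cderiv
  refine ContDiffAt.sum fun c _ => contDiffAt_const.mul ?_
  exact (hf.fderiv_right hk).clm_apply contDiffAt_const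

lemma ContDiff.cderiv (hf : ContDiff ℝ ∞ f) : ContDiff ℝ ∞ (cderiv Z f) :=
  contDiff_iff_contDiffAt.2 fun _ => ContDiffAt.cderiv hf.contDiffAt le_rfl

lemma cderiv_cderiv (hf : ContDiffAt ℝ 2 f p) : cderiv Z (cderiv W f) p =
    ∑ c, ∑ d, Z c * W d * fderiv ℝ (fderiv ℝ f) p (realBasis c) (realBasis d) := by
  have hd : DifferentiableAt ℝ (fderiv ℝ f) p :=
    (hf.fderiv_right (m := 1) (by norm_num)).differentiableAt (by norm_num)
  have hd' : ∀ v, DifferentiableAt ℝ (fun x => fderiv ℝ f x v) p := fun v =>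
    hd.clm_apply (differentiableAt_const v)
  have h : cderiv W f = fun x => ∑ d, W d * fderiv ℝ f x (realBasis d) := rfl
  rw [h, cderiv_sum (F := fun d x => W d * fderiv ℝ f x (realBasis d))
    fun d _ => (differentiableAt_const _).mul (hd' _)]
  simp only [cderiv_mul (differentiableAt_const _) (hd' _), cderiv_const, zero_mul, zero_add]
  simp only [cderiv]
  rw [Finset.sum_comm' (t' := Finset.univ) (s' := fun _ => Finset.univ) (by simp)]
  refine Finset.sum_congr rfl fun c _ => ?_
  rw [Finset.mul_sum]
  refine Finset.sum_congr rfl fun d _ => ?_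
  rw [fderiv_clm_apply hd (differentiableAt_const _)]
  simp
  ring

lemma cderiv_comm (hf : ContDiffAt ℝ 2 f p) :
    cderiv Z (cderiv W f) p = cderiv W (cderiv Z f) p := by
  rw [cderiv_cderiv hf, cderiv_cderiv hf, Finset.sum_comm]
  have hs : IsSymmSndFDerivAt ℝ f p := hf.isSymmSndFDerivAt (by simp)
  refine Finset.sum_congr rfl fun c _ => Finset.sum_congr rfl fun d _ => ?_
  rw [hs.eq, mul_comm (Z d)]

lemma cderiv_ofReal_comp {u : Cn n → ℝ} {g : ℝ → ℝ} {g' : ℝ} (hg : HasDerivAt g g' (u p))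
    (hu : DifferentiableAt ℝ u p) :
    cderiv Z (fun x => (g (u x) : ℂ)) p = g' * cderiv Z (fun x => (u x : ℂ)) p := by
  have h1 : HasFDerivAt (fun x => (u x : ℂ)) (Complex.ofRealCLM.comp (fderiv ℝ u p)) p :=
    Complex.ofRealCLM.hasFDerivAt.comp p hu.hasFDerivAt
  have h2 : HasFDerivAt (fun x => (g (u x) : ℂ))
      (Complex.ofRealCLM.comp (g' • fderiv ℝ u p)) p :=
    Complex.ofRealCLM.hasFDerivAt.comp p (hg.comp_hasFDerivAt p hu.hasFDerivAt)
  simp only [cderiv, h1.fderiv, h2.fderiv, Finset.mul_sum]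
  refine Finset.sum_congr rfl fun c _ => ?_
  simp
  ring

lemma cderiv_conj_ofReal {u : Cn n → ℝ} (hu : DifferentiableAt ℝ u p) :
    conj (cderiv Z (fun x => (u x : ℂ)) p) = cderiv (conjVec Z) (fun x => (u x : ℂ)) p := by
  have h1 : HasFDerivAt (fun x => (u x : ℂ)) (Complex.ofRealCLM.comp (fderiv ℝ u p)) p :=
    Complex.ofRealCLM.hasFDerivAt.comp p hu.hasFDerivAt
  simp [cderiv, conjVec, h1.fderiv]

/-- In the second derivative along the `(1,0)`- and the `(0,1)`-part of `v`, the mixed terms in `v`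
and `iv` cancel by symmetry of the Hessian. -/
lemma leviForm_eq {φ : Cn n → ℝ} (hφ : ContDiffAt ℝ 2 φ p) (v : Cn n) :
    (leviForm φ p v : ℂ) = cderiv (holVec v) (cderiv (antiVec v) fun x => (φ x : ℂ)) p := by
  have hφc : ContDiffAt ℝ 2 (fun x => (φ x : ℂ)) p := Complex.ofRealCLM.contDiff.contDiffAt.comp p hφ
  have hs : IsSymmSndFDerivAt ℝ (fun x => (φ x : ℂ)) p := hφc.isSymmSndFDerivAt (by simp)
  set D := fderiv ℝ (fderiv ℝ fun x => (φ x : ℂ)) p with hD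
  have key : ∀ Z W : Cn n, ∑ c, ∑ d, rvec Z c * rvec W d * D (realBasis c) (realBasis d) =
      D Z W := by
    intro Z W
    conv_rhs => rw [← sum_realCoord_smul_realBasis Z, ← sum_realCoord_smul_realBasis W]
    simp only [map_sum, map_smul, sum_apply, smul_apply, rvec,
      Complex.real_smul, Finset.mul_sum]
    rw [Finset.sum_comm]
    refine Finset.sum_congr rfl fun c _ => Finset.sum_congr rfl fun d _ => ?_
    ring
  have hreal : ∀ u w : Cn n, D u w = (fderiv ℝ (fderiv ℝ φ) p u w : ℂ) := by
    intro u w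
    have hd : DifferentiableAt ℝ (fderiv ℝ φ) p :=
      (hφ.fderiv_right (m := 1) (by norm_num)).differentiableAt (by norm_num)
    have e : (fderiv ℝ fun x => (φ x : ℂ)) =ᶠ[nhds p]
        fun x => Complex.ofRealCLM.comp (fderiv ℝ φ x) := by
      filter_upwards [hφ.eventually (by simp)] with x hx
      exact (Complex.ofRealCLM.hasFDerivAt.comp x
        (hx.differentiableAt (by norm_num)).hasFDerivAt).fderiv
    rw [hD, e.fderiv_eq, fderiv_clm_comp (differentiableAt_const _) hd]
    simp
  rw [cderiv_cderiv hφc, ← hD, holVec_eq, antiVec_eq]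
  have e : ∑ c, ∑ d, ((2⁻¹ : ℂ) • rvec v + (-(Complex.I / 2)) • rvec (Complex.I • v)) c *
      ((2⁻¹ : ℂ) • rvec v + (Complex.I / 2) • rvec (Complex.I • v)) d *
        D (realBasis c) (realBasis d) = (D v v + D (Complex.I • v) (Complex.I • v)) / 4 := by
    have h4 : ∑ c, ∑ d, ((2⁻¹ : ℂ) • rvec v + (-(Complex.I / 2)) • rvec (Complex.I • v)) c *
      ((2⁻¹ : ℂ) • rvec v + (Complex.I / 2) • rvec (Complex.I • v)) d *
        D (realBasis c) (realBasis d) = 4⁻¹ * D v v + (Complex.I / 4) * D v (Complex.I • v) -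
          (Complex.I / 4) * D (Complex.I • v) v -
          (Complex.I * Complex.I / 4) * D (Complex.I • v) (Complex.I • v) := by
      rw [← key v v, ← key v, ← key _ v, ← key (Complex.I • v) (Complex.I • v)]
      simp only [Finset.mul_sum, ← Finset.sum_add_distrib, ← Finset.sum_sub_distrib]
      refine Finset.sum_congr rfl fun c _ => Finset.sum_congr rfl fun d _ => ?_
      simp only [Pi.add_apply, Pi.smul_apply, smul_eq_mul]
      ring
    rw [h4, hs.eq v (Complex.I • v), Complex.I_mul_I]
    ring
  rw [e, hreal, hreal, leviForm, iteratedFDeriv_two_apply, iteratedFDeriv_two_apply]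
  simp

/-- The integral of a derivative of a function with compact support vanishes. -/
lemma integral_cderiv (hf : ContDiff ℝ ∞ f) (hc : HasCompactSupport f) :
    ∫ x, cderiv Z f x = 0 := by
  have hcs : ∀ v, Continuous fun x => fderiv ℝ f x v := fun v =>
    (hf.continuous_fderiv (by simp)).clm_apply continuous_const
  have hcc : ∀ v, HasCompactSupport fun x => fderiv ℝ f x v := fun v =>
    hc.fderiv_apply ℝ v
  have hi : ∀ v, Integrable (fun x => fderiv ℝ f x v) := fun v =>
    (hcs v).integrable_of_hasCompactSupport (hcc v)
  have h0 : ∀ v, ∫ x, fderiv ℝ f x v = 0 := by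
    intro v
    -- Integration by parts against the constant function `1`.
    have := integral_mul_fderiv_eq_neg_fderiv_mul_of_integrable (μ := volume) (𝕜 := ℂ) (v := v)
      (f := fun _ : Cn n => (1 : ℂ)) (g := f) (by simp) (by simpa using hi v)
      (by simpa using hf.continuous.integrable_of_hasCompactSupport hc)
      (fun _ _ => differentiableAt_const _) (fun x _ => hf.differentiable (by simp) x)
    simpa using this
  simp only [cderiv]
  rw [integral_finsetSum _ fun c _ => (hi _).const_mul _]
  simp [integral_const_mul, h0]

end Wirtinger

/-! ### The weighted Bochner identity in `ℂⁿ` -/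

section Bochner

variable {n : ℕ}

lemma holVec_eq_sum (v : Cn n) : holVec v = ∑ k, v k • holVec (unitVec k) := by
  conv_lhs => rw [← sum_smul_single v]
  rw [← holVecLM_apply, map_sum]
  simp only [map_smul, holVecLM_apply, unitVec]

lemma antiVec_eq_sum (v : Cn n) : antiVec v = ∑ k, conj (v k) • antiVec (unitVec k) := by
  conv_lhs => rw [← sum_smul_single v]
  rw [antiVec_sum]
  simp only [antiVec_smul, unitVec]

/-- `∂/∂z_k`. -/
def dz (k : Fin n) (f : Cn n → ℂ) : Cn n → ℂ := cderiv (holVec (unitVec k)) f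

/-- `∂/∂z̄_k`. -/
def dzbar (k : Fin n) (f : Cn n → ℂ) : Cn n → ℂ := cderiv (antiVec (unitVec k)) f

lemma dz_def (k : Fin n) (f : Cn n → ℂ) : cderiv (holVec (unitVec k)) f = dz k f := rfl

lemma dzbar_def (k : Fin n) (f : Cn n → ℂ) : cderiv (antiVec (unitVec k)) f = dzbar k f := rfl

lemma delAt_eq_sum (f : Cn n → ℂ) (p v : Cn n) : delAt f p v = ∑ k, v k * dz k f p := by
  rw [← cderiv_holVec, holVec_eq_sum, cderiv_sum_left]
  simp only [cderiv_smul_left, dz]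

lemma leviForm_eq_sum {φ : Cn n → ℝ} {p : Cn n} (hφ : ContDiffAt ℝ 2 φ p) (v : Cn n) :
    (leviForm φ p v : ℂ) =
      ∑ k, ∑ j, v k * conj (v j) * dz k (dzbar j fun x => (φ x : ℂ)) p := by
  have hφc : ContDiffAt ℝ 2 (fun x => (φ x : ℂ)) p :=
    Complex.ofRealCLM.contDiff.contDiffAt.comp p hφ
  rw [leviForm_eq hφ, holVec_eq_sum, cderiv_sum_left]
  refine Finset.sum_congr rfl fun k _ => ?_
  rw [cderiv_smul_left]
  have e : (cderiv (antiVec v) fun x => (φ x : ℂ)) = fun y =>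
      ∑ j, conj (v j) * dzbar j (fun x => (φ x : ℂ)) y := by
    funext y
    rw [antiVec_eq_sum, cderiv_sum_left]
    simp only [cderiv_smul_left, dzbar]
  have hd : ∀ j, DifferentiableAt ℝ (dzbar j fun x => (φ x : ℂ)) p := fun j =>
    (ContDiffAt.cderiv (k := 1) hφc (by norm_num)).differentiableAt (by norm_num)
  rw [e, cderiv_sum (F := fun j y => conj (v j) * dzbar j (fun x => (φ x : ℂ)) y)
    fun j _ => (differentiableAt_const _).mul (hd j), Finset.mul_sum]
  refine Finset.sum_congr rfl fun j _ => ?_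
  rw [cderiv_mul (differentiableAt_const _) (hd j), cderiv_const, dz]
  ring

/-- The divergence `e^φ ∑ ∂_k (e^{-φ} V_k)`. -/
def wdiv (φ : Cn n → ℝ) (V : Fin n → Cn n → ℂ) (p : Cn n) : ℂ :=
  ∑ k, (dz k (V k) p - dz k (fun x => (φ x : ℂ)) p * V k p)

/-- The algebra behind `bochner_identity` at one point, with `G = g`, `E = e^{-φ}`, `v = V`, `a k =
∂_k V_k`, `f = ∂φ`, `γ = ∂g`, `b j k = ∂̄_j V_k`, `L` and `M` the complex Hessians of `φ` and `g`,
and `c k j = ∂_k ∂̄_j V_k`. The unknown `c` cancels. -/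
lemma bochner_algebra (G E : ℂ) (v a f γ : Fin n → ℂ) (b L M c : Fin n → Fin n → ℂ) (δ : ℂ)
    (hδ : δ = ∑ k, (a k - f k * v k)) :
    ∑ j, ((conj (γ j) * δ + G * ∑ k, (c k j - (L k j * v k + f k * b j k))) * (E * conj (v j)) +
        G * δ * (E * (conj (a j) - conj (f j) * conj (v j)))) -
      ∑ k, ((γ k * E + G * (-f k * E)) * ∑ j, b j k * conj (v j) + G * E *
        ∑ j, (c k j * conj (v j) + b j k * conj (b k j))) +
      ∑ j, (E * (conj (a j) - conj (f j) * conj (v j)) * ∑ k, v k * γ k +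
        E * conj (v j) * ∑ k, (b j k * γ k + v k * M k j)) =
    G * E * (δ * conj δ - ∑ j, ∑ k, b j k * conj (b k j)) -
      E * ∑ k, ∑ j, (G * L k j - M k j) * (v k * conj (v j)) +
      E * (δ * conj (∑ k, v k * γ k) + conj δ * ∑ k, v k * γ k) := by
  have h1 : ∀ X Y : ℂ, ∑ j, X * (Y * (conj (a j) - conj (f j) * conj (v j))) =
      X * Y * conj δ := by
    intro X Y
    rw [hδ, map_sum, Finset.mul_sum]
    refine Finset.sum_congr rfl fun j _ => ?_
    simp only [map_sub, map_mul]; ring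
  have h2 : ∑ j, (conj (γ j) * δ + G * ∑ k, (c k j - (L k j * v k + f k * b j k))) *
      (E * conj (v j)) = E * δ * conj (∑ k, v k * γ k) +
        ∑ j, ∑ k, G * E * (c k j - (L k j * v k + f k * b j k)) * conj (v j) := by
    rw [map_sum, Finset.mul_sum, ← Finset.sum_add_distrib]
    refine Finset.sum_congr rfl fun j _ => ?_
    rw [add_mul, Finset.mul_sum, Finset.sum_mul]
    congr 1
    · simp only [map_mul]; ring
    · refine Finset.sum_congr rfl fun k _ => ?_; ring
  have h3 : ∑ k, ((γ k * E + G * (-f k * E)) * ∑ j, b j k * conj (v j) + G * E *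
        ∑ j, (c k j * conj (v j) + b j k * conj (b k j))) =
      ∑ j, ∑ k, ((γ k * E + G * (-f k * E)) * (b j k * conj (v j)) + G * E *
        (c k j * conj (v j) + b j k * conj (b k j))) := by
    rw [Finset.sum_comm]
    refine Finset.sum_congr rfl fun k _ => ?_
    rw [Finset.mul_sum, Finset.mul_sum, ← Finset.sum_add_distrib]
  have h4 : ∑ j, (E * (conj (a j) - conj (f j) * conj (v j)) * ∑ k, v k * γ k +
        E * conj (v j) * ∑ k, (b j k * γ k + v k * M k j)) =
      E * conj δ * (∑ k, v k * γ k) + ∑ j, ∑ k, E * conj (v j) * (b j k * γ k + v k * M k j) := by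
    have := h1 (∑ k, v k * γ k) E
    rw [Finset.sum_add_distrib]
    simp only [Finset.mul_sum]
    congr 1
    rw [← Finset.mul_sum, mul_comm _ (∑ i, v i * γ i), ← mul_assoc, ← this]
    refine Finset.sum_congr rfl fun j _ => ?_
    rw [← Finset.mul_sum, mul_comm]
  have h5 : ∑ k, ∑ j, (G * L k j - M k j) * (v k * conj (v j)) =
      ∑ j, ∑ k, (G * L k j - M k j) * (v k * conj (v j)) := Finset.sum_comm
  rw [Finset.sum_add_distrib, h1, h2, h3, h4, h5]
  have key : ∑ j, ∑ k, G * E * (c k j - (L k j * v k + f k * b j k)) * conj (v j) -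
      ∑ j, ∑ k, ((γ k * E + G * (-f k * E)) * (b j k * conj (v j)) + G * E *
        (c k j * conj (v j) + b j k * conj (b k j))) +
      ∑ j, ∑ k, E * conj (v j) * (b j k * γ k + v k * M k j) =
      - (G * E * ∑ j, ∑ k, b j k * conj (b k j)) -
        E * ∑ j, ∑ k, (G * L k j - M k j) * (v k * conj (v j)) := by
    simp only [Finset.mul_sum, ← Finset.sum_add_distrib, ← Finset.sum_sub_distrib,
      ← Finset.sum_neg_distrib]
    refine Finset.sum_congr rfl fun j _ => Finset.sum_congr rfl fun k _ => ?_
    ring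
  linear_combination key

variable {φ g : Cn n → ℝ} {V : Fin n → Cn n → ℂ}

/-- The integrand of the Bochner identity. -/
def bochnerIntegrand (φ g : Cn n → ℝ) (V : Fin n → Cn n → ℂ) (p : Cn n) : ℂ :=
  (g p : ℂ) * (Real.exp (-φ p) : ℂ) * (wdiv φ V p * conj (wdiv φ V p) -
      ∑ j, ∑ k, dzbar j (V k) p * conj (dzbar k (V j) p)) -
    (Real.exp (-φ p) : ℂ) * ∑ k, ∑ j, ((g p : ℂ) * dz k (dzbar j fun x => (φ x : ℂ)) p -
      dz k (dzbar j fun x => (g x : ℂ)) p) * (V k p * conj (V j p)) +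
    (Real.exp (-φ p) : ℂ) * (wdiv φ V p * conj (∑ k, V k p * dz k (fun x => (g x : ℂ)) p) +
      conj (wdiv φ V p) * ∑ k, V k p * dz k (fun x => (g x : ℂ)) p)

lemma ContDiff.ofReal {u : Cn n → ℝ} (hu : ContDiff ℝ ∞ u) :
    ContDiff ℝ ∞ fun x => (u x : ℂ) := Complex.ofRealCLM.contDiff.comp hu

lemma ContDiff.conj' {u : Cn n → ℂ} (hu : ContDiff ℝ ∞ u) :
    ContDiff ℝ ∞ fun x => conj (u x) := (Complex.conjCLE : ℂ →L[ℝ] ℂ).contDiff.comp hu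

lemma ContDiff.dz {u : Cn n → ℂ} (hu : ContDiff ℝ ∞ u) (k : Fin n) : ContDiff ℝ ∞ (dz k u) :=
  ContDiff.cderiv hu

lemma ContDiff.dzbar {u : Cn n → ℂ} (hu : ContDiff ℝ ∞ u) (k : Fin n) :
    ContDiff ℝ ∞ (dzbar k u) :=
  ContDiff.cderiv hu

lemma contDiff_wdiv (hφ : ContDiff ℝ ∞ φ) (hV : ∀ k, ContDiff ℝ ∞ (V k)) :
    ContDiff ℝ ∞ (wdiv φ V) :=
  ContDiff.sum fun k _ => (ContDiff.dz (hV k) k).sub ((ContDiff.dz (ContDiff.ofReal hφ) k).mul (hV k))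

/-- The integrand is a sum of derivatives of functions with compact support. No metric on `ℂⁿ` and
no sign of `g` is involved; the Kähler metric will only enter when the terms are read as norms of
`∂̄*ξ` and `∂̄ξ`. -/
lemma bochner_identity (hφ : ContDiff ℝ ∞ φ) (hg : ContDiff ℝ ∞ g) (hgc : HasCompactSupport g)
    (hV : ∀ k, ContDiff ℝ ∞ (V k)) :
    ∫ p, bochnerIntegrand φ g V p = 0 := by
  set G : Cn n → ℂ := fun x => (g x : ℂ) with hG
  set E : Cn n → ℂ := fun x => (Real.exp (-φ x) : ℂ) with hE
  set Φ : Cn n → ℂ := fun x => (φ x : ℂ) with hΦ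
  set δ := wdiv φ V with hδ
  have sG : ContDiff ℝ ∞ G := ContDiff.ofReal hg
  have sE : ContDiff ℝ ∞ E := ContDiff.ofReal (Real.contDiff_exp.comp hφ.neg)
  have sΦ : ContDiff ℝ ∞ Φ := ContDiff.ofReal hφ
  have sδ : ContDiff ℝ ∞ δ := contDiff_wdiv hφ hV
  have sVb : ∀ k, ContDiff ℝ ∞ fun x => conj (V k x) := fun k => ContDiff.conj' (hV k)
  have d : ∀ {u : Cn n → ℂ}, ContDiff ℝ ∞ u → ∀ p, DifferentiableAt ℝ u p :=
    fun hu p => hu.differentiable (by simp) p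
  have c2 : ∀ {u : Cn n → ℂ}, ContDiff ℝ ∞ u → ∀ p, ContDiffAt ℝ 2 u p :=
    fun hu p => (hu.of_le (by norm_cast)).contDiffAt
  have cG : HasCompactSupport G := hgc.comp_left (g := fun t : ℝ => (t : ℂ)) rfl
  -- Since `∑ ∂̄_j (e^{-φ} V̄_j) = e^{-φ} δ̄`, the divergence of `F₁` contains `g e^{-φ} |δ|²` and a
  -- term with `∂̄_j δ`. Subtracting that of `F₂` removes the second derivatives of `V` and brings
  -- in the trace `∑ ∂̄_j V_k · conj (∂̄_k V_j)`. That of `F₃` removes the remaining products of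
  -- `∂g` and `∂̄V` and brings in the complex Hessian of `g`.
  let F₁ : Fin n → Cn n → ℂ := fun j x => G x * δ x * (E x * conj (V j x))
  let F₂ : Fin n → Cn n → ℂ := fun k x => G x * E x * ∑ j, dzbar j (V k) x * conj (V j x)
  let F₃ : Fin n → Cn n → ℂ := fun j x => E x * conj (V j x) * ∑ k, V k x * dz k G x
  have sF₁ : ∀ j, ContDiff ℝ ∞ (F₁ j) := fun j => (sG.mul sδ).mul (sE.mul (sVb j))
  have sS₂ : ∀ k, ContDiff ℝ ∞ fun x => ∑ j, dzbar j (V k) x * conj (V j x) := fun k =>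
    ContDiff.sum fun j _ => (ContDiff.dzbar (hV k) j).mul (sVb j)
  have sF₂ : ∀ k, ContDiff ℝ ∞ (F₂ k) := fun k => (sG.mul sE).mul (sS₂ k)
  have sS₃ : ContDiff ℝ ∞ fun x => ∑ k, V k x * dz k G x :=
    ContDiff.sum fun k _ => (hV k).mul (ContDiff.dz sG k)
  have sF₃ : ∀ j, ContDiff ℝ ∞ (F₃ j) := fun j => (sE.mul (sVb j)).mul sS₃
  have cF₁ : ∀ j, HasCompactSupport (F₁ j) := fun j => cG.mul_right.mul_right
  have cF₂ : ∀ k, HasCompactSupport (F₂ k) := fun k => cG.mul_right.mul_right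
  have cF₃ : ∀ j, HasCompactSupport (F₃ j) := by
    intro j
    refine cG.of_isClosed_subset (isClosed_tsupport _) ?_
    refine closure_minimal (fun x hx => ?_) (isClosed_tsupport _)
    by_contra hx'
    refine hx ?_
    have : fderiv ℝ G x = 0 := by
      have := support_fderiv_subset ℝ (f := G)
      by_contra h0
      exact hx' (this h0)
    simp [F₃, dz, cderiv, this]
  have cc : ∀ {u : Cn n → ℂ} (Z), ContDiff ℝ ∞ u → HasCompactSupport u →
      Integrable (cderiv Z u) := by
    intro u Z hu hc
    refine (ContDiff.cderiv hu).continuous.integrable_of_hasCompactSupport ?_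
    refine hc.of_isClosed_subset (isClosed_tsupport _) ?_
    refine closure_minimal (fun x hx => ?_) (isClosed_tsupport _)
    by_contra hx'
    refine hx ?_
    have : fderiv ℝ u x = 0 := by
      have := support_fderiv_subset ℝ (f := u)
      by_contra h0
      exact hx' (this h0)
    simp [cderiv, this]
  have hpt : ∀ p, bochnerIntegrand φ g V p = ∑ j, dzbar j (F₁ j) p - ∑ k, dz k (F₂ k) p +
      ∑ j, dzbar j (F₃ j) p := by
    intro p
    have hGr : ∀ j, dzbar j G p = conj (dz j G p) := fun j => by
      rw [dz, hG, cderiv_conj_ofReal (hg.differentiable (by simp) p), conjVec_holVec, dzbar]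
    have hΦr : ∀ j, dzbar j Φ p = conj (dz j Φ p) := fun j => by
      rw [dz, hΦ, cderiv_conj_ofReal (hφ.differentiable (by simp) p), conjVec_holVec, dzbar]
    have hEd : ∀ Z, cderiv Z E p = -cderiv Z Φ p * E p := by
      intro Z
      have : HasDerivAt (fun t => Real.exp (-t)) (-Real.exp (-φ p)) (φ p) := by
        simpa using (hasDerivAt_neg (φ p)).exp
      rw [hE, cderiv_ofReal_comp this (hφ.differentiable (by simp) p)]
      push_cast
      ring
    have hVbar : ∀ j k, dz k (fun x => conj (V j x)) p = conj (dzbar k (V j) p) := fun j k => by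
      rw [dz, cderiv_conj (d (hV j) p), conjVec_holVec, dzbar]
    have hVbar' : ∀ j k, dzbar k (fun x => conj (V j x)) p = conj (dz k (V j) p) := fun j k => by
      rw [dzbar, cderiv_conj (d (hV j) p), conjVec_antiVec, dz]
    have hδd : ∀ j, dzbar j δ p = ∑ k, (dz k (dzbar j (V k)) p -
        (dz k (dzbar j Φ) p * V k p + dz k Φ p * dzbar j (V k) p)) := by
      intro j
      have e : δ = fun x => ∑ k, (dz k (V k) x - dz k Φ x * V k x) := rfl
      rw [e, dzbar, cderiv_sum (F := fun k x => dz k (V k) x - dz k Φ x * V k x) fun k _ =>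
        (d (ContDiff.dz (hV k) k) p).sub ((d (ContDiff.dz sΦ k) p).mul (d (hV k) p))]
      refine Finset.sum_congr rfl fun k _ => ?_
      rw [cderiv_sub (g := fun x => dz k Φ x * V k x) (d (ContDiff.dz (hV k) k) p)
        ((d (ContDiff.dz sΦ k) p).mul (d (hV k) p)),
        cderiv_mul (d (ContDiff.dz sΦ k) p) (d (hV k) p)]
      simp only [dz, dzbar]
      rw [cderiv_comm (c2 (hV k) p), cderiv_comm (c2 sΦ p)]
    have h1 : ∀ j, dzbar j (F₁ j) p = (conj (dz j G p) * δ p + G p * ∑ k, (dz k (dzbar j (V k)) p -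
        (dz k (dzbar j Φ) p * V k p + dz k Φ p * dzbar j (V k) p))) * (E p * conj (V j p)) +
        G p * δ p * (E p * (conj (dz j (V j) p) - conj (dz j Φ p) * conj (V j p))) := by
      intro j
      rw [dzbar, cderiv_mul (d (sG.mul sδ) p) (d (sE.mul (sVb j)) p), cderiv_mul (d sG p) (d sδ p),
        cderiv_mul (d sE p) (d (sVb j) p), hEd]
      simp only [dzbar_def, hδd, hGr, hΦr, hVbar']
      ring
    have h2 : ∀ k, dz k (F₂ k) p = (dz k G p * E p + G p * (-dz k Φ p * E p)) *
        ∑ j, dzbar j (V k) p * conj (V j p) + G p * E p *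
        ∑ j, (dz k (dzbar j (V k)) p * conj (V j p) +
          dzbar j (V k) p * conj (dzbar k (V j) p)) := by
      intro k
      rw [dz, cderiv_mul (d (sG.mul sE) p) (d (sS₂ k) p), cderiv_mul (d sG p) (d sE p), hEd,
        cderiv_sum (F := fun j x => dzbar j (V k) x * conj (V j x)) fun j _ =>
          (d (ContDiff.dzbar (hV k) j) p).mul (d (sVb j) p)]
      congr 2
      refine Finset.sum_congr rfl fun j _ => ?_
      rw [cderiv_mul (d (ContDiff.dzbar (hV k) j) p) (d (sVb j) p)]
      simp only [dz_def, hVbar]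
    have h3 : ∀ j, dzbar j (F₃ j) p =
        E p * (conj (dz j (V j) p) - conj (dz j Φ p) * conj (V j p)) * ∑ k, V k p * dz k G p +
        E p * conj (V j p) * ∑ k, (dzbar j (V k) p * dz k G p + V k p * dz k (dzbar j G) p) := by
      intro j
      rw [dzbar, cderiv_mul (d (sE.mul (sVb j)) p) (d sS₃ p), cderiv_mul (d sE p) (d (sVb j) p),
        hEd, cderiv_sum (F := fun k x => V k x * dz k G x) fun k _ =>
          (d (hV k) p).mul (d (ContDiff.dz sG k) p)]
      simp only [dzbar_def, hΦr, hVbar']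
      congr 1
      · ring
      · congr 1
        refine Finset.sum_congr rfl fun k _ => ?_
        rw [dzbar, cderiv_mul (d (hV k) p) (d (ContDiff.dz sG k) p)]
        simp only [dz, dzbar]
        rw [cderiv_comm (c2 sG p)]
    simp only [h1, h2, h3]
    exact (bochner_algebra (G p) (E p) (fun k => V k p) (fun k => dz k (V k) p)
      (fun k => dz k Φ p) (fun k => dz k G p) (fun j k => dzbar j (V k) p)
      (fun k j => dz k (dzbar j Φ) p) (fun k j => dz k (dzbar j G) p)
      (fun k j => dz k (dzbar j (V k)) p) (δ p) rfl).symm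
  simp only [hpt]
  rw [integral_add, integral_sub, integral_finsetSum, integral_finsetSum, integral_finsetSum]
  · simp only [dz, dzbar]
    rw [Finset.sum_eq_zero fun j _ => integral_cderiv (sF₁ j) (cF₁ j),
      Finset.sum_eq_zero fun j _ => integral_cderiv (sF₂ j) (cF₂ j),
      Finset.sum_eq_zero fun j _ => integral_cderiv (sF₃ j) (cF₃ j)]
    simp
  · exact fun j _ => cc _ (sF₃ j) (cF₃ j)
  · exact fun j _ => cc _ (sF₂ j) (cF₂ j)
  · exact fun j _ => cc _ (sF₁ j) (cF₁ j)
  · exact integrable_finsetSum _ fun j _ => cc _ (sF₁ j) (cF₁ j)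
  · exact integrable_finsetSum _ fun j _ => cc _ (sF₂ j) (cF₂ j)
  · exact (integrable_finsetSum _ fun j _ => cc _ (sF₁ j) (cF₁ j)).sub
      (integrable_finsetSum _ fun j _ => cc _ (sF₂ j) (cF₂ j))
  · exact integrable_finsetSum _ fun j _ => cc _ (sF₃ j) (cF₃ j)

end Bochner

/-! ### The exterior derivative on complexified vectors -/

section ExtDeriv

variable {n k : ℕ}

lemma hasFDerivAt_form_apply {A : Type*} [NormedAddCommGroup A] [NormedSpace ℝ A]
    {F : Cn n → Cn n [⋀^Fin k]→L[ℝ] A} {p : Cn n}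
    (hF : DifferentiableAt ℝ F p) (v : Fin k → Cn n) :
    HasFDerivAt (fun x => F x v)
      ((ContinuousAlternatingMap.apply ℝ (Cn n) A v).comp (fderiv ℝ F p)) p :=
  (ContinuousAlternatingMap.apply ℝ (Cn n) A v).hasFDerivAt.comp p hF.hasFDerivAt

lemma contDiffAt_cext {m : WithTop ℕ∞} {F : Cn n → Cn n [⋀^Fin k]→L[ℝ] ℂ} {p : Cn n}
    (hF : ContDiffAt ℝ m F p) (Z : Fin k → Fin (2 * n) → ℂ) :
    ContDiffAt ℝ m (fun x => cext (F x) Z) p := by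
  simp only [cext_apply]
  exact ContDiffAt.sum fun I _ => ((ContinuousAlternatingMap.apply ℝ (Cn n) ℂ
    (fun a => realBasis (I a))).contDiff.contDiffAt.comp p hF).mul contDiffAt_const

/-- Both sides are complex multilinear in `Z`, so that the real formula with constant vector fields
carries over coefficient by coefficient. -/
lemma cext_extDeriv {F : Cn n → Cn n [⋀^Fin k]→L[ℝ] ℂ} {p : Cn n}
    (hF : DifferentiableAt ℝ F p) (Z : Fin (k + 1) → Fin (2 * n) → ℂ) :
    cext (extDeriv F p) Z =
      ∑ i : Fin (k + 1), (-1) ^ (i : ℕ) * cderiv (Z i) (fun x => cext (F x) (i.removeNth Z)) p := by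
  simp only [cext_apply, extDeriv_apply hF, (hasFDerivAt_form_apply hF _).fderiv, Finset.sum_mul]
  rw [Finset.sum_comm]
  refine Finset.sum_congr rfl fun i _ => ?_
  have h1 : ∀ J : Fin k → Fin (2 * n), HasFDerivAt
      (fun x => F x (fun a => realBasis (J a)) * ∏ a, i.removeNth Z a (J a))
      ((∏ a, i.removeNth Z a (J a)) • ((ContinuousAlternatingMap.apply ℝ (Cn n) ℂ
        (fun a => realBasis (J a))).comp (fderiv ℝ F p))) p := fun J =>
    (hasFDerivAt_form_apply hF _).mul_const _
  rw [cderiv_sum fun J _ => (h1 J).differentiableAt]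
  simp only [cderiv, (h1 _).fderiv]
  rw [← (Fin.insertNthEquiv (fun _ => Fin (2 * n)) i).sum_comp, Fintype.sum_prod_type,
    Finset.sum_comm, Finset.mul_sum]
  refine Finset.sum_congr rfl fun J _ => ?_
  rw [Finset.mul_sum]
  refine Finset.sum_congr rfl fun c _ => ?_
  rw [Fin.prod_univ_succAbove _ i]
  simp only [Fin.insertNthEquiv_apply, Fin.insertNth_apply_same, Fin.insertNth_apply_succAbove]
  have e : (i.removeNth fun a => (realBasis (Fin.insertNth (α := fun _ => Fin (2 * n)) i c J a) : Cn n)) =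
      fun a => realBasis (J a) := by
    ext a : 1
    simp [Fin.removeNth]
  rw [e]
  simp [Fin.removeNth]
  ring

end ExtDeriv

/-! ### The coefficients of `∂̄` and the Kähler condition -/

section Coefficients

variable {n k : ℕ}

/-- The exterior derivative of a form of type `(p,q)`, evaluated on `q + 1` antiholomorphic and
otherwise holomorphic vectors. -/
lemma cext_extDeriv_type {F : Cn n → Cn n [⋀^Fin k]→L[ℝ] ℂ} {x : Cn n} {p q : ℕ}
    (hF : DifferentiableAt ℝ F x) (hty : ∀ᶠ y in nhds x, IsOfType p q (F y))
    (t : Fin (k + 1) → Bool) (v : Fin (k + 1) → Cn n)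
    (ht : (Finset.univ.filter fun a => t a = true).card = q + 1) :
    cext (extDeriv F x) (fun a => partVec (t a) (v a)) =
      ∑ i : Fin (k + 1), if t i then (-1) ^ (i : ℕ) * cderiv (antiVec (v i)) (fun y => cext (F y)
        (fun a => partVec (t (i.succAbove a)) (v (i.succAbove a)))) x else 0 := by
  rw [cext_extDeriv hF]
  refine Finset.sum_congr rfl fun i _ => ?_
  split_ifs with hi
  · have e : partVec (t i) (v i) = antiVec (v i) := by simp [partVec, hi]
    rw [e]
    rfl
  -- Removing a holomorphic vector leaves `q + 1` antiholomorphic ones, and on these `F` vanishes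
  -- near `x`.
  · have hcard : (Finset.univ.filter fun a => t (i.succAbove a) = true).card ≠ q := by
      rw [Fin.univ_succAbove _ i, Finset.filter_cons, if_neg hi] at ht
      simp only [Finset.filter_map, Finset.card_map] at ht
      have : (Finset.univ.filter fun a => t (i.succAbove a) = true).card = q + 1 := ht
      omega
    have e : (fun y => cext (F y) (i.removeNth fun a => partVec (t a) (v a))) =ᶠ[nhds x]
        fun _ => 0 := by
      filter_upwards [hty] with y hy
      exact hy.cext_eq_zero (fun a => t (i.succAbove a)) (fun a => v (i.succAbove a)) hcard
    rw [cderiv_congr e, cderiv_const, mul_zero]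

lemma partVec_cons {m : ℕ} (v : Cn n) (s : Fin m → Cn n) :
    (fun a : Fin (m + 1) => partVec ((Fin.cons true fun _ => false : Fin (m + 1) → Bool) a)
      ((Fin.cons v s : Fin (m + 1) → Cn n) a)) = Fin.cons (antiVec v) fun j => holVec (s j) := by
  ext a : 1
  induction a using Fin.cases <;> simp [partVec]

lemma partVec_cons_cons {m : ℕ} (u v : Cn n) (s : Fin m → Cn n) :
    (fun a : Fin (m + 2) => partVec
      ((Fin.cons true (Fin.cons true fun _ => false) : Fin (m + 2) → Bool) a)
      ((Fin.cons u (Fin.cons v s) : Fin (m + 2) → Cn n) a)) =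
      Fin.cons (antiVec u) (Fin.cons (antiVec v) fun j => holVec (s j)) := by
  ext a : 1
  induction a using Fin.cases with
  | zero => simp [partVec]
  | succ a => induction a using Fin.cases <;> simp [partVec]

lemma antiCoeff_extDeriv {F : Cn n → Cn n [⋀^Fin n]→L[ℝ] ℂ} {x : Cn n}
    (hF : DifferentiableAt ℝ F x) (hty : ∀ᶠ y in nhds x, IsOfType n 0 (F y)) (a : Fin n) :
    antiCoeff (extDeriv F x) a = dzbar a (fun y => topCoeff (F y)) x := by
  rw [antiCoeff, ← partVec_cons, cext_extDeriv_type hF hty]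
  · rw [Fin.sum_univ_succ]
    simp [partVec, dzbar, topCoeff]
  · rw [Finset.card_eq_one]
    refine ⟨0, ?_⟩
    ext b
    induction b using Fin.cases <;> simp

lemma antiCoeff₂_extDeriv {F : Cn n → Cn n [⋀^Fin (n + 1)]→L[ℝ] ℂ} {x : Cn n}
    (hF : DifferentiableAt ℝ F x) (hty : ∀ᶠ y in nhds x, IsOfType n 1 (F y)) (a b : Fin n) :
    antiCoeff₂ (extDeriv F x) a b = dzbar a (fun y => antiCoeff (F y) b) x -
      dzbar b (fun y => antiCoeff (F y) a) x := by
  rw [antiCoeff₂, ← partVec_cons_cons, cext_extDeriv_type hF hty]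
  · rw [Fin.sum_univ_succ, Fin.sum_univ_succ]
    have e0 : (fun c : Fin (n + 1) => partVec
      ((Fin.cons true (Fin.cons true fun _ => false) : Fin (n + 2) → Bool) ((0 : Fin (n + 2)).succAbove c))
      ((Fin.cons (unitVec a) (Fin.cons (unitVec b) unitVec) : Fin (n + 2) → Cn n)
        ((0 : Fin (n + 2)).succAbove c))) =
        Fin.cons (antiVec (unitVec b)) fun j => holVec (unitVec j) := by
      rw [← partVec_cons]; simp
    have e1 : (fun c : Fin (n + 1) => partVec
      ((Fin.cons true (Fin.cons true fun _ => false) : Fin (n + 2) → Bool)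
        ((Fin.succ 0 : Fin (n + 2)).succAbove c))
      ((Fin.cons (unitVec a) (Fin.cons (unitVec b) unitVec) : Fin (n + 2) → Cn n)
        ((Fin.succ 0 : Fin (n + 2)).succAbove c))) =
        Fin.cons (antiVec (unitVec a)) fun j => holVec (unitVec j) := by
      ext c : 1
      induction c using Fin.cases <;> simp [partVec]
    simp only [Fin.cons_zero, if_true, Fin.cons_succ, e0, e1]
    simp [dzbar, antiCoeff, sub_eq_add_neg]
  · rw [Finset.card_eq_two]
    refine ⟨0, Fin.succ 0, by simp, ?_⟩
    ext c
    induction c using Fin.cases with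
    | zero => simp
    | succ c => induction c using Fin.cases <;> simp [Fin.ext_iff]

/-- A real form as a complex valued form. -/
def complexForm (w : Cn n [⋀^Fin k]→L[ℝ] ℝ) : Cn n [⋀^Fin k]→L[ℝ] ℂ :=
  Complex.ofRealCLM.compContinuousAlternatingMap w

lemma complexForm_apply (w : Cn n [⋀^Fin k]→L[ℝ] ℝ) (v : Fin k → Cn n) :
    complexForm w v = (w v : ℂ) := rfl

lemma IsPositiveOneOne.isOfType {w : Cn n [⋀^Fin 2]→L[ℝ] ℝ} (hw : IsPositiveOneOne w) :
    IsOfType 1 1 (complexForm w) := by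
  refine ⟨rfl, fun c v => ?_⟩
  have hv : v = ![v 0, v 1] := by ext i : 1; fin_cases i <;> rfl
  have hcv : (fun a => c • v a) = ![c • v 0, c • v 1] := by ext i : 1; fin_cases i <;> rfl
  have hc : ∀ u : Cn n, c • u = c.re • u + c.im • (Complex.I • u) := by
    intro u
    rw [← Complex.coe_smul, ← Complex.coe_smul, smul_smul, ← add_smul, Complex.re_add_im]
  rw [complexForm_apply, complexForm_apply, hcv]
  conv_rhs => rw [hv]
  rw [hc, hc, form_add_left, form_add_right, form_add_right]
  simp only [form_smul_left, form_smul_right, hw.typeOneOne, hw.form_I_left]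
  rw [pow_one, pow_one, Complex.mul_conj, Complex.normSq_apply, smul_eq_mul]
  push_cast
  ring

/-- In classical terms `ω = (i/2) ∑ h_{jl} dz_j ∧ dz̄_l`, hence the factor `-2i`. In this form the
closedness of `ω` can be read off from the exterior derivative. -/
lemma hermMat_eq_cext {w : Cn n [⋀^Fin 2]→L[ℝ] ℝ} (hw : IsPositiveOneOne w) (j l : Fin n) :
    hermMat w j l = -2 * Complex.I *
      cext (complexForm w) ![holVec (unitVec j), antiVec (unitVec l)] := by
  have e : (![holVec (unitVec j), antiVec (unitVec l)] : Fin 2 → Fin (2 * n) → ℂ) =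
      fun a => partVec ((![false, true] : Fin 2 → Bool) a)
        ((![unitVec j, unitVec l] : Fin 2 → Cn n) a) := by
    ext a : 1
    fin_cases a <;> simp [partVec]
  have hb : ∀ g : (Fin 2 → Bool) → ℂ, ∑ S : Fin 2 → Bool, g S =
      g ![false, false] + g ![false, true] + g ![true, false] + g ![true, true] := by
    intro g
    rw [← (finTwoArrowEquiv Bool).symm.sum_comp, Fintype.sum_prod_type]
    simp [finTwoArrowEquiv]
    ring
  have hA : ∀ S : Fin 2 → Bool, ∀ x y : Cn n,
      (fun a => if S a then Complex.I • (![x, y] : Fin 2 → Cn n) a else (![x, y] : Fin 2 → Cn n) a)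
        = ![if S 0 then Complex.I • x else x, if S 1 then Complex.I • y else y] := by
    intro S x y
    ext a : 1
    fin_cases a <;> rfl
  rw [e, cext_partVec, hb]
  simp only [hA, Fin.prod_univ_two, complexForm_apply]
  simp only [Matrix.cons_val_zero, Matrix.cons_val_one, if_true, partCoeff, Bool.false_eq_true,
    if_false, hw.typeOneOne, hw.form_I_left, hermMat, hermForm]
  change _ - _ * (w ![unitVec j, unitVec l] : ℂ) = _
  rw [show (Pi.single j 1 : Cn n) = unitVec j from rfl,
    show (Pi.single l 1 : Cn n) = unitVec l from rfl]
  push_cast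
  linear_combination ((w ![unitVec j, Complex.I • unitVec l] : ℂ) -
    Complex.I * w ![unitVec j, unitVec l] / 2) * Complex.I_sq

lemma extDeriv_complexForm {w : Cn n → Cn n [⋀^Fin k]→L[ℝ] ℝ} {x : Cn n}
    (hw : DifferentiableAt ℝ w x) (h0 : extDeriv w x = 0) :
    extDeriv (fun y => complexForm (w y)) x = 0 := by
  have hc : ∀ v : Fin k → Cn n, HasFDerivAt (fun y => complexForm (w y) v) (Complex.ofRealCLM.comp
      ((ContinuousAlternatingMap.apply ℝ (Cn n) ℝ v).comp (fderiv ℝ w x))) x := fun v =>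
    Complex.ofRealCLM.hasFDerivAt.comp x (hasFDerivAt_form_apply hw v)
  have hd : DifferentiableAt ℝ (fun y => complexForm (w y)) x :=
    (ContinuousLinearMap.differentiableAt
      (ContinuousLinearMap.compContinuousAlternatingMapCLM (ι := Fin k) ℝ (Cn n) ℝ ℂ
        Complex.ofRealCLM)).comp x hw
  ext v
  have := congrArg (fun f => ((f v : ℝ) : ℂ)) h0
  simp only [extDeriv_apply hw, (hasFDerivAt_form_apply hw _).fderiv] at this
  simp only [extDeriv_apply hd, (hc _).fderiv]
  simpa using this

/-- The Kähler condition in coordinates. -/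
lemma dzbar_hermMat_symm {w : Cn n → Cn n [⋀^Fin 2]→L[ℝ] ℝ} {x : Cn n}
    (hw : DifferentiableAt ℝ w x) (hpos : ∀ᶠ y in nhds x, IsPositiveOneOne (w y))
    (h0 : extDeriv w x = 0) (j a b : Fin n) :
    dzbar a (fun y => hermMat (w y) j b) x = dzbar b (fun y => hermMat (w y) j a) x := by
  have hd : DifferentiableAt ℝ (fun y => complexForm (w y)) x :=
    (ContinuousLinearMap.differentiableAt
      (ContinuousLinearMap.compContinuousAlternatingMapCLM (ι := Fin 2) ℝ (Cn n) ℝ ℂ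
        Complex.ofRealCLM)).comp x hw
  have hty : ∀ᶠ y in nhds x, IsOfType 1 1 (complexForm (w y)) := hpos.mono fun y hy => hy.isOfType
  -- The component of `dω = 0` on one holomorphic and two antiholomorphic vectors, that is `∂̄ω =
  -- 0`.
  have key := cext_extDeriv_type hd hty ![false, true, true] ![unitVec j, unitVec a, unitVec b]
    (by decide)
  rw [extDeriv_complexForm hw h0] at key
  have hz : ∀ z : Fin 3 → Fin (2 * n) → ℂ, cext (0 : Cn n [⋀^Fin 3]→L[ℝ] ℂ) z = 0 := by
    intro z; simp [cext_apply]
  have e1 : (fun c : Fin 2 => partVec ((![false, true, true] : Fin 3 → Bool) ((1 : Fin 3).succAbove c))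
      ((![unitVec j, unitVec a, unitVec b] : Fin 3 → Cn n) ((1 : Fin 3).succAbove c))) =
      ![holVec (unitVec j), antiVec (unitVec b)] := by
    ext c : 1
    fin_cases c <;> simp [partVec, Fin.succAbove]
  have e2 : (fun c : Fin 2 => partVec ((![false, true, true] : Fin 3 → Bool) ((2 : Fin 3).succAbove c))
      ((![unitVec j, unitVec a, unitVec b] : Fin 3 → Cn n) ((2 : Fin 3).succAbove c))) =
      ![holVec (unitVec j), antiVec (unitVec a)] := by
    ext c : 1
    fin_cases c <;> simp [partVec, Fin.succAbove]
  rw [hz, Fin.sum_univ_three] at key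
  simp only [Matrix.cons_val_zero, Matrix.cons_val_one, Bool.false_eq_true, if_false, if_true,
    e1, e2, Matrix.cons_val, dzbar_def] at key
  have hh : ∀ l, (fun y => hermMat (w y) j l) =ᶠ[nhds x] fun y => (-2 * Complex.I) *
      cext (complexForm (w y)) ![holVec (unitVec j), antiVec (unitVec l)] := fun l =>
    hpos.mono fun y hy => hermMat_eq_cext hy j l
  have hdc : ∀ l, DifferentiableAt ℝ (fun y =>
      cext (complexForm (w y)) ![holVec (unitVec j), antiVec (unitVec l)]) x := by
    intro l
    simp only [cext_apply]
    exact DifferentiableAt.fun_sum fun I _ =>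
      ((hasFDerivAt_form_apply hd _).differentiableAt).mul (differentiableAt_const _)
  simp only [dzbar] at key ⊢
  rw [cderiv_congr (hh b), cderiv_congr (hh a), cderiv_mul (differentiableAt_const _) (hdc b),
    cderiv_mul (differentiableAt_const _) (hdc a), cderiv_const, cderiv_const]
  norm_num at key
  linear_combination (-(2 * Complex.I)) * key

end Coefficients

/-! ### The pointwise Bochner inequality in coordinates -/

section LocalEstimate

variable {n : ℕ}

lemma contDiffAt_matrix_det {𝕜 : Type*} [NontriviallyNormedField 𝕜] [NormedAlgebra ℝ 𝕜] {ι : Type*}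
    [Fintype ι] [DecidableEq ι] {m : WithTop ℕ∞}
    {M : Cn n → Matrix ι ι 𝕜} {p : Cn n} (hM : ∀ i j, ContDiffAt ℝ m (fun x => M x i j) p) :
    ContDiffAt ℝ m (fun x => (M x).det) p := by
  simp only [Matrix.det_apply']
  exact ContDiffAt.sum fun σ _ => contDiffAt_const.mul (contDiffAt_prod fun i _ => hM _ _)

lemma contDiffAt_matrix_inv {𝕜 : Type*} [NontriviallyNormedField 𝕜] [NormedAlgebra ℝ 𝕜] {ι : Type*}
    [Fintype ι] [DecidableEq ι] {m : WithTop ℕ∞}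
    {M : Cn n → Matrix ι ι 𝕜} {p : Cn n} (hM : ∀ i j, ContDiffAt ℝ m (fun x => M x i j) p)
    (h0 : (M p).det ≠ 0) (i j : ι) :
    ContDiffAt ℝ m (fun x => (M x)⁻¹ i j) p := by
  simp only [Matrix.inv_def, Matrix.smul_apply, Ring.inverse_eq_inv', smul_eq_mul,
    Matrix.adjugate_apply]
  refine ((contDiffAt_matrix_det hM).inv h0).mul (contDiffAt_matrix_det fun a b => ?_)
  by_cases h : a = j
  · subst h
    simpa using contDiffAt_const
  · simpa [Matrix.updateRow_ne h] using hM a b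

lemma contDiffAt_form_apply {A : Type*} [NormedAddCommGroup A] [NormedSpace ℝ A] {k : ℕ}
    {m : WithTop ℕ∞} {F : Cn n → Cn n [⋀^Fin k]→L[ℝ] A} {p : Cn n}
    (hF : ContDiffAt ℝ m F p) (v : Fin k → Cn n) : ContDiffAt ℝ m (fun x => F x v) p :=
  (ContinuousAlternatingMap.apply ℝ (Cn n) A v).contDiff.contDiffAt.comp p hF

variable {w : Cn n → Cn n [⋀^Fin 2]→L[ℝ] ℝ} {f : Cn n → Cn n [⋀^Fin (n + 1)]→L[ℝ] ℂ}
  {p : Cn n} {m : WithTop ℕ∞}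

lemma contDiffAt_hermMat (hw : ContDiffAt ℝ m w p) (i j : Fin n) :
    ContDiffAt ℝ m (fun x => hermMat (w x) i j) p := by
  have h : ∀ v, ContDiffAt ℝ m (fun x => (w x v : ℂ)) p := fun v =>
    Complex.ofRealCLM.contDiff.contDiffAt.comp p (contDiffAt_form_apply hw v)
  exact (h _).sub (contDiffAt_const.mul (h _))

lemma contDiffAt_gram (hw : ContDiffAt ℝ m w p) (i j : Fin (2 * n)) :
    ContDiffAt ℝ m (fun x => gram (w x) i j) p :=
  contDiffAt_form_apply hw _

lemma IsPositiveOneOne.det_hermMat_ne_zero {w : Cn n [⋀^Fin 2]→L[ℝ] ℝ}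
    (hw : IsPositiveOneOne w) : (hermMat w).det ≠ 0 := by
  intro h
  have := hw.det_re_pos
  rw [h] at this
  simp at this

lemma IsPositiveOneOne.det_gram_ne_zero {w : Cn n [⋀^Fin 2]→L[ℝ] ℝ}
    (hw : IsPositiveOneOne w) : (gram w).det ≠ 0 := by
  intro h
  have := hw.sqrt_det_gram
  rw [h, Real.sqrt_zero, Complex.ofReal_zero] at this
  exact hw.det_hermMat_ne_zero this.symm

lemma contDiffAt_dualVec (hw : ContDiffAt ℝ m w p) (hpos : IsPositiveOneOne (w p))
    (hf : ContDiffAt ℝ m f p) (k : Fin n) :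
    ContDiffAt ℝ m (fun x => dualVec (w x) (f x) k) p := by
  simp only [dualVec, Matrix.vecMul, dotProduct]
  exact ContDiffAt.sum fun i _ => (contDiffAt_cext hf _).mul
    (contDiffAt_matrix_inv (fun a b => contDiffAt_hermMat hw a b) hpos.det_hermMat_ne_zero i k)

lemma antiCoeff_eq_sum {w : Cn n [⋀^Fin 2]→L[ℝ] ℝ} (hw : IsPositiveOneOne w)
    (f : Cn n [⋀^Fin (n + 1)]→L[ℝ] ℂ) (b : Fin n) :
    antiCoeff f b = ∑ i, dualVec w f i * hermMat w i b := by
  have : Matrix.vecMul (dualVec w f) (hermMat w) = antiCoeff f := by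
    rw [dualVec, Matrix.vecMul_vecMul, Matrix.nonsing_inv_mul _
      (isUnit_iff_ne_zero.2 hw.det_hermMat_ne_zero), Matrix.vecMul_one]
  rw [← this]; rfl

/-- The coefficients of `ξ` are `∑ V_i h_{ib}`. In the product rule for `∂̄`, the derivatives of `h`
are symmetric in `a` and `b` by the Kähler condition and cancel on antisymmetrization. Closedness of
`ω` is needed for this alone. -/
lemma antiCoeff₂_extDeriv_eq (hw : ContDiffAt ℝ 1 w p)
    (hpos : ∀ᶠ y in nhds p, IsPositiveOneOne (w y)) (hcl : extDeriv w p = 0)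
    (hf : ContDiffAt ℝ 1 f p) (hty : ∀ᶠ y in nhds p, IsOfType n 1 (f y)) (a b : Fin n) :
    antiCoeff₂ (extDeriv f p) a b =
      ∑ i, (dzbar a (fun x => dualVec (w x) (f x) i) p * hermMat (w p) i b -
        dzbar b (fun x => dualVec (w x) (f x) i) p * hermMat (w p) i a) := by
  have hd : ∀ i, DifferentiableAt ℝ (fun x => dualVec (w x) (f x) i) p := fun i =>
    (contDiffAt_dualVec hw hpos.self_of_nhds hf i).differentiableAt (by norm_num)
  have hh : ∀ i j, DifferentiableAt ℝ (fun x => hermMat (w x) i j) p := fun i j =>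
    (contDiffAt_hermMat hw i j).differentiableAt (by norm_num)
  have key : ∀ a b, dzbar a (fun y => antiCoeff (f y) b) p =
      ∑ i, (dzbar a (fun x => dualVec (w x) (f x) i) p * hermMat (w p) i b +
        dualVec (w p) (f p) i * dzbar a (fun x => hermMat (w x) i b) p) := by
    intro a b
    have e : (fun y => antiCoeff (f y) b) =ᶠ[nhds p]
        fun y => ∑ i, dualVec (w y) (f y) i * hermMat (w y) i b :=
      hpos.mono fun y hy => antiCoeff_eq_sum hy _ b
    rw [dzbar, cderiv_congr e, cderiv_sum (F := fun i y => dualVec (w y) (f y) i * hermMat (w y) i b)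
      fun i _ => (hd i).mul (hh i b)]
    exact Finset.sum_congr rfl fun i _ => cderiv_mul (hd i) (hh i b)
  rw [antiCoeff₂_extDeriv (hf.differentiableAt (by norm_num)) hty, key, key,
    ← Finset.sum_sub_distrib]
  refine Finset.sum_congr rfl fun i _ => ?_
  rw [dzbar_hermMat_symm (hw.differentiableAt (by norm_num)) hpos hcl i a b]
  ring

/-- The pointwise expression whose integral is nonnegative by the Bochner identity. -/
def bochnerTerm (w : Cn n [⋀^Fin 2]→L[ℝ] ℝ) (f : Cn n [⋀^Fin (n + 1)]→L[ℝ] ℂ)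
    (df : Cn n [⋀^Fin (n + 2)]→L[ℝ] ℂ) (y : Cn n [⋀^Fin n]→L[ℝ] ℂ) (φ g : Cn n → ℝ) (p : Cn n) :
    ℝ :=
  Real.exp (-φ p) * (g p * ((innerForm w stdPair y y).re + (innerForm w stdPair df df).re) -
    2 ^ (n + 2) / (hermMat w).det.re * (g p * leviForm φ p (dualVec w f) -
      leviForm g p (dualVec w f) +
      (topCoeff y * conj (delAt (fun x => (g x : ℂ)) p (dualVec w f))).re))

/-- The norm of `∂̄ξ` dominates the trace term of the Bochner integrand by
`innerForm_self_ge_neg_trace`; all other terms agree. The determinant converts the volume of the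
metric into Lebesgue measure. -/
lemma bochnerTerm_ge (hw : ContDiffAt ℝ 1 w p)
    (hpos : ∀ᶠ y in nhds p, IsPositiveOneOne (w y)) (hcl : extDeriv w p = 0)
    (hf : ContDiffAt ℝ 1 f p) (hty : ∀ᶠ y in nhds p, IsOfType n 1 (f y))
    {φ g : Cn n → ℝ} (hφ : ContDiffAt ℝ 2 φ p) (hg : ContDiffAt ℝ 2 g p) (hg0 : 0 ≤ g p)
    {y : Cn n [⋀^Fin n]→L[ℝ] ℂ} (hy : IsOfType n 0 y)
    (hyw : topCoeff y = -2 * wdiv φ (fun k x => dualVec (w x) (f x) k) p) :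
    2 ^ (n + 2) * (bochnerIntegrand φ g (fun k x => dualVec (w x) (f x) k) p).re ≤
      (hermMat (w p)).det.re * bochnerTerm (w p) (f p) (extDeriv f p) y φ g p := by
  have hwp := hpos.self_of_nhds
  have hdet := hwp.det_re_pos
  set d := (hermMat (w p)).det.re with hd
  set V := dualVec (w p) (f p) with hV
  set δ := wdiv φ (fun k x => dualVec (w x) (f x) k) p with hδ
  set E := Real.exp (-φ p) with hE
  set B : Matrix (Fin n) (Fin n) ℂ := Matrix.of fun a i => dzbar a (fun x => dualVec (w x) (f x) i) p
    with hB
  have h1 := hwp.innerForm_self_ge_neg_trace (extDeriv f p) B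
    (antiCoeff₂_extDeriv_eq hw hpos hcl hf hty)
  -- The `4` from `topCoeff y = -2δ` raises the power `2^n` to the `2^(n+2)` common to all terms.
  have h2 : (innerForm (w p) stdPair y y).re = 2 ^ (n + 2) / d * Complex.normSq δ := by
    rw [hwp.innerForm_top hy, Complex.mul_conj, hyw, ← hwp.ofReal_det_re, map_mul, ← hd]
    have : Complex.normSq (-2) = 4 := by simp [Complex.normSq_apply]; norm_num
    have e : (2 ^ n / (d : ℂ) * ((Complex.normSq (-2) * Complex.normSq δ : ℝ) : ℂ)) =
        ((2 ^ n / d * (4 * Complex.normSq δ) : ℝ) : ℂ) := by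
      rw [this]; push_cast; ring
    rw [e, Complex.ofReal_re, pow_add]
    ring
  have h3 : bochnerIntegrand φ g (fun k x => dualVec (w x) (f x) k) p =
      (g p : ℂ) * (E : ℂ) * (δ * conj δ - ∑ j, ∑ k, B j k * conj (B k j)) -
      (E : ℂ) * ((g p : ℂ) * leviForm φ p V - leviForm g p V) +
      (E : ℂ) * (δ * conj (delAt (fun x => (g x : ℂ)) p V) +
        conj δ * delAt (fun x => (g x : ℂ)) p V) := by
    rw [leviForm_eq_sum hφ, leviForm_eq_sum hg, delAt_eq_sum, bochnerIntegrand]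
    congr 2
    congr 1
    rw [Finset.mul_sum, ← Finset.sum_sub_distrib]
    refine Finset.sum_congr rfl fun k _ => ?_
    rw [Finset.mul_sum, ← Finset.sum_sub_distrib]
    refine Finset.sum_congr rfl fun j _ => ?_
    ring
  have h4 : (bochnerIntegrand φ g (fun k x => dualVec (w x) (f x) k) p).re =
      g p * E * (Complex.normSq δ - (∑ j, ∑ k, B j k * conj (B k j)).re) -
      E * (g p * leviForm φ p V - leviForm g p V) +
      E * (2 * (δ * conj (delAt (fun x => (g x : ℂ)) p V)).re) := by
    rw [h3, Complex.mul_conj]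
    set S := ∑ j, ∑ k, B j k * conj (B k j)
    set T := delAt (fun x => (g x : ℂ)) p V
    simp only [Complex.mul_re, Complex.add_re, Complex.sub_re, Complex.mul_im, Complex.add_im,
      Complex.sub_im, Complex.ofReal_re, Complex.ofReal_im, Complex.conj_re, Complex.conj_im]
    ring
  rw [h4, bochnerTerm, h2, hyw, ← hV, ← hd, ← hE]
  set S := (∑ j, ∑ k, B j k * conj (B k j)).re
  set T := delAt (fun x => (g x : ℂ)) p V
  set N := (innerForm (w p) stdPair (extDeriv f p) (extDeriv f p)).re
  have h5 : (-2 * δ * conj T).re = -2 * (δ * conj T).re := by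
    rw [mul_assoc]
    simp [Complex.mul_re]
  rw [h5]
  have hEp : 0 < E := Real.exp_pos _
  have h6 : d * (E * (g p * (2 ^ (n + 2) / d * Complex.normSq δ + N) -
      2 ^ (n + 2) / d * (g p * leviForm φ p V - leviForm g p V + -2 * (δ * conj T).re))) =
      2 ^ (n + 2) * (E * (g p * Complex.normSq δ - (g p * leviForm φ p V - leviForm g p V +
        -2 * (δ * conj T).re))) + E * g p * (d * N) := by
    field_simp
    ring
  rw [h6]
  have h7 : -(2 ^ (n + 2) * S) ≤ d * N := by
    have := mul_le_mul_of_nonneg_left h1 hdet.le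
    calc -(2 ^ (n + 2) * S) = d * -(2 ^ (n + 2) / d * S) := by field_simp
      _ ≤ _ := this
  have h8 := mul_le_mul_of_nonneg_left h7 (mul_nonneg hEp.le hg0)
  nlinarith [h8]

end LocalEstimate

/-! ### The Bochner inequality on an open subset of `ℂⁿ` -/

section LocalIntegral

variable {n : ℕ} {w : Cn n → Cn n [⋀^Fin 2]→L[ℝ] ℝ} {f : Cn n → Cn n [⋀^Fin (n + 1)]→L[ℝ] ℂ}
  {y : Cn n → Cn n [⋀^Fin n]→L[ℝ] ℂ} {φ g : Cn n → ℝ} {p : Cn n}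

lemma contDiffAt_innerForm {k : ℕ} {m : WithTop ℕ∞} {u v : Cn n → Cn n [⋀^Fin k]→L[ℝ] ℂ}
    (hw : ContDiffAt ℝ m w p) (hpos : IsPositiveOneOne (w p)) (hu : ContDiffAt ℝ m u p)
    (hv : ContDiffAt ℝ m v p) :
    ContDiffAt ℝ m (fun x => innerForm (w x) stdPair (u x) (v x)) p := by
  refine contDiffAt_const.mul (ContDiffAt.sum fun I _ => ContDiffAt.sum fun J _ => ?_)
  have hG : ContDiffAt ℝ m (fun x => ∏ a, (gram (w x))⁻¹ (I a) (J a)) p :=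
    contDiffAt_prod fun a _ => contDiffAt_matrix_inv (fun i j => contDiffAt_gram hw i j)
      hpos.det_gram_ne_zero _ _
  refine ContDiffAt.mul (Complex.ofRealCLM.contDiff.contDiffAt.comp p hG) ?_
  exact (contDiffAt_form_apply hu _).mul
    ((Complex.conjCLE : ℂ →L[ℝ] ℂ).contDiff.contDiffAt.comp p (contDiffAt_form_apply hv _))

lemma contDiffAt_re {m : WithTop ℕ∞} {u : Cn n → ℂ} (hu : ContDiffAt ℝ m u p) :
    ContDiffAt ℝ m (fun x => (u x).re) p :=
  Complex.reCLM.contDiff.contDiffAt.comp p hu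

lemma contDiffAt_ofReal {m : WithTop ℕ∞} {u : Cn n → ℝ} (hu : ContDiffAt ℝ m u p) :
    ContDiffAt ℝ m (fun x => (u x : ℂ)) p :=
  Complex.ofRealCLM.contDiff.contDiffAt.comp p hu

lemma contDiffAt_conj {m : WithTop ℕ∞} {u : Cn n → ℂ} (hu : ContDiffAt ℝ m u p) :
    ContDiffAt ℝ m (fun x => conj (u x)) p :=
  (Complex.conjCLE : ℂ →L[ℝ] ℂ).contDiff.contDiffAt.comp p hu

set_option synthInstance.maxHeartbeats 200000 in
lemma contDiffAt_extDeriv {k : ℕ} {F : Cn n → Cn n [⋀^Fin k]→L[ℝ] ℂ} (hF : ContDiffAt ℝ ∞ F p) :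
    ContDiffAt ℝ ∞ (extDeriv F) p := by
  have h1 : ContDiffAt ℝ ∞ (fderiv ℝ F) p := hF.fderiv_right (by simp)
  exact (ContinuousAlternatingMap.alternatizeUncurryFinCLM ℝ (Cn n) ℂ
    (n := k)).contDiff.contDiffAt.comp p h1

lemma contDiffAt_leviForm {v : Cn n → Cn n} (hφ : ContDiffAt ℝ ∞ φ p)
    (hv : ∀ k, ContDiffAt ℝ ∞ (fun x => v x k) p) :
    ContDiffAt ℝ ∞ (fun x => leviForm φ x (v x)) p := by
  have e : (fun x => leviForm φ x (v x)) =ᶠ[nhds p] fun x =>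
      (∑ k, ∑ j, v x k * conj (v x j) * dz k (dzbar j fun x => (φ x : ℂ)) x).re := by
    have h2 : ContDiffAt ℝ 2 φ p := hφ.of_le (by norm_cast)
    filter_upwards [h2.eventually (by simp)] with x hx
    rw [← leviForm_eq_sum hx, Complex.ofReal_re]
  refine (contDiffAt_re ?_).congr_of_eventuallyEq e
  refine ContDiffAt.sum fun k _ => ContDiffAt.sum fun j _ =>
    ((hv k).mul (contDiffAt_conj (hv j))).mul ?_
  exact ContDiffAt.cderiv (ContDiffAt.cderiv (contDiffAt_ofReal hφ) le_rfl) le_rfl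

lemma contDiffAt_delAt {u : Cn n → ℂ} {v : Cn n → Cn n} (hu : ContDiffAt ℝ ∞ u p)
    (hv : ∀ k, ContDiffAt ℝ ∞ (fun x => v x k) p) :
    ContDiffAt ℝ ∞ (fun x => delAt u x (v x)) p := by
  simp only [delAt_eq_sum]
  exact ContDiffAt.sum fun k _ => (hv k).mul (ContDiffAt.cderiv hu le_rfl)

lemma contDiffAt_bochnerTerm (hw : ContDiffAt ℝ ∞ w p) (hpos : IsPositiveOneOne (w p))
    (hf : ContDiffAt ℝ ∞ f p) (hy : ContDiffAt ℝ ∞ y p) (hφ : ContDiffAt ℝ ∞ φ p)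
    (hg : ContDiffAt ℝ ∞ g p) :
    ContDiffAt ℝ ∞ (fun x => bochnerTerm (w x) (f x) (extDeriv f x) (y x) φ g x) p := by
  have hV := contDiffAt_dualVec hw hpos hf
  have hd : ContDiffAt ℝ ∞ (fun x => (hermMat (w x)).det.re) p :=
    contDiffAt_re (contDiffAt_matrix_det fun i j => contDiffAt_hermMat hw i j)
  refine (Real.contDiff_exp.contDiffAt.comp p hφ.neg).mul ((hg.mul
    ((contDiffAt_re (contDiffAt_innerForm hw hpos hy hy)).add (contDiffAt_re
      (contDiffAt_innerForm hw hpos (contDiffAt_extDeriv hf) (contDiffAt_extDeriv hf))))).sub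
    ((contDiffAt_const.div hd hpos.det_re_pos.ne').mul
      (((hg.mul (contDiffAt_leviForm hφ hV)).sub (contDiffAt_leviForm hg hV)).add ?_)))
  exact contDiffAt_re ((contDiffAt_cext hy _).mul
    (contDiffAt_conj (contDiffAt_delAt (contDiffAt_ofReal hg) hV)))

lemma wdiv_congr {φ' : Cn n → ℝ} {V V' : Fin n → Cn n → ℂ} (hφ : φ =ᶠ[nhds p] φ')
    (hV : ∀ k, V k =ᶠ[nhds p] V' k) : wdiv φ V p = wdiv φ' V' p := by
  have hφc : (fun x => (φ x : ℂ)) =ᶠ[nhds p] fun x => (φ' x : ℂ) := hφ.fun_comp Complex.ofReal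
  simp only [wdiv, dz]
  refine Finset.sum_congr rfl fun k _ => ?_
  rw [cderiv_congr (hV k), cderiv_congr hφc, (hV k).eq_of_nhds]

lemma cderiv_congr_eventually {Z : Fin (2 * n) → ℂ} {u v : Cn n → ℂ} (h : u =ᶠ[nhds p] v) :
    cderiv Z u =ᶠ[nhds p] cderiv Z v :=
  h.eventuallyEq_nhds.mono fun _ hx => cderiv_congr hx

/-- The integrand depends on germs only, so that cutting off the data away from the support of `g`
does not change the integral. -/
lemma bochnerIntegrand_congr {φ' g' : Cn n → ℝ} {V V' : Fin n → Cn n → ℂ}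
    (hφ : φ =ᶠ[nhds p] φ') (hg : g =ᶠ[nhds p] g') (hV : ∀ k, V k =ᶠ[nhds p] V' k) :
    bochnerIntegrand φ g V p = bochnerIntegrand φ' g' V' p := by
  have hφc : (fun x => (φ x : ℂ)) =ᶠ[nhds p] fun x => (φ' x : ℂ) := hφ.fun_comp Complex.ofReal
  have hgc : (fun x => (g x : ℂ)) =ᶠ[nhds p] fun x => (g' x : ℂ) := hg.fun_comp Complex.ofReal
  have h1 : ∀ j k, dzbar j (V k) p = dzbar j (V' k) p := fun j k => cderiv_congr (hV k)
  have h2 : ∀ k j, dz k (dzbar j fun x => (φ x : ℂ)) p = dz k (dzbar j fun x => (φ' x : ℂ)) p :=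
    fun k j => cderiv_congr (cderiv_congr_eventually hφc)
  have h3 : ∀ k j, dz k (dzbar j fun x => (g x : ℂ)) p = dz k (dzbar j fun x => (g' x : ℂ)) p :=
    fun k j => cderiv_congr (cderiv_congr_eventually hgc)
  have h4 : ∀ k, dz k (fun x => (g x : ℂ)) p = dz k (fun x => (g' x : ℂ)) p :=
    fun k => cderiv_congr hgc
  have h5 : ∀ k, V k p = V' k p := fun k => (hV k).eq_of_nhds
  simp only [bochnerIntegrand, wdiv_congr hφ hV, h1, h2, h3, h4, h5, hφ.eq_of_nhds, hg.eq_of_nhds]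

lemma bochnerIntegrand_zero {V : Fin n → Cn n → ℂ} : bochnerIntegrand φ (fun _ => 0) V p = 0 := by
  have h : ∀ Z : Fin (2 * n) → ℂ, cderiv Z (fun _ : Cn n => (0 : ℂ)) = fun _ => 0 :=
    fun Z => funext fun x => cderiv_const 0
  simp [bochnerIntegrand, dz, dzbar, h]

/-- A smooth function on an open set agrees near a compact subset with a smooth function on the
whole space. -/
lemma exists_contDiff_eq_near {K U : Set (Cn n)} (hK : IsCompact K) (hU : IsOpen U) (hKU : K ⊆ U) :
    ∃ χ : Cn n → ℝ, ContDiff ℝ ∞ χ ∧ (∀ x ∈ K, χ =ᶠ[nhds x] fun _ => 1) ∧ tsupport χ ⊆ U := by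
  obtain ⟨C, hC, hKC, hCU⟩ := exists_compact_between hK hU hKU
  obtain ⟨χ, h1, h0, -⟩ := exists_contMDiffMap_one_nhds_of_subset_interior (n := ⊤)
    𝓘(ℝ, Cn n) hK.isClosed hKC
  refine ⟨χ, χ.contMDiff.contDiff, fun x hx => ?_, ?_⟩
  · exact (Filter.eventually_of_mem (mem_nhdsSet_iff_forall.1 h1 x hx) fun y hy => hy)
  · refine (closure_minimal (fun x hx => ?_) hC.isClosed).trans hCU
    by_contra hxC
    exact hx (h0 x hxC)

lemma contDiff_smul_of_tsupport {E : Type*} [NormedAddCommGroup E] [NormedSpace ℝ E]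
    {U : Set (Cn n)} (hU : IsOpen U) {χ : Cn n → ℝ}
    (hχ : ContDiff ℝ ∞ χ) (hχU : tsupport χ ⊆ U) {u : Cn n → E} (hu : ContDiffOn ℝ ∞ u U) :
    ContDiff ℝ ∞ fun x => χ x • u x := by
  refine contDiff_iff_contDiffAt.2 fun x => ?_
  by_cases hx : x ∈ U
  · exact hχ.contDiffAt.smul (hu.contDiffAt (hU.mem_nhds hx))
  · have h0 : (fun x => χ x • u x) =ᶠ[nhds x] fun _ => 0 := by
      filter_upwards [(isClosed_tsupport χ).isOpen_compl.mem_nhds fun h => hx (hχU h)] with z hz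
      rw [image_eq_zero_of_notMem_tsupport hz, zero_smul]
    exact contDiffAt_const.congr_of_eventuallyEq h0

/-- The local Bochner inequality. -/
theorem integral_bochnerTerm_nonneg {U K : Set (Cn n)} (hU : IsOpen U) (hK : IsCompact K)
    (hKU : K ⊆ U) (hw : ContDiffOn ℝ ∞ w U) (hpos : ∀ x ∈ U, IsPositiveOneOne (w x))
    (hcl : ∀ x ∈ U, extDeriv w x = 0) (hf : ContDiffOn ℝ ∞ f U)
    (hty : ∀ x ∈ U, IsOfType n 1 (f x)) (hy : ContDiffOn ℝ ∞ y U)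
    (hyty : ∀ x ∈ U, IsOfType n 0 (y x)) (hφ : ContDiffOn ℝ ∞ φ U) (hg : ContDiffOn ℝ ∞ g U)
    (hg0 : ∀ x ∈ U, 0 ≤ g x) (hgK : ∀ x ∈ U, x ∉ K → g x = 0)
    (hyw : ∀ x ∈ U, topCoeff (y x) = -2 * wdiv φ (fun k x => dualVec (w x) (f x) k) x) :
    0 ≤ ∫ x in K, (hermMat (w x)).det.re *
      bochnerTerm (w x) (f x) (extDeriv f x) (y x) φ g x := by
  have hmem : ∀ x ∈ U, U ∈ nhds x := fun x hx => hU.mem_nhds hx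
  -- The data are defined on `U` only. Multiplied by `χ`, which is `1` near `K`, they become smooth
  -- on `ℂⁿ`, and `bochner_identity` applies.
  obtain ⟨χ, hχ, hχ1, hχU⟩ := exists_contDiff_eq_near hK hU hKU
  let V : Fin n → Cn n → ℂ := fun k x => dualVec (w x) (f x) k
  have hV : ∀ k, ContDiffOn ℝ ∞ (V k) U := fun k x hx =>
    (contDiffAt_dualVec (hw.contDiffAt (hmem x hx)) (hpos x hx)
      (hf.contDiffAt (hmem x hx)) k).contDiffWithinAt
  let V' : Fin n → Cn n → ℂ := fun k x => χ x • V k x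
  let φ' : Cn n → ℝ := fun x => χ x • φ x
  let g' : Cn n → ℝ := fun x => χ x • g x
  have hV' : ∀ k, ContDiff ℝ ∞ (V' k) := fun k => contDiff_smul_of_tsupport hU hχ hχU (hV k)
  have hφ' : ContDiff ℝ ∞ φ' := contDiff_smul_of_tsupport hU hχ hχU hφ
  have hg' : ContDiff ℝ ∞ g' := contDiff_smul_of_tsupport hU hχ hχU hg
  have hg'K : ∀ x, x ∉ K → g' x = 0 := by
    intro x hx
    by_cases hxU : x ∈ U
    · simp [g', hgK x hxU hx]
    · simp [g', image_eq_zero_of_notMem_tsupport fun h => hxU (hχU h)]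
  have hid := bochner_identity hφ' hg' (HasCompactSupport.intro hK hg'K) hV'
  have hoff : ∀ x, x ∉ K → bochnerIntegrand φ' g' V' x = 0 := by
    intro x hx
    rw [bochnerIntegrand_congr (Filter.EventuallyEq.refl _ _) (g' := fun _ => 0)
      (by filter_upwards [hK.isClosed.isOpen_compl.mem_nhds hx] with z hz using hg'K z hz)
      fun k => Filter.EventuallyEq.refl _ _]
    exact bochnerIntegrand_zero
  have hon : ∀ x ∈ K, bochnerIntegrand φ' g' V' x = bochnerIntegrand φ g V x := by
    intro x hx
    refine bochnerIntegrand_congr ?_ ?_ fun k => ?_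
    all_goals filter_upwards [hχ1 x hx] with z hz; simp [φ', g', V', hz]
  have hV2 : ContDiffOn ℝ ∞ (fun x => (bochnerIntegrand φ g V x).re) U := by
    intro x hx
    refine (contDiffAt_re ?_).contDiffWithinAt
    have sV : ∀ k, ContDiffAt ℝ ∞ (V k) x := fun k => (hV k).contDiffAt (hmem x hx)
    have sφ := contDiffAt_ofReal (hφ.contDiffAt (hmem x hx))
    have sg := contDiffAt_ofReal (hg.contDiffAt (hmem x hx))
    have sE : ContDiffAt ℝ ∞ (fun x => ((Real.exp (-φ x) : ℝ) : ℂ)) x := contDiffAt_ofReal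
      (Real.contDiff_exp.contDiffAt.comp x (hφ.contDiffAt (hmem x hx)).neg)
    have sδ : ContDiffAt ℝ ∞ (wdiv φ V) x := ContDiffAt.sum fun k _ =>
      (ContDiffAt.cderiv (sV k) le_rfl).sub ((ContDiffAt.cderiv sφ le_rfl).mul (sV k))
    have sγ : ContDiffAt ℝ ∞ (fun p => ∑ k, V k p * dz k (fun x => (g x : ℂ)) p) x :=
      ContDiffAt.sum fun k _ => (sV k).mul (ContDiffAt.cderiv sg le_rfl)
    refine (((sg.mul sE).mul ((sδ.mul (contDiffAt_conj sδ)).sub ?_)).sub (sE.mul ?_)).add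
      (sE.mul ((sδ.mul (contDiffAt_conj sγ)).add ((contDiffAt_conj sδ).mul sγ)))
    · exact ContDiffAt.sum fun j _ => ContDiffAt.sum fun k _ =>
        (ContDiffAt.cderiv (sV k) le_rfl).mul (contDiffAt_conj (ContDiffAt.cderiv (sV j) le_rfl))
    · exact ContDiffAt.sum fun k _ => ContDiffAt.sum fun j _ =>
        ((sg.mul (ContDiffAt.cderiv (ContDiffAt.cderiv sφ le_rfl) le_rfl)).sub
          (ContDiffAt.cderiv (ContDiffAt.cderiv sg le_rfl) le_rfl)).mul
          ((sV k).mul (contDiffAt_conj (sV j)))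
  have hi1 : IntegrableOn (fun x => 2 ^ (n + 2) * (bochnerIntegrand φ g V x).re) K :=
    ((hV2.continuousOn.mono hKU).integrableOn_compact hK).const_mul _
  have hi2 : IntegrableOn (fun x => (hermMat (w x)).det.re *
      bochnerTerm (w x) (f x) (extDeriv f x) (y x) φ g x) K := by
    refine ContinuousOn.integrableOn_compact hK fun x hx => ?_
    have hxU := hKU hx
    have hd : ContDiffAt ℝ ∞ (fun x => (hermMat (w x)).det.re) x :=
      contDiffAt_re (contDiffAt_matrix_det fun i j =>
        contDiffAt_hermMat (hw.contDiffAt (hmem x hxU)) i j)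
    exact (hd.mul (contDiffAt_bochnerTerm (hw.contDiffAt (hmem x hxU)) (hpos x hxU)
      (hf.contDiffAt (hmem x hxU)) (hy.contDiffAt (hmem x hxU)) (hφ.contDiffAt (hmem x hxU))
      (hg.contDiffAt (hmem x hxU)))).continuousAt.continuousWithinAt
  have hzero : ∫ x in K, 2 ^ (n + 2) * (bochnerIntegrand φ g V x).re = 0 := by
    have h1 : ∫ x in K, (bochnerIntegrand φ' g' V' x) = 0 := by
      rw [setIntegral_eq_integral_of_forall_compl_eq_zero fun x hx => hoff x hx, hid]
    have h2 : ∫ x in K, bochnerIntegrand φ g V x = 0 := by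
      rw [← h1]
      exact setIntegral_congr_fun hK.measurableSet fun x hx => (hon x hx).symm
    rw [integral_const_mul]
    -- Taking real parts under the integral requires integrability, which follows from the
    -- continuity of the cut-off integrand.
    by_cases hintg : IntegrableOn (bochnerIntegrand φ g V) K
    · have := integral_re (𝕜 := ℂ) hintg
      simp only [RCLike.re_eq_complex_re] at this
      rw [this, h2]
      simp
    · exfalso
      apply hintg
      have hc : Continuous (bochnerIntegrand φ' g' V') := by
        have sφ := ContDiff.ofReal hφ'
        have sg := ContDiff.ofReal hg'
        have sE : ContDiff ℝ ∞ (fun x => ((Real.exp (-φ' x) : ℝ) : ℂ)) := ContDiff.ofReal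
          (Real.contDiff_exp.comp hφ'.neg)
        have sδ := contDiff_wdiv hφ' hV'
        have sγ : ContDiff ℝ ∞ (fun p => ∑ k, V' k p * dz k (fun x => (g' x : ℂ)) p) :=
          ContDiff.sum fun k _ => (hV' k).mul (ContDiff.dz sg k)
        refine ContDiff.continuous (𝕜 := ℝ) (n := ∞) ?_
        refine (((sg.mul sE).mul ((sδ.mul (ContDiff.conj' sδ)).sub ?_)).sub (sE.mul ?_)).add
          (sE.mul ((sδ.mul (ContDiff.conj' sγ)).add ((ContDiff.conj' sδ).mul sγ)))
        · exact ContDiff.sum fun j _ => ContDiff.sum fun k _ =>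
            (ContDiff.dzbar (hV' k) j).mul (ContDiff.conj' (ContDiff.dzbar (hV' j) k))
        · exact ContDiff.sum fun k _ => ContDiff.sum fun j _ =>
            ((sg.mul (ContDiff.dz (ContDiff.dzbar sφ j) k)).sub
              (ContDiff.dz (ContDiff.dzbar sg j) k)).mul
              ((hV' k).mul (ContDiff.conj' (hV' j)))
      exact (hc.continuousOn.integrableOn_compact hK).congr_fun hon hK.measurableSet
  rw [← hzero]
  refine setIntegral_mono_on hi1 hi2 hK.measurableSet fun x hx => ?_
  have hxU := hKU hx
  exact bochnerTerm_ge ((hw.contDiffAt (hmem x hxU)).of_le (by norm_cast))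
    (Filter.eventually_of_mem (hmem x hxU) hpos) (hcl x hxU)
    ((hf.contDiffAt (hmem x hxU)).of_le (by norm_cast))
    (Filter.eventually_of_mem (hmem x hxU) hty)
    ((hφ.contDiffAt (hmem x hxU)).of_le (by norm_cast))
    ((hg.contDiffAt (hmem x hxU)).of_le (by norm_cast)) (hg0 x hxU) (hyty x hxU) (hyw x hxU)

end LocalIntegral

/-! ### Changes of charts and of frames -/

section Transition

variable {n : ℕ} {X : Type*} [TopologicalSpace X] [ChartedSpace (Cn n) X]
  [IsManifold 𝓘(ℂ, Cn n) ω X]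

/-- The coordinate change from the chart at `x₀` to the chart at `x₁`. -/
def chartChange (x₀ x₁ : X) (p : Cn n) : Cn n := chartAt (Cn n) x₁ (pt x₀ p)

lemma pt_mem_source {x₀ : X} {p : Cn n} (hp : p ∈ (chartAt (Cn n) x₀).target) :
    pt x₀ p ∈ (chartAt (Cn n) x₀).source := (chartAt (Cn n) x₀).map_target hp

lemma chartAt_pt {x₀ : X} {p : Cn n} (hp : p ∈ (chartAt (Cn n) x₀).target) :
    chartAt (Cn n) x₀ (pt x₀ p) = p := (chartAt (Cn n) x₀).right_inv hp

lemma continuousAt_pt {x₀ : X} {p : Cn n} (hp : p ∈ (chartAt (Cn n) x₀).target) :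
    ContinuousAt (pt x₀) p :=
  (chartAt (Cn n) x₀).symm.continuousAt hp

lemma pt_chartChange {x₀ x₁ : X} {p : Cn n} (h : pt x₀ p ∈ (chartAt (Cn n) x₁).source) :
    pt x₁ (chartChange x₀ x₁ p) = pt x₀ p :=
  (chartAt (Cn n) x₁).left_inv h

lemma eventually_mem_target {x₀ : X} {p : Cn n} (hp : p ∈ (chartAt (Cn n) x₀).target) :
    ∀ᶠ p' in nhds p, p' ∈ (chartAt (Cn n) x₀).target :=
  (chartAt (Cn n) x₀).open_target.mem_nhds hp

lemma eventually_pt_mem {x₀ : X} {p : Cn n} (hp : p ∈ (chartAt (Cn n) x₀).target) {s : Set X}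
    (hs : IsOpen s) (h : pt x₀ p ∈ s) : ∀ᶠ p' in nhds p, pt x₀ p' ∈ s :=
  (continuousAt_pt hp).eventually_mem (hs.mem_nhds h)

lemma contDiffAt_chartChange {x₀ x₁ : X} {p : Cn n} (hp : p ∈ (chartAt (Cn n) x₀).target)
    (h : pt x₀ p ∈ (chartAt (Cn n) x₁).source) :
    ContDiffAt ℂ ω (chartChange x₀ x₁) p := by
  have := contDiffWithinAt_ext_coord_change (I := 𝓘(ℂ, Cn n)) (n := ω) x₁ x₀ (y := p) (by
    simp only [extChartAt, mfld_simps]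
    exact ⟨hp, h⟩)
  simpa [extChartAt, chartChange, pt, Function.comp_def] using! this

lemma tangentCoordChange_eq {x₀ x₁ : X} {p : Cn n} (hp : p ∈ (chartAt (Cn n) x₀).target)
    (_ : pt x₀ p ∈ (chartAt (Cn n) x₁).source) :
    tangentCoordChange 𝓘(ℂ, Cn n) x₀ x₁ (pt x₀ p) = fderiv ℂ (chartChange x₀ x₁) p := by
  rw [tangentCoordChange_def]
  simp only [modelWithCornersSelf_coe, Set.range_id, fderivWithin_univ]
  have e : extChartAt 𝓘(ℂ, Cn n) x₀ (pt x₀ p) = p := by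
    simpa [extChartAt] using chartAt_pt hp
  rw [e]
  congr 1

lemma fderiv_real_chartChange {x₀ x₁ : X} {p : Cn n} (hp : p ∈ (chartAt (Cn n) x₀).target)
    (h : pt x₀ p ∈ (chartAt (Cn n) x₁).source) :
    fderiv ℝ (chartChange x₀ x₁) p = (fderiv ℂ (chartChange x₀ x₁) p).restrictScalars ℝ :=
  (((contDiffAt_chartChange hp h).differentiableAt (by simp)).hasFDerivAt.restrictScalars ℝ).fderiv

lemma toTangent_eq_comp {x₀ x₁ : X} {p : Cn n} (hp : p ∈ (chartAt (Cn n) x₀).target)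
    (h : pt x₀ p ∈ (chartAt (Cn n) x₁).source) :
    toTangent x₀ (pt x₀ p) =
      (toTangent x₁ (pt x₀ p)).comp (fderiv ℝ (chartChange x₀ x₁) p) := by
  rw [fderiv_real_chartChange hp h, ← tangentCoordChange_eq hp h]
  ext v : 1
  simp only [toTangent, ContinuousLinearMap.coe_restrictScalars', ContinuousLinearMap.comp_apply]
  refine (tangentCoordChange_comp ⟨⟨?_, ?_⟩, ?_⟩).symm
  · simpa using pt_mem_source hp
  · simpa using h
  · simp

/-- The tangent map from the coordinates at `x₀` to the tangent space at `q`, over `ℂ`. -/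
def toTangentLM (x₀ q : X) : Cn n →ₗ[ℂ] Cn n := (tangentCoordChange 𝓘(ℂ, Cn n) x₀ q q).toLinearMap

lemma toTangent_inverse {x₀ q : X} (hq : q ∈ (chartAt (Cn n) x₀).source) (v : Cn n) :
    tangentCoordChange 𝓘(ℂ, Cn n) q x₀ q (toTangent x₀ q v) = v := by
  have : tangentCoordChange 𝓘(ℂ, Cn n) q x₀ q (toTangent x₀ q v) =
      tangentCoordChange 𝓘(ℂ, Cn n) x₀ x₀ q v :=
    tangentCoordChange_comp (by simpa using hq)
  rw [this]
  exact tangentCoordChange_self (by simpa using hq)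

lemma toTangentLM_injective {x₀ q : X} (hq : q ∈ (chartAt (Cn n) x₀).source) :
    Function.Injective (toTangentLM (n := n) x₀ q) :=
  Function.LeftInverse.injective (g := tangentCoordChange 𝓘(ℂ, Cn n) q x₀ q)
    fun v => toTangent_inverse hq v

variable {L : X → Type*} [TopologicalSpace (TotalSpace ℂ L)] [∀ x, TopologicalSpace (L x)]
  [∀ x, AddCommGroup (L x)] [∀ x, Module ℂ (L x)] [FiberBundle ℂ L] [VectorBundle ℂ ℂ L]

variable (L) in
/-- The transition function from the frame at `x₁` to the frame at `x₀`, in the coordinates at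
`x₀`. -/
def frameChange (x₀ x₁ : X) (p : Cn n) : ℂ := fibreCoord L x₀ (pt x₀ p) (frame L x₁ (pt x₀ p))

lemma fibreCoord_eq_frameChange (x₀ : X) {x₁ : X} {p : Cn n}
    (h₁ : pt x₀ p ∈ (trivializationAt ℂ L x₁).baseSet) (a : L (pt x₀ p)) :
    fibreCoord L x₀ (pt x₀ p) a = frameChange L x₀ x₁ p * fibreCoord L x₁ (pt x₀ p) a := by
  conv_lhs => rw [← fibreCoord_smul_frame x₁ h₁ a, map_smul, smul_eq_mul, mul_comm]
  rfl

lemma frame_eq_frameChange {x₀ : X} (x₁ : X) {p : Cn n}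
    (h₀ : pt x₀ p ∈ (trivializationAt ℂ L x₀).baseSet) :
    frame L x₁ (pt x₀ p) = frameChange L x₀ x₁ p • frame L x₀ (pt x₀ p) :=
  (fibreCoord_smul_frame x₀ h₀ _).symm

lemma frameChange_ne_zero {x₀ x₁ : X} {p : Cn n}
    (h₀ : pt x₀ p ∈ (trivializationAt ℂ L x₀).baseSet)
    (h₁ : pt x₀ p ∈ (trivializationAt ℂ L x₁).baseSet) : frameChange L x₀ x₁ p ≠ 0 := by
  intro h
  have := frame_eq_frameChange (n := n) x₁ h₀
  rw [h, zero_smul] at this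
  exact frame_ne_zero x₁ h₁ this

lemma contDiffAt_frameChange [ContMDiffVectorBundle ω ℂ L 𝓘(ℂ, Cn n)] {x₀ x₁ : X} {p : Cn n}
    (hp : p ∈ (chartAt (Cn n) x₀).target)
    (h₀ : pt x₀ p ∈ (trivializationAt ℂ L x₀).baseSet)
    (h₁ : pt x₀ p ∈ (trivializationAt ℂ L x₁).baseSet) :
    ContDiffAt ℂ ω (frameChange (n := n) L x₀ x₁) p := by
  have hpt : ContMDiffAt 𝓘(ℂ, Cn n) 𝓘(ℂ, Cn n) ω (pt x₀) p :=
    (contMDiffOn_chart_symm (I := 𝓘(ℂ, Cn n)) (n := ω) (x := x₀)).contMDiffAt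
      ((chartAt (Cn n) x₀).open_target.mem_nhds hp)
  have h := (hpt.coordChangeL (F := ℂ) (E := L) (e := trivializationAt ℂ L x₁)
    (e' := trivializationAt ℂ L x₀) h₁ h₀)
  have h2 : ContDiffAt ℂ ω (fun y => ((trivializationAt ℂ L x₁).coordChangeL ℂ
      (trivializationAt ℂ L x₀) (pt x₀ y) : ℂ →L[ℂ] ℂ) 1) p :=
    h.contDiffAt.clm_apply contDiffAt_const
  refine h2.congr_of_eventuallyEq ?_
  filter_upwards [eventually_pt_mem hp (trivializationAt ℂ L x₁).open_baseSet h₁,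
    eventually_pt_mem hp (trivializationAt ℂ L x₀).open_baseSet h₀] with y hy₁ hy₀
  rw [frameChange, frame, fibreCoord]
  simp [Trivialization.coordChangeL_apply _ _ ⟨hy₁, hy₀⟩, Trivialization.symmL_apply _ hy₁,
    Trivialization.continuousLinearMapAt_apply, Trivialization.coe_linearMapAt_of_mem _ hy₀]

lemma localScalarForm_eq {k : ℕ} (w : X → Cn n [⋀^Fin k]→L[ℝ] ℝ) {x₀ x₁ : X} {p : Cn n}
    (hp : p ∈ (chartAt (Cn n) x₀).target) (h : pt x₀ p ∈ (chartAt (Cn n) x₁).source) :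
    localScalarForm w x₀ p = (localScalarForm w x₁ (chartChange x₀ x₁ p)).compContinuousLinearMap
      (fderiv ℝ (chartChange x₀ x₁) p) := by
  rw [localScalarForm, localScalarForm, pt_chartChange h, toTangent_eq_comp hp h]
  rfl

lemma localForm_apply {k : ℕ} (ξ : LForm n L k) (x₀ : X) (p : Cn n) (v : Fin k → Cn n) :
    localForm ξ x₀ p v =
      fibreCoord L x₀ (pt x₀ p) (ξ (pt x₀ p) fun i => toTangent x₀ (pt x₀ p) (v i)) := rfl

lemma localForm_eq {k : ℕ} (ξ : LForm n L k) {x₀ x₁ : X} {p : Cn n}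
    (hp : p ∈ (chartAt (Cn n) x₀).target) (h : pt x₀ p ∈ (chartAt (Cn n) x₁).source)
    (h₁ : pt x₀ p ∈ (trivializationAt ℂ L x₁).baseSet) :
    localForm ξ x₀ p = frameChange L x₀ x₁ p •
      (localForm ξ x₁ (chartChange x₀ x₁ p)).compContinuousLinearMap
        (fderiv ℝ (chartChange x₀ x₁) p) := by
  ext v
  rw [localForm_apply, fibreCoord_eq_frameChange x₀ h₁]
  simp only [ContinuousAlternatingMap.smul_apply, smul_eq_mul,
    ContinuousAlternatingMap.compContinuousLinearMap_apply, localForm_apply, Function.comp_def]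
  -- The point is a variable because the fibre depends on it.
  have e : ∀ q, q = pt x₀ p → fibreCoord L x₁ q (ξ q fun i =>
      toTangent x₁ q (fderiv ℝ (chartChange x₀ x₁) p (v i))) =
      fibreCoord L x₁ (pt x₀ p) (ξ (pt x₀ p) fun i => toTangent x₀ (pt x₀ p) (v i)) := by
    rintro _ rfl
    rw [toTangent_eq_comp hp h]
    rfl
  rw [e _ (pt_chartChange h)]

/-- Forms in the coordinates at `x₀` in terms of their values at the base point. -/
lemma localForm_eq_central {k : ℕ} (ξ : LForm n L k) (x₀ : X) (p : Cn n) (v : Fin k → Cn n) :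
    localForm ξ x₀ p v = frameChange L x₀ (pt x₀ p) p *
      centralForm ξ (pt x₀ p) (fun i => toTangentLM x₀ (pt x₀ p) (v i)) := by
  rw [localForm_apply, fibreCoord_eq_frameChange x₀ (mem_baseSet_trivializationAt ℂ L _)]
  rfl

lemma localForm_isOfType {k a b : ℕ} {ξ : LForm n L k} {x₀ : X} {p : Cn n}
    (h : IsOfType a b (ξ (pt x₀ p))) : IsOfType a b (localForm ξ x₀ p) := by
  refine ⟨h.1, fun c v => ?_⟩
  rw [localForm_apply, localForm_apply]
  have : (fun i => toTangent x₀ (pt x₀ p) (c • v i)) =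
      fun i => c • toTangent x₀ (pt x₀ p) (v i) := by
    ext i : 1
    exact (toTangentLM x₀ (pt x₀ p)).map_smul c (v i)
  rw [this, h.2, map_smul]

end Transition

/-! ### Forms of type `(n+1,b)` vanish -/

section TypeVanishing

variable {n k : ℕ}

/-- There are no forms of type `(a,b)` with `a > n`. -/
lemma IsOfType.eq_zero {a b : ℕ} {T : Cn n [⋀^Fin k]→L[ℝ] ℂ} (hT : IsOfType a b T) (ha : n < a) :
    T = 0 := by
  ext v
  rw [← cext_rvec]
  -- Every vector is split into its two parts, and `T` is expanded over the subsets `s` of slots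
  -- that receive the antiholomorphic part.
  have e : (fun i => rvec (v i)) = (fun i => antiVec (v i)) + fun i => holVec (v i) := by
    ext i : 1
    rw [rvec_eq, add_comm]; rfl
  rw [e, ← AlternatingMap.coe_multilinearMap, MultilinearMap.map_add_univ]
  refine Finset.sum_eq_zero fun s _ => ?_
  have es : s.piecewise (fun i => antiVec (v i)) (fun i => holVec (v i)) =
      fun i => partVec (decide (i ∈ s)) (v i) := by
    ext i : 1
    by_cases hi : i ∈ s <;> simp [partVec, hi]
  rw [es, AlternatingMap.coe_multilinearMap]
  by_cases hs : (Finset.univ.filter fun i => decide (i ∈ s) = true).card = b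
  -- If `s` has `b` elements, the other `a > n` slots hold `(1,0)`-vectors, which are linearly
  -- dependent.
  · refine AlternatingMap.map_linearDependent _ _ fun hli => ?_
    have hli2 : LinearIndependent ℂ fun i : {i // i ∉ s} => holVec (v i) := by
      have := hli.comp (fun i : {i // i ∉ s} => (i : Fin k)) Subtype.val_injective
      have e : (fun i : {i // i ∉ s} => holVec (v i)) =
          (fun i => partVec (decide (i ∈ s)) (v i)) ∘ fun i : {i // i ∉ s} => (i : Fin k) := by
        ext i : 1
        simp [partVec, i.2]
      rw [e]
      exact this
    have hli3 : LinearIndependent ℂ fun i : {i // i ∉ s} => v i :=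
      LinearIndependent.of_comp (holVecLM n) hli2
    have hc := hli3.fintype_card_le_finrank
    rw [Module.finrank_fin_fun, Fintype.card_subtype_compl, Fintype.card_fin] at hc
    have : Fintype.card {i // i ∈ s} = b := by
      rw [Fintype.card_coe, ← hs]; congr 1; ext; simp
    have hk := hT.1
    omega
  · exact hT.cext_eq_zero _ _ hs

/-- The difference of the two sides is `∂G ∧ F`, a form of type `(n+1,b)`, hence zero. This is what
makes `∂̄` independent of the holomorphic frame. -/
lemma extDeriv_smul_holomorphic {b : ℕ} {G : Cn n → ℂ} {F : Cn n → Cn n [⋀^Fin k]→L[ℝ] ℂ}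
    {p : Cn n} (hG : DifferentiableAt ℂ G p) (hF : DifferentiableAt ℝ F p)
    (hty : IsOfType n b (F p)) :
    extDeriv (fun x => G x • F x) p = G p • extDeriv F p := by
  have hGr : HasFDerivAt G ((fderiv ℂ G p).restrictScalars ℝ) p :=
    hG.hasFDerivAt.restrictScalars ℝ
  have hGF : DifferentiableAt ℝ (fun x => G x • F x) p := hGr.differentiableAt.smul hF
  have hT : ∀ v, (extDeriv (fun x => G x • F x) p - G p • extDeriv F p) v =
      ∑ i : Fin (k + 1), (-1) ^ (i : ℕ) * (fderiv ℂ G p (v i) * F p (i.removeNth v)) := by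
    intro v
    rw [ContinuousAlternatingMap.sub_apply, ContinuousAlternatingMap.smul_apply,
      extDeriv_apply hGF, extDeriv_apply hF, Finset.smul_sum, ← Finset.sum_sub_distrib]
    refine Finset.sum_congr rfl fun i _ => ?_
    have h1 : HasFDerivAt (fun x => (G x • F x) (i.removeNth v))
        (G p • ((ContinuousAlternatingMap.apply ℝ (Cn n) ℂ (i.removeNth v)).comp (fderiv ℝ F p)) +
          F p (i.removeNth v) • (fderiv ℂ G p).restrictScalars ℝ) p :=
      hGr.mul (hasFDerivAt_form_apply hF _)
    rw [h1.fderiv, (hasFDerivAt_form_apply hF _).fderiv]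
    simp
    ring
  have h0 : extDeriv (fun x => G x • F x) p - G p • extDeriv F p = 0 := by
    refine IsOfType.eq_zero (a := n + 1) (b := b) ⟨by have := hty.1; omega, fun c v => ?_⟩
      (Nat.lt_succ_self n)
    rw [hT, hT, Finset.smul_sum]
    refine Finset.sum_congr rfl fun i _ => ?_
    have e : (i.removeNth fun a => c • v a) = fun a => c • (i.removeNth v) a := rfl
    rw [e, hty.2, map_smul, smul_eq_mul, smul_eq_mul, smul_eq_mul]
    ring
  exact sub_eq_zero.1 h0

end TypeVanishing

/-! ### The Levi form under holomorphic maps, and pluriharmonic functions -/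

section Levi

variable {n : ℕ} {p : Cn n}

lemma cderiv_holVec_comp {ψ : Cn n → Cn n} {Φ : Cn n → ℂ} (hψ : DifferentiableAt ℂ ψ p)
    (hΦ : DifferentiableAt ℝ Φ (ψ p)) (v : Cn n) :
    cderiv (holVec v) (fun x => Φ (ψ x)) p = cderiv (holVec (fderiv ℂ ψ p v)) Φ (ψ p) := by
  have h : HasFDerivAt (fun x => Φ (ψ x))
      ((fderiv ℝ Φ (ψ p)).comp ((fderiv ℂ ψ p).restrictScalars ℝ)) p :=
    hΦ.hasFDerivAt.comp p (hψ.hasFDerivAt.restrictScalars ℝ)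
  rw [cderiv_holVec, cderiv_holVec, delAt, delAt, h.fderiv]
  simp

lemma cderiv_antiVec_comp {ψ : Cn n → Cn n} {Φ : Cn n → ℂ} (hψ : DifferentiableAt ℂ ψ p)
    (hΦ : DifferentiableAt ℝ Φ (ψ p)) (v : Cn n) :
    cderiv (antiVec v) (fun x => Φ (ψ x)) p = cderiv (antiVec (fderiv ℂ ψ p v)) Φ (ψ p) := by
  have h : HasFDerivAt (fun x => Φ (ψ x))
      ((fderiv ℝ Φ (ψ p)).comp ((fderiv ℂ ψ p).restrictScalars ℝ)) p :=
    hΦ.hasFDerivAt.comp p (hψ.hasFDerivAt.restrictScalars ℝ)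
  rw [cderiv_antiVec, cderiv_antiVec, h.fderiv]
  simp

lemma cderiv_antiVec_holomorphic {H : Cn n → ℂ} (hH : DifferentiableAt ℂ H p) (v : Cn n) :
    cderiv (antiVec v) H p = 0 := by
  rw [cderiv_antiVec, (hH.hasFDerivAt.restrictScalars ℝ).fderiv]
  simp only [ContinuousLinearMap.coe_restrictScalars', map_smul, smul_eq_mul]
  linear_combination (fderiv ℂ H p v / 2) * Complex.I_sq

lemma cderiv_holVec_holomorphic {H : Cn n → ℂ} (hH : DifferentiableAt ℂ H p) (v : Cn n) :
    cderiv (holVec v) H p = fderiv ℂ H p v := by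
  rw [cderiv_holVec, delAt, (hH.hasFDerivAt.restrictScalars ℝ).fderiv]
  simp only [ContinuousLinearMap.coe_restrictScalars', map_smul, smul_eq_mul]
  linear_combination (-(fderiv ℂ H p v) / 2) * Complex.I_sq

lemma cderiv_holVec_conj_holomorphic {H : Cn n → ℂ} (hH : DifferentiableAt ℂ H p) (v : Cn n) :
    cderiv (holVec v) (fun x => conj (H x)) p = 0 := by
  rw [cderiv_conj (hH.restrictScalars ℝ), conjVec_holVec, cderiv_antiVec_holomorphic hH, map_zero]

/-- The coefficients of `∂̄(φ ∘ ψ)` involve the conjugate of the Jacobian of `ψ`, which is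
antiholomorphic, so that `∂` does not see it and no second derivative of `ψ` remains. -/
lemma leviForm_comp {ψ : Cn n → Cn n} {φ : Cn n → ℝ} (hψ : ContDiffAt ℂ ω ψ p)
    (hφ : ContDiffAt ℝ 2 φ (ψ p)) (v : Cn n) :
    leviForm (fun x => φ (ψ x)) p v = leviForm φ (ψ p) (fderiv ℂ ψ p v) := by
  have hψr : ContDiffAt ℝ 2 ψ p := (hψ.restrict_scalars ℝ).of_le (by simp)
  have hψe : ∀ᶠ x in nhds p, DifferentiableAt ℂ ψ x := by
    filter_upwards [(hψ.of_le (show (1 : WithTop ℕ∞) ≤ ω by simp)).eventually (by simp)] with x hx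
    exact hx.differentiableAt (by norm_num)
  set Φ : Cn n → ℂ := fun x => (φ x : ℂ) with hΦdef
  have hΦ : ContDiffAt ℝ 2 Φ (ψ p) := contDiffAt_ofReal hφ
  have hΦe : ∀ᶠ x in nhds p, DifferentiableAt ℝ Φ (ψ x) := by
    have := hψr.continuousAt.eventually (hΦ.eventually (by simp))
    filter_upwards [this] with x hx
    exact hx.differentiableAt (by norm_num)
  have hcomp : ContDiffAt ℝ 2 (fun x => φ (ψ x)) p := hφ.comp p hψr
  have hD : DifferentiableAt ℂ (fun x => fderiv ℂ ψ x v) p :=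
    (((hψ.fderiv_right (m := 1) (by simp)).differentiableAt (by norm_num))).clm_apply
      (differentiableAt_const v)
  have hDk : ∀ k, DifferentiableAt ℂ (fun x => fderiv ℂ ψ x v k) p := fun k =>
    (differentiableAt_pi.1 hD) k
  have hb : ∀ k, DifferentiableAt ℝ (fun y => dzbar k Φ y) (ψ p) := fun k =>
    (ContDiffAt.cderiv (k := 1) hΦ (by norm_num)).differentiableAt (by norm_num)
  have hbc : ∀ k, DifferentiableAt ℝ (fun x => dzbar k Φ (ψ x)) p := fun k =>
    (hb k).comp p (hψr.differentiableAt (by norm_num))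
  have hck : ∀ k, DifferentiableAt ℝ (fun x => conj (fderiv ℂ ψ x v k)) p := fun k =>
    (Complex.conjCLE : ℂ →L[ℝ] ℂ).differentiableAt.comp p ((hDk k).restrictScalars ℝ)
  have key : (leviForm (fun x => φ (ψ x)) p v : ℂ) = leviForm φ (ψ p) (fderiv ℂ ψ p v) := by
    rw [leviForm_eq hcomp, leviForm_eq hφ]
    have e : (cderiv (antiVec v) fun x => (φ (ψ x) : ℂ)) =ᶠ[nhds p] fun x =>
        ∑ k, conj (fderiv ℂ ψ x v k) * dzbar k Φ (ψ x) := by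
      filter_upwards [hψe, hΦe] with x hx hx'
      rw [cderiv_antiVec_comp (Φ := Φ) hx hx', antiVec_eq_sum, cderiv_sum_left]
      simp only [cderiv_smul_left, dzbar]
    have e2 : (cderiv (antiVec (fderiv ℂ ψ p v)) Φ) =
        fun y => ∑ k, conj (fderiv ℂ ψ p v k) * dzbar k Φ y := by
      funext y
      rw [antiVec_eq_sum, cderiv_sum_left]
      simp only [cderiv_smul_left, dzbar]
    rw [cderiv_congr e, cderiv_sum (F := fun k x => conj (fderiv ℂ ψ x v k) * dzbar k Φ (ψ x))
      fun k _ => (hck k).mul (hbc k), e2,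
      cderiv_sum (F := fun k y => conj (fderiv ℂ ψ p v k) * dzbar k Φ y)
      fun k _ => (differentiableAt_const _).mul (hb k)]
    refine Finset.sum_congr rfl fun k _ => ?_
    rw [cderiv_mul (hck k) (hbc k), cderiv_mul (differentiableAt_const _) (hb k), cderiv_const,
      cderiv_holVec_conj_holomorphic (hDk k),
      cderiv_holVec_comp (Φ := dzbar k Φ) (hψ.differentiableAt (by simp)) (hb k)]
  exact_mod_cast key

lemma leviForm_congr {φ φ' : Cn n → ℝ} (h : φ =ᶠ[nhds p] φ') (v : Cn n) :
    leviForm φ p v = leviForm φ' p v := by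
  rw [leviForm, leviForm, (h.iteratedFDeriv ℝ 2).self_of_nhds]

lemma leviForm_add {φ φ' : Cn n → ℝ} (h : ContDiffAt ℝ 2 φ p) (h' : ContDiffAt ℝ 2 φ' p)
    (v : Cn n) : leviForm (fun x => φ x + φ' x) p v = leviForm φ p v + leviForm φ' p v := by
  have e : iteratedFDeriv ℝ 2 (fun x => φ x + φ' x) p =
    iteratedFDeriv ℝ 2 φ p + iteratedFDeriv ℝ 2 φ' p := iteratedFDeriv_add_apply h h'
  rw [leviForm, leviForm, leviForm, e]
  simp only [add_apply]
  ring

lemma leviForm_smul_vec {φ : Cn n → ℝ} (h : ContDiffAt ℝ 2 φ p) (c : ℂ) (v : Cn n) :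
    leviForm φ p (c • v) = Complex.normSq c * leviForm φ p v := by
  have : (leviForm φ p (c • v) : ℂ) = (Complex.normSq c : ℂ) * leviForm φ p v := by
    rw [leviForm_eq_sum h, leviForm_eq_sum h, ← Complex.mul_conj, Finset.mul_sum]
    refine Finset.sum_congr rfl fun k _ => ?_
    rw [Finset.mul_sum]
    refine Finset.sum_congr rfl fun j _ => ?_
    simp only [Pi.smul_apply, smul_eq_mul, map_mul]
    ring
  exact_mod_cast this

lemma contDiffAt_log_normSq {G : Cn n → ℂ} {m : WithTop ℕ∞} (hG : ContDiffAt ℝ m G p)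
    (h0 : G p ≠ 0) : ContDiffAt ℝ m (fun x => Real.log (Complex.normSq (G x))) p := by
  have h : ContDiffAt ℝ m (fun x => (G x * conj (G x)).re) p :=
    contDiffAt_re (hG.mul (contDiffAt_conj hG))
  have e : (fun x => (G x * conj (G x)).re) = fun x => Complex.normSq (G x) := by
    ext x; rw [Complex.mul_conj, Complex.ofReal_re]
  rw [e] at h
  exact h.log (by simpa using h0)

/-- `log |G|²` is pluriharmonic: its `∂̄` is the conjugate of the holomorphic form `dG / G`. -/
lemma leviForm_log_normSq {G : Cn n → ℂ} (hG : ContDiffAt ℂ ω G p) (h0 : G p ≠ 0) (v : Cn n) :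
    leviForm (fun x => Real.log (Complex.normSq (G x))) p v = 0 := by
  have hGr : ContDiffAt ℝ ω G p := hG.restrict_scalars ℝ
  have hGe : ∀ᶠ x in nhds p, DifferentiableAt ℂ G x := by
    filter_upwards [(hG.of_le (show (1 : WithTop ℕ∞) ≤ ω by simp)).eventually (by simp)] with x hx
    exact hx.differentiableAt (by norm_num)
  have hne : ∀ᶠ x in nhds p, G x ≠ 0 := hG.continuousAt.eventually_ne h0
  have e : (cderiv (antiVec v) fun x => ((Real.log (Complex.normSq (G x)) : ℝ) : ℂ)) =ᶠ[nhds p]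
      fun x => conj (fderiv ℂ G x v / G x) := by
    filter_upwards [hGe, hne] with x hx hx0
    have hd : DifferentiableAt ℝ G x := hx.restrictScalars ℝ
    have hdc : DifferentiableAt ℝ (fun x => conj (G x)) x :=
      (Complex.conjCLE : ℂ →L[ℝ] ℂ).differentiableAt.comp x hd
    have hns : DifferentiableAt ℝ (fun x => Complex.normSq (G x)) x := by
      have : DifferentiableAt ℝ (fun x => (G x * conj (G x)).re) x :=
        Complex.reCLM.differentiableAt.comp x (hd.mul hdc)
      simpa [Complex.mul_conj] using this
    rw [cderiv_ofReal_comp (u := fun x => Complex.normSq (G x)) (g := Real.log)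
      (Real.hasDerivAt_log (by simpa using hx0)) hns]
    simp only [← Complex.mul_conj]
    rw [cderiv_mul hd hdc, cderiv_antiVec_holomorphic hx, cderiv_conj hd, conjVec_antiVec,
      cderiv_holVec_holomorphic hx]
    have hc0 : conj (G x) ≠ 0 := by simpa using hx0
    push_cast
    rw [← Complex.mul_conj, map_div₀]
    field_simp
    ring
  have hH : DifferentiableAt ℂ (fun x => fderiv ℂ G x v / G x) p := by
    have h1 : DifferentiableAt ℂ (fderiv ℂ G) p :=
      (hG.fderiv_right (m := 1) (by simp)).differentiableAt (by norm_num)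
    simp only [div_eq_mul_inv]
    exact (h1.clm_apply (differentiableAt_const v)).mul
      ((hG.differentiableAt (by simp)).fun_inv h0)
  have : (leviForm (fun x => Real.log (Complex.normSq (G x))) p v : ℂ) = 0 := by
    rw [leviForm_eq (contDiffAt_log_normSq (hGr.of_le (by simp)) h0), cderiv_congr e,
      cderiv_holVec_conj_holomorphic hH]
  exact_mod_cast this

end Levi

/-! ### Invariance of the Bochner term under changes of coordinates and frame -/

section Pullback

variable {n : ℕ} {w w' : Cn n [⋀^Fin 2]→L[ℝ] ℝ} {A : Cn n →ₗ[ℂ] Cn n} {G : ℂ}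

/-- The matrix whose rows are the images of the standard basis. -/
def rowMat (A : Cn n →ₗ[ℂ] Cn n) : Matrix (Fin n) (Fin n) ℂ := Matrix.of fun j => A (unitVec j)

lemma rowMat_det (A : Cn n →ₗ[ℂ] Cn n) : (rowMat A).det = LinearMap.det A := by
  have : rowMat A = (LinearMap.toMatrix' A).transpose := by
    ext i j
    simp [rowMat, LinearMap.toMatrix'_apply, unitVec]
  rw [this, Matrix.det_transpose, LinearMap.det_toMatrix']

lemma det_ne_zero_of_injective (hA : Function.Injective A) : LinearMap.det A ≠ 0 := by
  intro h
  have hb := LinearMap.injective_iff_surjective.1 hA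
  have hu := (LinearEquiv.ofBijective A ⟨hA, hb⟩).isUnit_det'
  have e : ((LinearEquiv.ofBijective A ⟨hA, hb⟩ : Cn n ≃ₗ[ℂ] Cn n) : Cn n →ₗ[ℂ] Cn n) = A := by
    ext; rfl
  rw [e, h] at hu
  exact not_isUnit_zero hu

lemma IsPositiveOneOne.comp (hw' : IsPositiveOneOne w') (hA : Function.Injective A)
    (h : ∀ u v, w ![u, v] = w' ![A u, A v]) : IsPositiveOneOne w :=
  ⟨fun u v => by rw [h, h, map_smul, map_smul, hw'.typeOneOne], fun v hv => by
    rw [h, map_smul]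
    exact hw'.pos _ fun h0 => hv (hA (h0.trans (map_zero A).symm))⟩

lemma hermMat_pullback (hw' : IsPositiveOneOne w')
    (h : ∀ u v, w ![u, v] = w' ![A u, A v]) :
    hermMat w = rowMat A * hermMat w' * (rowMat A).conjTranspose := by
  ext j l
  have e : hermMat w j l = hermForm w' (A (unitVec j)) (A (unitVec l)) := by
    simp only [hermMat, hermForm, h, map_smul, unitVec]
  rw [e, hw'.hermForm_eq_sum, Matrix.mul_apply]
  simp only [Matrix.mul_apply, Finset.sum_mul, Matrix.conjTranspose_apply, RCLike.star_def]
  rw [Finset.sum_comm]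
  refine Finset.sum_congr rfl fun a _ => Finset.sum_congr rfl fun b _ => ?_
  simp only [rowMat, Matrix.of_apply]
  ring

lemma det_hermMat_pullback (hw' : IsPositiveOneOne w')
    (h : ∀ u v, w ![u, v] = w' ![A u, A v]) :
    (hermMat w).det.re = Complex.normSq (LinearMap.det A) * (hermMat w').det.re := by
  rw [hermMat_pullback hw' h, Matrix.det_mul, Matrix.det_mul, Matrix.det_conjTranspose,
    rowMat_det, ← hw'.ofReal_det_re, Complex.ofReal_re, mul_right_comm]
  have : LinearMap.det A * star (LinearMap.det A) = (Complex.normSq (LinearMap.det A) : ℂ) :=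
    Complex.mul_conj _
  rw [this]
  norm_cast

lemma topCoeff_pullback {y y' : Cn n [⋀^Fin n]→L[ℝ] ℂ}
    (hy : ∀ v, y v = G * y' fun i => A (v i)) :
    topCoeff y = G * LinearMap.det A * topCoeff y' := by
  have h := cext_comp_partVec y' y A (fun v => map_smul A _ v) G hy (fun _ => false) unitVec
  have e := alternating_holVec_frame (cext y') (rowMat A)
  rw [rowMat_det] at e
  rw [topCoeff, topCoeff, mul_assoc, ← e]
  exact h

lemma antiCoeff_pullback {f f' : Cn n [⋀^Fin (n + 1)]→L[ℝ] ℂ}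
    (hf : ∀ v, f v = G * f' fun i => A (v i)) (a : Fin n) :
    antiCoeff f a = G * LinearMap.det A * ∑ b, conj (rowMat A a b) * antiCoeff f' b := by
  have h := cext_comp_partVec f' f A (fun v => map_smul A _ v) G hf (Fin.cons true fun _ => false)
    (Fin.cons (unitVec a) unitVec)
  rw [partVec_cons] at h
  have e1 : (fun i => A ((Fin.cons (unitVec a) unitVec : Fin (n + 1) → Cn n) i)) =
      Fin.cons (A (unitVec a)) fun j => A (unitVec j) := by
    ext i : 1
    induction i using Fin.cases <;> rfl
  have e2 : (fun i => partVec ((Fin.cons true fun _ => false : Fin (n + 1) → Bool) i)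
      (A ((Fin.cons (unitVec a) unitVec : Fin (n + 1) → Cn n) i))) =
      Fin.cons (antiVec (A (unitVec a))) fun j => holVec (A (unitVec j)) := by
    rw [← partVec_cons, ← e1]
  have e := cext_cons_frame f' (rowMat A) a
  rw [rowMat_det] at e
  rw [antiCoeff, h, e2, mul_assoc, ← e]
  rfl

/-- The factors `det A` and `G` express that the dual vector takes its values in `K_X ⊗ L`. Both
sides have the same product with an invertible matrix. -/
lemma dualVec_pullback (hw' : IsPositiveOneOne w') (hA : Function.Injective A)
    (h : ∀ u v, w ![u, v] = w' ![A u, A v]) {f f' : Cn n [⋀^Fin (n + 1)]→L[ℝ] ℂ}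
    (hf : ∀ v, f v = G * f' fun i => A (v i)) :
    A (dualVec w f) = (G * LinearMap.det A) • dualVec w' f' := by
  have hw := hw'.comp hA h
  have hd : IsUnit (hermMat w' * (rowMat A).conjTranspose).det := by
    rw [Matrix.det_mul, Matrix.det_conjTranspose, rowMat_det]
    exact isUnit_iff_ne_zero.2 (mul_ne_zero hw'.det_hermMat_ne_zero
      (star_ne_zero.2 (det_ne_zero_of_injective hA)))
  have hAV : A (dualVec w f) = Matrix.vecMul (dualVec w f) (rowMat A) := by
    conv_lhs => rw [← sum_smul_single (dualVec w f)]
    ext l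
    simp [map_sum, Matrix.vecMul, dotProduct, rowMat, unitVec, Finset.sum_apply]
  have h1 : Matrix.vecMul (Matrix.vecMul (dualVec w f) (rowMat A))
      (hermMat w' * (rowMat A).conjTranspose) = antiCoeff f := by
    rw [Matrix.vecMul_vecMul, ← Matrix.mul_assoc, ← hermMat_pullback hw' h]
    ext b
    rw [antiCoeff_eq_sum hw f b]; rfl
  have h2 : Matrix.vecMul ((G * LinearMap.det A) • dualVec w' f')
      (hermMat w' * (rowMat A).conjTranspose) = antiCoeff f := by
    rw [Matrix.smul_vecMul, ← Matrix.vecMul_vecMul]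
    have e : Matrix.vecMul (dualVec w' f') (hermMat w') = antiCoeff f' := by
      ext b
      rw [antiCoeff_eq_sum hw' f' b]; rfl
    rw [e]
    ext a
    rw [antiCoeff_pullback hf a]
    simp [Matrix.vecMul, dotProduct, Matrix.conjTranspose_apply, mul_comm]
  rw [hAV]
  have := congrArg (fun x => Matrix.vecMul x (hermMat w' * (rowMat A).conjTranspose)⁻¹)
    (h1.trans h2.symm)
  simp only [Matrix.vecMul_vecMul _ _ (hermMat w' * (rowMat A).conjTranspose)⁻¹,
    Matrix.mul_nonsing_inv _ hd, Matrix.vecMul_one] at this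
  exact this

/-- Every term quadratic in the dual vector acquires `|G|² |det A|²`. Here `|det A|²` is absorbed by
the determinant of the metric and `|G|²` by the weight `e^{-φ}`. -/
lemma bochnerTerm_pullback (hw' : IsPositiveOneOne w') (hA : Function.Injective A)
    (h : ∀ u v, w ![u, v] = w' ![A u, A v]) (hG : G ≠ 0) {f f' : Cn n [⋀^Fin (n + 1)]→L[ℝ] ℂ}
    (hf : ∀ v, f v = G * f' fun i => A (v i)) {df df' : Cn n [⋀^Fin (n + 2)]→L[ℝ] ℂ}
    (hdf : ∀ v, df v = G * df' fun i => A (v i)) {y y' : Cn n [⋀^Fin n]→L[ℝ] ℂ}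
    (hy : ∀ v, y v = G * y' fun i => A (v i)) {φ φ' g g' : Cn n → ℝ} {p p' : Cn n}
    (hφ : Real.exp (-φ p) * Complex.normSq G = Real.exp (-φ' p')) (hg : g p = g' p')
    (hlφ : ∀ v, leviForm φ p v = leviForm φ' p' (A v))
    (hlg : ∀ v, leviForm g p v = leviForm g' p' (A v))
    (hdg : ∀ v, delAt (fun x => (g x : ℂ)) p v = delAt (fun x => (g' x : ℂ)) p' (A v))
    (hφ2 : ContDiffAt ℝ 2 φ' p') (hg2 : ContDiffAt ℝ 2 g' p') :
    bochnerTerm w f df y φ g p = bochnerTerm w' f' df' y' φ' g' p' := by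
  have hin : ∀ {k : ℕ} {u u' : Cn n [⋀^Fin k]→L[ℝ] ℂ}, (∀ v, u v = G * u' fun i => A (v i)) →
      (innerForm w stdPair u u).re = Complex.normSq G * (innerForm w' stdPair u' u').re := by
    intro k u u' hu
    rw [hw'.innerForm_comp w A hA h u' u u' u G G hu hu, Complex.mul_conj]
    simp
  have hdA := det_ne_zero_of_injective hA
  have hdel : ∀ c v, delAt (fun x => (g' x : ℂ)) p' (c • v) =
      c * delAt (fun x => (g' x : ℂ)) p' v := fun c v =>
    (delLM (fun x => (g' x : ℂ)) p').map_smul c v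
  have hdel' : (topCoeff y * conj (delAt (fun x => (g x : ℂ)) p (dualVec w f))).re =
      Complex.normSq (G * LinearMap.det A) *
        (topCoeff y' * conj (delAt (fun x => (g' x : ℂ)) p' (dualVec w' f'))).re := by
    rw [hdg, dualVec_pullback hw' hA h hf, hdel, topCoeff_pullback hy]
    have e : G * LinearMap.det A * topCoeff y' * conj (G * LinearMap.det A *
        delAt (fun x => (g' x : ℂ)) p' (dualVec w' f')) =
        (Complex.normSq (G * LinearMap.det A) : ℂ) *
          (topCoeff y' * conj (delAt (fun x => (g' x : ℂ)) p' (dualVec w' f'))) := by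
      rw [← Complex.mul_conj, map_mul conj (G * LinearMap.det A)]
      ring
    rw [e, Complex.re_ofReal_mul]
  rw [bochnerTerm, bochnerTerm, hin hy, hin hdf, hdel', hlφ, hlg, dualVec_pullback hw' hA h hf,
    leviForm_smul_vec hφ2, leviForm_smul_vec hg2, ← hφ, hg, det_hermMat_pullback hw' h, map_mul]
  have h1 : Complex.normSq G ≠ 0 := by simpa using hG
  have h2 : Complex.normSq (LinearMap.det A) ≠ 0 := by simpa using hdA
  have h3 := hw'.det_re_pos.ne'
  field_simp

end Pullback

/-! ### The Kähler form and `∂̄` in arbitrary charts -/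

section Manifold

variable {n : ℕ} {X : Type*} [TopologicalSpace X] [ChartedSpace (Cn n) X]
  [IsManifold 𝓘(ℂ, Cn n) ω X]
  {L : X → Type*} [TopologicalSpace (TotalSpace ℂ L)] [∀ x, TopologicalSpace (L x)]
  [∀ x, AddCommGroup (L x)] [∀ x, Module ℂ (L x)] [FiberBundle ℂ L] [VectorBundle ℂ ℂ L]

lemma localScalarForm_central (K : KahlerForm n X) (x₀ : X) (p u v : Cn n) :
    localScalarForm K.form x₀ p ![u, v] = K.form (pt x₀ p)
      ![toTangentLM x₀ (pt x₀ p) u, toTangentLM x₀ (pt x₀ p) v] := by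
  rw [localScalarForm, ContinuousAlternatingMap.compContinuousLinearMap_apply]
  congr 1
  ext i : 1
  fin_cases i <;> rfl

lemma KahlerForm.isPositiveOneOne_local (K : KahlerForm n X) {x₀ : X} {p : Cn n}
    (hp : p ∈ (chartAt (Cn n) x₀).target) : IsPositiveOneOne (localScalarForm K.form x₀ p) :=
  (K.isPositiveOneOne _).comp (toTangentLM_injective (pt_mem_source hp))
    (localScalarForm_central K x₀ p)

lemma chartChange_pt (x₀ : X) (p : Cn n) :
    chartChange x₀ (pt x₀ p) p = chartAt (Cn n) (pt x₀ p) (pt x₀ p) := rfl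

lemma fderiv_chartChange_pt {x₀ : X} {p : Cn n} (hp : p ∈ (chartAt (Cn n) x₀).target) (v : Cn n) :
    fderiv ℂ (chartChange x₀ (pt x₀ p)) p v = toTangentLM x₀ (pt x₀ p) v := by
  rw [← tangentCoordChange_eq hp (mem_chart_source _ _)]; rfl

/-- `KahlerForm.closed` speaks of each preferred chart at its base point only. At another point the
form is a pullback from the preferred chart of that point. -/
lemma KahlerForm.closed_local (K : KahlerForm n X) {x₀ : X} {p : Cn n}
    (hp : p ∈ (chartAt (Cn n) x₀).target) : extDeriv (localScalarForm K.form x₀) p = 0 := by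
  set q := pt x₀ p with hq
  have hqs : pt x₀ p ∈ (chartAt (Cn n) q).source := mem_chart_source _ _
  have e : localScalarForm K.form x₀ =ᶠ[nhds p] fun x =>
      (localScalarForm K.form q (chartChange x₀ q x)).compContinuousLinearMap
        (fderiv ℝ (chartChange x₀ q) x) := by
    filter_upwards [eventually_mem_target hp,
      eventually_pt_mem hp (chartAt (Cn n) q).open_source hqs] with x hx hx'
    exact localScalarForm_eq K.form hx hx'
  have hψ : ContDiffAt ℝ ω (chartChange x₀ q) p := (contDiffAt_chartChange hp hqs).restrict_scalars ℝ
  have hd : DifferentiableAt ℝ (localScalarForm K.form q) (chartChange x₀ q p) :=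
    ((K.smooth q).contDiffAt ((chartAt (Cn n) q).open_target.mem_nhds
      (mem_chart_target _ q))).differentiableAt (by simp)
  rw [e.extDeriv_eq, extDeriv_pullback hd hψ (by simp)]
  have : chartChange x₀ q p = chartAt (Cn n) q q := rfl
  rw [this, K.closed q]
  ext v
  simp

variable (L) in
/-- The part of the chart at `x₀` over which the frame at `x₀` is defined. -/
def goodSet (x₀ : X) : Set (Cn n) :=
  {p | p ∈ (chartAt (Cn n) x₀).target ∧ pt x₀ p ∈ (trivializationAt ℂ L x₀).baseSet}

lemma isOpen_goodSet (x₀ : X) : IsOpen (goodSet (n := n) L x₀) :=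
  (chartAt (Cn n) x₀).isOpen_inter_preimage_symm (trivializationAt ℂ L x₀).open_baseSet

lemma mem_goodSet_self (x : X) : chartAt (Cn n) x x ∈ goodSet (n := n) L x :=
  ⟨mem_chart_target _ x, by rw [pt_chartAt]; exact mem_baseSet_trivializationAt ℂ L x⟩

/-- `dbar` is defined at each point by the chart and the frame of that point. The chart change is a
pullback, which commutes with `d`, and the transition function is holomorphic, so that
`extDeriv_smul_holomorphic` applies. -/
lemma localForm_dbar [ContMDiffVectorBundle ω ℂ L 𝓘(ℂ, Cn n)] {k b : ℕ} {ξ : LForm n L k}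
    (hs : IsSmoothForm ξ) (hty : ∀ x, IsOfType n b (ξ x)) {x₀ : X} {p : Cn n}
    (hp : p ∈ goodSet L x₀) :
    localForm (dbar ξ) x₀ p = extDeriv (localForm ξ x₀) p := by
  obtain ⟨hpt, hp₀⟩ := hp
  set q := pt x₀ p with hq
  have hqs : pt x₀ p ∈ (chartAt (Cn n) q).source := mem_chart_source _ _
  have hqb : pt x₀ p ∈ (trivializationAt ℂ L q).baseSet := mem_baseSet_trivializationAt ℂ L _
  have e : localForm ξ x₀ =ᶠ[nhds p] fun x => frameChange L x₀ q x •
      (localForm ξ q (chartChange x₀ q x)).compContinuousLinearMap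
        (fderiv ℝ (chartChange x₀ q) x) := by
    filter_upwards [eventually_mem_target hpt,
      eventually_pt_mem hpt (chartAt (Cn n) q).open_source hqs,
      eventually_pt_mem hpt (trivializationAt ℂ L q).open_baseSet hqb] with x hx hx' hx''
    exact localForm_eq ξ hx hx' hx''
  have hψ : ContDiffAt ℝ ω (chartChange x₀ q) p :=
    (contDiffAt_chartChange hpt hqs).restrict_scalars ℝ
  have hsq : ContDiffAt ℝ ∞ (localForm ξ q) (chartChange x₀ q p) :=
    (hs q).contDiffAt ((isOpen_goodSet q).mem_nhds (mem_goodSet_self q))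
  have hG : DifferentiableAt ℂ (frameChange (n := n) L x₀ q) p :=
    (contDiffAt_frameChange hpt hp₀ hqb).differentiableAt (by simp)
  have hψ' : DifferentiableAt ℝ (fderiv ℝ (chartChange x₀ q)) p :=
    (hψ.fderiv_right (m := 1) (by simp)).differentiableAt (by norm_num)
  have hpull : DifferentiableAt ℝ (fun x => (localForm ξ q
      (chartChange x₀ q x)).compContinuousLinearMap (fderiv ℝ (chartChange x₀ q) x)) p := by
    have h1 : DifferentiableAt ℝ (fun x => localForm ξ q (chartChange x₀ q x)) p :=
      (hsq.differentiableAt (by simp)).comp p (hψ.differentiableAt (by simp))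
    exact h1.continuousAlternatingMapCompContinuousLinearMap hψ'
  have hty' : IsOfType n b ((localForm ξ q
      (chartChange x₀ q p)).compContinuousLinearMap (fderiv ℝ (chartChange x₀ q) p)) := by
    have h1 : IsOfType n b (localForm ξ q (chartChange x₀ q p)) := localForm_isOfType (hty _)
    refine ⟨h1.1, fun c v => ?_⟩
    rw [fderiv_real_chartChange hpt hqs]
    simp only [ContinuousAlternatingMap.compContinuousLinearMap_apply]
    rw [← h1.2]
    congr 1
    ext i : 1
    simp
  rw [e.extDeriv_eq, extDeriv_smul_holomorphic hG hpull hty',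
    extDeriv_pullback (hsq.differentiableAt (by simp)) hψ (by simp)]
  ext v
  rw [localForm_apply, fibreCoord_eq_frameChange x₀ hqb]
  simp only [ContinuousAlternatingMap.smul_apply, smul_eq_mul,
    ContinuousAlternatingMap.compContinuousLinearMap_apply, dbar]
  congr 1
  rw [fderiv_real_chartChange hpt hqs]
  have key : ∀ z : ℂ, fibreCoord L q q ((trivializationAt ℂ L q).symmL ℂ q z) = z := fun z =>
    (trivializationAt ℂ L q).continuousLinearMapAt_symmL (R := ℂ) hqb z
  refine (key _).trans ?_
  change extDeriv (localForm ξ q) (chartChange x₀ q p) _ = _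
  congr 1
  ext i : 1
  exact (fderiv_chartChange_pt hpt (v i)).symm

end Manifold

/-! ### Smooth functions, weights and curvature in arbitrary charts -/

section Weights

variable {n : ℕ} {X : Type*} [TopologicalSpace X] [ChartedSpace (Cn n) X]
  [IsManifold 𝓘(ℂ, Cn n) ω X]

variable (n X) in
/-- The smooth real manifold underlying a complex manifold. -/
lemma isManifold_real : IsManifold 𝓘(ℝ, Cn n) ∞ X := by
  refine isManifold_of_contDiffOn _ _ _ fun e e' he he' => ?_
  have h := (contDiffGroupoid ω 𝓘(ℂ, Cn n)).compatible he he'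
  rw [contDiffGroupoid, mem_groupoid_of_pregroupoid] at h
  exact (ContDiffOn.restrict_scalars ℝ h.1).of_le (by simp)

/-- A real function on `X` which is smooth in the charts. -/
def IsSmoothFun (g : X → ℝ) : Prop :=
  ∀ x : X, ContDiffAt ℝ ∞ (fun p => g (pt x p)) (chartAt (Cn n) x x)

/-- Smoothness is required at the base points of the preferred charts only; chart changes carry it
to all points of a chart. -/
lemma IsSmoothFun.contDiffAt {g : X → ℝ} (hg : IsSmoothFun (n := n) g) {x₀ : X} {p : Cn n}
    (hp : p ∈ (chartAt (Cn n) x₀).target) : ContDiffAt ℝ ∞ (fun p => g (pt x₀ p)) p := by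
  have hq : pt x₀ p ∈ (chartAt (Cn n) (pt x₀ p)).source := mem_chart_source _ _
  have hψ : ContDiffAt ℝ ∞ (chartChange x₀ (pt x₀ p)) p :=
    ((contDiffAt_chartChange hp hq).restrict_scalars ℝ).of_le (by simp)
  have h : ContDiffAt ℝ ∞ (fun p' => g (pt (pt x₀ p) (chartChange x₀ (pt x₀ p) p'))) p :=
    ContDiffAt.comp (g := fun p' => g (pt (pt x₀ p) p')) p (hg (pt x₀ p)) hψ
  refine h.congr_of_eventuallyEq ?_
  filter_upwards [eventually_pt_mem hp (chartAt (Cn n) (pt x₀ p)).open_source hq] with p' hp'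
  rw [pt_chartChange hp']

lemma IsSmoothFun.mul {f g : X → ℝ} (hf : IsSmoothFun (n := n) f) (hg : IsSmoothFun (n := n) g) :
    IsSmoothFun (n := n) fun x => f x * g x := fun x => (hf x).mul (hg x)

lemma IsSmoothFun.comp {f : ℝ → ℝ} {g : X → ℝ} (hg : IsSmoothFun (n := n) g)
    (hf : ∀ x, ContDiffAt ℝ ∞ f (g x)) : IsSmoothFun (n := n) fun x => f (g x) := fun x => by
  refine ContDiffAt.comp _ ?_ (hg x)
  rw [pt_chartAt]
  exact hf x

lemma leviForm_comp_pt {g : X → ℝ} (hg : IsSmoothFun (n := n) g) {x₀ : X} {p : Cn n}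
    (hp : p ∈ (chartAt (Cn n) x₀).target) (v : Cn n) :
    leviForm (fun p => g (pt x₀ p)) p v =
      leviForm (fun p' => g (pt (pt x₀ p) p')) (chartAt (Cn n) (pt x₀ p) (pt x₀ p))
        (toTangentLM x₀ (pt x₀ p) v) := by
  have hq : pt x₀ p ∈ (chartAt (Cn n) (pt x₀ p)).source := mem_chart_source _ _
  rw [← fderiv_chartChange_pt hp, ← chartChange_pt x₀ p, ← leviForm_comp
    (contDiffAt_chartChange hp hq) ((hg _).of_le (by norm_cast))]
  refine leviForm_congr ?_ v
  filter_upwards [eventually_pt_mem hp (chartAt (Cn n) (pt x₀ p)).open_source hq] with p' hp'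
  rw [pt_chartChange hp']

lemma delAt_comp_pt {g : X → ℝ} (hg : IsSmoothFun (n := n) g) {x₀ : X} {p : Cn n}
    (hp : p ∈ (chartAt (Cn n) x₀).target) (v : Cn n) :
    delAt (fun p => (g (pt x₀ p) : ℂ)) p v =
      delAt (fun p' => (g (pt (pt x₀ p) p') : ℂ)) (chartAt (Cn n) (pt x₀ p) (pt x₀ p))
        (toTangentLM x₀ (pt x₀ p) v) := by
  have hq : pt x₀ p ∈ (chartAt (Cn n) (pt x₀ p)).source := mem_chart_source _ _
  rw [← cderiv_holVec, ← cderiv_holVec, ← fderiv_chartChange_pt hp, ← chartChange_pt x₀ p,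
    ← cderiv_holVec_comp (Φ := fun p' => (g (pt (pt x₀ p) p') : ℂ))
      ((contDiffAt_chartChange hp hq).differentiableAt (by simp))
      ((contDiffAt_ofReal (hg (pt x₀ p))).differentiableAt (by simp))]
  refine cderiv_congr ?_
  filter_upwards [eventually_pt_mem hp (chartAt (Cn n) (pt x₀ p)).open_source hq] with p' hp'
  rw [pt_chartChange hp']

variable {L : X → Type*} [TopologicalSpace (TotalSpace ℂ L)] [∀ x, TopologicalSpace (L x)]
  [∀ x, AddCommGroup (L x)] [∀ x, Module ℂ (L x)] [FiberBundle ℂ L] [VectorBundle ℂ ℂ L]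

namespace HermitianMetric

variable (h : HermitianMetric (n := n) L)

lemma exp_neg_weight {x₀ : X} {p : Cn n} (hp : pt x₀ p ∈ (trivializationAt ℂ L x₀).baseSet) :
    Real.exp (-h.weight x₀ p) = h.normSq (pt x₀ p) (frame L x₀ (pt x₀ p)) := by
  rw [weight, neg_neg, Real.exp_log (h.normSq_frame_pos x₀ hp)]

lemma weight_eq {x₀ x₁ : X} {p : Cn n} (h : HermitianMetric (n := n) L)
    (h₀ : pt x₀ p ∈ (trivializationAt ℂ L x₀).baseSet)
    (h₁ : pt x₀ p ∈ (trivializationAt ℂ L x₁).baseSet)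
    (hs : pt x₀ p ∈ (chartAt (Cn n) x₁).source) :
    h.weight x₀ p = h.weight x₁ (chartChange x₀ x₁ p) +
      Real.log (Complex.normSq (frameChange L x₀ x₁ p)) := by
  have hG := frameChange_ne_zero h₀ h₁
  rw [weight, weight, pt_chartChange hs, h.normSq_eq x₀ h₀ (frame L x₁ (pt x₀ p)),
    Real.log_mul (h.normSq_frame_pos x₀ h₀).ne' (by simpa using! hG)]
  simp only [frameChange]
  ring

lemma contDiffAt_weight {x₀ : X} {p : Cn n} (hp : p ∈ goodSet L x₀) :
    ContDiffAt ℝ ∞ (h.weight x₀) p := by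
  have := isManifold_real n X
  have hpt : ContMDiffAt 𝓘(ℝ, Cn n) 𝓘(ℝ, Cn n) ∞ (pt x₀) p :=
    (contMDiffOn_chart_symm (I := 𝓘(ℝ, Cn n)) (n := ∞) (x := x₀)).contMDiffAt
      ((chartAt (Cn n) x₀).open_target.mem_nhds hp.1)
  have h1 : ContMDiffAt 𝓘(ℝ, Cn n) 𝓘(ℝ, ℝ) ∞
      (fun q => h.normSq q (frame L x₀ q)) (pt x₀ p) :=
    (h.smooth x₀).contMDiffAt ((trivializationAt ℂ L x₀).open_baseSet.mem_nhds hp.2)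
  have h2 : ContDiffAt ℝ ∞ (fun p => h.normSq (pt x₀ p) (frame L x₀ (pt x₀ p))) p :=
    (ContMDiffAt.comp p h1 hpt).contDiffAt
  exact (h2.log (h.normSq_frame_pos x₀ hp.2).ne').neg

variable [ContMDiffVectorBundle ω ℂ L 𝓘(ℂ, Cn n)]

/-- Two weights differ by `log |G|²` with `G` holomorphic and without zeros, which has no Levi form.
Hence the curvature does not depend on the frame. -/
lemma leviForm_weight {x₀ : X} {p : Cn n} (hp : p ∈ goodSet L x₀) (v : Cn n) :
    leviForm (h.weight x₀) p v = h.curvature (pt x₀ p) (toTangentLM x₀ (pt x₀ p) v) := by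
  have hq : pt x₀ p ∈ (chartAt (Cn n) (pt x₀ p)).source := mem_chart_source _ _
  have hb : pt x₀ p ∈ (trivializationAt ℂ L (pt x₀ p)).baseSet := mem_baseSet_trivializationAt ℂ L _
  have hψ := contDiffAt_chartChange hp.1 hq
  have hw : ContDiffAt ℝ 2 (h.weight (pt x₀ p)) (chartChange x₀ (pt x₀ p) p) :=
    (h.contDiffAt_weight (mem_goodSet_self _)).of_le (by norm_cast)
  have hG := contDiffAt_frameChange (L := L) hp.1 hp.2 hb
  have hG0 := frameChange_ne_zero hp.2 hb
  have e : h.weight x₀ =ᶠ[nhds p] fun p' => h.weight (pt x₀ p) (chartChange x₀ (pt x₀ p) p') +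
      Real.log (Complex.normSq (frameChange L x₀ (pt x₀ p) p')) := by
    filter_upwards [eventually_pt_mem hp.1 (chartAt (Cn n) (pt x₀ p)).open_source hq,
      eventually_pt_mem hp.1 (trivializationAt ℂ L (pt x₀ p)).open_baseSet hb,
      eventually_pt_mem hp.1 (trivializationAt ℂ L x₀).open_baseSet hp.2] with p' h1 h2 h3
    exact h.weight_eq h3 h2 h1
  rw [leviForm_congr e, leviForm_add (φ := fun p' => h.weight (pt x₀ p) (chartChange x₀ (pt x₀ p) p'))
    (hw.comp p ((hψ.restrict_scalars ℝ).of_le (by simp)))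
    (contDiffAt_log_normSq ((hG.restrict_scalars ℝ).of_le (by simp)) hG0),
    leviForm_log_normSq hG hG0, add_zero, leviForm_comp hψ hw, fderiv_chartChange_pt hp.1]
  rfl

end HermitianMetric

lemma innerForm_local (K : KahlerForm n X) (h : HermitianMetric (n := n) L) {x₀ : X} {p : Cn n}
    (hp : p ∈ goodSet L x₀) {k : ℕ} (u v : LForm n L k) :
    innerForm (K.form (pt x₀ p)) (h.pair (pt x₀ p)) (u (pt x₀ p)) (v (pt x₀ p)) =
      (Real.exp (-h.weight x₀ p) : ℂ) *
        innerForm (localScalarForm K.form x₀ p) stdPair (localForm u x₀ p) (localForm v x₀ p) := by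
  rw [innerForm_pair h _ x₀ hp.2, h.exp_neg_weight hp.2]
  congr 1
  have key := (K.isPositiveOneOne (pt x₀ p)).innerForm_comp (localScalarForm K.form x₀ p)
    (toTangentLM x₀ (pt x₀ p)) (toTangentLM_injective (pt_mem_source hp.1))
    (localScalarForm_central K x₀ p)
    (((fibreCoord L x₀ (pt x₀ p)).restrictScalars ℝ).compContinuousAlternatingMap (u (pt x₀ p)))
    (localForm u x₀ p)
    (((fibreCoord L x₀ (pt x₀ p)).restrictScalars ℝ).compContinuousAlternatingMap (v (pt x₀ p)))
    (localForm v x₀ p) 1 1 (fun _ => (one_mul _).symm) (fun _ => (one_mul _).symm)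
  rw [key, map_one, mul_one, one_mul]
  rfl

/-- The integrand of the Bochner inequality at a point of `X`. -/
def bochnerAt (K : KahlerForm n X) (h : HermitianMetric (n := n) L) (ξ : LForm n L (n + 1))
    (η : LForm n L n) (g : X → ℝ) (x : X) : ℝ :=
  bochnerTerm (K.form x) (centralForm ξ x) (centralForm (dbar ξ) x) (centralForm η x)
    (h.weight x) (fun p => g (pt x p)) (chartAt (Cn n) x x)

/-- `bochnerAt` is defined at each point by the chart and the frame of that point. In a fixed chart
it becomes an expression in the local data, to which the inequality in `ℂⁿ` applies. -/
lemma bochnerAt_pt [ContMDiffVectorBundle ω ℂ L 𝓘(ℂ, Cn n)] (K : KahlerForm n X)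
    (h : HermitianMetric (n := n) L) (ξ : LForm n L (n + 1)) (η : LForm n L n) {g : X → ℝ}
    (hg : IsSmoothFun (n := n) g) {x₀ : X} {p : Cn n} (hp : p ∈ goodSet L x₀) :
    bochnerAt K h ξ η g (pt x₀ p) = bochnerTerm (localScalarForm K.form x₀ p) (localForm ξ x₀ p)
      (localForm (dbar ξ) x₀ p) (localForm η x₀ p) (h.weight x₀) (fun p => g (pt x₀ p)) p := by
  have hb : pt x₀ p ∈ (trivializationAt ℂ L (pt x₀ p)).baseSet := mem_baseSet_trivializationAt ℂ L _
  have hq : pt x₀ p ∈ (chartAt (Cn n) (pt x₀ p)).source := mem_chart_source _ _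
  have hG0 := frameChange_ne_zero hp.2 hb
  refine (bochnerTerm_pullback (K.isPositiveOneOne _)
    (toTangentLM_injective (pt_mem_source hp.1)) (localScalarForm_central K x₀ p) hG0
    (localForm_eq_central ξ x₀ p) (localForm_eq_central (dbar ξ) x₀ p)
    (localForm_eq_central η x₀ p) ?_ ?_ ?_ ?_ ?_ ?_ ?_).symm
  · rw [h.weight_eq hp.2 hb hq, neg_add, Real.exp_add, Real.exp_neg (Real.log _),
      Real.exp_log (by simpa [Complex.normSq_pos] using hG0), chartChange_pt]
    have : Complex.normSq (frameChange L x₀ (pt x₀ p) p) ≠ 0 := by simpa using hG0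
    field_simp
  · rw [pt_chartAt]
  · exact h.leviForm_weight hp
  · exact leviForm_comp_pt hg hp.1
  · exact delAt_comp_pt hg hp.1
  · exact (h.contDiffAt_weight (mem_goodSet_self _)).of_le (by norm_cast)
  · exact (hg _).of_le (by norm_cast)

end Weights

/-! ### The volume measure in charts -/

section Volume

variable {n : ℕ} {X : Type*} [TopologicalSpace X] [ChartedSpace (Cn n) X]
  [IsManifold 𝓘(ℂ, Cn n) ω X]

/-- The density of the Kähler volume in the chart at `x₀`. -/
def volDensity (K : KahlerForm n X) (x₀ : X) (p : Cn n) : ℝ :=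
  (hermMat (localScalarForm K.form x₀ p)).det.re

lemma volDensity_pos (K : KahlerForm n X) {x₀ : X} {p : Cn n}
    (hp : p ∈ (chartAt (Cn n) x₀).target) : 0 < volDensity K x₀ p :=
  (K.isPositiveOneOne_local hp).det_re_pos

lemma sqrt_det_gram_eq (K : KahlerForm n X) {x₀ : X} {p : Cn n}
    (hp : p ∈ (chartAt (Cn n) x₀).target) :
    Real.sqrt (gram (localScalarForm K.form x₀ p)).det = volDensity K x₀ p := by
  rw [volDensity, ← (K.isPositiveOneOne_local hp).sqrt_det_gram, Complex.ofReal_re]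

lemma KahlerForm.contDiffAt_local (K : KahlerForm n X) {x₀ : X} {p : Cn n}
    (hp : p ∈ (chartAt (Cn n) x₀).target) : ContDiffAt ℝ ∞ (localScalarForm K.form x₀) p :=
  (K.smooth x₀).contDiffAt ((chartAt (Cn n) x₀).open_target.mem_nhds hp)

lemma contDiffAt_volDensity (K : KahlerForm n X) {x₀ : X} {p : Cn n}
    (hp : p ∈ (chartAt (Cn n) x₀).target) : ContDiffAt ℝ ∞ (volDensity K x₀) p :=
  contDiffAt_re (contDiffAt_matrix_det fun i j => contDiffAt_hermMat (K.contDiffAt_local hp) i j)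

/-- The real Jacobian determinant of a holomorphic map is the squared modulus of the complex one, by
which `det H` is multiplied. -/
lemma volDensity_chartChange (K : KahlerForm n X) {x₀ x₁ : X} {p : Cn n}
    (hp : p ∈ (chartAt (Cn n) x₀).target) (h : pt x₀ p ∈ (chartAt (Cn n) x₁).source) :
    volDensity K x₀ p = |(fderiv ℝ (chartChange x₀ x₁) p).det| *
      volDensity K x₁ (chartChange x₀ x₁ p) := by
  have ht : chartChange x₀ x₁ p ∈ (chartAt (Cn n) x₁).target := (chartAt (Cn n) x₁).map_source h
  have e : |(fderiv ℝ (chartChange x₀ x₁) p).det| =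
      Complex.normSq (LinearMap.det (fderiv ℂ (chartChange x₀ x₁) p).toLinearMap) := by
    rw [fderiv_real_chartChange hp h, ← Algebra.norm_complex_apply, ← LinearMap.det_restrictScalars]
    have h0 : 0 ≤ LinearMap.det ((fderiv ℂ (chartChange x₀ x₁) p).toLinearMap.restrictScalars ℝ) := by
      rw [LinearMap.det_restrictScalars, Algebra.norm_complex_apply]
      exact Complex.normSq_nonneg _
    exact abs_of_nonneg h0
  rw [e, volDensity, volDensity]
  refine det_hermMat_pullback (K.isPositiveOneOne_local ht) fun u v => ?_
  rw [localScalarForm_eq K.form hp h, fderiv_real_chartChange hp h,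
    ContinuousAlternatingMap.compContinuousLinearMap_apply]
  congr 1
  ext i : 1
  fin_cases i <;> rfl

variable [MeasurableSpace X] [BorelSpace X]

lemma aemeasurable_pt (x₀ : X) (ρ : Cn n → ENNReal) :
    AEMeasurable (pt x₀) ((volume.restrict (chartAt (Cn n) x₀).target).withDensity ρ) :=
  ((chartAt (Cn n) x₀).continuousOn_symm.aemeasurable
    (chartAt (Cn n) x₀).open_target.measurableSet).mono_ac (withDensity_absolutelyContinuous _ _)

lemma measurableSet_pt_preimage (x₀ : X) {s : Set X} (hs : MeasurableSet s) :
    MeasurableSet ((chartAt (Cn n) x₀).target ∩ pt x₀ ⁻¹' s) := by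
  have h1 : Measurable ((chartAt (Cn n) x₀).target.domRestrict (pt x₀)) :=
    (chartAt (Cn n) x₀).continuousOn_symm.domRestrict.measurable
  have := (MeasurableEmbedding.subtype_coe
    (chartAt (Cn n) x₀).open_target.measurableSet).measurableSet_image.2 (h1 hs)
  convert! this using 1
  ext p
  simp [Set.domRestrict]
  tauto

lemma chartVolume_eq_map (K : KahlerForm n X) (x₀ : X) :
    chartVolume K x₀ = Measure.map (pt x₀) ((volume.restrict
      (chartAt (Cn n) x₀).target).withDensity fun p => ENNReal.ofReal (volDensity K x₀ p)) := by
  rw [chartVolume]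
  congr 1
  refine withDensity_congr_ae ?_
  filter_upwards [ae_restrict_mem (chartAt (Cn n) x₀).open_target.measurableSet] with p hp
  rw [sqrt_det_gram_eq K hp]

lemma chartVolume_apply (K : KahlerForm n X) (x₀ : X) {s : Set X} (hs : MeasurableSet s) :
    chartVolume K x₀ s = ∫⁻ p in (chartAt (Cn n) x₀).target ∩ pt x₀ ⁻¹' s,
      ENNReal.ofReal (volDensity K x₀ p) := by
  have hm := measurableSet_pt_preimage (n := n) x₀ hs
  have ht := (chartAt (Cn n) x₀).open_target.measurableSet
  rw [chartVolume_eq_map, Measure.map_apply_of_aemeasurable (aemeasurable_pt x₀ _) hs, ← restrict_withDensity ht,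
    Measure.restrict_apply' ht, withDensity_apply' , Set.inter_comm]

lemma chartVolume_compl_source (K : KahlerForm n X) (x₀ : X) :
    chartVolume K x₀ (chartAt (Cn n) x₀).sourceᶜ = 0 := by
  rw [chartVolume_apply K x₀ (chartAt (Cn n) x₀).open_source.measurableSet.compl]
  have : (chartAt (Cn n) x₀).target ∩ pt x₀ ⁻¹' (chartAt (Cn n) x₀).sourceᶜ = ∅ := by
    ext p
    simp only [Set.mem_inter_iff, Set.mem_preimage, Set.mem_compl_iff, Set.mem_empty_iff_false,
      iff_false, not_and, not_not]
    exact pt_mem_source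
  rw [this]; simp

/-- The change of variables formula, with the Jacobian absorbed by `volDensity_chartChange`. -/
lemma chartVolume_eq (K : KahlerForm n X) (x₀ x₁ : X) {s : Set X} (hs : MeasurableSet s)
    (h₀ : s ⊆ (chartAt (Cn n) x₀).source) (h₁ : s ⊆ (chartAt (Cn n) x₁).source) :
    chartVolume K x₀ s = chartVolume K x₁ s := by
  rw [chartVolume_apply K x₀ hs, chartVolume_apply K x₁ hs]
  have e : (chartAt (Cn n) x₁).target ∩ pt x₁ ⁻¹' s =
      chartChange x₀ x₁ '' ((chartAt (Cn n) x₀).target ∩ pt x₀ ⁻¹' s) := by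
    ext p
    constructor
    · rintro ⟨hp, hps⟩
      refine ⟨chartAt (Cn n) x₀ (pt x₁ p), ⟨(chartAt (Cn n) x₀).map_source (h₀ hps), ?_⟩, ?_⟩
      · have : pt x₀ (chartAt (Cn n) x₀ (pt x₁ p)) = pt x₁ p :=
          (chartAt (Cn n) x₀).left_inv (h₀ hps)
        rw [Set.mem_preimage, this]; exact hps
      · rw [chartChange]
        have : pt x₀ (chartAt (Cn n) x₀ (pt x₁ p)) = pt x₁ p :=
          (chartAt (Cn n) x₀).left_inv (h₀ hps)
        rw [this, chartAt_pt hp]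
    · rintro ⟨p', ⟨hp', hps'⟩, rfl⟩
      refine ⟨(chartAt (Cn n) x₁).map_source (h₁ hps'), ?_⟩
      rw [Set.mem_preimage, pt_chartChange (h₁ hps')]
      exact hps'
  rw [e, lintegral_image_eq_lintegral_abs_det_fderiv_mul volume (measurableSet_pt_preimage x₀ hs)
    (f' := fderiv ℝ (chartChange x₀ x₁)) ?_ ?_]
  · refine setLIntegral_congr_fun (measurableSet_pt_preimage x₀ hs) fun p hp => ?_
    rw [volDensity_chartChange K hp.1 (h₁ hp.2), ENNReal.ofReal_mul (abs_nonneg _)]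
  · intro p hp
    exact (((contDiffAt_chartChange hp.1 (h₁ hp.2)).restrict_scalars ℝ).differentiableAt
      (by simp)).hasFDerivAt.hasFDerivWithinAt
  · intro p hp p' hp' h
    have h2 : pt x₀ p = pt x₀ p' := (chartAt (Cn n) x₁).injOn (h₁ hp.2) (h₁ hp'.2) h
    rw [← chartAt_pt hp.1, ← chartAt_pt hp'.1, h2]

/-- On the domain of a chart the volume measure is the one given by this chart. -/
lemma volMeasure_restrict_source (K : KahlerForm n X) (x₀ : X) :
    (volMeasure K).restrict (chartAt (Cn n) x₀).source = chartVolume K x₀ := by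
  have hS := (chartAt (Cn n) x₀).open_source.measurableSet
  set S := (chartAt (Cn n) x₀).source with hSdef
  -- A supremum of measures is not computed set by set. A bound by a single measure, however, may be
  -- checked for each member, and the second summand vanishes on `S`.
  have hle : volMeasure K ≤ chartVolume K x₀ + (volMeasure K).restrict Sᶜ := by
    refine iSup_le fun x₁ => Measure.le_iff.2 fun s hs => ?_
    have hS1 := (chartAt (Cn n) x₁).open_source.measurableSet
    rw [← measure_inter_add_sdiff s hS, Measure.add_apply, Measure.restrict_apply hs]
    refine add_le_add ?_ (le_iSup (chartVolume K) x₁ _)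
    rw [← measure_inter_add_sdiff (s ∩ S) hS1]
    have h0 : chartVolume K x₁ ((s ∩ S) \ (chartAt (Cn n) x₁).source) = 0 :=
      measure_mono_null (fun x hx => hx.2) (chartVolume_compl_source K x₁)
    rw [h0, add_zero, chartVolume_eq K x₁ x₀ ((hs.inter hS).inter hS1) Set.inter_subset_right
      fun x hx => hx.1.2]
    exact measure_mono fun x hx => hx.1.1
  have h1 : chartVolume K x₀ ≤ volMeasure K := le_iSup (chartVolume K) x₀
  refine le_antisymm (Measure.le_iff.2 fun s hs => ?_) (Measure.le_iff.2 fun s hs => ?_)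
  · rw [Measure.restrict_apply hs]
    refine (hle _).trans ?_
    rw [Measure.add_apply, Measure.restrict_apply (hs.inter hS)]
    have : s ∩ S ∩ Sᶜ = ∅ := by rw [Set.inter_assoc, Set.inter_compl_self, Set.inter_empty]
    rw [this, measure_empty, add_zero]
    exact measure_mono Set.inter_subset_left
  · rw [Measure.restrict_apply hs, ← measure_inter_add_sdiff s hS,
      measure_mono_null (s := s \ S) (fun x hx => hx.2) (chartVolume_compl_source K x₀), add_zero]
    exact h1 _

/-- The density is bounded on a compact neighbourhood in the chart. This is what makes continuous
functions with compact support integrable. -/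
lemma isLocallyFiniteMeasure_volMeasure (K : KahlerForm n X) :
    IsLocallyFiniteMeasure (volMeasure K) := by
  refine ⟨fun x => ?_⟩
  have hT := (chartAt (Cn n) x).open_target
  obtain ⟨C, hC, hxC, hCt⟩ := exists_compact_subset hT (mem_chart_target (Cn n) x)
  have ho : IsOpen ((chartAt (Cn n) x).source ∩ chartAt (Cn n) x ⁻¹' interior C) :=
    (chartAt (Cn n) x).isOpen_inter_preimage isOpen_interior
  refine ⟨_, ho.mem_nhds ⟨mem_chart_source _ x, hxC⟩, ?_⟩
  rw [← Set.inter_eq_self_of_subset_left (Set.inter_subset_left :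
    (chartAt (Cn n) x).source ∩ chartAt (Cn n) x ⁻¹' interior C ⊆ _),
    ← Measure.restrict_apply ho.measurableSet, volMeasure_restrict_source,
    chartVolume_apply K x ho.measurableSet]
  have hintg : IntegrableOn (volDensity K x) C :=
    ContinuousOn.integrableOn_compact hC fun p hp =>
      (contDiffAt_volDensity K (hCt hp)).continuousAt.continuousWithinAt
  refine (lintegral_mono_set ?_).trans_lt (Integrable.lintegral_lt_top hintg)
  rintro p ⟨hp, -, hpC⟩
  rw [Set.mem_preimage, chartAt_pt hp] at hpC
  exact interior_subset hpC

/-- Integration of a function supported in the domain of a chart. -/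
lemma integral_volMeasure_eq (K : KahlerForm n X) (x₀ : X) {E : Type*} [NormedAddCommGroup E]
    [NormedSpace ℝ E] [SecondCountableTopology E] {h : X → E} (hc : Continuous h)
    (h0 : ∀ x, x ∉ (chartAt (Cn n) x₀).source → h x = 0) {C : Set (Cn n)}
    (hCt : C ⊆ (chartAt (Cn n) x₀).target)
    (hC0 : ∀ p ∈ (chartAt (Cn n) x₀).target, p ∉ C → h (pt x₀ p) = 0) :
    ∫ x, h x ∂(volMeasure K) = ∫ p in C, volDensity K x₀ p • h (pt x₀ p) := by
  have ht := (chartAt (Cn n) x₀).open_target.measurableSet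
  have h1 : ∫ x, h x ∂(volMeasure K) = ∫ x, h x ∂(chartVolume K x₀) := by
    rw [← volMeasure_restrict_source, setIntegral_eq_integral_of_forall_compl_eq_zero]
    exact h0
  have hm : AEMeasurable (fun p => ENNReal.ofReal (volDensity K x₀ p))
      (volume.restrict (chartAt (Cn n) x₀).target) := by
    refine AEMeasurable.ennreal_ofReal (ContinuousOn.aemeasurable (fun p hp => ?_) ht)
    exact (contDiffAt_volDensity K hp).continuousAt.continuousWithinAt
  rw [h1, chartVolume_eq_map, integral_map (aemeasurable_pt x₀ _) hc.aestronglyMeasurable,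
    integral_withDensity_eq_integral_toReal_smul₀ hm (by simp)]
  rw [setIntegral_congr_fun (g := fun p => volDensity K x₀ p • h (pt x₀ p)) ht fun p hp => by
    simp only [ENNReal.toReal_ofReal (volDensity_pos K hp).le]]
  refine (setIntegral_eq_of_subset_of_forall_sdiff_eq_zero ht hCt fun p hp => ?_)
  rw [hC0 p hp.1 hp.2, smul_zero]

end Volume

/-! ### Test forms supported in a chart -/

section TestForms

variable {n : ℕ}

variable (n) in
/-- The form `dz₁ ∧ ⋯ ∧ dzₙ`. -/
def dzForm : Cn n [⋀^Fin n]→L[ℝ] ℂ :=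
  { (Matrix.detRowAlternating (n := Fin n) (R := ℂ)).restrictScalars ℝ with
    cont := by
      change Continuous fun v : Fin n → Fin n → ℂ => Matrix.det (Matrix.of v)
      exact Continuous.matrix_det continuous_id
    map_eq_zero_of_eq' := (Matrix.detRowAlternating (n := Fin n) (R := ℂ)).map_eq_zero_of_eq' }

lemma dzForm_apply (v : Fin n → Cn n) : dzForm n v = Matrix.det (Matrix.of v) := rfl

lemma dzForm_smul (c : Fin n → ℂ) (v : Fin n → Cn n) :
    dzForm n (fun a => c a • v a) = (∏ a, c a) * dzForm n v :=
  MultilinearMap.map_smul_univ (Matrix.detRowAlternating (n := Fin n) (R := ℂ)).toMultilinearMap c v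

lemma isOfType_dzForm : IsOfType n 0 (dzForm n) :=
  ⟨rfl, fun c v => by rw [dzForm_smul]; simp⟩

/-- The sum over the choices of `v` or `iv` factors into `n` sums `1/2 + (-i/2) i = 1`. -/
lemma topCoeff_dzForm : topCoeff (dzForm n) = 1 := by
  have h := cext_partVec (dzForm n) (fun _ => false) unitVec
  have e : ∀ S : Fin n → Bool, (∏ a, partCoeff false (S a)) *
      dzForm n (fun a => if S a then Complex.I • unitVec a else unitVec a) =
      ∏ a, (partCoeff false (S a) * if S a then Complex.I else 1) := by
    intro S
    have h1 : (fun a => if S a then Complex.I • unitVec a else unitVec a) =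
        fun a => (if S a then Complex.I else 1) • (unitVec a : Cn n) := by
      ext a : 1
      split_ifs <;> simp
    have h2 : dzForm n unitVec = 1 := by
      rw [dzForm_apply]
      convert Matrix.det_one (n := Fin n) (R := ℂ)
      ext i j
      simp [unitVec, Matrix.one_apply, Pi.single_apply, eq_comm]
    rw [h1, dzForm_smul, h2, mul_one, Finset.prod_mul_distrib]
  rw [Finset.sum_congr rfl fun S _ => e S] at h
  have h3 := Finset.prod_univ_sum (fun _ : Fin n => (Finset.univ : Finset Bool))
    (fun _ s => partCoeff false s * if s then Complex.I else 1)
  rw [Fintype.piFinset_univ] at h3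
  rw [topCoeff]
  refine h.trans (h3.symm.trans (Finset.prod_eq_one fun a _ => ?_))
  simp only [Fintype.sum_bool, partCoeff]
  simp
  ring_nf
  simp
  norm_num

/-- A form is smooth as soon as its coefficients are. -/
lemma contDiffAt_of_apply {k : ℕ} {m : WithTop ℕ∞} {F : Cn n → Cn n [⋀^Fin k]→L[ℝ] ℂ} {p : Cn n}
    (h : ∀ v, ContDiffAt ℝ m (fun x => F x v) p) : ContDiffAt ℝ m F p := by
  let Φ : (Cn n [⋀^Fin k]→L[ℝ] ℂ) →ₗ[ℝ] ((Fin k → Fin (2 * n)) → ℂ) :=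
    { toFun := fun T I => T fun a => realBasis (I a)
      map_add' := fun _ _ => rfl
      map_smul' := fun _ _ => rfl }
  have hΦ : LinearMap.ker Φ = ⊥ := by
    refine LinearMap.ker_eq_bot'.2 fun T hT => ?_
    ext v
    rw [← cext_rvec, cext_apply]
    refine Finset.sum_eq_zero fun I _ => ?_
    have : T (fun a => realBasis (I a)) = 0 := congrFun hT I
    rw [this, zero_mul]
  -- The values on the real basis determine the form linearly and injectively, and a linear left
  -- inverse on a finite-dimensional space is continuous.
  obtain ⟨Ψ, hΨ⟩ := LinearMap.exists_leftInverse_of_injective Φ hΦ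
  have e : F = fun x => LinearMap.toContinuousLinearMap Ψ (Φ (F x)) := by
    funext x
    exact (LinearMap.congr_fun hΨ (F x)).symm
  rw [e]
  refine (ContinuousLinearMap.contDiff _).contDiffAt.comp p ?_
  exact contDiffAt_pi.2 fun I => h _

lemma contDiffAt_compContinuousLinearMap {k : ℕ} {m : WithTop ℕ∞}
    {F : Cn n → Cn n [⋀^Fin k]→L[ℝ] ℂ} {A : Cn n → Cn n →L[ℝ] Cn n} {p : Cn n}
    (hF : ContDiffAt ℝ m F p) (hA : ContDiffAt ℝ m A p) :
    ContDiffAt ℝ m (fun x => (F x).compContinuousLinearMap (A x)) p := by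
  refine contDiffAt_of_apply fun v => ?_
  have h : (fun x => (F x).compContinuousLinearMap (A x) v) = fun x =>
      ∑ I : Fin k → Fin (2 * n), F x (fun a => realBasis (I a)) *
        ∏ a, ((realCoord (A x (v a)) (I a) : ℝ) : ℂ) := by
    funext x
    rw [ContinuousAlternatingMap.compContinuousLinearMap_apply, ← cext_rvec, cext_apply]
    rfl
  rw [h]
  refine ContDiffAt.sum fun I _ => (contDiffAt_form_apply hF _).mul (contDiffAt_prod fun a _ => ?_)
  refine contDiffAt_ofReal ?_
  have hl : ContDiffAt ℝ m (fun x => A x (v a)) p := hA.clm_apply contDiffAt_const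
  unfold realCoord
  split_ifs
  · exact Complex.reCLM.contDiff.contDiffAt.comp p (contDiffAt_pi.1 hl _)
  · exact Complex.imCLM.contDiff.contDiffAt.comp p (contDiffAt_pi.1 hl _)

variable {X : Type*} [TopologicalSpace X] [ChartedSpace (Cn n) X]
  [IsManifold 𝓘(ℂ, Cn n) ω X]
  {L : X → Type*} [TopologicalSpace (TotalSpace ℂ L)] [∀ x, TopologicalSpace (L x)]
  [∀ x, AddCommGroup (L x)] [∀ x, Module ℂ (L x)] [FiberBundle ℂ L] [VectorBundle ℂ ℂ L]

open Classical in
variable (L) in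
/-- The form `a dz₁ ∧ ⋯ ∧ dzₙ ⊗ e` in the coordinates and the frame `e` at `x₀`, extended by zero. -/
def bumpForm (x₀ : X) (a : Cn n → ℝ) : LForm n L n := fun x =>
  if x ∈ (chartAt (Cn n) x₀).source ∧ x ∈ (trivializationAt ℂ L x₀).baseSet then
    (((trivializationAt ℂ L x₀).symmL ℂ x).restrictScalars ℝ).compContinuousAlternatingMap
      ((a (chartAt (Cn n) x₀ x) • dzForm n).compContinuousLinearMap
        ((tangentCoordChange 𝓘(ℂ, Cn n) x x₀ x).restrictScalars ℝ))
  else 0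

lemma localForm_bumpForm {x₀ : X} (a : Cn n → ℝ) {p : Cn n} (hp : p ∈ goodSet L x₀) :
    localForm (bumpForm L x₀ a) x₀ p = a p • dzForm n := by
  ext v
  have hs := pt_mem_source hp.1
  rw [localForm_apply, bumpForm, if_pos ⟨hs, hp.2⟩]
  refine ((trivializationAt ℂ L x₀).continuousLinearMapAt_symmL (R := ℂ) hp.2 _).trans ?_
  change a (chartAt (Cn n) x₀ (pt x₀ p)) • dzForm n _ = a p • dzForm n v
  rw [chartAt_pt hp.1]
  congr 2
  ext i : 1
  exact toTangent_inverse hs (v i)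

lemma isOfType_bumpForm (x₀ : X) (a : Cn n → ℝ) (x : X) : IsOfType n 0 (bumpForm L x₀ a x) := by
  refine ⟨rfl, fun c v => ?_⟩
  rw [bumpForm]
  split_ifs with h
  · change (trivializationAt ℂ L x₀).symmL ℂ x (a (chartAt (Cn n) x₀ x) • dzForm n
      fun i => tangentCoordChange 𝓘(ℂ, Cn n) x x₀ x (c • v i)) = (c ^ n * conj c ^ 0) •
      (trivializationAt ℂ L x₀).symmL ℂ x (a (chartAt (Cn n) x₀ x) • dzForm n
        fun i => tangentCoordChange 𝓘(ℂ, Cn n) x x₀ x (v i))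
    refine Eq.trans ?_ (map_smul ((trivializationAt ℂ L x₀).symmL ℂ x) _ _)
    congr 1
    have e : (fun i => tangentCoordChange 𝓘(ℂ, Cn n) x x₀ x (c • v i)) =
        fun i => c • tangentCoordChange 𝓘(ℂ, Cn n) x x₀ x (v i) := by
      ext i : 1
      exact map_smul _ _ _
    rw [e, isOfType_dzForm.2]
    simp only [Complex.real_smul, smul_eq_mul]
    ring
  · simp

lemma bumpForm_eq_zero {x₀ : X} {a : Cn n → ℝ} {x : X} (hx : x ∉ pt x₀ '' tsupport a) :
    bumpForm L x₀ a x = 0 := by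
  rw [bumpForm]
  split_ifs with h
  · have h0 : a (chartAt (Cn n) x₀ x) = 0 := image_eq_zero_of_notMem_tsupport fun h' =>
      hx ⟨_, h', (chartAt (Cn n) x₀).left_inv h.1⟩
    rw [h0]
    ext v
    simp
  · rfl

lemma isCompact_pt_image {x₀ : X} {C : Set (Cn n)} (hC : IsCompact C)
    (hCt : C ⊆ (chartAt (Cn n) x₀).target) : IsCompact (pt x₀ '' C) :=
  hC.image_of_continuousOn ((chartAt (Cn n) x₀).continuousOn_symm.mono hCt)

/-- At points of `C` any local expression is a smooth transform of the one at `x₀`; off the closed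
set `C` the form vanishes on a neighbourhood. -/
lemma isSmoothForm_of_eventually [ContMDiffVectorBundle ω ℂ L 𝓘(ℂ, Cn n)] {k : ℕ}
    {ξ : LForm n L k} (x₀ : X) (h₀ : ContDiffOn ℝ ∞ (localForm ξ x₀) (goodSet L x₀)) {C : Set X}
    (hC : IsClosed C) (hCs : ∀ x ∈ C, x ∈ (chartAt (Cn n) x₀).source ∧
      x ∈ (trivializationAt ℂ L x₀).baseSet) (hz : ∀ x, x ∉ C → ξ x = 0) : IsSmoothForm ξ := by
  intro x₁ p hp
  refine ContDiffAt.contDiffWithinAt ?_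
  by_cases hx : pt x₁ p ∈ C
  · obtain ⟨hs, hb⟩ := hCs _ hx
    have hψ : ContDiffAt ℝ ω (chartChange x₁ x₀) p :=
      (contDiffAt_chartChange hp.1 hs).restrict_scalars ℝ
    have hmem : chartChange x₁ x₀ p ∈ goodSet L x₀ :=
      ⟨(chartAt (Cn n) x₀).map_source hs, by rw [pt_chartChange hs]; exact hb⟩
    have hG : ContDiffAt ℝ ∞ (frameChange (n := n) L x₁ x₀) p :=
      ((contDiffAt_frameChange hp.1 hp.2 hb).restrict_scalars ℝ).of_le (by simp)
    have e : localForm ξ x₁ =ᶠ[nhds p] fun x => frameChange L x₁ x₀ x •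
        (localForm ξ x₀ (chartChange x₁ x₀ x)).compContinuousLinearMap
          (fderiv ℝ (chartChange x₁ x₀) x) := by
      filter_upwards [eventually_mem_target hp.1,
        eventually_pt_mem hp.1 (chartAt (Cn n) x₀).open_source hs,
        eventually_pt_mem hp.1 (trivializationAt ℂ L x₀).open_baseSet hb] with x hx hx' hx''
      exact localForm_eq ξ hx hx' hx''
    refine ContDiffAt.congr_of_eventuallyEq ?_ e
    have h1 : ContDiffAt ℝ ∞ (fun x => localForm ξ x₀ (chartChange x₁ x₀ x)) p :=
      ContDiffAt.comp p (h₀.contDiffAt ((isOpen_goodSet x₀).mem_nhds hmem)) (hψ.of_le (by simp))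
    have h2 : ContDiffAt ℝ ∞ (fderiv ℝ (chartChange x₁ x₀)) p := hψ.fderiv_right (by simp)
    exact hG.smul (contDiffAt_compContinuousLinearMap h1 h2)
  · have e : localForm ξ x₁ =ᶠ[nhds p] fun _ => 0 := by
      filter_upwards [eventually_pt_mem hp.1 hC.isOpen_compl hx] with x hx
      ext v
      rw [localForm_apply, hz _ hx]
      simp
    exact contDiffAt_const.congr_of_eventuallyEq e

/-- Extension by zero is smooth because the compact support is closed in the Hausdorff space `X`.
These forms are used to test the definition of `∂̄*`. -/
lemma isTestForm_bumpForm [T2Space X] [ContMDiffVectorBundle ω ℂ L 𝓘(ℂ, Cn n)] {x₀ : X}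
    {a : Cn n → ℝ} (ha : ContDiff ℝ ∞ a) (hc : HasCompactSupport a)
    (hs : tsupport a ⊆ goodSet L x₀) : IsTestForm n 0 (bumpForm L x₀ a) := by
  have hK := isCompact_pt_image hc.isCompact fun p hp => (hs hp).1
  refine ⟨isSmoothForm_of_eventually x₀ ?_ hK.isClosed ?_ fun x hx => bumpForm_eq_zero hx,
    isOfType_bumpForm x₀ a, hK.of_isClosed_subset isClosed_closure
      (closure_minimal (fun x hx => ?_) hK.isClosed)⟩
  · refine ContDiffOn.congr (f := fun p => a p • dzForm n) ?_ fun p hp => localForm_bumpForm a hp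
    exact (ha.smul contDiff_const).contDiffOn
  · rintro _ ⟨p, hp, rfl⟩
    exact ⟨pt_mem_source (hs hp).1, (hs hp).2⟩
  · by_contra h
    exact hx (bumpForm_eq_zero h)

lemma IsSmoothForm.contDiffAt {k : ℕ} {ξ : LForm n L k} (hξ : IsSmoothForm ξ) {x₀ : X} {p : Cn n}
    (hp : p ∈ goodSet L x₀) : ContDiffAt ℝ ∞ (localForm ξ x₀) p :=
  (hξ x₀).contDiffAt ((isOpen_goodSet x₀).mem_nhds hp)

lemma IsSmoothForm.dbar [ContMDiffVectorBundle ω ℂ L 𝓘(ℂ, Cn n)] {k b : ℕ} {ξ : LForm n L k}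
    (hs : IsSmoothForm ξ) (hty : ∀ x, IsOfType n b (ξ x)) : IsSmoothForm (dbar ξ) := by
  intro x₀ p hp
  refine (ContDiffAt.congr_of_eventuallyEq (contDiffAt_extDeriv (hs.contDiffAt hp))
    ?_).contDiffWithinAt
  filter_upwards [(isOpen_goodSet x₀).mem_nhds hp] with p' hp'
  exact localForm_dbar hs hty hp'

lemma continuousAt_of_pt {E : Type*} [TopologicalSpace E] {h : X → E} {x : X}
    (hc : ContinuousAt (fun p => h (pt x p)) (chartAt (Cn n) x x)) : ContinuousAt h x := by
  have h1 : ContinuousAt (fun y => h (pt x (chartAt (Cn n) x y))) x :=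
    ContinuousAt.comp (f := chartAt (Cn n) x) (g := fun p => h (pt x p)) hc
      ((chartAt (Cn n) x).continuousAt (mem_chart_source _ x))
  refine h1.congr ?_
  filter_upwards [(chartAt (Cn n) x).open_source.mem_nhds (mem_chart_source _ x)] with y hy
  rw [pt, (chartAt (Cn n) x).left_inv hy]

lemma continuous_innerForm_pair (K : KahlerForm n X) (h : HermitianMetric (n := n) L) {k : ℕ}
    {u v : LForm n L k} (hu : IsSmoothForm u) (hv : IsSmoothForm v) :
    Continuous fun x => innerForm (K.form x) (h.pair x) (u x) (v x) := by
  refine continuous_iff_continuousAt.2 fun x => continuousAt_of_pt (n := n) ?_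
  have hx := mem_goodSet_self (n := n) (L := L) x
  have h1 : ContDiffAt ℝ ∞ (fun p => (Real.exp (-h.weight x p) : ℂ) *
      innerForm (localScalarForm K.form x p) stdPair (localForm u x p) (localForm v x p))
      (chartAt (Cn n) x x) :=
    (contDiffAt_ofReal (Real.contDiff_exp.contDiffAt.comp _ (h.contDiffAt_weight hx).neg)).mul
      (contDiffAt_innerForm (K.contDiffAt_local hx.1) (K.isPositiveOneOne_local hx.1)
        (hu.contDiffAt hx) (hv.contDiffAt hx))
  refine h1.continuousAt.congr ?_
  filter_upwards [(isOpen_goodSet x).mem_nhds hx] with p hp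
  exact (innerForm_local K h hp u v).symm

end TestForms

/-! ### The formal adjoint of `∂̄` as a weighted divergence -/

section Adjoint

variable {n : ℕ} {X : Type*} [TopologicalSpace X] [ChartedSpace (Cn n) X]
  [IsManifold 𝓘(ℂ, Cn n) ω X]
  {L : X → Type*} [TopologicalSpace (TotalSpace ℂ L)] [∀ x, TopologicalSpace (L x)]
  [∀ x, AddCommGroup (L x)] [∀ x, Module ℂ (L x)] [FiberBundle ℂ L] [VectorBundle ℂ ℂ L]

lemma dbar_eq_zero {k : ℕ} {ξ : LForm n L k} {x : X} (h : ∀ᶠ y in nhds x, ξ y = 0) :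
    dbar ξ x = 0 := by
  have e : localForm ξ x =ᶠ[nhds (chartAt (Cn n) x x)] fun _ => 0 := by
    have hc := continuousAt_pt (mem_chart_target (Cn n) x)
    rw [ContinuousAt, pt_chartAt] at hc
    filter_upwards [hc.eventually h] with p hp
    ext v
    rw [localForm_apply, hp]
    simp
  have : extDeriv (localForm ξ x) (chartAt (Cn n) x x) = 0 := by
    rw [e.extDeriv_eq]
    ext v
    simp [extDeriv, ContinuousAlternatingMap.alternatizeUncurryFin_apply]
  rw [dbar, this]
  ext v
  simp

/-- The coefficient of the vector field dual to `ξ` in the coordinates at `x₀`. -/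
def localDual (K : KahlerForm n X) (ξ : LForm n L (n + 1)) (x₀ : X) (k : Fin n) (p : Cn n) : ℂ :=
  dualVec (localScalarForm K.form x₀ p) (localForm ξ x₀ p) k

lemma contDiffAt_localDual (K : KahlerForm n X) {ξ : LForm n L (n + 1)} (hξ : IsSmoothForm ξ)
    {x₀ : X} {p : Cn n} (hp : p ∈ goodSet L x₀) (k : Fin n) :
    ContDiffAt ℝ ∞ (localDual K ξ x₀ k) p :=
  contDiffAt_dualVec (K.contDiffAt_local hp.1) (K.isPositiveOneOne_local hp.1)
    (hξ.contDiffAt hp) k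

lemma contDiffAt_wdiv {φ : Cn n → ℝ} {V : Fin n → Cn n → ℂ} {p : Cn n} (hφ : ContDiffAt ℝ ∞ φ p)
    (hV : ∀ k, ContDiffAt ℝ ∞ (V k) p) : ContDiffAt ℝ ∞ (wdiv φ V) p :=
  ContDiffAt.sum fun k _ => (ContDiffAt.cderiv (hV k) le_rfl).sub
    ((ContDiffAt.cderiv (contDiffAt_ofReal hφ) le_rfl).mul (hV k))

/-- Differentiation of a product with a weight. -/
lemma dzbar_weighted {a φ : Cn n → ℝ} {u : Cn n → ℂ} {p : Cn n} (ha : DifferentiableAt ℝ a p)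
    (hφ : DifferentiableAt ℝ φ p) (hu : DifferentiableAt ℝ u p) (k : Fin n) :
    dzbar k (fun x => a x • ((Real.exp (-φ x) : ℂ) * conj (u x))) p =
      Real.exp (-φ p) * (dzbar k (fun x => (a x : ℂ)) p * conj (u p)) +
        a p * (Real.exp (-φ p) * conj (dz k u p - dz k (fun x => (φ x : ℂ)) p * u p)) := by
  have hof : ∀ {b : Cn n → ℝ}, DifferentiableAt ℝ b p →
      DifferentiableAt ℝ (fun x => (b x : ℂ)) p := fun hb =>
    Complex.ofRealCLM.differentiableAt.comp p hb
  have hE : DifferentiableAt ℝ (fun x => (Real.exp (-φ x) : ℂ)) p := hof hφ.neg.exp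
  have hcu : DifferentiableAt ℝ (fun x => conj (u x)) p :=
    Complex.conjCLE.differentiableAt.comp p hu
  have h1 : dzbar k (fun x => (Real.exp (-φ x) : ℂ)) p =
      (-Real.exp (-φ p) : ℝ) * conj (dz k (fun x => (φ x : ℂ)) p) := by
    have hd : HasDerivAt (fun t => Real.exp (-t)) (-Real.exp (-φ p)) (φ p) := by
      simpa using (hasDerivAt_neg (φ p)).exp
    rw [dzbar, cderiv_ofReal_comp hd hφ, dz, cderiv_conj_ofReal hφ, conjVec_holVec]
  have h2 : dzbar k (fun x => conj (u x)) p = conj (dz k u p) := by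
    rw [dzbar, cderiv_conj hu, conjVec_antiVec, dz]
  simp only [Complex.real_smul]
  rw [dzbar, cderiv_mul (hof ha) (hE.fun_mul hcu), cderiv_mul hE hcu, dzbar_def, dzbar_def, dzbar_def,
    h1, h2, map_sub, map_mul]
  push_cast
  ring

variable [MeasurableSpace X] [BorelSpace X] [T2Space X] [SecondCountableTopology X]
  [ContMDiffVectorBundle ω ℂ L 𝓘(ℂ, Cn n)]

/-- The volume density cancels the determinant in `innerForm_top`: for `(n,0)`-forms the metric of
`X` drops out. -/
lemma volDensity_smul_innerForm_bumpForm (K : KahlerForm n X) (h : HermitianMetric (n := n) L)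
    {η : LForm n L n} (hη : ∀ x, IsOfType n 0 (η x)) {x₀ : X} {p : Cn n} (hp : p ∈ goodSet L x₀)
    (a : Cn n → ℝ) :
    volDensity K x₀ p • innerForm (K.form (pt x₀ p)) (h.pair (pt x₀ p))
      (bumpForm L x₀ a (pt x₀ p)) (η (pt x₀ p)) =
      2 ^ n * (a p * (Real.exp (-h.weight x₀ p) * conj (topCoeff (localForm η x₀ p)))) := by
  have hw := K.isPositiveOneOne_local hp.1
  have htop : topCoeff (a p • dzForm n) = a p := by
    have := topCoeff_pullback (y := a p • dzForm n) (y' := dzForm n) (A := LinearMap.id)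
      (G := (a p : ℂ)) fun v => by simp
    rw [this, topCoeff_dzForm]; simp
  rw [innerForm_local K h hp, localForm_bumpForm a hp, hw.innerForm_top (localForm_isOfType (hη _)),
    htop, volDensity, Complex.real_smul, hw.ofReal_det_re]
  have := hw.det_hermMat_ne_zero
  field_simp

/-- The metric of `X` now enters through the dual vector only. Comparing `2^(n+1)` here with the
`2^n` of the preceding pairing explains the factor `2` in the adjoint. -/
lemma volDensity_smul_innerForm_dbar_bumpForm (K : KahlerForm n X)
    (h : HermitianMetric (n := n) L) {ξ : LForm n L (n + 1)} (hξ : ∀ x, IsOfType n 1 (ξ x))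
    {x₀ : X} {p : Cn n} (hp : p ∈ goodSet L x₀) {a : Cn n → ℝ} (ha : ContDiff ℝ ∞ a)
    (hc : HasCompactSupport a) (hs : tsupport a ⊆ goodSet L x₀) :
    volDensity K x₀ p • innerForm (K.form (pt x₀ p)) (h.pair (pt x₀ p))
      (dbar (bumpForm L x₀ a) (pt x₀ p)) (ξ (pt x₀ p)) =
      2 ^ (n + 1) * (Real.exp (-h.weight x₀ p) *
        ∑ k, dzbar k (fun x => (a x : ℂ)) p * conj (localDual K ξ x₀ k p)) := by
  have hw := K.isPositiveOneOne_local hp.1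
  have hT := isTestForm_bumpForm ha hc hs
  have htop : ∀ y ∈ goodSet L x₀, topCoeff (localForm (bumpForm L x₀ a) x₀ y) = a y := by
    intro y hy
    have := topCoeff_pullback (y := a y • dzForm n) (y' := dzForm n) (A := LinearMap.id)
      (G := (a y : ℂ)) fun v => by simp
    rw [localForm_bumpForm a hy, this, topCoeff_dzForm]; simp
  have hanti : ∀ k, antiCoeff (extDeriv (localForm (bumpForm L x₀ a) x₀) p) k =
      dzbar k (fun x => (a x : ℂ)) p := by
    intro k
    rw [antiCoeff_extDeriv ((hT.1.contDiffAt hp).differentiableAt (by simp))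
      (Filter.Eventually.of_forall fun y => localForm_isOfType (hT.2.1 _))]
    refine cderiv_congr ?_
    filter_upwards [(isOpen_goodSet x₀).mem_nhds hp] with y hy using htop y hy
  rw [innerForm_local K h hp, localForm_dbar hT.1 hT.2.1 hp,
    hw.innerForm_anti (localForm_isOfType (hξ _)), volDensity, Complex.real_smul, hw.ofReal_det_re]
  simp only [hanti]
  have := hw.det_hermMat_ne_zero
  field_simp
  rfl

/-- The formal adjoint of `∂̄` in local coordinates. -/
theorem topCoeff_dbarAdjoint {K : KahlerForm n X} {h : HermitianMetric (n := n) L}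
    {ξ : LForm n L (n + 1)} (hs : IsSmoothForm ξ) (hty : ∀ x, IsOfType n 1 (ξ x))
    {η : LForm n L n} (hη : IsDbarAdjoint K h ξ η) {x₀ : X} {p : Cn n} (hp : p ∈ goodSet L x₀) :
    topCoeff (localForm η x₀ p) = -2 * wdiv (h.weight x₀) (localDual K ξ x₀) p := by
  obtain ⟨hηs, hηty, hadj⟩ := hη
  have hU := isOpen_goodSet (n := n) (L := L) x₀
  -- The weighted conjugate of the difference between the two sides; it is shown to be orthogonal to
  -- every bump function on the good set.
  let f : Cn n → ℂ := fun p => (Real.exp (-h.weight x₀ p) : ℂ) * conj (topCoeff (localForm η x₀ p) +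
    2 * wdiv (h.weight x₀) (localDual K ξ x₀) p)
  have hEc : ∀ p ∈ goodSet L x₀, ContDiffAt ℝ ∞ (fun p => (Real.exp (-h.weight x₀ p) : ℂ)) p :=
    fun p hp => contDiffAt_ofReal
      (Real.contDiff_exp.contDiffAt.comp p (h.contDiffAt_weight hp).neg)
  have hfc : ContinuousOn f (goodSet L x₀) := fun p hp => by
    refine ContinuousAt.continuousWithinAt (ContDiffAt.continuousAt (𝕜 := ℝ) (n := ∞) ?_)
    exact (hEc p hp).mul (contDiffAt_conj ((contDiffAt_cext (hηs.contDiffAt hp) _).add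
      (contDiffAt_const.mul (contDiffAt_wdiv (h.contDiffAt_weight hp)
        fun k => contDiffAt_localDual K hs hp k))))
  suffices hz : Set.EqOn f (fun _ => 0) (goodSet L x₀) by
    have h0 := hz hp
    simp only [f, mul_eq_zero, Complex.ofReal_eq_zero, (Real.exp_pos _).ne', false_or,
      map_eq_zero] at h0
    linear_combination h0
  refine Measure.eqOn_open_of_ae_eq (μ := volume) ?_ hU hfc continuousOn_const
  rw [Filter.EventuallyEq, ae_restrict_iff' hU.measurableSet]
  -- The fundamental lemma of the calculus of variations gives the vanishing almost everywhere;
  -- continuity then gives it everywhere.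
  refine hU.ae_eq_zero_of_integral_contDiff_smul_eq_zero
    (hfc.locallyIntegrableOn hU.measurableSet) fun a ha hc hsa => ?_
  have hT := isTestForm_bumpForm ha hc hsa
  let H : Fin n → Cn n → ℂ := fun k p =>
    a p • ((Real.exp (-h.weight x₀ p) : ℂ) * conj (localDual K ξ x₀ k p))
  have hH : ∀ k, ContDiff ℝ ∞ (H k) := fun k => contDiff_smul_of_tsupport hU ha hsa fun p hp =>
    ((hEc p hp).mul (contDiffAt_conj (contDiffAt_localDual K hs hp k))).contDiffWithinAt
  have hHz : ∀ k p, p ∉ tsupport a → H k p = 0 := fun k p hp => by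
    simp [H, image_eq_zero_of_notMem_tsupport hp]
  have hR : ∫ p in tsupport a, ∑ k, dzbar k (H k) p = 0 := by
    have hHc : ∀ k, HasCompactSupport (H k) := fun k => HasCompactSupport.intro hc.isCompact (hHz k)
    have hzero : ∀ k p, p ∉ tsupport a → dzbar k (H k) p = 0 := fun k p hp => by
      have : H k =ᶠ[nhds p] fun _ => 0 := by
        filter_upwards [(isClosed_tsupport a).isOpen_compl.mem_nhds hp] with y hy using hHz k y hy
      rw [dzbar, cderiv_congr this, cderiv_const]
    rw [integral_finsetSum]
    · refine Finset.sum_eq_zero fun k _ => ?_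
      rw [setIntegral_eq_integral_of_forall_compl_eq_zero (hzero k)]
      exact integral_cderiv (hH k) (hHc k)
    · intro k _
      exact (ContDiff.dzbar (hH k) k).continuous.continuousOn.integrableOn_compact hc.isCompact
  have hcs : ∀ {I : X → ℂ}, Continuous I →
      IntegrableOn (fun p => volDensity K x₀ p • I (pt x₀ p)) (tsupport a) := fun hI => by
    refine ContinuousOn.integrableOn_compact hc.isCompact fun p hp => ?_
    exact ((contDiffAt_volDensity K (hsa hp).1).continuousAt.smul
      (hI.continuousAt.comp (continuousAt_pt (hsa hp).1))).continuousWithinAt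
  have hc1 := continuous_innerForm_pair K h (hT.1.dbar hT.2.1) hs
  have hc2 := continuous_innerForm_pair K h hT.1 hηs
  have hK := isCompact_pt_image hc.isCompact fun p hp => (hsa hp).1
  have hnot : ∀ p ∈ (chartAt (Cn n) x₀).target, p ∉ tsupport a → pt x₀ p ∉ pt x₀ '' tsupport a := by
    rintro p hp hpa ⟨p', hp', e⟩
    apply hpa
    rwa [← chartAt_pt hp, ← e, chartAt_pt (hsa hp').1]
  have hsrc : ∀ x, x ∉ (chartAt (Cn n) x₀).source → x ∉ pt x₀ '' tsupport a := by
    rintro x hx ⟨p', hp', rfl⟩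
    exact hx (pt_mem_source (hsa hp').1)
  have hz1 : ∀ x, x ∉ pt x₀ '' tsupport a →
      innerForm (K.form x) (h.pair x) (dbar (bumpForm L x₀ a) x) (ξ x) = 0 := fun x hx => by
    have : dbar (bumpForm L x₀ a) x = 0 := dbar_eq_zero (by
      filter_upwards [hK.isClosed.isOpen_compl.mem_nhds hx] with y hy using bumpForm_eq_zero hy)
    rw [this]
    simp [innerForm, HermitianMetric.pair]
  have hz2 : ∀ x, x ∉ pt x₀ '' tsupport a →
      innerForm (K.form x) (h.pair x) (bumpForm L x₀ a x) (η x) = 0 := fun x hx => by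
    rw [bumpForm_eq_zero hx]
    simp [innerForm, HermitianMetric.pair]
  have key := hadj _ hT
  rw [integral_volMeasure_eq K x₀ hc1 (fun x hx => hz1 x (hsrc x hx)) (fun p hp => (hsa hp).1)
      (fun p hp hpa => hz1 _ (hnot p hp hpa)),
    integral_volMeasure_eq K x₀ hc2 (fun x hx => hz2 x (hsrc x hx)) (fun p hp => (hsa hp).1)
      (fun p hp hpa => hz2 _ (hnot p hp hpa))] at key
  -- The difference of the two integrands in the definition of the adjoint, which have equal
  -- integrals, plus a divergence, whose integral is zero.
  have hpt : ∀ p ∈ tsupport a, a p • f p = (2 ^ n)⁻¹ * (volDensity K x₀ p •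
      innerForm (K.form (pt x₀ p)) (h.pair (pt x₀ p)) (bumpForm L x₀ a (pt x₀ p)) (η (pt x₀ p)) -
      volDensity K x₀ p • innerForm (K.form (pt x₀ p)) (h.pair (pt x₀ p))
        (dbar (bumpForm L x₀ a) (pt x₀ p)) (ξ (pt x₀ p))) + 2 * ∑ k, dzbar k (H k) p := by
    intro p hp
    have hpU := hsa hp
    rw [volDensity_smul_innerForm_bumpForm K h hηty hpU,
      volDensity_smul_innerForm_dbar_bumpForm K h hty hpU ha hc hsa]
    have hk : ∀ k, dzbar k (H k) p = _ := fun k => dzbar_weighted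
      (ha.contDiffAt.differentiableAt (by simp))
      ((h.contDiffAt_weight hpU).differentiableAt (by simp))
      ((contDiffAt_localDual K hs hpU k).differentiableAt (by simp)) k
    rw [Finset.sum_congr rfl fun k _ => hk k, Finset.sum_add_distrib, ← Finset.mul_sum,
      ← Finset.mul_sum, ← Finset.mul_sum, ← map_sum]
    simp only [f, wdiv, Complex.real_smul, map_add, map_mul, Complex.conj_ofNat]
    field_simp
    ring
  rw [← setIntegral_eq_integral_of_forall_compl_eq_zero (s := tsupport a) fun p hp => by
    rw [image_eq_zero_of_notMem_tsupport hp, zero_smul]]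
  rw [setIntegral_congr_fun hc.isCompact.measurableSet hpt, integral_add, integral_const_mul,
    integral_sub (hcs hc2) (hcs hc1), integral_const_mul, hR, key]
  · simp
  · exact ((hcs hc2).sub (hcs hc1)).const_mul _
  · refine Integrable.const_mul (integrable_finsetSum _ fun k _ => ?_) _
    exact (ContDiff.dzbar (hH k) k).continuous.continuousOn.integrableOn_compact hc.isCompact

end Adjoint

/-! ### The Bochner inequality on `X` -/

section Global

variable {n : ℕ}

lemma dualVec_zero (w : Cn n [⋀^Fin 2]→L[ℝ] ℝ) :
    dualVec w (0 : Cn n [⋀^Fin (n + 1)]→L[ℝ] ℂ) = 0 := by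
  have : antiCoeff (0 : Cn n [⋀^Fin (n + 1)]→L[ℝ] ℂ) = 0 := by
    ext a
    rw [antiCoeff, cext_apply]
    simp
  rw [dualVec, this, Matrix.zero_vecMul]

lemma leviForm_zero_vec (φ : Cn n → ℝ) (p : Cn n) : leviForm φ p 0 = 0 := by
  have : (![0, 0] : Fin 2 → Cn n) = 0 := by ext i : 1; fin_cases i <;> rfl
  rw [leviForm, smul_zero, this]
  simp

lemma leviForm_const (c : ℝ) (p v : Cn n) : leviForm (fun _ => c) p v = 0 := by
  simp [leviForm, iteratedFDeriv_const_of_ne (𝕜 := ℝ) two_ne_zero c]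

variable {X : Type*} [TopologicalSpace X] [ChartedSpace (Cn n) X]
  [IsManifold 𝓘(ℂ, Cn n) ω X]
  {L : X → Type*} [TopologicalSpace (TotalSpace ℂ L)] [∀ x, TopologicalSpace (L x)]
  [∀ x, AddCommGroup (L x)] [∀ x, Module ℂ (L x)] [FiberBundle ℂ L] [VectorBundle ℂ ℂ L]
  {K : KahlerForm n X} {h : HermitianMetric (n := n) L} {ξ : LForm n L (n + 1)} {η : LForm n L n}
  {g g' : X → ℝ} {x : X}

lemma eventually_pt {P : X → Prop} (hP : ∀ᶠ y in nhds x, P y) :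
    ∀ᶠ p in nhds (chartAt (Cn n) x x), P (pt x p) := by
  have hc := continuousAt_pt (mem_chart_target (Cn n) x)
  rw [ContinuousAt, pt_chartAt] at hc
  exact hc.eventually hP

lemma IsSmoothFun.ofContMDiff {f : X → ℝ} (hf : ContMDiff 𝓘(ℝ, Cn n) 𝓘(ℝ, ℝ) ∞ f) :
    IsSmoothFun (n := n) f := fun x => by
  have := isManifold_real n X
  have hpt : ContMDiffAt 𝓘(ℝ, Cn n) 𝓘(ℝ, Cn n) ∞ (pt x) (chartAt (Cn n) x x) :=
    (contMDiffOn_chart_symm (I := 𝓘(ℝ, Cn n)) (n := ∞) (x := x)).contMDiffAt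
      ((chartAt (Cn n) x).open_target.mem_nhds (mem_chart_target _ x))
  exact (ContMDiffAt.comp _ hf.contMDiffAt hpt).contDiffAt

lemma bochnerAt_congr (hg : g =ᶠ[nhds x] g') : bochnerAt K h ξ η g x = bochnerAt K h ξ η g' x := by
  have e : (fun p => g (pt x p)) =ᶠ[nhds (chartAt (Cn n) x x)] fun p => g' (pt x p) :=
    eventually_pt hg
  have e' : (fun p => (g (pt x p) : ℂ)) =ᶠ[nhds (chartAt (Cn n) x x)] fun p => (g' (pt x p) : ℂ) :=
    e.fun_comp Complex.ofReal
  rw [bochnerAt, bochnerAt, bochnerTerm, bochnerTerm, leviForm_congr e, ← cderiv_holVec,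
    ← cderiv_holVec, cderiv_congr e', e.eq_of_nhds]

lemma bochnerAt_zero : bochnerAt K h ξ η (fun _ => 0) x = 0 := by
  rw [bochnerAt, bochnerTerm, leviForm_const]
  simp [← cderiv_holVec, cderiv_const]

/-- Because the expression is linear in `g`, derivative terms included, a partition of unity splits
it without error terms. -/
lemma bochnerAt_add (hg : IsSmoothFun (n := n) g) (hg' : IsSmoothFun (n := n) g') :
    bochnerAt K h ξ η (fun y => g y + g' y) x =
      bochnerAt K h ξ η g x + bochnerAt K h ξ η g' x := by
  simp only [bochnerAt, bochnerTerm]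
  rw [leviForm_add ((hg x).of_le (by norm_cast)) ((hg' x).of_le (by norm_cast))]
  simp only [← cderiv_holVec, Complex.ofReal_add]
  rw [cderiv_add ((contDiffAt_ofReal (hg x)).differentiableAt (by simp))
    ((contDiffAt_ofReal (hg' x)).differentiableAt (by simp)), map_add,
    mul_add (topCoeff _), Complex.add_re]
  ring

lemma IsSmoothFun.sum {ι : Type*} {s : Finset ι} {f : ι → X → ℝ}
    (hf : ∀ i, IsSmoothFun (n := n) (f i)) : IsSmoothFun (n := n) fun y => ∑ i ∈ s, f i y :=
  fun x => ContDiffAt.sum fun i _ => hf i x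

lemma bochnerAt_sum {ι : Type*} (s : Finset ι) {f : ι → X → ℝ}
    (hf : ∀ i, IsSmoothFun (n := n) (f i)) :
    bochnerAt K h ξ η (fun y => ∑ i ∈ s, f i y) x = ∑ i ∈ s, bochnerAt K h ξ η (f i) x := by
  classical
  induction s using Finset.induction_on with
  | empty => simpa using bochnerAt_zero
  | insert i s hi ih =>
    simp only [Finset.sum_insert hi]
    rw [bochnerAt_add (hf i) (IsSmoothFun.sum hf), ih]

variable [ContMDiffVectorBundle ω ℂ L 𝓘(ℂ, Cn n)]

lemma continuous_bochnerAt (hs : IsSmoothForm ξ) (hty : ∀ x, IsOfType n 1 (ξ x))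
    (hη : IsSmoothForm η) (hg : IsSmoothFun (n := n) g) : Continuous (bochnerAt K h ξ η g) := by
  refine continuous_iff_continuousAt.2 fun x => continuousAt_of_pt (n := n) ?_
  have hx := mem_goodSet_self (n := n) (L := L) x
  refine (contDiffAt_bochnerTerm (K.contDiffAt_local hx.1) (K.isPositiveOneOne_local hx.1)
    (hs.contDiffAt hx) (hη.contDiffAt hx) (h.contDiffAt_weight hx)
    (hg.contDiffAt hx.1)).continuousAt.congr ?_
  filter_upwards [(isOpen_goodSet x).mem_nhds hx] with p hp
  rw [bochnerAt_pt K h ξ η hg hp, localForm_dbar hs hty hp]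

variable [MeasurableSpace X] [BorelSpace X] [T2Space X] [SecondCountableTopology X]

lemma eventually_eq_zero {k : ℕ} {ξ : LForm n L k} (hx : x ∉ closure {x | ξ x ≠ 0}) :
    ∀ᶠ y in nhds x, ξ y = 0 := by
  filter_upwards [isClosed_closure.isOpen_compl.mem_nhds hx] with y hy
  by_contra h0
  exact hy (subset_closure h0)

/-- `∂̄*ξ` is a divergence of the dual vector field, hence is supported where `ξ` is. The definition
of the adjoint does not say so by itself. -/
lemma topCoeff_eq_zero (hξ : IsTestForm n 1 ξ) (hη : IsDbarAdjoint K h ξ η)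
    (hx : x ∉ closure {x | ξ x ≠ 0}) : topCoeff (centralForm η x) = 0 := by
  rw [← localForm_self, topCoeff_dbarAdjoint hξ.1 hξ.2.1 hη (mem_goodSet_self x), wdiv_congr
    (V' := fun _ _ => 0) (Filter.EventuallyEq.refl _ _) fun k => ?_]
  · simp [wdiv, dz, cderiv_const]
  · filter_upwards [eventually_pt (n := n) (eventually_eq_zero hx)] with p hp
    have : localForm ξ x p = 0 := by
      ext v
      rw [localForm_apply, hp]
      simp
    rw [localDual, this, dualVec_zero]
    rfl

lemma innerForm_adjoint_eq_zero (hξ : IsTestForm n 1 ξ) (hη : IsDbarAdjoint K h ξ η)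
    (hx : x ∉ closure {x | ξ x ≠ 0}) :
    innerForm (K.form x) stdPair (centralForm η x) (centralForm η x) = 0 := by
  rw [(K.isPositiveOneOne x).innerForm_top (IsOfType.centralForm (hη.2.1 x)),
    topCoeff_eq_zero hξ hη hx]
  simp

lemma innerForm_dbar_eq_zero (hx : x ∉ closure {x | ξ x ≠ 0}) :
    innerForm (K.form x) stdPair (centralForm (dbar ξ) x) (centralForm (dbar ξ) x) = 0 := by
  have hd : centralForm (dbar ξ) x = 0 := by
    ext v
    rw [centralForm_apply, dbar_eq_zero (eventually_eq_zero hx)]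
    simp
  rw [hd]
  simp [innerForm, stdPair]

lemma bochnerAt_eq_zero (hξ : IsTestForm n 1 ξ) (hη : IsDbarAdjoint K h ξ η)
    (hx : x ∉ closure {x | ξ x ≠ 0}) : bochnerAt K h ξ η g x = 0 := by
  have hc : centralForm ξ x = 0 := by
    ext v
    rw [centralForm_apply, (eventually_eq_zero hx).self_of_nhds]
    simp
  rw [bochnerAt, bochnerTerm, hc, dualVec_zero, leviForm_zero_vec, leviForm_zero_vec,
    innerForm_adjoint_eq_zero hξ hη hx, innerForm_dbar_eq_zero hx, topCoeff_eq_zero hξ hη hx]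
  simp

lemma integrable_bochnerAt (hξ : IsTestForm n 1 ξ) (hη : IsDbarAdjoint K h ξ η)
    (hg : IsSmoothFun (n := n) g) : Integrable (bochnerAt K h ξ η g) (volMeasure K) := by
  have := isLocallyFiniteMeasure_volMeasure K
  exact (continuous_bochnerAt hξ.1 hξ.2.1 hη.1 hg).integrable_of_hasCompactSupport
    (HasCompactSupport.intro hξ.2.2 fun x hx => bochnerAt_eq_zero hξ hη hx)

/-- When the twist is supported in one trivializing chart, the integral is the one over a compact
set of coordinates treated by `integral_bochnerTerm_nonneg`. -/
lemma integral_bochnerAt_nonneg_of_chart (hs : IsSmoothForm ξ) (hty : ∀ x, IsOfType n 1 (ξ x))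
    (hη : IsDbarAdjoint K h ξ η) (hg : IsSmoothFun (n := n) g) (hg0 : ∀ x, 0 ≤ g x) {x₀ : X}
    (hc : HasCompactSupport g) (hsup : tsupport g ⊆ (chartAt (Cn n) x₀).source ∩
      (trivializationAt ℂ L x₀).baseSet) : 0 ≤ ∫ x, bochnerAt K h ξ η g x ∂(volMeasure K) := by
  have hz : ∀ x, x ∉ tsupport g → bochnerAt K h ξ η g x = 0 := fun x hx => by
    rw [bochnerAt_congr (g' := fun _ => 0), bochnerAt_zero]
    filter_upwards [(isClosed_tsupport g).isOpen_compl.mem_nhds hx] with y hy using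
      image_eq_zero_of_notMem_tsupport hy
  set C := chartAt (Cn n) x₀ '' tsupport g with hC
  have hCc : IsCompact C := hc.isCompact.image_of_continuousOn
    ((chartAt (Cn n) x₀).continuousOn.mono fun x hx => (hsup hx).1)
  have hCU : C ⊆ goodSet L x₀ := by
    rintro _ ⟨x, hx, rfl⟩
    refine ⟨(chartAt (Cn n) x₀).map_source (hsup hx).1, ?_⟩
    rw [pt, (chartAt (Cn n) x₀).left_inv (hsup hx).1]
    exact (hsup hx).2
  have hCn : ∀ p ∈ (chartAt (Cn n) x₀).target, p ∉ C → pt x₀ p ∉ tsupport g := fun p hp hpC hpt =>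
    hpC ⟨_, hpt, chartAt_pt hp⟩
  rw [integral_volMeasure_eq K x₀ (continuous_bochnerAt hs hty hη.1 hg)
    (fun x hx => hz x fun hx' => hx (hsup hx').1) (fun p hp => (hCU hp).1)
    fun p hp hpC => hz _ (hCn p hp hpC)]
  have hU := isOpen_goodSet (n := n) (L := L) x₀
  refine (integral_bochnerTerm_nonneg (g := fun p => g (pt x₀ p)) hU hCc hCU
    ((K.smooth x₀).mono fun p hp => hp.1) (fun p hp => K.isPositiveOneOne_local hp.1)
    (fun p hp => K.closed_local hp.1) (hs x₀) (fun p _ => localForm_isOfType (hty _)) (hη.1 x₀)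
    (fun p _ => localForm_isOfType (hη.2.1 _))
    (fun p hp => (h.contDiffAt_weight hp).contDiffWithinAt)
    (fun p hp => (hg.contDiffAt hp.1).contDiffWithinAt) (fun p _ => hg0 _)
    (fun p hp hpC => image_eq_zero_of_notMem_tsupport (hCn p hp.1 hpC))
    (fun p hp => topCoeff_dbarAdjoint hs hty hη hp)).trans_eq ?_
  refine setIntegral_congr_fun hCc.measurableSet fun p hp => ?_
  simp only [bochnerAt_pt K h ξ η hg (hCU hp), localForm_dbar hs hty (hCU hp)]
  rfl

/-- The Bochner inequality. -/
theorem integral_bochnerAt_nonneg (hξ : IsTestForm n 1 ξ) (hη : IsDbarAdjoint K h ξ η)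
    (hg : IsSmoothFun (n := n) g) (hg0 : ∀ x, 0 ≤ g x) :
    0 ≤ ∫ x, bochnerAt K h ξ η g x ∂(volMeasure K) := by
  have := isManifold_real n X
  have : LocallyCompactSpace X := ChartedSpace.locallyCompactSpace (Cn n) X
  have hex : ∀ x : X, ∃ C, IsCompact C ∧ x ∈ interior C ∧ C ⊆ (chartAt (Cn n) x).source ∩
      (trivializationAt ℂ L x).baseSet := fun x =>
    exists_compact_subset ((chartAt (Cn n) x).open_source.inter
      (trivializationAt ℂ L x).open_baseSet)
      ⟨mem_chart_source _ x, mem_baseSet_trivializationAt ℂ L x⟩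
  choose C hC hxC hCU using hex
  obtain ⟨ρ, hρ⟩ := SmoothPartitionOfUnity.exists_isSubordinate 𝓘(ℝ, Cn n) isClosed_univ
    (fun x : X => interior (C x)) (fun x => isOpen_interior)
    (fun x _ => Set.mem_iUnion.2 ⟨x, hxC x⟩)
  -- Derivatives of the twist occur, so the finite sum of the partition must equal `1` on a
  -- neighbourhood of the support of `ξ`, and not merely on it.
  obtain ⟨K', hK', hKK'⟩ := exists_compact_superset hξ.2.2
  have hfin := ρ.locallyFinite'.finite_nonempty_inter_compact hK'
  have hsum : ∀ x ∈ K', ∑ i ∈ hfin.toFinset, ρ i x = 1 := by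
    intro x hx
    rw [← ρ.sum_eq_one (Set.mem_univ x)]
    refine (finsum_eq_sum_of_support_subset _ fun i hi => ?_).symm
    rw [Set.Finite.coe_toFinset]
    exact ⟨x, hi, hx⟩
  have hρs : ∀ i, IsSmoothFun (n := n) fun y => ρ i y * g y := fun i =>
    (IsSmoothFun.ofContMDiff (ρ i).contMDiff).mul hg
  have hdec : ∀ x, bochnerAt K h ξ η g x =
      ∑ i ∈ hfin.toFinset, bochnerAt K h ξ η (fun y => ρ i y * g y) x := by
    intro x
    by_cases hx : x ∈ closure {x | ξ x ≠ 0}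
    · rw [← bochnerAt_sum _ hρs]
      refine bochnerAt_congr ?_
      filter_upwards [mem_interior_iff_mem_nhds.1 (hKK' hx)] with y hy
      rw [← Finset.sum_mul, hsum y hy, one_mul]
    · rw [bochnerAt_eq_zero hξ hη hx]
      exact (Finset.sum_eq_zero fun i _ => bochnerAt_eq_zero hξ hη hx).symm
  simp only [hdec]
  rw [integral_finsetSum _ fun i _ => integrable_bochnerAt hξ hη (hρs i)]
  refine Finset.sum_nonneg fun i _ => ?_
  have hsub : tsupport (fun y => ρ i y * g y) ⊆ C i :=
    (tsupport_mul_subset_left.trans (hρ i)).trans interior_subset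
  exact integral_bochnerAt_nonneg_of_chart hξ.1 hξ.2.1 hη (hρs i)
    (fun y => mul_nonneg (ρ.nonneg i y) (hg0 y))
    ((hC i).of_isClosed_subset (isClosed_tsupport _) hsub) (hsub.trans (hCU i))

end Global

/-! ### The Levi form of the squared norm of a holomorphic section -/

section Calculus

variable {n : ℕ} {p : Cn n}

lemma differentiableAt_ofReal {u : Cn n → ℝ} (hu : DifferentiableAt ℝ u p) :
    DifferentiableAt ℝ (fun x => (u x : ℂ)) p := Complex.ofRealCLM.differentiableAt.comp p hu

lemma differentiableAt_conj {u : Cn n → ℂ} (hu : DifferentiableAt ℝ u p) :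
    DifferentiableAt ℝ (fun x => conj (u x)) p := Complex.conjCLE.differentiableAt.comp p hu

lemma delAt_comp_real {u : Cn n → ℝ} {g : ℝ → ℝ} {g' : ℝ} (hg : HasDerivAt g g' (u p))
    (hu : DifferentiableAt ℝ u p) (v : Cn n) :
    delAt (fun x => (g (u x) : ℂ)) p v = g' * delAt (fun x => (u x : ℂ)) p v := by
  rw [← cderiv_holVec, ← cderiv_holVec, cderiv_ofReal_comp hg hu]

/-- The Levi form of a function of `u`. -/
lemma leviForm_comp_real {u : Cn n → ℝ} {g g₁ : ℝ → ℝ} {g₂ : ℝ} (hu : ContDiffAt ℝ 2 u p)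
    (hg : ContDiffAt ℝ 2 g (u p)) (hg₁ : ∀ᶠ t in nhds (u p), HasDerivAt g (g₁ t) t)
    (hg₂ : HasDerivAt g₁ g₂ (u p)) (v : Cn n) :
    leviForm (fun x => g (u x)) p v = g₁ (u p) * leviForm u p v +
      g₂ * Complex.normSq (delAt (fun x => (u x : ℂ)) p v) := by
  have hd : DifferentiableAt ℝ u p := hu.differentiableAt (by norm_num)
  have e : cderiv (antiVec v) (fun x => (g (u x) : ℂ)) =ᶠ[nhds p] fun x =>
      (g₁ (u x) : ℂ) * cderiv (antiVec v) (fun y => (u y : ℂ)) x := by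
    filter_upwards [hu.continuousAt.eventually hg₁,
      (hu.eventually (by simp)).mono fun x hx => hx.differentiableAt (by norm_num)] with x hx hx'
    exact cderiv_ofReal_comp hx hx'
  have h1 : DifferentiableAt ℝ (cderiv (antiVec v) fun y => (u y : ℂ)) p :=
    (ContDiffAt.cderiv (k := 1) (contDiffAt_ofReal hu) (by norm_num)).differentiableAt (by norm_num)
  have h2 : DifferentiableAt ℝ (fun x => (g₁ (u x) : ℂ)) p :=
    differentiableAt_ofReal (hg₂.differentiableAt.comp p hd)
  have h3 : cderiv (antiVec v) (fun y => (u y : ℂ)) p =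
      conj (cderiv (holVec v) (fun y => (u y : ℂ)) p) := by
    rw [cderiv_conj_ofReal hd, conjVec_holVec]
  have key : (leviForm (fun x => g (u x)) p v : ℂ) = g₁ (u p) * leviForm u p v +
      g₂ * Complex.normSq (delAt (fun x => (u x : ℂ)) p v) := by
    rw [leviForm_eq (φ := fun x => g (u x)) (hg.comp p hu), cderiv_congr e, cderiv_mul h2 h1,
      cderiv_ofReal_comp hg₂ hd, leviForm_eq hu, h3, cderiv_holVec, mul_assoc, Complex.mul_conj]
    ring
  exact_mod_cast key

variable {σ : Cn n → ℂ} {φ : Cn n → ℝ}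

/-- The squared norm of a holomorphic function for the weight `φ`. -/
def weightedSq (σ : Cn n → ℂ) (φ : Cn n → ℝ) (x : Cn n) : ℝ :=
  Complex.normSq (σ x) * Real.exp (-φ x)

/-- The Chern derivative along the constant vector field `v`. -/
def chernDeriv (σ : Cn n → ℂ) (φ : Cn n → ℝ) (v x : Cn n) : ℂ :=
  delAt σ x v - σ x * delAt (fun y => (φ y : ℂ)) x v

lemma ofReal_weightedSq (x : Cn n) : (weightedSq σ φ x : ℂ) =
    σ x * ((Real.exp (-φ x) : ℂ) * conj (σ x)) := by
  rw [weightedSq, Complex.ofReal_mul, ← Complex.mul_conj]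
  ring

lemma contDiffAt_weightedSq {m : WithTop ℕ∞} (hσ : ContDiffAt ℝ m σ p) (hφ : ContDiffAt ℝ m φ p) :
    ContDiffAt ℝ m (weightedSq σ φ) p := by
  have h : weightedSq σ φ = fun x => (σ x * conj (σ x)).re * Real.exp (-φ x) := by
    funext x
    rw [Complex.mul_conj, Complex.ofReal_re, weightedSq]
  rw [h]
  exact (contDiffAt_re (hσ.mul (contDiffAt_conj hσ))).mul
    (Real.contDiff_exp.contDiffAt.comp p hφ.neg)

lemma cderiv_exp_neg {Z : Fin (2 * n) → ℂ} (hφ : DifferentiableAt ℝ φ p) :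
    cderiv Z (fun x => (Real.exp (-φ x) : ℂ)) p =
      -Real.exp (-φ p) * cderiv Z (fun x => (φ x : ℂ)) p := by
  have hd : HasDerivAt (fun t => Real.exp (-t)) (-Real.exp (-φ p)) (φ p) := by
    simpa using (hasDerivAt_neg (φ p)).exp
  rw [cderiv_ofReal_comp hd hφ]
  push_cast
  ring

lemma cderiv_antiVec_weightedSq (hσ : DifferentiableAt ℂ σ p) (hφ : DifferentiableAt ℝ φ p)
    (v : Cn n) : cderiv (antiVec v) (fun x => (weightedSq σ φ x : ℂ)) p =
      σ p * (Real.exp (-φ p) * conj (chernDeriv σ φ v p)) := by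
  have hσ' : DifferentiableAt ℝ σ p := hσ.restrictScalars ℝ
  have hE : DifferentiableAt ℝ (fun x => (Real.exp (-φ x) : ℂ)) p :=
    differentiableAt_ofReal hφ.neg.exp
  simp only [ofReal_weightedSq]
  rw [cderiv_mul hσ' (hE.fun_mul (differentiableAt_conj hσ')),
    cderiv_mul hE (differentiableAt_conj hσ'), cderiv_antiVec_holomorphic hσ, cderiv_conj hσ',
    conjVec_antiVec, cderiv_exp_neg hφ, chernDeriv, map_sub, map_mul, ← cderiv_holVec,
    ← cderiv_holVec, cderiv_conj_ofReal hφ, conjVec_holVec]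
  ring

lemma delAt_weightedSq (hσ : DifferentiableAt ℂ σ p) (hφ : DifferentiableAt ℝ φ p)
    (v : Cn n) : delAt (fun x => (weightedSq σ φ x : ℂ)) p v =
      conj (σ p) * (Real.exp (-φ p) * chernDeriv σ φ v p) := by
  have hd : DifferentiableAt ℝ (weightedSq σ φ) p := by
    have h : weightedSq σ φ = fun x => (σ x * conj (σ x)).re * Real.exp (-φ x) := by
      funext x
      rw [Complex.mul_conj, Complex.ofReal_re, weightedSq]
    have hσ' : DifferentiableAt ℝ σ p := hσ.restrictScalars ℝ
    rw [h]
    exact (Complex.reCLM.differentiableAt.comp p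
      (hσ'.fun_mul (differentiableAt_conj hσ'))).mul hφ.neg.exp
  have h1 := congrArg conj (cderiv_antiVec_weightedSq hσ hφ v)
  rw [cderiv_conj_ofReal hd, conjVec_antiVec, cderiv_holVec] at h1
  rw [h1, map_mul, map_mul, Complex.conj_ofReal, Complex.conj_conj]

/-- The Levi form of the squared norm of a holomorphic section. -/
lemma leviForm_weightedSq (hσ : ContDiffAt ℂ ω σ p) (hφ : ContDiffAt ℝ 2 φ p) (v : Cn n) :
    leviForm (weightedSq σ φ) p v = Real.exp (-φ p) * Complex.normSq (chernDeriv σ φ v p) -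
      weightedSq σ φ p * leviForm φ p v := by
  have hσr : ContDiffAt ℝ 2 σ p := (hσ.restrict_scalars ℝ).of_le (by simp)
  have hdσ : DifferentiableAt ℂ σ p := hσ.differentiableAt (by simp)
  have hdσ' : DifferentiableAt ℝ σ p := hdσ.restrictScalars ℝ
  have hdφ : DifferentiableAt ℝ φ p := hφ.differentiableAt (by norm_num)
  have hφc := contDiffAt_ofReal hφ
  have hσev : ∀ᶠ x in nhds p, DifferentiableAt ℂ σ x :=
    (hσ.eventually (by simp)).mono fun x hx => hx.differentiableAt (by simp)
  have hφev : ∀ᶠ x in nhds p, DifferentiableAt ℝ φ x :=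
    (hφ.eventually (by simp)).mono fun x hx => hx.differentiableAt (by norm_num)
  have e : cderiv (antiVec v) (fun x => (weightedSq σ φ x : ℂ)) =ᶠ[nhds p] fun x =>
      σ x * ((Real.exp (-φ x) : ℂ) * conj (chernDeriv σ φ v x)) := by
    filter_upwards [hσev, hφev] with x hx hx'
    exact cderiv_antiVec_weightedSq hx hx' v
  have hE : DifferentiableAt ℝ (fun x => (Real.exp (-φ x) : ℂ)) p :=
    differentiableAt_ofReal hdφ.neg.exp
  have d1 : DifferentiableAt ℝ (cderiv (holVec v) σ) p :=
    (ContDiffAt.cderiv (k := 1) hσr (by norm_num)).differentiableAt (by norm_num)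
  have d2 : DifferentiableAt ℝ (cderiv (holVec v) fun x => (φ x : ℂ)) p :=
    (ContDiffAt.cderiv (k := 1) hφc (by norm_num)).differentiableAt (by norm_num)
  have hS : chernDeriv σ φ v = fun x => cderiv (holVec v) σ x -
      σ x * cderiv (holVec v) (fun y => (φ y : ℂ)) x := by
    funext x
    rw [chernDeriv, cderiv_holVec, cderiv_holVec]
  have dS : DifferentiableAt ℝ (chernDeriv σ φ v) p := by
    rw [hS]
    exact d1.fun_sub (hdσ'.fun_mul d2)
  -- The commutator of `∂̄` with the Chern derivative is the curvature, as `∂̄σ = 0`.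
  have hbar : cderiv (antiVec v) (chernDeriv σ φ v) p = -σ p * leviForm φ p v := by
    have h0 : cderiv (antiVec v) σ =ᶠ[nhds p] fun _ => 0 := by
      filter_upwards [hσev] with x hx using cderiv_antiVec_holomorphic hx v
    rw [hS, cderiv_sub d1 (hdσ'.fun_mul d2), cderiv_mul hdσ' d2, cderiv_comm hσr, cderiv_congr h0,
      cderiv_const, cderiv_antiVec_holomorphic hdσ, cderiv_comm hφc, leviForm_eq hφ]
    ring
  have key : (leviForm (weightedSq σ φ) p v : ℂ) = Real.exp (-φ p) *
      Complex.normSq (chernDeriv σ φ v p) - weightedSq σ φ p * leviForm φ p v := by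
    have hSp : cderiv (holVec v) σ p = chernDeriv σ φ v p +
        σ p * cderiv (holVec v) (fun y => (φ y : ℂ)) p := by
      rw [hS]; ring
    rw [leviForm_eq (contDiffAt_weightedSq hσr hφ), cderiv_congr e,
      cderiv_mul hdσ' (hE.fun_mul (differentiableAt_conj dS)),
      cderiv_mul hE (differentiableAt_conj dS), cderiv_conj dS, conjVec_holVec, hbar,
      cderiv_exp_neg hdφ, hSp, map_mul, map_neg, Complex.conj_ofReal, ofReal_weightedSq,
      ← Complex.mul_conj]
    ring
  exact_mod_cast key

end Calculus

/-! ### The twisting function and the pointwise inequality -/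

section Barrier

/-- The logarithmic function `log (1 + τ²) - log (τ² + t)`. -/
def logRatio (τ t : ℝ) : ℝ := Real.log (1 + τ ^ 2) - Real.log (τ ^ 2 + t)

/-- The function `B + u + log (1 + u)`. -/
def concaveFun (B u : ℝ) : ℝ := B + u + Real.log (1 + u)

lemma hasDerivAt_concaveFun {B u : ℝ} (hu : 0 < 1 + u) :
    HasDerivAt (concaveFun B) (1 + (1 + u)⁻¹) u := by
  have h := ((hasDerivAt_id u).const_add 1).log hu.ne'
  exact (((hasDerivAt_id u).const_add B).add h).congr_deriv (by simp)

lemma hasDerivAt_one_add_inv {u : ℝ} (hu : 0 < 1 + u) :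
    HasDerivAt (fun u : ℝ => 1 + (1 + u)⁻¹) (-((1 + u) ^ 2)⁻¹) u := by
  have h := (((hasDerivAt_id u).const_add 1).inv hu.ne').const_add 1
  simpa [div_eq_mul_inv] using h

lemma contDiffAt_concaveFun {B u : ℝ} {m : WithTop ℕ∞} (hu : 0 < 1 + u) :
    ContDiffAt ℝ m (concaveFun B) u :=
  (contDiffAt_const.add contDiffAt_id).add ((contDiffAt_const.add contDiffAt_id).log hu.ne')

lemma hasDerivAt_logRatio {τ t : ℝ} (ht : 0 < τ ^ 2 + t) :
    HasDerivAt (logRatio τ) (-(τ ^ 2 + t)⁻¹) t := by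
  have h := (((hasDerivAt_id t).const_add (τ ^ 2)).log ht.ne').const_sub (Real.log (1 + τ ^ 2))
  exact h.congr_deriv (by simp)

lemma hasDerivAt_neg_inv {τ t : ℝ} (ht : 0 < τ ^ 2 + t) :
    HasDerivAt (fun t : ℝ => -(τ ^ 2 + t)⁻¹) (((τ ^ 2 + t) ^ 2)⁻¹) t := by
  have h := (((hasDerivAt_id t).const_add (τ ^ 2)).inv ht.ne').neg
  exact h.congr_deriv (by simp [div_eq_mul_inv])

lemma contDiffAt_logRatio {τ t : ℝ} {m : WithTop ℕ∞} (ht : 0 < τ ^ 2 + t) :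
    ContDiffAt ℝ m (logRatio τ) t :=
  contDiffAt_const.sub ((contDiffAt_const.add contDiffAt_id).log ht.ne')

variable {n : ℕ} {p : Cn n} {σ : Cn n → ℂ} {φ : Cn n → ℝ}

lemma weightedSq_nonneg (x : Cn n) : 0 ≤ weightedSq σ φ x :=
  mul_nonneg (Complex.normSq_nonneg _) (Real.exp_pos _).le

/-- With `N = |σ|²` and `|∂N|² = N |Dσ|²`, the coefficient of `|Dσ|²` is `-1/(τ²+N) + N/(τ²+N)² =
-τ²/(τ²+N)²`. This is where the weight on the left-hand side of the estimate comes from. -/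
lemma leviForm_logRatio (hσ : ContDiffAt ℂ ω σ p) (hφ : ContDiffAt ℝ 2 φ p) {τ : ℝ} (hτ : τ ≠ 0)
    (v : Cn n) : leviForm (fun x => logRatio τ (weightedSq σ φ x)) p v =
      -(τ ^ 2 / (τ ^ 2 + weightedSq σ φ p) ^ 2 *
        (Real.exp (-φ p) * Complex.normSq (chernDeriv σ φ v p))) +
      weightedSq σ φ p / (τ ^ 2 + weightedSq σ φ p) * leviForm φ p v := by
  have hτ2 : 0 < τ ^ 2 := by positivity
  have hpos : 0 < τ ^ 2 + weightedSq σ φ p := by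
    linarith [weightedSq_nonneg (σ := σ) (φ := φ) p]
  have hN : ContDiffAt ℝ 2 (weightedSq σ φ) p :=
    contDiffAt_weightedSq ((hσ.restrict_scalars ℝ).of_le (by simp)) hφ
  have hev : ∀ᶠ t in nhds (weightedSq σ φ p), HasDerivAt (logRatio τ) (-(τ ^ 2 + t)⁻¹) t := by
    have : ∀ᶠ t in nhds (weightedSq σ φ p), 0 < τ ^ 2 + t :=
      (continuous_const.add continuous_id).continuousAt.eventually (lt_mem_nhds hpos)
    filter_upwards [this] with t ht using hasDerivAt_logRatio ht
  rw [leviForm_comp_real hN (contDiffAt_logRatio hpos) hev (hasDerivAt_neg_inv hpos),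
    leviForm_weightedSq hσ hφ, delAt_weightedSq (hσ.differentiableAt (by simp))
      (hφ.differentiableAt (by norm_num))]
  simp only [map_mul, Complex.normSq_conj, Complex.normSq_ofReal]
  have hw : Complex.normSq (σ p) * Real.exp (-φ p) = weightedSq σ φ p := rfl
  have e : Complex.normSq (σ p) * (Real.exp (-φ p) * Real.exp (-φ p) *
      Complex.normSq (chernDeriv σ φ v p)) = weightedSq σ φ p *
      (Real.exp (-φ p) * Complex.normSq (chernDeriv σ φ v p)) := by
    rw [← hw]; ring
  rw [e]
  field_simp
  ring

/-- The pointwise inequality behind the estimate. -/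
lemma pointwise_estimate {E c Y Z u f a δ Lψ Lφ P : ℝ} {t D : ℂ} (hE : 0 ≤ E) (hc : 0 ≤ c)
    (hY : c * Complex.normSq t / 4 = Y) (hZ : 0 ≤ Z) (hu : 0 ≤ u) (hP : 0 ≤ P) (ha : 0 ≤ a)
    (hδ : 0 < δ) (hL : δ * Lφ ≤ Lψ) (hL0 : 0 ≤ Lψ) (hf : (1 + (1 + u)⁻¹) * a / δ ≤ f) :
    E * (c * P) ≤ (f + 4 * (1 + u) ^ 2) * (E * Y + E * Z) -
      E * (f * (Y + Z) - c * (f * Lψ - ((1 + (1 + u)⁻¹) * (-P + a * Lφ) +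
        -((1 + u) ^ 2)⁻¹ * Complex.normSq D) +
        (t * conj (((1 + (1 + u)⁻¹ : ℝ) : ℂ) * D)).re)) := by
  set f₁ := 1 + (1 + u)⁻¹ with hf₁
  have hu1 : 0 < 1 + u := by linarith
  have hf1 : 1 ≤ f₁ := by
    have := inv_pos.2 hu1
    linarith
  -- The unfavourable curvature of the divisor is paid for by that of `L`: `Lφ ≤ Lψ / δ` and `f₁ a /
  -- δ ≤ f`.
  have h1 : f₁ * a * Lφ ≤ f * Lψ := by
    have h2 : Lφ ≤ Lψ / δ := by rw [le_div_iff₀ hδ]; linarith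
    calc f₁ * a * Lφ ≤ f₁ * a * (Lψ / δ) := by gcongr
      _ = f₁ * a / δ * Lψ := by ring
      _ ≤ f * Lψ := by gcongr
  have h2 : -((t * conj ((f₁ : ℂ) * D)).re) ≤ f₁ * (‖t‖ * ‖D‖) := by
    have := Complex.abs_re_le_norm (t * conj ((f₁ : ℂ) * D))
    rw [norm_mul, RCLike.norm_conj, norm_mul, Complex.norm_real, Real.norm_eq_abs,
      abs_of_nonneg (by linarith : (0:ℝ) ≤ f₁)] at this
    linarith [neg_abs_le (t * conj ((f₁ : ℂ) * D)).re]
  -- As `f₁ ≤ 2`, the cross term is at most `2 ‖t‖ ‖D‖`. It is split so that the part with `‖D‖²` is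
  -- exactly the term gained from the concavity of the twist.
  have h3 : f₁ * (‖t‖ * ‖D‖) ≤ ((1 + u) ^ 2)⁻¹ * ‖D‖ ^ 2 + (1 + u) ^ 2 * ‖t‖ ^ 2 := by
    have e : f₁ = (u + 2) * (1 + u)⁻¹ := by rw [hf₁]; field_simp; ring
    have h4 := sq_nonneg ((1 + u)⁻¹ * ‖D‖ - (1 + u) * ‖t‖)
    have h5 : f₁ ≤ 2 := by
      rw [e, ← div_eq_mul_inv, div_le_iff₀ hu1]; linarith
    have h6 : f₁ * (‖t‖ * ‖D‖) ≤ 2 * (‖t‖ * ‖D‖) := by gcongr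
    have h7 : (1 + u)⁻¹ * (1 + u) = 1 := inv_mul_cancel₀ hu1.ne'
    have h8 : ((1 + u)⁻¹ * ‖D‖ - (1 + u) * ‖t‖) ^ 2 = ((1 + u)⁻¹) ^ 2 * ‖D‖ ^ 2 +
        (1 + u) ^ 2 * ‖t‖ ^ 2 - 2 * (‖t‖ * ‖D‖) := by
      linear_combination (-2 * ‖t‖ * ‖D‖) * h7
    rw [← inv_pow]
    linarith
  rw [Complex.normSq_eq_norm_sq] at hY ⊢
  have h4 : 0 ≤ 4 * (1 + u) ^ 2 * Z := by positivity
  have h5 : P ≤ f₁ * P := by nlinarith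
  -- Since `c ‖t‖² = 4Y`, the other part of the cross term is `4 (1+u)² Y`, a multiple of the norm
  -- of `∂̄*ξ`.
  have key : c * P ≤ 4 * (1 + u) ^ 2 * (Y + Z) + c * (f * Lψ - (f₁ * (-P + a * Lφ) +
      -((1 + u) ^ 2)⁻¹ * Complex.normSq D) + (t * conj ((f₁ : ℂ) * D)).re) := by
    rw [Complex.normSq_eq_norm_sq]
    have h6 : P - (1 + u) ^ 2 * ‖t‖ ^ 2 ≤ f * Lψ - (f₁ * (-P + a * Lφ) +
      -((1 + u) ^ 2)⁻¹ * ‖D‖ ^ 2) + (t * conj ((f₁ : ℂ) * D)).re := by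
      linarith
    have h7 := mul_le_mul_of_nonneg_left h6 hc
    have h8 : 4 * (1 + u) ^ 2 * Y = c * ((1 + u) ^ 2 * ‖t‖ ^ 2) := by rw [← hY]; ring
    linarith
  have := mul_le_mul_of_nonneg_left key hE
  rw [Complex.normSq_eq_norm_sq] at this
  linarith

end Barrier

/-! ### The estimate of the densities at a point of `X` -/

section Estimate

variable {n : ℕ} {X : Type*} [TopologicalSpace X] [ChartedSpace (Cn n) X]
  [IsManifold 𝓘(ℂ, Cn n) ω X]
  {F : X → Type*} [TopologicalSpace (TotalSpace ℂ F)] [∀ x, TopologicalSpace (F x)]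
  [∀ x, AddCommGroup (F x)] [∀ x, Module ℂ (F x)] [FiberBundle ℂ F] [VectorBundle ℂ ℂ F]
  [ContMDiffVectorBundle ω ℂ F 𝓘(ℂ, Cn n)]

/-- The coordinate of a section in the frame and the chart at `x`. -/
def localSection (s : ∀ x, F x) (x : X) (p : Cn n) : ℂ := fibreCoord F x (pt x p) (s (pt x p))

lemma contDiffAt_localSection (s : Cₛ^ω⟮𝓘(ℂ, Cn n); ℂ, F⟯) (x : X) :
    ContDiffAt ℂ ω (localSection (n := n) s x) (chartAt (Cn n) x x) := by
  have hpt : ContMDiffAt 𝓘(ℂ, Cn n) 𝓘(ℂ, Cn n) ω (pt x) (chartAt (Cn n) x x) :=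
    (contMDiffOn_chart_symm (I := 𝓘(ℂ, Cn n)) (n := ω) (x := x)).contMDiffAt
      ((chartAt (Cn n) x).open_target.mem_nhds (mem_chart_target _ x))
  have h1 : ContMDiffAt 𝓘(ℂ, Cn n) 𝓘(ℂ, ℂ) ω
      (fun y => (trivializationAt ℂ F x ⟨y, s y⟩).2) (pt x (chartAt (Cn n) x x)) := by
    rw [pt_chartAt]
    exact (contMDiffAt_section x).1 (s.contMDiff x)
  refine (ContMDiffAt.comp _ h1 hpt).contDiffAt.congr_of_eventuallyEq ?_
  filter_upwards [eventually_pt (n := n) ((trivializationAt ℂ F x).open_baseSet.mem_nhds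
    (mem_baseSet_trivializationAt ℂ F x))] with p hp
  simp only [localSection, fibreCoord, Function.comp_apply]
  rw [Trivialization.continuousLinearMapAt_apply, Trivialization.coe_linearMapAt_of_mem _ hp]

lemma normSq_eq_weightedSq (h : HermitianMetric (n := n) F) (s : ∀ x, F x) {x : X} {p : Cn n}
    (hp : pt x p ∈ (trivializationAt ℂ F x).baseSet) :
    h.normSq (pt x p) (s (pt x p)) = weightedSq (localSection s x) (h.weight x) p := by
  rw [h.normSq_eq x hp, weightedSq, h.exp_neg_weight hp, mul_comm]
  rfl

lemma eventually_normSq_eq (h : HermitianMetric (n := n) F) (s : ∀ x, F x) (x : X) :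
    (fun p => h.normSq (pt x p) (s (pt x p))) =ᶠ[nhds (chartAt (Cn n) x x)]
      weightedSq (localSection s x) (h.weight x) := by
  filter_upwards [eventually_pt (n := n) ((trivializationAt ℂ F x).open_baseSet.mem_nhds
    (mem_baseSet_trivializationAt ℂ F x))] with p hp using normSq_eq_weightedSq h s hp

lemma isSmoothFun_normSq (h : HermitianMetric (n := n) F) (s : Cₛ^ω⟮𝓘(ℂ, Cn n); ℂ, F⟯) :
    IsSmoothFun (n := n) fun x => h.normSq x (s x) := fun x =>
  (contDiffAt_weightedSq (((contDiffAt_localSection s x).restrict_scalars ℝ).of_le (by simp))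
    (h.contDiffAt_weight (mem_goodSet_self x))).congr_of_eventuallyEq (eventually_normSq_eq h s x)

lemma chernLM_eq_chernDeriv (h : HermitianMetric (n := n) F) (s : ∀ x, F x) (x : X) (v : Cn n) :
    chernLM h s x v = chernDeriv (localSection s x) (h.weight x) v (chartAt (Cn n) x x) := by
  have e : ∀ q, q = x → fibreCoord F x q (s q) = fibreCoord F x x (s x) := by rintro _ rfl; rfl
  rw [chernDeriv, localSection, e _ (pt_chartAt x)]
  rfl

variable {L : X → Type*} [TopologicalSpace (TotalSpace ℂ L)] [∀ x, TopologicalSpace (L x)]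
  [∀ x, AddCommGroup (L x)] [∀ x, Module ℂ (L x)] [FiberBundle ℂ L] [VectorBundle ℂ ℂ L]

lemma normSqForm_eq (K : KahlerForm n X) (h : HermitianMetric (n := n) L) {k : ℕ}
    (u : LForm n L k) (x : X) : normSqForm K h u x =
      h.normSq x (frame L x x) *
        (innerForm (K.form x) stdPair (centralForm u x) (centralForm u x)).re := by
  rw [normSqForm, innerForm_pair h _ x (mem_baseSet_trivializationAt ℂ L x), Complex.re_ofReal_mul]
  rfl

lemma normSqForm_nonneg (K : KahlerForm n X) (h : HermitianMetric (n := n) L) {k : ℕ}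
    (u : LForm n L k) (x : X) : 0 ≤ normSqForm K h u x := by
  rw [normSqForm_eq]
  exact mul_nonneg (h.normSq_nonneg x _) ((K.isPositiveOneOne x).innerForm_self_nonneg _)

/-- The density of the left-hand side of the estimate. -/
def tangentialDensity (K : KahlerForm n X) (hL : HermitianMetric (n := n) L)
    (hF : HermitianMetric (n := n) F) (s : ∀ x, F x) (τ : ℝ) (ξ : LForm n L (n + 1)) (x : X) : ℝ :=
  τ ^ 2 / (τ ^ 2 + hF.normSq x (s x)) ^ 2 *
    (2 ^ (n + 2) * hL.normSq x (frame L x x) / (hermMat (K.form x)).det.re *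
      (hF.normSq x (frame F x x) *
        Complex.normSq (chernLM hF s x (dualVec (K.form x) (centralForm ξ x)))))

lemma tangentialDensity_nonneg (K : KahlerForm n X) (hL : HermitianMetric (n := n) L)
    (hF : HermitianMetric (n := n) F) (s : ∀ x, F x) (τ : ℝ) (ξ : LForm n L (n + 1)) (x : X) :
    0 ≤ tangentialDensity K hL hF s τ ξ x := by
  have h1 := hL.normSq_nonneg x (frame L x x)
  have h2 := hF.normSq_nonneg x (frame F x x)
  have h3 := (K.isPositiveOneOne x).det_re_pos.le
  have h4 := Complex.normSq_nonneg (chernLM hF s x (dualVec (K.form x) (centralForm ξ x)))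
  unfold tangentialDensity
  positivity

lemma estimateLHS_eq [MeasurableSpace X] (hn : 1 ≤ n) (K : KahlerForm n X)
    (hL : HermitianMetric (n := n) L) (hF : HermitianMetric (n := n) F) (s : ∀ x, F x) (τ : ℝ)
    {ξ : LForm n L (n + 1)} (hξ : ∀ x, IsOfType n 1 (ξ x)) :
    estimateLHS hn K hL hF s τ ξ = ∫ x, tangentialDensity K hL hF s τ ξ x ∂(volMeasure K) := by
  have e : ∀ x, ((τ ^ 2 / (τ ^ 2 + hF.normSq x (s x)) ^ 2 : ℝ) : ℂ) *
      tangentialForm hn K hL hF s ξ x realBasis / (volForm (K.form x) realBasis : ℂ) =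
      (tangentialDensity K hL hF s τ ξ x : ℂ) := fun x => by
    rw [mul_div_assoc, tangentialForm_div_volForm hn K hL hF s ξ x (hξ x), ← Complex.ofReal_mul]
    rfl
  rw [estimateLHS, integralTop]
  simp only [e]
  rw [integral_complex_ofReal, Complex.ofReal_re]

/-- After subtraction of the Bochner term, whose integral is nonnegative, only the norms of `∂̄*ξ`
and `∂̄ξ` bound the density. Hypothesis `hB` is the condition under which the curvature of `L`
absorbs that of the divisor. -/
lemma tangentialDensity_le (K : KahlerForm n X) (hL : HermitianMetric (n := n) L)
    (hF : HermitianMetric (n := n) F) (s : Cₛ^ω⟮𝓘(ℂ, Cn n); ℂ, F⟯) {τ : ℝ} (hτ : τ ≠ 0)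
    (ξ : LForm n L (n + 1)) {η : LForm n L n} (hη : ∀ x, IsOfType n 0 (η x)) {δ B : ℝ} (hδ : 0 < δ)
    {x : X} (hpos : ∀ v, 0 ≤ hL.curvature x v)
    (hcmp : ∀ v, δ * hF.curvature x v ≤ hL.curvature x v)
    (hu : 0 ≤ logRatio τ (hF.normSq x (s x)))
    (hB : (1 + (1 + logRatio τ (hF.normSq x (s x)))⁻¹) *
      (hF.normSq x (s x) / (τ ^ 2 + hF.normSq x (s x))) / δ ≤
        concaveFun B (logRatio τ (hF.normSq x (s x)))) :
    tangentialDensity K hL hF s τ ξ x ≤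
      (concaveFun B (logRatio τ (hF.normSq x (s x))) +
        4 * (1 + logRatio τ (hF.normSq x (s x))) ^ 2) *
        (normSqForm K hL η x + normSqForm K hL (dbar ξ) x) -
      bochnerAt K hL ξ η (fun y => concaveFun B (logRatio τ (hF.normSq y (s y)))) x := by
  set p := chartAt (Cn n) x x with hp
  set V := dualVec (K.form x) (centralForm ξ x) with hV
  set σ := localSection (n := n) s x with hσdef
  set φ := hF.weight x with hφdef
  have hw := K.isPositiveOneOne x
  have hσ := contDiffAt_localSection s x
  have hφ : ContDiffAt ℝ 2 φ p := (hF.contDiffAt_weight (mem_goodSet_self x)).of_le (by norm_cast)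
  have hbF : pt x p ∈ (trivializationAt ℂ F x).baseSet := (mem_goodSet_self (L := F) x).2
  have hbL : pt x p ∈ (trivializationAt ℂ L x).baseSet := (mem_goodSet_self (L := L) x).2
  have hN0 : weightedSq σ φ p = hF.normSq x (s x) := by
    rw [← normSq_eq_weightedSq hF s hbF]
    have e : ∀ q, q = x → hF.normSq q (s q) = hF.normSq x (s x) := by rintro _ rfl; rfl
    exact e _ (pt_chartAt x)
  have hEL : Real.exp (-hL.weight x p) = hL.normSq x (frame L x x) := by
    rw [hL.exp_neg_weight hbL]
    have e : ∀ q, q = x → hL.normSq q (frame L x q) = hL.normSq x (frame L x x) := by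
      rintro _ rfl; rfl
    exact e _ (pt_chartAt x)
  have hEF : Real.exp (-φ p) = hF.normSq x (frame F x x) := by
    rw [hF.exp_neg_weight hbF]
    have e : ∀ q, q = x → hF.normSq q (frame F x q) = hF.normSq x (frame F x x) := by
      rintro _ rfl; rfl
    exact e _ (pt_chartAt x)
  set N := hF.normSq x (s x) with hN
  have hNn : 0 ≤ N := hF.normSq_nonneg x _
  have hτN : 0 < τ ^ 2 + N := by positivity
  set u := logRatio τ N with hudef
  have hu1 : 0 < 1 + u := by linarith
  have hr : ContDiffAt ℝ 2 (fun q => logRatio τ (weightedSq σ φ q)) p :=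
    ContDiffAt.comp (g := logRatio τ) (f := weightedSq σ φ) p
      (by rw [hN0]; exact contDiffAt_logRatio hτN)
      (contDiffAt_weightedSq ((hσ.restrict_scalars ℝ).of_le (by simp)) hφ)
  have hru : logRatio τ (weightedSq σ φ p) = u := by rw [hN0]
  have hgc : (fun q => concaveFun B (logRatio τ (hF.normSq (pt x q) (s (pt x q))))) =ᶠ[nhds p]
      fun q => concaveFun B (logRatio τ (weightedSq σ φ q)) := by
    filter_upwards [eventually_normSq_eq hF s x] with q hq
    rw [hq]
  have hgc' : (fun q => (concaveFun B (logRatio τ (hF.normSq (pt x q) (s (pt x q)))) : ℂ))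
      =ᶠ[nhds p] fun q => (concaveFun B (logRatio τ (weightedSq σ φ q)) : ℂ) :=
    hgc.fun_comp Complex.ofReal
  have hev : ∀ᶠ t in nhds (logRatio τ (weightedSq σ φ p)),
      HasDerivAt (concaveFun B) (1 + (1 + t)⁻¹) t := by
    rw [hru]
    have : ∀ᶠ t in nhds u, 0 < 1 + t :=
      (continuous_const.add continuous_id).continuousAt.eventually (lt_mem_nhds hu1)
    filter_upwards [this] with t ht using hasDerivAt_concaveFun ht
  have hlevi : leviForm (fun q => concaveFun B (logRatio τ (hF.normSq (pt x q) (s (pt x q))))) p V =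
      (1 + (1 + u)⁻¹) * (-(τ ^ 2 / (τ ^ 2 + N) ^ 2 *
        (Real.exp (-φ p) * Complex.normSq (chernDeriv σ φ V p))) +
        N / (τ ^ 2 + N) * leviForm φ p V) + -((1 + u) ^ 2)⁻¹ *
        Complex.normSq (delAt (fun q => (logRatio τ (weightedSq σ φ q) : ℂ)) p V) := by
    rw [leviForm_congr hgc, leviForm_comp_real hr
      (by rw [hru]; exact contDiffAt_concaveFun hu1) hev
      (by rw [hru]; exact hasDerivAt_one_add_inv hu1), leviForm_logRatio hσ hφ hτ, hN0]
  have hdel : delAt (fun q => (concaveFun B (logRatio τ (hF.normSq (pt x q) (s (pt x q)))) : ℂ))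
      p V = ((1 + (1 + u)⁻¹ : ℝ) : ℂ) *
        delAt (fun q => (logRatio τ (weightedSq σ φ q) : ℂ)) p V := by
    rw [← cderiv_holVec, cderiv_congr hgc', cderiv_holVec, delAt_comp_real
      (u := fun q => logRatio τ (weightedSq σ φ q)) (by rw [hru]; exact hasDerivAt_concaveFun hu1)
      (hr.differentiableAt (by norm_num))]
  have hd := hw.det_re_pos
  have hval : concaveFun B (logRatio τ (hF.normSq (pt x p) (s (pt x p)))) = concaveFun B u := by
    rw [hgc.eq_of_nhds, hru]
  -- The division by `4` reconciles the factor `2^(n+2)` of the Bochner term with the `2^n` in the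
  -- norm of an `(n,0)`-form.
  have hY : 2 ^ (n + 2) / (hermMat (K.form x)).det.re *
      Complex.normSq (topCoeff (centralForm η x)) / 4 =
      (innerForm (K.form x) stdPair (centralForm η x) (centralForm η x)).re := by
    rw [hw.innerForm_top (IsOfType.centralForm (hη x)), Complex.mul_conj, ← hw.ofReal_det_re]
    norm_cast
    rw [pow_add]
    push_cast
    ring
  have key := pointwise_estimate (E := hL.normSq x (frame L x x))
    (c := 2 ^ (n + 2) / (hermMat (K.form x)).det.re) (f := concaveFun B u)
    (Lψ := hL.curvature x V) (Lφ := leviForm φ p V)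
    (D := delAt (fun q => (logRatio τ (weightedSq σ φ q) : ℂ)) p V)
    (P := τ ^ 2 / (τ ^ 2 + N) ^ 2 * (Real.exp (-φ p) * Complex.normSq (chernDeriv σ φ V p)))
    (hL.normSq_nonneg x _) (by positivity) hY
    (hw.innerForm_self_nonneg (centralForm (dbar ξ) x)) hu
    (mul_nonneg (by positivity) (mul_nonneg (Real.exp_pos _).le (Complex.normSq_nonneg _)))
    (div_nonneg hNn hτN.le) hδ (hcmp V) (hpos V) hB
  rw [normSqForm_eq, normSqForm_eq, bochnerAt, bochnerTerm, hEL, hval, hlevi, hdel]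
  refine Eq.trans_le ?_ key
  rw [tangentialDensity, chernLM_eq_chernDeriv, hEF]
  ring

end Estimate

/-! ### Bounds for the twisting function -/

section Constants

/-- For `t ≤ 1 - ε` one has `-log t ≥ 1 - t ≥ ε ≥ log (1 + ε)`; for `t ≥ 1 + ε` the logarithm is
monotone. -/
lemma log_one_add_le_abs_log {ε t : ℝ} (hε : 0 < ε) (ht : 0 < t) (h : ε ≤ |t - 1|) :
    Real.log (1 + ε) ≤ |Real.log t| := by
  rcases le_abs.1 h with h1 | h1
  · exact (Real.log_le_log (by linarith) (by linarith)).trans (le_abs_self _)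
  · refine le_trans ?_ (neg_le_abs _)
    have h2 := Real.log_le_sub_one_of_pos ht
    have h3 := Real.log_le_sub_one_of_pos (by linarith : 0 < 1 + ε)
    linarith

/-- In both cases `1 + u ≤ 2 + |log (τ²+N)|`: if `τ²+N ≥ 1` then `1+τ² ≤ 2(τ²+N)` and `u ≤ log 2`,
and otherwise `1+τ² ≤ 2`. The constant `2` is at most `(2 / log (1+ε)) |log (τ²+N)|`. -/
lemma one_add_logRatio_le {ε τ N : ℝ} (hε : 0 < ε) (hN : 0 ≤ N) (hpos : 0 < τ ^ 2 + N)
    (h : ε ≤ |τ ^ 2 + N - 1|) :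
    1 + logRatio τ N ≤ (1 + 2 / Real.log (1 + ε)) * |Real.log (τ ^ 2 + N)| := by
  have hm : 0 < Real.log (1 + ε) := Real.log_pos (by linarith)
  have hml := log_one_add_le_abs_log hε hpos h
  have h2 : 2 ≤ 2 / Real.log (1 + ε) * |Real.log (τ ^ 2 + N)| := by
    rw [div_mul_eq_mul_div, le_div_iff₀ hm]
    linarith
  have hl2 : Real.log 2 ≤ 1 := by linarith [Real.log_two_lt_d9]
  rw [add_mul, one_mul, logRatio]
  rcases le_total 1 (τ ^ 2 + N) with h1 | h1
  · have h3 : Real.log (1 + τ ^ 2) ≤ Real.log (2 * (τ ^ 2 + N)) :=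
      Real.log_le_log (by positivity) (by linarith)
    rw [Real.log_mul (by norm_num) hpos.ne'] at h3
    linarith [abs_nonneg (Real.log (τ ^ 2 + N))]
  · have h3 : Real.log (1 + τ ^ 2) ≤ Real.log 2 :=
      Real.log_le_log (by positivity) (by linarith)
    linarith [neg_le_abs (Real.log (τ ^ 2 + N))]

lemma logRatio_nonneg {τ N : ℝ} (hN1 : N ≤ 1) (hpos : 0 < τ ^ 2 + N) : 0 ≤ logRatio τ N := by
  rw [logRatio, sub_nonneg]
  exact Real.log_le_log hpos (by linarith)

/-- The constant of the estimate. -/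
def estimateConst (B ε : ℝ) : ℝ :=
  B / Real.log (1 + ε) ^ 2 + 6 * (1 + 2 / Real.log (1 + ε)) ^ 2

lemma estimateConst_nonneg {B ε : ℝ} (hB : 0 ≤ B) : 0 ≤ estimateConst B ε := by
  unfold estimateConst
  positivity

/-- From `log (1+u) ≤ u` the twist is at most `B + 2u ≤ B + 2(1+u)²`, which together with `4(1+u)²`
gives the coefficient `6`. The constant `B` is absorbed by means of `log² ≥ log²(1+ε)`. -/
lemma concaveFun_add_le {ε τ N B : ℝ} (hB : 0 ≤ B) (hε : 0 < ε) (hN : 0 ≤ N) (hN1 : N ≤ 1)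
    (hpos : 0 < τ ^ 2 + N) (h : ε ≤ |τ ^ 2 + N - 1|) :
    concaveFun B (logRatio τ N) + 4 * (1 + logRatio τ N) ^ 2 ≤
      estimateConst B ε * Real.log (τ ^ 2 + N) ^ 2 := by
  have hm : 0 < Real.log (1 + ε) := Real.log_pos (by linarith)
  have hml := log_one_add_le_abs_log hε hpos h
  have hu := logRatio_nonneg hN1 hpos
  have hle := one_add_logRatio_le hε hN hpos h
  set u := logRatio τ N
  set l := Real.log (τ ^ 2 + N)
  set m := Real.log (1 + ε)
  have h1 : B ≤ B / m ^ 2 * l ^ 2 := by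
    rw [div_mul_eq_mul_div, le_div_iff₀ (by positivity)]
    have : m ^ 2 ≤ l ^ 2 := by
      rw [← sq_abs l]
      gcongr
    gcongr
  have h2 : (1 + u) ^ 2 ≤ (1 + 2 / m) ^ 2 * l ^ 2 := by
    rw [← sq_abs l, ← mul_pow]
    gcongr
  have h3 : Real.log (1 + u) ≤ u := by
    have := Real.log_le_sub_one_of_pos (by linarith : 0 < 1 + u)
    linarith
  have h4 : 2 * u ≤ 2 * (1 + u) ^ 2 := by nlinarith
  rw [concaveFun, estimateConst, add_mul]
  have h5 : 6 * (1 + 2 / m) ^ 2 * l ^ 2 = 6 * ((1 + 2 / m) ^ 2 * l ^ 2) := by ring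
  linarith

/-- The derivative of the twist is at most `2` and the quotient at most `1`, so that the additive
constant `2/δ` suffices by itself. -/
lemma curvature_factor_le_of_const {τ N δ : ℝ} (hδ : 0 < δ) (hN : 0 ≤ N) (hN1 : N ≤ 1)
    (hpos : 0 < τ ^ 2 + N) :
    (1 + (1 + logRatio τ N)⁻¹) * (N / (τ ^ 2 + N)) / δ ≤ concaveFun (2 / δ) (logRatio τ N) := by
  have hu := logRatio_nonneg hN1 hpos
  set u := logRatio τ N
  have h1 : (1 + u)⁻¹ ≤ 1 := inv_le_one_of_one_le₀ (by linarith)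
  have h2 : N / (τ ^ 2 + N) ≤ 1 := by
    rw [div_le_one hpos]
    nlinarith [sq_nonneg τ]
  have h3 : (1 + (1 + u)⁻¹) * (N / (τ ^ 2 + N)) ≤ 2 * 1 := by
    gcongr
    linarith
  have h4 : 0 ≤ Real.log (1 + u) := Real.log_nonneg (by linarith)
  have h5 : (1 + (1 + u)⁻¹) * (N / (τ ^ 2 + N)) / δ ≤ 2 / δ := by
    gcongr
    linarith
  rw [concaveFun]
  linarith

/-- From `N ≤ e^{-1/δ}` and the definition of `u`, the quotient `a = N/(τ²+N)` is at most `e^{-(1/δ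
- u)}`. Then `a/δ ≤ u + 1`: this is clear if `u ≥ 1/δ`, and otherwise `a/δ = a(1/δ - u) + au`, where
`x e^{-x} ≤ 1` bounds the first term. Multiplied by the derivative of the twist, `u + 1` becomes `u
+ 2`. The additive constant therefore need not depend on `δ`. -/
lemma curvature_factor_le_of_exp {τ N δ : ℝ} (hδ : 0 < δ) (hN : 0 ≤ N)
    (hN1 : N ≤ Real.exp (-1 / δ)) (hpos : 0 < τ ^ 2 + N) :
    (1 + (1 + logRatio τ N)⁻¹) * (N / (τ ^ 2 + N)) / δ ≤ concaveFun 3 (logRatio τ N) := by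
  have hle1 : Real.exp (-1 / δ) ≤ 1 :=
    Real.exp_le_one_iff.2 (div_nonpos_of_nonpos_of_nonneg (by norm_num) hδ.le)
  have hu := logRatio_nonneg (hN1.trans hle1) hpos
  have hexp : Real.exp (logRatio τ N) = (1 + τ ^ 2) / (τ ^ 2 + N) := by
    rw [logRatio, Real.exp_sub, Real.exp_log (by positivity), Real.exp_log hpos]
  set u := logRatio τ N
  have ha1 : N / (τ ^ 2 + N) ≤ 1 := by
    rw [div_le_one hpos]
    nlinarith [sq_nonneg τ]
  have ha0 : 0 ≤ N / (τ ^ 2 + N) := by positivity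
  have ha2 : N / (τ ^ 2 + N) ≤ Real.exp (-(1 / δ - u)) := by
    have e : Real.exp (-(1 / δ - u)) = Real.exp (-1 / δ) * ((1 + τ ^ 2) / (τ ^ 2 + N)) := by
      rw [← hexp, ← Real.exp_add]
      congr 1
      ring
    rw [e, ← mul_div_assoc]
    gcongr
    nlinarith [sq_nonneg τ, Real.exp_pos (-1 / δ)]
  have hD : N / (τ ^ 2 + N) * (1 / δ) ≤ u + 1 := by
    rcases le_total (1 / δ) u with h | h
    · calc N / (τ ^ 2 + N) * (1 / δ) ≤ 1 * (1 / δ) := by gcongr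
        _ ≤ u + 1 := by linarith
    · have h1 : N / (τ ^ 2 + N) * (1 / δ - u) ≤ 1 := by
        have h2 : (1 / δ - u) * Real.exp (-(1 / δ - u)) ≤ 1 := by
          rw [Real.exp_neg, ← div_eq_mul_inv, div_le_one (Real.exp_pos _)]
          linarith [Real.add_one_le_exp (1 / δ - u)]
        have h3 : N / (τ ^ 2 + N) * (1 / δ - u) ≤ Real.exp (-(1 / δ - u)) * (1 / δ - u) :=
          mul_le_mul_of_nonneg_right ha2 (by linarith)
        linarith
      have h4 : N / (τ ^ 2 + N) * u ≤ 1 * u := by gcongr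
      linarith
  have h5 : (1 + (1 + u)⁻¹) * (u + 1) = u + 2 := by
    have : (1 + u) ≠ 0 := by linarith
    field_simp
    ring
  have h6 : (1 + (1 + u)⁻¹) * (N / (τ ^ 2 + N) * (1 / δ)) ≤ (1 + (1 + u)⁻¹) * (u + 1) := by
    have : 0 ≤ (1 + u)⁻¹ := inv_nonneg.2 (by linarith)
    gcongr
  have h7 : 0 ≤ Real.log (1 + u) := Real.log_nonneg (by linarith)
  rw [concaveFun]
  have h8 : (1 + (1 + u)⁻¹) * (N / (τ ^ 2 + N)) / δ =
      (1 + (1 + u)⁻¹) * (N / (τ ^ 2 + N) * (1 / δ)) := by ring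
  linarith

end Constants

/-! ### Integration of the pointwise estimate -/

section Conclusion

variable {n : ℕ} {X : Type*} [TopologicalSpace X] [ChartedSpace (Cn n) X]
  [IsManifold 𝓘(ℂ, Cn n) ω X] [MeasurableSpace X] [BorelSpace X] [T2Space X]
  [SecondCountableTopology X]
  {L : X → Type*} [TopologicalSpace (TotalSpace ℂ L)] [∀ x, TopologicalSpace (L x)]
  [∀ x, AddCommGroup (L x)] [∀ x, Module ℂ (L x)] [FiberBundle ℂ L] [VectorBundle ℂ ℂ L]
  [ContMDiffVectorBundle ω ℂ L 𝓘(ℂ, Cn n)]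
  {F : X → Type*} [TopologicalSpace (TotalSpace ℂ F)] [∀ x, TopologicalSpace (F x)]
  [∀ x, AddCommGroup (F x)] [∀ x, Module ℂ (F x)] [FiberBundle ℂ F] [VectorBundle ℂ ℂ F]
  [ContMDiffVectorBundle ω ℂ F 𝓘(ℂ, Cn n)]

lemma estimateRHS_nonneg (K : KahlerForm n X) (hL : HermitianMetric (n := n) L)
    (hF : HermitianMetric (n := n) F) (s : ∀ x, F x) (τ : ℝ) (ξ : LForm n L (n + 1))
    (η : LForm n L n) : 0 ≤ estimateRHS K hL hF s τ ξ η :=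
  integral_nonneg fun x => mul_nonneg (sq_nonneg _)
    (add_nonneg (normSqForm_nonneg K hL η x) (normSqForm_nonneg K hL (dbar ξ) x))

lemma integrable_estimateRHS {K : KahlerForm n X} {hL : HermitianMetric (n := n) L}
    (hF : HermitianMetric (n := n) F) (s : Cₛ^ω⟮𝓘(ℂ, Cn n); ℂ, F⟯) {τ : ℝ} (hτ : τ ≠ 0)
    {ξ : LForm n L (n + 1)} {η : LForm n L n} (hξ : IsTestForm n 1 ξ)
    (hη : IsDbarAdjoint K hL ξ η) :
    Integrable (fun x => Real.log (τ ^ 2 + hF.normSq x (s x)) ^ 2 *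
      (normSqForm K hL η x + normSqForm K hL (dbar ξ) x)) (volMeasure K) := by
  have := isLocallyFiniteMeasure_volMeasure K
  have hN : Continuous fun x => hF.normSq x (s x) := continuous_iff_continuousAt.2 fun x =>
    continuousAt_of_pt (n := n) (isSmoothFun_normSq hF s x).continuousAt
  have hlog : Continuous fun x => Real.log (τ ^ 2 + hF.normSq x (s x)) :=
    (continuous_const.add hN).log fun x =>
      (add_pos_of_pos_of_nonneg (by positivity) (hF.normSq_nonneg x (s x))).ne'
  have h1 : Continuous (normSqForm K hL η) :=
    Complex.continuous_re.comp (continuous_innerForm_pair K hL hη.1 hη.1)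
  have h2 : Continuous (normSqForm K hL (dbar ξ)) :=
    Complex.continuous_re.comp (continuous_innerForm_pair K hL (hξ.1.dbar hξ.2.1)
      (hξ.1.dbar hξ.2.1))
  refine ((hlog.pow 2).mul (h1.add h2)).integrable_of_hasCompactSupport
    (HasCompactSupport.intro hξ.2.2 fun x hx => ?_)
  change _ * (normSqForm K hL η x + normSqForm K hL (dbar ξ) x) = 0
  rw [normSqForm_eq, normSqForm_eq, innerForm_adjoint_eq_zero hξ hη hx,
    innerForm_dbar_eq_zero hx]
  simp

/-- The weighted estimate, under a bound of the curvature term by the barrier function. -/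
theorem estimateLHS_le (hn : 1 ≤ n) {K : KahlerForm n X} {hL : HermitianMetric (n := n) L}
    {hF : HermitianMetric (n := n) F} {s : Cₛ^ω⟮𝓘(ℂ, Cn n); ℂ, F⟯} {τ ε δ B : ℝ} (hδ : 0 < δ)
    (hε : 0 < ε) (hB : 0 ≤ B) (hpos : ∀ x v, 0 ≤ hL.curvature x v)
    (hcmp : ∀ x v, δ * hF.curvature x v ≤ hL.curvature x v)
    (hτε : ∀ x, ε ≤ |τ ^ 2 + hF.normSq x (s x) - 1|)
    {ξ : LForm n L (n + 1)} (hξ : IsTestForm n 1 ξ) {η : LForm n L n}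
    (hη : IsDbarAdjoint K hL ξ η) (hN1 : ∀ x, hF.normSq x (s x) ≤ 1)
    (hbar : ∀ x, 0 < τ ^ 2 + hF.normSq x (s x) →
      (1 + (1 + logRatio τ (hF.normSq x (s x)))⁻¹) *
        (hF.normSq x (s x) / (τ ^ 2 + hF.normSq x (s x))) / δ ≤
          concaveFun B (logRatio τ (hF.normSq x (s x)))) :
    estimateLHS hn K hL hF s τ ξ ≤ estimateConst B ε * estimateRHS K hL hF s τ ξ η := by
  rw [estimateLHS_eq hn K hL hF s τ hξ.2.1]
  -- For `τ = 0` the weight on the left is zero, while `u` would be singular along the divisor.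
  rcases eq_or_ne τ 0 with rfl | hτ
  · have h0 : ∀ x, tangentialDensity K hL hF s 0 ξ x = 0 := fun x => by simp [tangentialDensity]
    simp only [h0, integral_zero]
    exact mul_nonneg (estimateConst_nonneg hB) (estimateRHS_nonneg K hL hF s 0 ξ η)
  have hN0 : ∀ x, 0 ≤ hF.normSq x (s x) := fun x => hF.normSq_nonneg x _
  have hτN : ∀ x, 0 < τ ^ 2 + hF.normSq x (s x) := fun x => by
    have := hN0 x
    positivity
  have hu : ∀ x, 0 ≤ logRatio τ (hF.normSq x (s x)) := fun x => logRatio_nonneg (hN1 x) (hτN x)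
  let g : X → ℝ := fun x => concaveFun B (logRatio τ (hF.normSq x (s x)))
  have hg : IsSmoothFun (n := n) g :=
    ((isSmoothFun_normSq hF s).comp fun x => contDiffAt_logRatio (hτN x)).comp fun x =>
      contDiffAt_concaveFun (by linarith [hu x])
  have hg0 : ∀ x, 0 ≤ g x := fun x => by
    have := Real.log_nonneg (by linarith [hu x] : 1 ≤ 1 + logRatio τ (hF.normSq x (s x)))
    simp only [g, concaveFun]
    linarith [hu x]
  have hi := (integrable_estimateRHS hF s hτ hξ hη).const_mul (estimateConst B ε)
  have hb := integrable_bochnerAt hξ hη hg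
  -- As the left density is nonnegative, only the majorant has to be integrable.
  have hle := integral_mono_of_nonneg
    (Filter.Eventually.of_forall (tangentialDensity_nonneg K hL hF s τ ξ)) (hi.sub hb)
    (Filter.Eventually.of_forall fun x => by
      refine (tangentialDensity_le K hL hF s hτ ξ hη.2.1 hδ (hpos x) (hcmp x) (hu x)
        (hbar x (hτN x))).trans (sub_le_sub_right ?_ _)
      refine le_of_le_of_eq ?_ (mul_assoc _ _ _)
      exact mul_le_mul_of_nonneg_right
        (concaveFun_add_le hB hε (hN0 x) (hN1 x) (hτN x) (hτε x))
        (add_nonneg (normSqForm_nonneg K hL η x) (normSqForm_nonneg K hL (dbar ξ) x)))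
  have hbn := integral_bochnerAt_nonneg hξ hη hg hg0
  have hsub := integral_sub hi hb
  rw [integral_const_mul] at hsub
  rw [estimateRHS]
  refine hle.trans ?_
  refine (le_of_eq hsub).trans ?_
  linarith

end Conclusion

end

end KahlerForms

theorem mainTheorem5 :
    ∃ (C : ℝ → ℝ → ℝ) (C₀ : ℝ → ℝ),
      ∀ (n : ℕ) (hn : 1 ≤ n) (X : Type*) [TopologicalSpace X] [T2Space X]
        [SecondCountableTopology X] [MeasurableSpace X] [BorelSpace X]
        [ChartedSpace (Cn n) X] [IsManifold 𝓘(ℂ, Cn n) ω X]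
        -- the Kähler metric, the divisor
        (K : KahlerForm n X) (Y : SNCDivisor n X)
        -- the holomorphic line bundle `L` with its metric `h_L`
        (L : X → Type*) [TopologicalSpace (TotalSpace ℂ L)] [∀ x, TopologicalSpace (L x)]
        [∀ x, AddCommGroup (L x)] [∀ x, Module ℂ (L x)] [FiberBundle ℂ L] [VectorBundle ℂ ℂ L]
        [ContMDiffVectorBundle ω ℂ L 𝓘(ℂ, Cn n)] (hL : HermitianMetric (n := n) L)
        -- the holomorphic line bundle `F = 𝒪(Y)` with its metric `h_Y` and its canonical section
        (F : X → Type*) [TopologicalSpace (TotalSpace ℂ F)] [∀ x, TopologicalSpace (F x)]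
        [∀ x, AddCommGroup (F x)] [∀ x, Module ℂ (F x)] [FiberBundle ℂ F] [VectorBundle ℂ ℂ F]
        [ContMDiffVectorBundle ω ℂ F 𝓘(ℂ, Cn n)] (hY : HermitianMetric (n := n) F)
        (sY : Cₛ^ω⟮𝓘(ℂ, Cn n); ℂ, F⟯) (_ : IsCanonicalSection Y sY)
        -- the curvature conditions
        (δ : ℝ) (_ : 0 < δ) (_ : ∀ x v, 0 ≤ hL.curvature x v)
        (_ : ∀ x v, δ * hY.curvature x v ≤ hL.curvature x v)
        -- the parameter `τ`, for which `τ² + |s_Y|²` stays away from the zero `1` of `log`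
        (ε : ℝ) (_ : 0 < ε) (τ : ℝ) (_ : ∀ x, ε ≤ |τ ^ 2 + hY.normSq x (sY x) - 1|)
        -- the form `ξ`, and `η = ∂̄*ξ`
        (ξ : LForm n L (n + 1)) (_ : IsTestForm n 1 ξ)
        (η : LForm n L n) (_ : IsDbarAdjoint K hL ξ η),
        ((∀ x, hY.normSq x (sY x) ≤ Real.exp (-δ)) →
          estimateLHS hn K hL hY sY τ ξ ≤ C δ ε * estimateRHS K hL hY sY τ ξ η) ∧
        ((∀ x, hY.normSq x (sY x) ≤ Real.exp (-1 / δ)) →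
          estimateLHS hn K hL hY sY τ ξ ≤ C₀ ε * estimateRHS K hL hY sY τ ξ η) := by
  -- The two cases differ only in the additive constant `B` of the twist, which is `2/δ` in the
  -- first and `3` in the second.
  refine ⟨fun δ ε => estimateConst (2 / δ) ε, fun ε => estimateConst 3 ε, ?_⟩
  intro n hn X _ _ _ _ _ _ _ K Y L _ _ _ _ _ _ _ hL F _ _ _ _ _ _ _ hY sY _ δ hδ hpos hcmp ε hε
    τ hτ ξ hξ η hη
  refine ⟨fun hs => ?_, fun hs => ?_⟩
  · have hs1 : ∀ x, hY.normSq x (sY x) ≤ 1 := fun x =>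
      (hs x).trans (Real.exp_le_one_iff.2 (by linarith))
    exact estimateLHS_le hn hδ hε (by positivity) hpos hcmp hτ hξ hη hs1 fun x hx =>
      curvature_factor_le_of_const hδ (hY.normSq_nonneg x _) (hs1 x) hx
  · have hs1 : ∀ x, hY.normSq x (sY x) ≤ 1 := fun x =>
      (hs x).trans (Real.exp_le_one_iff.2
        (div_nonpos_of_nonpos_of_nonneg (by norm_num) hδ.le))
    exact estimateLHS_le hn hδ hε (by norm_num) hpos hcmp hτ hξ hη hs1 fun x hx =>
      curvature_factor_le_of_exp hδ (hY.normSq_nonneg x _) (hs x) hx
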